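/- Let $T,\alpha,\theta_\pm\in\mathbb R$, $q_0>0$, $q_\pm=q_0e^{i\theta_\pm}$ and $\Upsilon(x,t)=\alpha x+(2q_0^2+4T^2q_0^4-\alpha^2)t$. Let $q\in C^2(\mathbb R^2,\mathbb C)$ be a solution of the focusing Kundu–Eckhaus equation $$iq_t+q_{xx}+2|q|^2q+4T^2|q|^4q-4iT(|q|^2)_xq=0$$ with non-zero boundary conditions: for every $t$, $qe^{-i\Upsilon}\to q_\pm$ and $(qe^{-i\Upsilon})_x\to0$ as $x\to\pm\infty$, and $(1+|x|)(qe^{-i\Upsilon}-q_\pm)\in L^1(\mathbb R^\pm)$; moreover $q,q_x$ are bounded on every strip $|t|\le\tau$. Put $\omega_+(x,t)=T\int_x^\infty(|q(y,t)|^2-q_0^2)\,dy$. *Scattering data.* For $\zeta\in\mathbb C\setminus\{0\}$ let $\lambda=\frac12(\zeta+q_0^2\zeta^{-1})$, $z=\frac12(\zeta-q_0^2\zeta^{-1})+Tq_0^2-\frac\alpha2$, $\Theta(x,t,\zeta)=\lambda\,(x+2(z+Tq_0^2-\frac\alpha2)t)$, and let a dot denote $\partial_\zeta$. Consider the Lax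 pair $$\Psi_x=\bigl(-i(z+\tfrac\alpha2)\sigma_3+U\bigr)\Psi,\qquad \Psi_t=\bigl(-2i(z^2+\tfrac14(2q_0^2+4T^2q_0^4-\alpha^2))\sigma_3+V\bigr)\Psi,$$ $$U=\begin{pmatrix}iT|q|^2&qe^{-i\Upsilon}\\-\bar qe^{i\Upsilon}&-iT|q|^2\end{pmatrix},\qquad V=\begin{pmatrix}v&(iq_x+2zq+2T|q|^2q)e^{-i\Upsilon}\\(i\bar q_x-2z\bar q-2T|q|^2\bar q)e^{i\Upsilon}&-v\end{pmatrix},$$ $v=i|q|^2+4iT^2|q|^4+T(q\bar q_x-q_x\bar q)$. The Jost solutions $\psi_\pm=(\psi_{\pm1},\psi_{\pm2})$ are the simultaneous solutions whose modified columns $\mu_{\pm1}=e^{i\Theta}\psi_{\pm1}$, $\mu_{\pm2}=e^{-i\Theta}\psi_{\pm2}$ tend, as $x\to\pm\infty$, to the columns of $\begin{pmatrix}1&-iq_\pm/\zeta\\-i\bar q_\pm/\zeta&1\end{pmatrix}$ ($\psi_{-1},\psi_{+2}$ for $\operatorname{Im}\lambda\ge0$; $\psi_{-2},\psi_{+1}$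 for $\operatorname{Im}\lambda\le0$). On $\Sigma=(\mathbb R\cup\{|\zeta|=q_0\})\setminus\{0,\pm iq_0\}$ write $\psi_{-1}=a\psi_{+1}+b\psi_{+2}$; $a=\det(\psi_{-1},\psi_{+2})/(1+q_0^2\zeta^{-2})$ continues to $\operatorname{Im}\lambda>0$. Assume that the data are reflectionless, $b=0$ on $\Sigma$, and that the zeros of $a$ in $\{|\zeta|>q_0,\ \operatorname{Im}\zeta>0\}$ are exactly the distinct points $\zeta_1,\dots,\zeta_{N_2}$ ($N_2\ge0$), each a double zero: $a(\zeta_j)=\dot a(\zeta_j)=0\ne\ddot a(\zeta_j)$. *Claim.* There are constants $b_j,d_j$, independent of $x,t$, such that at $\zeta=\zeta_j$, for all $x,t$, $$\mu_{-1}=e^{2i\Theta}b_j\mu_{+2},\qquad \dot\mu_{-1}=e^{2i\Theta}\bigl(d_j\mu_{+2}+2i\dot\Theta b_j\mu_{+2}+b_j\dot\mu_{+2}\bigr).$$ For any such constants let $A_j=\dfrac{2b_j}{\ddot a(\zeta_j)}$, $B_j=\dfrac{d_j}{b_j}-\dfrac{a^{(3)}(\zeta_j)}{3\ddot a(\zeta_j)}$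 and, for $1\le j\le N_2$, $$\eta_j=\zeta_j,\quad \eta_{N_2+j}=-q_0^2/\bar\zeta_j,\quad \hat\eta_j=-q_0^2/\zeta_j,\quad \hat\eta_{N_2+j}=\bar\zeta_j,$$ $$\hat A_j=A_j\frac{q_+q_0^4}{\bar q_+\zeta_j^4},\quad \hat A_{N_2+j}=-\overline{A_j},\quad \hat B_j=\frac{\zeta_j^2}{q_0^2}\Bigl(B_j-\frac2{\zeta_j}\Bigr),\quad \hat B_{N_2+j}=\overline{B_j},$$ and for $1\le j\le2N_2$, $\hat C_j=\hat A_je^{-2i\Theta(x,t,\hat\eta_j)}$, $\hat D_j=\hat B_j-2i\dot\Theta(x,t,\hat\eta_j)$. Let $N=\begin{pmatrix}n^{(1,1)}&n^{(1,2)}\\n^{(2,1)}&n^{(2,2)}\end{pmatrix}$ be the $4N_2\times4N_2$ matrix with $2N_2\times2N_2$ blocks $$n^{(1,1)}_{k,j}=\frac{\hat C_j}{\eta_k-\hat\eta_j},\qquad n^{(1,2)}_{k,j}=\frac{\hat C_j}{\eta_k-\hat\eta_j}\Bigl(\frac1{\eta_k-\hat\eta_j}+\hat D_j\Bigr)+\frac{iq_+}{\eta_k}\delta_{jk},$$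 $$n^{(2,1)}_{k,j}=\frac{\hat C_j}{(\eta_k-\hat\eta_j)^2}-\frac{iq_0^2q_+}{\eta_k^3}\delta_{jk},\qquad n^{(2,2)}_{k,j}=\frac{\hat C_j}{(\eta_k-\hat\eta_j)^2}\Bigl(\frac2{\eta_k-\hat\eta_j}+\hat D_j\Bigr)+\frac{iq_+}{\eta_k^2}\delta_{jk},$$ and let $N^\Delta=\begin{pmatrix}\chi^{\rm T}&0\\N&\rho\end{pmatrix}$ be the $(4N_2+1)\times(4N_2+1)$ matrix with $\chi^{\rm T}=\bigl((\hat C_j)_j,(\hat C_j\hat D_j)_j\bigr)$, $\rho=\bigl((1/\eta_k)_k,(1/\eta_k^2)_k\bigr)^{\rm T}$. Then for all $x,t$ one has $|N|\ne0$ and $$q(x,t)=e^{i(\Upsilon-2\omega_+)}\,q_+\left(1+\frac{|N^\Delta|}{|N|}\right),$$ where $|\cdot|$ is the determinant. -/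

import Mathlib

open Complex Filter Topology MeasureTheory Set
open scoped ComplexConjugate

noncomputable section

namespace KE

/-- Real parameters: the constant `T` of the Kundu-Eckhaus equation, the amplitude `q₀`, the
wave number `α` and the phases `θp`, `θm` of the boundary values at `+∞`, `-∞`. -/
structure Params where
  T : ℝ
  q₀ : ℝ
  α : ℝ
  θp : ℝ
  θm : ℝ

/- The equation and the boundary conditions -/

/-- `q` is a classical solution of the focusing Kundu-Eckhaus equation
`i q_t + q_xx + 2|q|²q + 4T²|q|⁴q - 4iT(|q|²)_x q = 0` on the whole `(x,t)`-plane. -/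
def IsSolution (T : ℝ) (q : ℝ → ℝ → ℂ) : Prop :=
  ContDiff ℝ 2 (fun y : ℝ × ℝ => q y.1 y.2) ∧
  ∀ x t : ℝ,
    I * deriv (fun s => q x s) t + deriv (deriv (fun y => q y t)) x
      + 2 * (‖q x t‖ : ℂ) ^ 2 * q x t + 4 * (T : ℂ) ^ 2 * (‖q x t‖ : ℂ) ^ 4 * q x t
      - 4 * I * T * ((deriv (fun y => ‖q y t‖ ^ 2) x : ℝ) : ℂ) * q x t = 0

/-- The boundary value `q₊ = q₀ e^{iθ₊}`. -/
def qPlus (P : Params) : ℂ := P.q₀ * exp (I * P.θp)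

/-- The boundary value `q₋ = q₀ e^{iθ₋}`. -/
def qMinus (P : Params) : ℂ := P.q₀ * exp (I * P.θm)

/-- The phase `Υ = αx + (2q₀² + 4T²q₀⁴ - α²)t`. -/
def Ups (P : Params) (x t : ℝ) : ℝ :=
  P.α * x + (2 * P.q₀ ^ 2 + 4 * P.T ^ 2 * P.q₀ ^ 4 - P.α ^ 2) * t

/-- The envelope `q e^{-iΥ}`. -/
def envelope (P : Params) (q : ℝ → ℝ → ℂ) (x t : ℝ) : ℂ := q x t * exp (-(I * Ups P x t))

/-- Non-zero boundary conditions: for every `t` the envelope tends to `q_±` and its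
`x`-derivative to `0` as `x → ±∞`, the first moment of `q e^{-iΥ} - q_±` is finite on the
corresponding half-line, and `q`, `q_x` are bounded on every strip `|t| ≤ τ`. -/
structure HasNZBC (P : Params) (q : ℝ → ℝ → ℂ) : Prop where
  tendsto_top : ∀ t, Tendsto (fun x => envelope P q x t) atTop (𝓝 (qPlus P))
  tendsto_bot : ∀ t, Tendsto (fun x => envelope P q x t) atBot (𝓝 (qMinus P))
  deriv_top : ∀ t, Tendsto (fun x => deriv (fun y => envelope P q y t) x) atTop (𝓝 0)
  deriv_bot : ∀ t, Tendsto (fun x => deriv (fun y => envelope P q y t) x) atBot (𝓝 0)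
  integrable_top : ∀ t,
    IntegrableOn (fun x : ℝ => ((1 + |x| : ℝ) : ℂ) * (envelope P q x t - qPlus P)) (Ioi 0)
  integrable_bot : ∀ t,
    IntegrableOn (fun x : ℝ => ((1 + |x| : ℝ) : ℂ) * (envelope P q x t - qMinus P)) (Iio 0)
  bounded : ∀ τ : ℝ, ∃ C : ℝ, ∀ x t : ℝ, |t| ≤ τ →
    ‖q x t‖ ≤ C ∧ ‖deriv (fun y => q y t) x‖ ≤ C

/-- `ω₊(x,t) = T ∫_x^∞ (|q(y,t)|² - q₀²) dy`. -/
def omegaPlus (P : Params) (q : ℝ → ℝ → ℂ) (x t : ℝ) : ℝ :=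
  P.T * ∫ y in Ioi x, (‖q y t‖ ^ 2 - P.q₀ ^ 2)

/- The uniformization variable and the Lax pair -/

/-- `λ = (ζ + q₀²/ζ)/2`. -/
def lam (P : Params) (ζ : ℂ) : ℂ := (ζ + (P.q₀ : ℂ) ^ 2 / ζ) / 2

/-- The spectral parameter `z`, determined by `z - T q₀² + α/2 = (ζ - q₀²/ζ)/2`. -/
def zOf (P : Params) (ζ : ℂ) : ℂ :=
  (ζ - (P.q₀ : ℂ) ^ 2 / ζ) / 2 + P.T * (P.q₀ : ℂ) ^ 2 - P.α / 2

/-- `Θ(x,t,ζ) = λ (x + 2(z + T q₀² - α/2) t)`. -/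
def Theta (P : Params) (x t : ℝ) (ζ : ℂ) : ℂ :=
  lam P ζ * (x + 2 * (zOf P ζ + P.T * (P.q₀ : ℂ) ^ 2 - P.α / 2) * t)

/-- The derivative of `Θ` in `ζ`. -/
def dTheta (P : Params) (x t : ℝ) (ζ : ℂ) : ℂ := deriv (fun w => Theta P x t w) ζ

def sigma3 : Matrix (Fin 2) (Fin 2) ℂ := !![1, 0; 0, -1]

/-- The matrix of the `x`-part `Ψ_x = (-i(z + α/2)σ₃ + U) Ψ`. -/
def laxX (P : Params) (q : ℝ → ℝ → ℂ) (ζ : ℂ) (x t : ℝ) : Matrix (Fin 2) (Fin 2) ℂ :=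
  let U : Matrix (Fin 2) (Fin 2) ℂ :=
    !![I * P.T * (‖q x t‖ : ℂ) ^ 2, q x t * exp (-(I * Ups P x t));
       -conj (q x t) * exp (I * Ups P x t), -(I * P.T * (‖q x t‖ : ℂ) ^ 2)]
  U - (I * (zOf P ζ + P.α / 2)) • sigma3

/-- The matrix of the `t`-part
`Ψ_t = (-2i(z² + (2q₀² + 4T²q₀⁴ - α²)/4)σ₃ + V) Ψ`. -/
def laxT (P : Params) (q : ℝ → ℝ → ℂ) (ζ : ℂ) (x t : ℝ) : Matrix (Fin 2) (Fin 2) ℂ :=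
  let z := zOf P ζ
  let u := q x t
  let ux := deriv (fun y => q y t) x
  let n2 : ℂ := (‖u‖ : ℂ) ^ 2
  let v11 : ℂ := I * n2 + 4 * I * (P.T : ℂ) ^ 2 * n2 ^ 2 + P.T * (u * conj ux - ux * conj u)
  let V : Matrix (Fin 2) (Fin 2) ℂ :=
    !![v11, (I * ux + 2 * z * u + 2 * P.T * n2 * u) * exp (-(I * Ups P x t));
       (I * conj ux - 2 * z * conj u - 2 * P.T * n2 * conj u) * exp (I * Ups P x t), -v11]
  V - (2 * I * (z ^ 2 + (2 * (P.q₀ : ℂ) ^ 2 + 4 * (P.T : ℂ) ^ 2 * (P.q₀ : ℂ) ^ 4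
      - (P.α : ℂ) ^ 2) / 4)) • sigma3

/- Jost solutions and scattering data -/

/-- The matrix `E_±(ζ)`, for the boundary value `qb = q_±`. -/
def Emat (qb ζ : ℂ) : Matrix (Fin 2) (Fin 2) ℂ :=
  !![1, -(I * qb / ζ); -(I * conj qb / ζ), 1]

/-- The diagonal factor `e^{iΘσ₃}`: `e^{iΘ}` for the first column, `e^{-iΘ}` for the second. -/
def colExp (P : Params) (c : Fin 2) (ζ : ℂ) (x t : ℝ) : ℂ :=
  if c = 0 then exp (I * Theta P x t ζ) else exp (-(I * Theta P x t ζ))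

/-- `f` is the `c`-th column of the Jost matrix normalised at `l = ±∞` with boundary value `qb`:
a simultaneous solution of both parts of the Lax pair such that `e^{±iΘ} f` tends to the `c`-th
column of `E_±`.  Such an `f` is unique when `Im λ(ζ) ≥ 0` for the columns `(-∞, 1)`, `(+∞, 2)`
and when `Im λ(ζ) ≤ 0` for the columns `(-∞, 2)`, `(+∞, 1)`; only these are used. -/
def IsJost (P : Params) (q : ℝ → ℝ → ℂ) (l : Filter ℝ) (qb : ℂ) (c : Fin 2) (ζ : ℂ)
    (f : ℝ → ℝ → Fin 2 → ℂ) : Prop :=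
  (∀ x t, HasDerivAt (fun y => f y t) ((laxX P q ζ x t).mulVec (f x t)) x) ∧
  (∀ x t, HasDerivAt (fun s => f x s) ((laxT P q ζ x t).mulVec (f x t)) t) ∧
  ∀ t, Tendsto (fun x => colExp P c ζ x t • f x t) l (𝓝 (fun i => Emat qb ζ i c))

/-- Columns of `ψ₋`, the Jost matrix normalised at `x → -∞`. -/
def psiMinus (P : Params) (q : ℝ → ℝ → ℂ) (c : Fin 2) (ζ : ℂ) : ℝ → ℝ → Fin 2 → ℂ :=
  Classical.epsilon (IsJost P q atBot (qMinus P) c ζ)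

/-- Columns of `ψ₊`, the Jost matrix normalised at `x → +∞`. -/
def psiPlus (P : Params) (q : ℝ → ℝ → ℂ) (c : Fin 2) (ζ : ℂ) : ℝ → ℝ → Fin 2 → ℂ :=
  Classical.epsilon (IsJost P q atTop (qPlus P) c ζ)

/-- Columns of the modified Jost matrix `μ₋ = ψ₋ e^{iΘσ₃}`. -/
def muMinus (P : Params) (q : ℝ → ℝ → ℂ) (c : Fin 2) (x t : ℝ) (ζ : ℂ) : Fin 2 → ℂ :=
  colExp P c ζ x t • psiMinus P q c ζ x t

/-- Columns of the modified Jost matrix `μ₊ = ψ₊ e^{iΘσ₃}`. -/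
def muPlus (P : Params) (q : ℝ → ℝ → ℂ) (c : Fin 2) (x t : ℝ) (ζ : ℂ) : Fin 2 → ℂ :=
  colExp P c ζ x t • psiPlus P q c ζ x t

/-- The continuous spectrum `Σ`: the real line and the circle `|ζ| = q₀`, without `0`, `± i q₀`. -/
def contSpec (P : Params) : Set ℂ :=
  {ζ | (ζ.im = 0 ∨ ‖ζ‖ = P.q₀) ∧ ζ ≠ 0 ∧ ζ ≠ I * P.q₀ ∧ ζ ≠ -(I * P.q₀)}

def wronskian (u v : Fin 2 → ℂ) : ℂ := u 0 * v 1 - u 1 * v 0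

/-- The entry `a(ζ)` of the scattering matrix `s`, `ψ₋ = ψ₊ s`, in its Wronskian form, which
also gives its continuation to `Im λ > 0`.  Here `1 + q₀²/ζ² = det ψ₊`.  The right-hand side does
not depend on the point at which it is evaluated. -/
def aCoef (P : Params) (q : ℝ → ℝ → ℂ) (ζ : ℂ) : ℂ :=
  wronskian (psiMinus P q 0 ζ 0 0) (psiPlus P q 1 ζ 0 0) / (1 + (P.q₀ : ℂ) ^ 2 / ζ ^ 2)

/-- The entry `b(ζ)` of the scattering matrix: `ψ₋₁ = a ψ₊₁ + b ψ₊₂` for `ζ ∈ Σ`. -/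
def bCoef (P : Params) (q : ℝ → ℝ → ℂ) (ζ : ℂ) : ℂ :=
  wronskian (psiPlus P q 0 ζ 0 0) (psiMinus P q 0 ζ 0 0) / (1 + (P.q₀ : ℂ) ^ 2 / ζ ^ 2)

/-- Reflectionless: `b`, hence the reflection coefficient `b / a`, vanishes on `Σ`. -/
def Reflectionless (P : Params) (q : ℝ → ℝ → ℂ) : Prop := ∀ ζ ∈ contSpec P, bCoef P q ζ = 0

/-- The zeros of `a` in `{|ζ| > q₀, Im ζ > 0}` are precisely the distinct points `ζ_j`, and they
are double zeros. -/
structure HasDoubleZeros (P : Params) (q : ℝ → ℝ → ℂ) {N : ℕ} (ζ : Fin N → ℂ) : Prop where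
  injective : Function.Injective ζ
  norm_gt : ∀ j, P.q₀ < ‖ζ j‖
  im_pos : ∀ j, 0 < (ζ j).im
  zero_iff : ∀ w : ℂ, P.q₀ < ‖w‖ → 0 < w.im → (aCoef P q w = 0 ↔ ∃ j, w = ζ j)
  deriv_eq : ∀ j, deriv (aCoef P q) (ζ j) = 0
  deriv2_ne : ∀ j, iteratedDeriv 2 (aCoef P q) (ζ j) ≠ 0

/-- `b_j`, `d_j` are the norming constants at `ζ_j`: with dots denoting `ζ`-derivatives, at `ζ_j`
`μ₋₁ = e^{2iΘ} b_j μ₊₂` and `μ̇₋₁ = e^{2iΘ} (d_j μ₊₂ + 2iΘ̇ b_j μ₊₂ + b_j μ̇₊₂)`,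
for all `x`, `t`. -/
def IsNorming (P : Params) (q : ℝ → ℝ → ℂ) {N : ℕ} (ζ b d : Fin N → ℂ) : Prop :=
  ∀ (j : Fin N) (x t : ℝ),
    muMinus P q 0 x t (ζ j)
      = (exp (2 * I * Theta P x t (ζ j)) * b j) • muPlus P q 1 x t (ζ j) ∧
    deriv (fun w => muMinus P q 0 x t w) (ζ j)
      = exp (2 * I * Theta P x t (ζ j)) •
          (d j • muPlus P q 1 x t (ζ j)
            + (2 * I * dTheta P x t (ζ j) * b j) • muPlus P q 1 x t (ζ j)
            + b j • deriv (fun w => muPlus P q 1 x t w) (ζ j))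

/-- `A_j = 2 b_j / a''(ζ_j)`. -/
def Acoef (P : Params) (q : ℝ → ℝ → ℂ) {N : ℕ} (ζ b : Fin N → ℂ) (j : Fin N) : ℂ :=
  2 * b j / iteratedDeriv 2 (aCoef P q) (ζ j)

/-- `B_j = d_j / b_j - a'''(ζ_j) / (3 a''(ζ_j))`. -/
def Bcoef (P : Params) (q : ℝ → ℝ → ℂ) {N : ℕ} (ζ b d : Fin N → ℂ) (j : Fin N) : ℂ :=
  d j / b j - iteratedDeriv 3 (aCoef P q) (ζ j) / (3 * iteratedDeriv 2 (aCoef P q) (ζ j))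

/- The determinants, for given `ζ_j`, `A_j`, `B_j` -/

section Determinants

/-- `η_j = ζ_j`, `η_{N+j} = -q₀² / conj ζ_j`. -/
def eta (P : Params) {N : ℕ} (ζ : Fin N → ℂ) : Fin (N + N) → ℂ :=
  Fin.append ζ (fun j => -(P.q₀ : ℂ) ^ 2 / conj (ζ j))

/-- `η̂_j = -q₀² / ζ_j`, `η̂_{N+j} = conj ζ_j`. -/
def etaHat (P : Params) {N : ℕ} (ζ : Fin N → ℂ) : Fin (N + N) → ℂ :=
  Fin.append (fun j => -(P.q₀ : ℂ) ^ 2 / ζ j) (fun j => conj (ζ j))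

/-- `Â_j = A_j q₊ q₀⁴ / (conj q₊ ζ_j⁴)`, `Â_{N+j} = - conj A_j`. -/
def AHat (P : Params) {N : ℕ} (ζ A : Fin N → ℂ) : Fin (N + N) → ℂ :=
  Fin.append (fun j => A j * (qPlus P * (P.q₀ : ℂ) ^ 4 / (conj (qPlus P) * ζ j ^ 4)))
    (fun j => -conj (A j))

/-- `B̂_j q₀² / ζ_j² = B_j - 2 / ζ_j`, `B̂_{N+j} = conj B_j`. -/
def BHat (P : Params) {N : ℕ} (ζ B : Fin N → ℂ) : Fin (N + N) → ℂ :=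
  Fin.append (fun j => (B j - 2 / ζ j) * (ζ j ^ 2 / (P.q₀ : ℂ) ^ 2)) (fun j => conj (B j))

/-- `Ĉ_j = Â_j e^{-2iΘ(η̂_j)}`. -/
def CHat (P : Params) {N : ℕ} (ζ A : Fin N → ℂ) (x t : ℝ) (j : Fin (N + N)) : ℂ :=
  AHat P ζ A j * exp (-(2 * I * Theta P x t (etaHat P ζ j)))

/-- `D̂_j = B̂_j - 2iΘ̇(η̂_j)`. -/
def DHat (P : Params) {N : ℕ} (ζ B : Fin N → ℂ) (x t : ℝ) (j : Fin (N + N)) : ℂ :=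
  BHat P ζ B j - 2 * I * dTheta P x t (etaHat P ζ j)

variable (P : Params) {N : ℕ} (ζ A B : Fin N → ℂ) (x t : ℝ)

def n11 : Matrix (Fin (N + N)) (Fin (N + N)) ℂ := Matrix.of fun k j =>
  CHat P ζ A x t j / (eta P ζ k - etaHat P ζ j)

def n12 : Matrix (Fin (N + N)) (Fin (N + N)) ℂ := Matrix.of fun k j =>
  CHat P ζ A x t j / (eta P ζ k - etaHat P ζ j)
      * (1 / (eta P ζ k - etaHat P ζ j) + DHat P ζ B x t j)
    + if j = k then I * qPlus P / eta P ζ k else 0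

def n21 : Matrix (Fin (N + N)) (Fin (N + N)) ℂ := Matrix.of fun k j =>
  CHat P ζ A x t j / (eta P ζ k - etaHat P ζ j) ^ 2
    - if j = k then I * (P.q₀ : ℂ) ^ 2 * qPlus P / eta P ζ k ^ 3 else 0

def n22 : Matrix (Fin (N + N)) (Fin (N + N)) ℂ := Matrix.of fun k j =>
  CHat P ζ A x t j / (eta P ζ k - etaHat P ζ j) ^ 2
      * (2 / (eta P ζ k - etaHat P ζ j) + DHat P ζ B x t j)
    + if j = k then I * qPlus P / eta P ζ k ^ 2 else 0

/-- The `4N × 4N` matrix `N`. -/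
def matN : Matrix (Fin ((N + N) + (N + N))) (Fin ((N + N) + (N + N))) ℂ :=
  Matrix.reindex finSumFinEquiv finSumFinEquiv
    (Matrix.fromBlocks (n11 P ζ A x t) (n12 P ζ A B x t) (n21 P ζ A x t) (n22 P ζ A B x t))

/-- The row `χᵀ = (Ĉ_j, Ĉ_j D̂_j)`. -/
def chi : Fin ((N + N) + (N + N)) → ℂ :=
  Fin.append (fun j => CHat P ζ A x t j) (fun j => CHat P ζ A x t j * DHat P ζ B x t j)

/-- The column `ρ = (1/η_k, 1/η_k²)`. -/
def rho : Fin ((N + N) + (N + N)) → ℂ :=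
  Fin.append (fun k => 1 / eta P ζ k) (fun k => 1 / eta P ζ k ^ 2)

/-- The `(4N+1) × (4N+1)` matrix with first row `(χᵀ, 0)` and remaining rows `(N, ρ)`. -/
def matNDelta : Matrix (Fin ((N + N) + (N + N) + 1)) (Fin ((N + N) + (N + N) + 1)) ℂ :=
  Matrix.of (Fin.cons (Fin.snoc (α := fun _ => ℂ) (chi P ζ A B x t) 0)
    (fun k => Fin.snoc (α := fun _ => ℂ) (fun j => matN P ζ A B x t k j) (rho P ζ k)))

end Determinants

end KE

end

/-! The formula is an instance of inverse scattering. For fixed `(x, t)` the modified Jost functions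
are pieces of a single rational function of the spectral variable `ζ`, and `q` is read off from the
coefficient of `1/ζ` in its expansion at infinity.

Direct problem. Put `u = q e^{-iΥ}`. Then `m = e^{-iΘ} ψ₊₂` satisfies `m_x = (L + B(x)) m` with a
constant matrix `L` belonging to `q₊` and a remainder `B` of the size of `u - q₊`. Since `L² =
-2iλL`, the exponential `e^{sL}` equals `1 + L (e^{-2iλs} - 1)/(-2iλ)`, and for `s ≤ 0` it is
bounded by `3 + 2q₀|s|` uniformly on the region `|ζ| ≥ q₀`, `Im ζ ≥ 0`, branch point `iq₀` included.
A finite first moment therefore makes the Volterra equation from `+∞` solvable on the whole closed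
region, with continuity there and holomorphy inside (`VolterraKernel.exists_solution`,
`exists_modifiedJost`). The zero curvature identity and uniqueness at `+∞` show that these solutions
also satisfy the `t`-part (`isJost_ofModified`). Conjugation combined with `(x, t) ↦ (-x, -t)`
preserves the equation and exchanges the ends, which yields `ψ₋₁`.

Norming constants. The Wronskian of `ψ₋₁` and `ψ₊₂` is `a (1 + q₀²/ζ²)` and vanishes to second order
at `ζ_j`. The value gives `ψ₋₁ = b ψ₊₂`, the derivative gives `d` (`exists_norming`).

Riemann-Hilbert problem. Because `b = 0`, the boundary values of `μ₋₁ / a` are images of `μ₊₂`: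
under conjugation on the real axis, under `ζ ↦ -q₀²/ζ` on the arc `|ζ| = q₀`. The four scalar
components can thus be glued, by conjugation to the lower exterior and by inversion to the interior
of the circle, into one function `g` on the plane, with partner `f(w) = -(i q̄₊/w) g(-q₀²/w)`.
Painlevé's theorem removes the seams. The remaining singularities are a simple pole at `0`, double
poles at the points `η̂_k` whose principal parts are given by `f(η̂_k)` and `f'(η̂_k)`, and the
branch points `±iq₀`. At the latter `g` is bounded because `a` has a finite non-zero limit at `iq₀`:
on the arc `a(ζ) a(-q₀²/ζ) = q₊/q₋`, so the Wronskian vanishes at `iq₀`, and it does so to first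
order in `λ` (`wronskian_branchPoint`, `tendsto_wronskian_div_lam`, `exists_aCoef_limit`). By
Liouville `g` is the sum of its principal parts (`RHData.gFun_eq`).

Determinants. Evaluating `f` and `f'` at the `η̂_k` turns this representation into a linear system
with matrix `N` and right-hand side proportional to `ρ` (`matN_mulVec_eq_iff`). The coefficient of
`1/ζ` of `g` at infinity is, by integration by parts in the differential equation, `-i u e^{iω₊}`,
and expressing it through the solution of the system produces the bordered determinant.

Solvability. A kernel vector of `N` would give a pair `f`, `g` without pole at `0` in `g`. By the
symmetry of the data the poles of `R(ζ) = f(ζ) conj f(ζ̄) + g(ζ) conj g(ζ̄)` cancel, so `R = 0` by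
Liouville. On the real axis `R = |f|² + |g|²`, hence `f` and `g` vanish and so does the vector
(`det_matN_ne_zero`). -/

noncomputable section

namespace KE

open scoped BoundedContinuousFunction

/-! ### Volterra integral equations with parameters -/

section Volterra

set_option linter.unusedSectionVars false

theorem setIntegral_Ioi_sub_of_le {E : Type*} [NormedAddCommGroup E] [NormedSpace ℝ E]
    {f : ℝ → E} {a x : ℝ} (hf : IntegrableOn f (Ioi a)) (hx : a ≤ x) :
    ∫ y in Ioi x, f y = (∫ y in Ioi a, f y) - ∫ y in a..x, f y := by
  rw [← intervalIntegral.integral_Ioi_sub_Ioi hf hx]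
  abel

theorem hasDerivAt_integral_Ioi {E : Type*} [NormedAddCommGroup E] [NormedSpace ℝ E]
    [CompleteSpace E] {f : ℝ → E} {a x : ℝ} (hc : ContinuousOn f (Ioi a))
    (hf : IntegrableOn f (Ioi a)) (hx : a < x) :
    HasDerivAt (fun z => ∫ y in Ioi z, f y) (-f x) x := by
  have h1 : HasDerivAt (fun z => ∫ y in a..z, f y) (f x) x := by
    refine intervalIntegral.integral_hasDerivAt_right ?_ ?_ (hc.continuousAt (Ioi_mem_nhds hx))
    · rw [intervalIntegrable_iff_integrableOn_Ioc_of_le hx.le]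
      exact hf.mono_set Ioc_subset_Ioi_self
    · exact ContinuousOn.stronglyMeasurableAtFilter isOpen_Ioi hc x hx
  refine ((h1.const_sub (∫ y in Ioi a, f y))).congr_of_eventuallyEq ?_
  filter_upwards [Ioi_mem_nhds hx] with z hz
  exact setIntegral_Ioi_sub_of_le hf (le_of_lt hz)

variable {E P : Type*} [NormedAddCommGroup E] [NormedSpace ℝ E] [CompleteSpace E]
  [TopologicalSpace P] [FirstCountableTopology P]

/-- The kernel of a linear Volterra equation on `[x₀, ∞)` with parameter in `P`. -/
structure VolterraKernel (x₀ : ℝ) (κ : ℝ → ℝ) (k : ℝ → ℝ → P → E → E) : Prop where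
  cont_bound : Continuous κ
  bound_nonneg : ∀ y, 0 ≤ κ y
  bound_integrable : IntegrableOn κ (Ioi x₀)
  map_zero : ∀ x y p, k x y p 0 = 0
  lipschitz : ∀ x y p v w, x₀ ≤ x → x ≤ y → ‖k x y p v - k x y p w‖ ≤ κ y * ‖v - w‖
  -- No continuity in `y` is required, only measurability along continuous functions, so that a
  -- kernel cut off at some value of `y` is admissible.
  cont : ∀ y, Continuous fun r : ℝ × P × E => k r.1 y r.2.1 r.2.2
  meas : ∀ x p (f : ℝ → E), Continuous f →
    AEStronglyMeasurable (fun y => k x y p (f y)) (volume.restrict (Ioi x₀))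

namespace VolterraKernel

variable {x₀ : ℝ} {κ : ℝ → ℝ} {k : ℝ → ℝ → P → E → E}

theorem norm_le (K : VolterraKernel x₀ κ k) {x y : ℝ} (p : P) (v : E) (hx : x₀ ≤ x)
    (hy : x ≤ y) : ‖k x y p v‖ ≤ κ y * ‖v‖ := by
  simpa [K.map_zero] using K.lipschitz x y p v 0 hx hy

theorem integrable (K : VolterraKernel x₀ κ k) {x : ℝ} (p : P) {f : ℝ → E}
    (hf : Continuous f) {C : ℝ} (hC : ∀ y, ‖f y‖ ≤ C) (hx : x₀ ≤ x) :
    IntegrableOn (fun y => k x y p (f y)) (Ioi x) := by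
  have h0 : Ioi x ⊆ Ioi x₀ := Ioi_subset_Ioi hx
  refine Integrable.mono' ((K.bound_integrable.mono_set h0).mul_const C)
    ((K.meas x p f hf).mono_measure (Measure.restrict_mono h0 le_rfl)) ?_
  refine (ae_restrict_mem measurableSet_Ioi).mono fun y hy => ?_
  exact (K.norm_le p _ hx (le_of_lt hy)).trans
    (mul_le_mul_of_nonneg_left (hC y) (K.bound_nonneg y))

/-- Dominated convergence after writing the moving half-line as an indicator: for fixed `y` the
integrand is continuous at `r` unless `y` is the endpoint, a null set. Replacing `x` by `max x x₀`
extends the integral to all real `x`, so that the fixed point problem lives in the bounded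
continuous functions on `ℝ × P`. -/
theorem continuous_integral (K : VolterraKernel x₀ κ k) {f : ℝ → P → E}
    (hf : Continuous fun r : ℝ × P => f r.1 r.2) {C : ℝ} (hC : ∀ y p, ‖f y p‖ ≤ C) :
    Continuous fun r : ℝ × P => ∫ y in Ioi (max r.1 x₀), k (max r.1 x₀) y r.2 (f y r.2) := by
  have e : ∀ r : ℝ × P, ∫ y in Ioi (max r.1 x₀), k (max r.1 x₀) y r.2 (f y r.2)
      = ∫ y in Ioi x₀, (Ioi (max r.1 x₀)).indicator
          (fun y => k (max r.1 x₀) y r.2 (f y r.2)) y := by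
    intro r
    rw [setIntegral_indicator measurableSet_Ioi,
      inter_eq_self_of_subset_right (Ioi_subset_Ioi (le_max_right _ _))]
  simp_rw [e]
  rw [continuous_iff_continuousAt]
  intro r
  refine continuousAt_of_dominated (bound := fun y => κ y * C) ?_ ?_
    (K.bound_integrable.mul_const C) ?_
  · refine Eventually.of_forall fun s => ?_
    refine AEStronglyMeasurable.indicator ?_ measurableSet_Ioi
    exact K.meas _ _ _ (hf.comp (by fun_prop : Continuous fun y : ℝ => (y, s.2)))
  · refine Eventually.of_forall fun s => Eventually.of_forall fun y => ?_
    by_cases hy : y ∈ Ioi (max s.1 x₀)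
    · rw [indicator_of_mem hy]
      exact (K.norm_le _ _ (le_max_right _ _) (le_of_lt hy)).trans
        (mul_le_mul_of_nonneg_left (hC y _) (K.bound_nonneg y))
    · rw [indicator_of_notMem hy, norm_zero]
      exact mul_nonneg (K.bound_nonneg y) ((norm_nonneg _).trans (hC y s.2))
  · refine ae_restrict_of_ae ((measure_eq_zero_iff_ae_notMem.1
      (measure_singleton (max r.1 x₀))).mono fun y hy => ?_)
    have hm : ContinuousAt (fun s : ℝ × P => max s.1 x₀) r := by fun_prop
    rcases lt_or_gt_of_ne (show y ≠ max r.1 x₀ from hy) with h | h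
    · refine (continuousAt_const (y := (0 : E))).congr ?_
      filter_upwards [hm.eventually (lt_mem_nhds h)] with s hs
      exact (indicator_of_notMem (s := Ioi (max s.1 x₀)) (not_lt.2 (le_of_lt hs)) _).symm
    · have hc : Continuous fun s : ℝ × P => k (max s.1 x₀) y s.2 (f y s.2) :=
        (K.cont y).comp ((by fun_prop : Continuous fun s : ℝ × P => max s.1 x₀).prodMk
          (continuous_snd.prodMk
            (hf.comp (by fun_prop : Continuous fun s : ℝ × P => (y, s.2)))))
      refine hc.continuousAt.congr ?_
      filter_upwards [hm.eventually (gt_mem_nhds h)] with s hs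
      rw [indicator_of_mem (by simpa using hs)]

/-- Contraction principle. With `σ(x) = ∫_x^∞ κ` and the weight `w = e^{-2σ}`, one has `w(x) ∫_x^∞ κ
/ w = (1 - w(x)) / 2`, so the integral operator contracts by `1/2` in the weighted norm, without any
smallness of `κ`. The last clause records that the solution is the limit of Picard iterates started
at `0`: a property of functions of the parameter that holds for `0` and survives the Picard step and
uniform limits holds for the solution. Holomorphy in `ζ` will be obtained in this way. -/
theorem exists_solution (K : VolterraKernel x₀ κ k) (v : P →ᵇ E) :
    ∃ m : ℝ → P → E, Continuous (fun r : ℝ × P => m r.1 r.2) ∧ (∃ C, ∀ x p, ‖m x p‖ ≤ C) ∧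
      (∀ x p, x₀ ≤ x → m x p = v p + ∫ y in Ioi x, k x y p (m y p)) ∧
      ∀ S : Set (P → E), (0 : P → E) ∈ S →
        (∀ h : ℝ → P → E, Continuous (fun r : ℝ × P => h r.1 r.2) → (∃ C, ∀ x p, ‖h x p‖ ≤ C) →
          (∀ x, h x ∈ S) → ∀ x, x₀ ≤ x → (fun p => v p + ∫ y in Ioi x, k x y p (h y p)) ∈ S) →
        (∀ (F : ℕ → P → E) (f : P → E), (∀ n, F n ∈ S) → TendstoUniformly F f atTop → f ∈ S) →
        ∀ x, m x ∈ S := by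
  set σ : ℝ → ℝ := fun x => ∫ y in Ioi x, κ y with hσ
  set w : ℝ → ℝ := fun x => Real.exp (-(2 * σ (max x x₀))) with hw
  have hσc : Continuous fun x => σ (max x x₀) := by
    have : ∀ x, σ (max x x₀) = (∫ y in Ioi x₀, κ y) - ∫ y in x₀..(max x x₀), κ y := fun x =>
      setIntegral_Ioi_sub_of_le K.bound_integrable (le_max_right _ _)
    simp_rw [this]
    refine continuous_const.sub ?_
    exact (intervalIntegral.continuous_primitive
      (fun a b => K.cont_bound.intervalIntegrable a b) x₀).comp (by fun_prop)
  have hσ0 : ∀ x, 0 ≤ σ x := fun x => setIntegral_nonneg measurableSet_Ioi fun y _ =>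
    K.bound_nonneg y
  have hσle : ∀ x, x₀ ≤ x → σ x ≤ σ x₀ := fun x hx =>
    setIntegral_mono_set K.bound_integrable (Eventually.of_forall K.bound_nonneg)
      (Ioi_subset_Ioi hx).eventuallyLE
  have hwc : Continuous w := Real.continuous_exp.comp (continuous_const.mul hσc).neg
  have hwpos : ∀ x, 0 < w x := fun x => Real.exp_pos _
  have hw1 : ∀ x, w x ≤ 1 := fun x => by
    simp only [hw]; rw [Real.exp_le_one_iff]; linarith [hσ0 (max x x₀)]
  set M : ℝ := Real.exp (2 * σ x₀) with hM
  have hMpos : 0 < M := Real.exp_pos _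
  have hwM : ∀ x, (w x)⁻¹ ≤ M := fun x => by
    simp only [hw, hM, ← Real.exp_neg, neg_neg]
    exact Real.exp_le_exp.2 (by linarith [hσle _ (le_max_right x x₀)])
  -- the weighted kernel integral
  have hint : ∀ x, x₀ ≤ x → IntegrableOn (fun y => κ y * (w y)⁻¹) (Ioi x) ∧
      w x * ∫ y in Ioi x, κ y * (w y)⁻¹ ≤ 1 / 2 := by
    intro x hx
    have hi : IntegrableOn (fun y => κ y * (w y)⁻¹) (Ioi x) := by
      refine Integrable.mono' ((K.bound_integrable.mono_set (Ioi_subset_Ioi hx)).mul_const M)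
        ((K.cont_bound.mul (hwc.inv₀ fun y => (hwpos y).ne')).aestronglyMeasurable) ?_
      refine Eventually.of_forall fun y => ?_
      rw [Real.norm_of_nonneg (mul_nonneg (K.bound_nonneg y) (inv_nonneg.2 (hwpos y).le))]
      exact mul_le_mul_of_nonneg_left (hwM y) (K.bound_nonneg y)
    refine ⟨hi, ?_⟩
    have hd : ∀ y ∈ Ioi x, HasDerivAt (fun y => -(Real.exp (2 * σ y) / 2)) (κ y * (w y)⁻¹) y := by
      intro y hy
      have hy' : x₀ < y := lt_of_le_of_lt hx hy
      have h1 : HasDerivAt σ (-κ y) y :=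
        hasDerivAt_integral_Ioi K.cont_bound.continuousOn K.bound_integrable hy'
      have h2 := (((h1.const_mul 2).exp).div_const 2).neg
      refine h2.congr_deriv ?_
      simp only [hw, max_eq_left (le_of_lt hy'), ← Real.exp_neg, neg_neg]
      ring
    have ht : Tendsto (fun y => -(Real.exp (2 * σ y) / 2)) atTop (𝓝 (-(Real.exp (2 * 0) / 2))) := by
      have : Tendsto σ atTop (𝓝 0) := by
        have h3 := intervalIntegral_tendsto_integral_Ioi x₀ K.bound_integrable tendsto_id
        have h4 := (tendsto_const_nhds (x := ∫ y in Ioi x₀, κ y)).sub h3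
        rw [sub_self] at h4
        refine h4.congr' ?_
        filter_upwards [eventually_ge_atTop x₀] with y hy
        exact (setIntegral_Ioi_sub_of_le K.bound_integrable hy).symm
      exact ((Real.continuous_exp.tendsto _).comp (this.const_mul 2)).div_const 2 |>.neg
    have hcw : ContinuousWithinAt (fun y => -(Real.exp (2 * σ y) / 2)) (Ici x) x := by
      have : ContinuousWithinAt (fun y => -(Real.exp (2 * σ (max y x₀)) / 2)) (Ici x) x :=
        ((Real.continuous_exp.comp (continuous_const.mul hσc)).div_const 2).neg.continuousWithinAt
      refine this.congr (fun y hy => ?_) ?_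
      · rw [max_eq_left (hx.trans hy)]
      · rw [max_eq_left hx]
    rw [integral_Ioi_of_hasDerivAt_of_tendsto hcw hd hi ht]
    have h5 : w x * Real.exp (2 * σ x) = 1 := by
      simp only [hw, max_eq_left hx, ← Real.exp_add]; simp
    have : w x * (-(Real.exp (2 * 0) / 2) - -(Real.exp (2 * σ x) / 2))
        = (w x * Real.exp (2 * σ x) - w x) / 2 := by simp; ring
    rw [this, h5]
    linarith [hwpos x]
  -- unweighted function attached to `f`
  let g : (ℝ × P →ᵇ E) → ℝ → P → E := fun f y p => (w y)⁻¹ • f (y, p)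
  have hgc : ∀ f, Continuous fun r : ℝ × P => g f r.1 r.2 := fun f => by
    have : Continuous fun r : ℝ × P => (w r.1)⁻¹ :=
      (hwc.comp continuous_fst).inv₀ fun r => (hwpos _).ne'
    exact this.smul f.continuous
  have hgb : ∀ f y p, ‖g f y p‖ ≤ M * ‖f‖ := fun f y p => by
    simp only [g, norm_smul, norm_inv, Real.norm_of_nonneg (hwpos y).le]
    exact mul_le_mul (hwM y) (f.norm_coe_le_norm _) (norm_nonneg _) hMpos.le
  let U : (ℝ × P →ᵇ E) → ℝ → P → E := fun f x p =>
    v p + ∫ y in Ioi (max x x₀), k (max x x₀) y p (g f y p)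
  have hUc : ∀ f, Continuous fun r : ℝ × P => U f r.1 r.2 := fun f =>
    (v.continuous.comp continuous_snd).add (K.continuous_integral (hgc f) (hgb f))
  have hdiff : ∀ f₁ f₂ x p, w x * ‖U f₁ x p - U f₂ x p‖ ≤ 1 / 2 * ‖f₁ - f₂‖ := by
    intro f₁ f₂ x p
    have hx : x₀ ≤ max x x₀ := le_max_right _ _
    have hwx : w x = w (max x x₀) := by simp [hw]
    have hcy : ∀ f, Continuous fun y => g f y p := fun f =>
      (hgc f).comp (by fun_prop : Continuous fun y : ℝ => (y, p))
    have h1 : U f₁ x p - U f₂ x p = ∫ y in Ioi (max x x₀),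
        (k (max x x₀) y p (g f₁ y p) - k (max x x₀) y p (g f₂ y p)) := by
      rw [integral_sub (K.integrable p (hcy f₁) (fun y => hgb f₁ y p) hx)
        (K.integrable p (hcy f₂) (fun y => hgb f₂ y p) hx)]
      simp only [U]; abel
    have h2 : ‖U f₁ x p - U f₂ x p‖ ≤
        ∫ y in Ioi (max x x₀), κ y * (w y)⁻¹ * ‖f₁ - f₂‖ := by
      rw [h1]
      refine norm_integral_le_of_norm_le ((hint _ hx).1.mul_const _) ?_
      refine (ae_restrict_mem measurableSet_Ioi).mono fun y hy => ?_
      refine (K.lipschitz _ _ _ _ _ hx (le_of_lt hy)).trans ?_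
      rw [mul_assoc]
      refine mul_le_mul_of_nonneg_left ?_ (K.bound_nonneg y)
      simp only [g, ← smul_sub, norm_smul, norm_inv, Real.norm_of_nonneg (hwpos y).le]
      exact mul_le_mul_of_nonneg_left ((f₁ - f₂).norm_coe_le_norm (y, p))
        (inv_nonneg.2 (hwpos y).le)
    rw [integral_mul_const] at h2
    calc w x * ‖U f₁ x p - U f₂ x p‖
        ≤ w x * ((∫ y in Ioi (max x x₀), κ y * (w y)⁻¹) * ‖f₁ - f₂‖) :=
          mul_le_mul_of_nonneg_left h2 (hwpos x).le
      _ = (w (max x x₀) * ∫ y in Ioi (max x x₀), κ y * (w y)⁻¹) * ‖f₁ - f₂‖ := by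
          rw [hwx]; ring
      _ ≤ _ := mul_le_mul_of_nonneg_right (hint _ hx).2 (norm_nonneg _)
  have hU0 : ∀ x p, U 0 x p = v p := fun x p => by simp [U, g, K.map_zero]
  have hUb : ∀ f x p, ‖w x • U f x p‖ ≤ 1 / 2 * ‖f‖ + ‖v‖ := by
    intro f x p
    have h1 := hdiff f 0 x p
    rw [hU0, sub_zero] at h1
    have h2 : w x * ‖U f x p‖ ≤ w x * ‖U f x p - v p‖ + w x * ‖v p‖ := by
      rw [← mul_add]
      refine mul_le_mul_of_nonneg_left ?_ (hwpos x).le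
      simpa using norm_add_le (U f x p - v p) (v p)
    have h3 : w x * ‖v p‖ ≤ 1 * ‖v‖ :=
      mul_le_mul (hw1 x) (v.norm_coe_le_norm p) (norm_nonneg _) zero_le_one
    rw [norm_smul, Real.norm_of_nonneg (hwpos x).le]
    linarith
  let Φ : (ℝ × P →ᵇ E) → (ℝ × P →ᵇ E) := fun f =>
    BoundedContinuousFunction.ofNormedAddCommGroup (fun r : ℝ × P => w r.1 • U f r.1 r.2)
      ((hwc.comp continuous_fst).smul (hUc f)) (1 / 2 * ‖f‖ + ‖v‖) fun r => hUb f r.1 r.2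
  have hΦ : ContractingWith (1 / 2) Φ := by
    refine ⟨by norm_num, LipschitzWith.of_dist_le_mul fun f₁ f₂ => ?_⟩
    rw [BoundedContinuousFunction.dist_le (by positivity)]
    intro r
    have h1 : Φ f₁ r - Φ f₂ r = w r.1 • (U f₁ r.1 r.2 - U f₂ r.1 r.2) := by
      simp [Φ, smul_sub]
    rw [dist_eq_norm, h1, norm_smul, Real.norm_of_nonneg (hwpos _).le, dist_eq_norm]
    simpa using hdiff f₁ f₂ r.1 r.2
  have hgΦ : ∀ f x p, g (Φ f) x p = U f x p := fun f x p => by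
    simp only [g, Φ, BoundedContinuousFunction.coe_ofNormedAddCommGroup]
    rw [inv_smul_smul₀ (hwpos x).ne']
  set F := ContractingWith.fixedPoint Φ hΦ with hF
  have hFix : Φ F = F := hΦ.fixedPoint_isFixedPt
  have hgF : ∀ x p, g F x p = U F x p := fun x p => by
    conv_lhs => rw [← hFix]
    exact hgΦ F x p
  refine ⟨g F, hgc F, ⟨_, hgb F⟩, ?_, ?_⟩
  · intro x p hx
    rw [hgF]
    simp only [U, max_eq_left hx]
  · intro S h0 hS hlim x
    have hiter : ∀ n, ∀ x, g (Φ^[n] 0) x ∈ S := by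
      intro n
      induction n with
      | zero =>
        intro x
        have : g (Φ^[0] 0) x = 0 := by funext p; simp [g]
        rwa [this]
      | succ n ih =>
        intro x
        have : g (Φ^[n + 1] 0) x = fun p =>
            v p + ∫ y in Ioi (max x x₀), k (max x x₀) y p (g (Φ^[n] 0) y p) := by
          funext p
          rw [Function.iterate_succ_apply', hgΦ]
        rw [this]
        exact hS _ (hgc _) ⟨_, hgb _⟩ ih _ (le_max_right _ _)
    -- Since `w⁻¹ ≤ M`, convergence in the weighted norm is uniform convergence of the unweighted
    -- functions.
    refine hlim (fun n => g (Φ^[n] 0) x) _ (fun n => hiter n x) ?_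
    have ht := hΦ.tendsto_iterate_fixedPoint 0
    rw [Metric.tendstoUniformly_iff]
    intro ε hε
    have h1 := (Metric.tendsto_nhds.1 ht) (ε / M) (by positivity)
    filter_upwards [h1] with n hn p
    rw [dist_comm, dist_eq_norm]
    have h2 : g (Φ^[n] 0) x p - g F x p = g (Φ^[n] 0 - F) x p := by
      simp [g, smul_sub]
    rw [h2]
    refine (hgb _ _ _).trans_lt ?_
    rw [dist_eq_norm, lt_div_iff₀ hMpos] at hn
    rwa [mul_comm]

end VolterraKernel

end Volterra

end KE

end

noncomputable section

namespace KE

/-! ### Holomorphic dependence of integrals on parameters -/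

/-- Cauchy's estimate on discs of radius `r / 2` turns the bound for `F` into one for its derivative
in `ζ`, so differentiation under the integral needs no separate hypothesis on derivatives. The
derivative at `ζ₀` is measurable in `y` as a limit of difference quotients along a sequence. -/
theorem differentiableOn_integral_of_dominated {α E : Type*} [MeasurableSpace α]
    [NormedAddCommGroup E] [NormedSpace ℂ E] [CompleteSpace E]
    {μ : Measure α} {U : Set ℂ} (hU : IsOpen U) {F : ℂ → α → E} {bound : α → ℝ}
    (hm : ∀ ζ ∈ U, AEStronglyMeasurable (F ζ) μ)
    (hd : ∀ᵐ y ∂μ, DifferentiableOn ℂ (fun ζ => F ζ y) U)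
    (hb : ∀ᵐ y ∂μ, ∀ ζ ∈ U, ‖F ζ y‖ ≤ bound y) (hi : Integrable bound μ) :
    DifferentiableOn ℂ (fun ζ => ∫ y, F ζ y ∂μ) U := by
  intro ζ₀ hζ₀
  obtain ⟨r, hr, hrU⟩ := Metric.isOpen_iff.1 hU ζ₀ hζ₀
  have hsub : ∀ z ∈ Metric.ball ζ₀ (r / 4), Metric.closedBall z (r / 2) ⊆ U := by
    intro z hz w hw
    refine hrU ?_
    rw [Metric.mem_ball] at *
    rw [Metric.mem_closedBall] at hw
    linarith [dist_triangle w z ζ₀]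
  have hder : ∀ᵐ y ∂μ, HasDerivAt (fun ζ => F ζ y) (deriv (fun ζ => F ζ y) ζ₀) ζ₀ := by
    filter_upwards [hd] with y hy
    exact (hy.differentiableAt (hU.mem_nhds hζ₀)).hasDerivAt
  have hmeas' : AEStronglyMeasurable (fun y => deriv (fun ζ => F ζ y) ζ₀) μ := by
    have hlim : Tendsto (fun n : ℕ => ζ₀ + (r / 4 / (n + 2) : ℝ)) atTop (𝓝[≠] ζ₀) := by
      refine tendsto_nhdsWithin_iff.2 ⟨?_, Eventually.of_forall fun n => ?_⟩
      · have h1 : Tendsto (fun n : ℕ => (r / 4 / (n + 2) : ℝ)) atTop (𝓝 0) := by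
          refine Tendsto.div_atTop tendsto_const_nhds ?_
          exact tendsto_atTop_add_const_right _ _ tendsto_natCast_atTop_atTop
        have h2 := (Complex.continuous_ofReal.tendsto 0).comp h1
        simpa using (tendsto_const_nhds (x := ζ₀)).add h2
      · have : (r / 4 / (n + 2) : ℝ) ≠ 0 := by positivity
        rw [mem_compl_iff, mem_singleton_iff, add_eq_left]
        exact_mod_cast this
    refine aestronglyMeasurable_of_tendsto_ae atTop
      (f := fun n : ℕ => fun y => slope (fun ζ => F ζ y) ζ₀ (ζ₀ + (r / 4 / (n + 2) : ℝ)))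
      (fun n => ?_) ?_
    · simp only [slope, vsub_eq_sub]
      refine AEStronglyMeasurable.const_smul (AEStronglyMeasurable.sub (hm _ (hrU ?_))
        (hm _ hζ₀)) _
      rw [Metric.mem_ball, dist_eq_norm, add_sub_cancel_left, Complex.norm_real,
        Real.norm_of_nonneg (by positivity), div_div, div_lt_iff₀ (by positivity)]
      nlinarith [(Nat.cast_nonneg n : (0 : ℝ) ≤ n)]
    · filter_upwards [hder] with y hy
      exact (hasDerivAt_iff_tendsto_slope.1 hy).comp hlim
  have key := hasDerivAt_integral_of_dominated_loc_of_deriv_le (μ := μ) (F := F)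
    (F' := fun z y => deriv (fun ζ => F ζ y) z) (x₀ := ζ₀)
    (bound := fun y => bound y / (r / 2)) (s := Metric.ball ζ₀ (r / 4))
    (Metric.ball_mem_nhds _ (by positivity)) ?_ ?_ hmeas' ?_ (hi.div_const _) ?_
  · exact key.2.differentiableAt.differentiableWithinAt
  · filter_upwards [hU.mem_nhds hζ₀] with z hz using hm z hz
  · exact hi.mono' (hm _ hζ₀) (hb.mono fun y hy => hy _ hζ₀)
  · filter_upwards [hd, hb] with y hy hby z hz
    refine Complex.norm_deriv_le_of_forall_mem_sphere_norm_le (by positivity) ?_ fun w hw =>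
      hby w (hsub z hz (Metric.sphere_subset_closedBall hw))
    refine DifferentiableOn.diffContOnCl ?_
    rw [closure_ball _ (by positivity)]
    exact hy.mono (hsub z hz)
  · filter_upwards [hd] with y hy z hz
    exact (hy.differentiableAt (hU.mem_nhds (hsub z hz
      (Metric.mem_closedBall_self (by positivity))))).hasDerivAt

/-! ### The function `(e^{cs} - 1) / c` -/

/-- `(e^{cs} - 1) / c`, continued by `s` to `c = 0`. -/
def expQuot (c : ℂ) (s : ℝ) : ℂ := s * dslope Complex.exp 0 (c * s)

theorem mul_expQuot (c : ℂ) (s : ℝ) : c * expQuot c s = Complex.exp (c * s) - 1 := by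
  have := sub_smul_dslope Complex.exp 0 (c * s)
  simp only [sub_zero, smul_eq_mul, Complex.exp_zero] at this
  rw [← this, expQuot]; ring

theorem expQuot_zero_left (s : ℝ) : expQuot 0 s = s := by
  simp [expQuot]

@[simp] theorem expQuot_zero_right (c : ℂ) : expQuot c 0 = 0 := by
  simp [expQuot]

theorem differentiable_dslope_exp : Differentiable ℂ (dslope Complex.exp 0) := by
  have := (Complex.differentiableOn_dslope (f := Complex.exp) (s := univ) (c := 0)
    univ_mem).2 Complex.differentiable_exp.differentiableOn
  exact differentiableOn_univ.1 this

theorem continuous_expQuot : Continuous fun r : ℂ × ℝ => expQuot r.1 r.2 := by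
  unfold expQuot
  have := differentiable_dslope_exp.continuous
  fun_prop

theorem differentiable_expQuot (s : ℝ) : Differentiable ℂ fun c => expQuot c s := by
  unfold expQuot
  have h : Differentiable ℂ fun c : ℂ => c * (s : ℂ) := by fun_prop
  exact (differentiable_dslope_exp.comp h).const_mul (s : ℂ)

theorem norm_exp_sub_one_le_of_re_nonpos {z : ℂ} (hz : z.re ≤ 0) :
    ‖Complex.exp z - 1‖ ≤ ‖z‖ := by
  have hc : Convex ℝ {w : ℂ | w.re ≤ 0} := convex_halfSpace_re_le 0
  have := hc.norm_image_sub_le_of_norm_deriv_le (f := Complex.exp) (C := 1) (x := 0) (y := z)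
    (fun w _ => Complex.differentiable_exp w) (fun w hw => ?_) (by simp) hz
  · simpa using this
  · rw [Complex.deriv_exp, Complex.norm_exp, Real.exp_le_one_iff]
    exact hw

/-- The mean value inequality for `exp` on the left half plane. The bound does not involve `c`, so
it persists at `c = 0`, that is at the branch point; its linear growth in `s` is what the first
moment pays for. The companion bound on `c * expQuot c s` handles large `c`. -/
theorem norm_expQuot_le {c : ℂ} {s : ℝ} (h : (c * s).re ≤ 0) : ‖expQuot c s‖ ≤ |s| := by
  by_cases hc : c = 0
  · simp [hc, expQuot_zero_left]
  · have h1 := norm_exp_sub_one_le_of_re_nonpos h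
    rw [← mul_expQuot, norm_mul, norm_mul, Complex.norm_real, Real.norm_eq_abs] at h1
    exact le_of_mul_le_mul_left h1 (norm_pos_iff.2 hc)

theorem norm_mul_expQuot_le {c : ℂ} {s : ℝ} (h : (c * s).re ≤ 0) : ‖c * expQuot c s‖ ≤ 2 := by
  rw [mul_expQuot]
  have : ‖Complex.exp (c * s)‖ ≤ 1 := by
    rw [Complex.norm_exp, Real.exp_le_one_iff]; exact h
  calc _ ≤ ‖Complex.exp (c * s)‖ + ‖(1 : ℂ)‖ := norm_sub_le _ _
    _ ≤ 2 := by rw [norm_one]; linarith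

/-- Separates the variables in `expQuot c (x - y)`, which allows the Volterra integral to be
differentiated in `x`. -/
theorem expQuot_add (c : ℂ) (s t : ℝ) :
    expQuot c (s + t) = expQuot c t + Complex.exp (c * t) * expQuot c s := by
  by_cases hc : c = 0
  · simp [hc, expQuot_zero_left]; ring
  · apply mul_left_cancel₀ hc
    have : c * (expQuot c t + Complex.exp (c * t) * expQuot c s)
      = c * expQuot c t + Complex.exp (c * t) * (c * expQuot c s) := by ring
    rw [this, mul_expQuot, mul_expQuot, mul_expQuot]
    push_cast
    rw [mul_add, Complex.exp_add]; ring

theorem hasDerivAt_expQuot (c : ℂ) (s : ℝ) :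
    HasDerivAt (fun s : ℝ => expQuot c s) (Complex.exp (c * s)) s := by
  by_cases hc : c = 0
  · simp only [hc, expQuot_zero_left]
    simpa using (hasDerivAt_id s).ofReal_comp
  · have h : HasDerivAt (fun s : ℝ => (Complex.exp (c * s) - 1) / c) (Complex.exp (c * s)) s := by
      have h1 : HasDerivAt (fun s : ℝ => c * (s : ℂ)) c s := by
        simpa using ((hasDerivAt_id s).ofReal_comp).const_mul c
      have h2 := (h1.cexp.sub_const 1).div_const c
      refine h2.congr_deriv ?_
      field_simp
    refine h.congr_of_eventuallyEq (Eventually.of_forall fun x => ?_)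
    rw [eq_div_iff hc, mul_comm]
    exact mul_expQuot c x

/-! ### The half-line problem -/

/-- Potentials on the line that tend to `qb` at `+∞` with a finite first moment. -/
structure IsStep (P : Params) (u : ℝ → ℂ) (qb : ℂ) : Prop where
  contDiff : ContDiff ℝ 1 u
  bounded : ∃ C, ∀ x, ‖u x‖ ≤ C
  norm_eq : ‖qb‖ = P.q₀
  integrable : IntegrableOn (fun x => (1 + |x|) * ‖u x - qb‖) (Ioi 0)

/-- The closed exterior of the circle `|ζ| = q₀` in the upper half plane. -/
def extUpper (P : Params) : Set ℂ := {ζ | P.q₀ ≤ ‖ζ‖ ∧ 0 ≤ ζ.im}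

/-- The open exterior of the circle `|ζ| = q₀` in the upper half plane. -/
def extUpperOpen (P : Params) : Set ℂ := {ζ | P.q₀ < ‖ζ‖ ∧ 0 < ζ.im}

theorem isOpen_extUpperOpen (P : Params) : IsOpen (extUpperOpen P) :=
  (isOpen_lt continuous_const continuous_norm).inter
    (isOpen_lt continuous_const Complex.continuous_im)

theorem isClosed_extUpper (P : Params) : IsClosed (extUpper P) :=
  (isClosed_le continuous_const continuous_norm).inter
    (isClosed_le continuous_const Complex.continuous_im)

theorem extUpperOpen_subset (P : Params) : extUpperOpen P ⊆ extUpper P :=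
  fun _ h => ⟨h.1.le, h.2.le⟩

theorem ne_zero_of_mem_extUpper {P : Params} (hq : 0 < P.q₀) {ζ : ℂ} (h : ζ ∈ extUpper P) :
    ζ ≠ 0 := by
  rintro rfl
  have := h.1
  simp at this
  linarith

theorem lam_im (P : Params) (ζ : ℂ) :
    (lam P ζ).im = ζ.im * (1 - P.q₀ ^ 2 / ‖ζ‖ ^ 2) / 2 := by
  have h2 : (2 : ℂ) = ((2 : ℝ) : ℂ) := by norm_num
  have h3 : ((P.q₀ : ℂ) ^ 2) = ((P.q₀ ^ 2 : ℝ) : ℂ) := by push_cast; ring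
  rw [lam, h2, Complex.div_ofReal_im, Complex.add_im, h3,
    div_eq_mul_inv ((P.q₀ ^ 2 : ℝ) : ℂ) ζ, Complex.im_ofReal_mul,
    Complex.inv_im, Complex.normSq_eq_norm_sq]
  ring

theorem lam_im_nonneg {P : Params} (hq : 0 < P.q₀) {ζ : ℂ} (h : ζ ∈ extUpper P) :
    0 ≤ (lam P ζ).im := by
  rw [lam_im]
  have h1 : P.q₀ ^ 2 / ‖ζ‖ ^ 2 ≤ 1 := by
    refine div_le_one_of_le₀ ?_ (by positivity)
    exact pow_le_pow_left₀ hq.le h.1 2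
  have := h.2
  have : 0 ≤ 1 - P.q₀ ^ 2 / ‖ζ‖ ^ 2 := by linarith
  positivity

theorem lam_im_pos {P : Params} (hq : 0 < P.q₀) {ζ : ℂ} (h : ζ ∈ extUpperOpen P) :
    0 < (lam P ζ).im := by
  rw [lam_im]
  have h1 : P.q₀ ^ 2 / ‖ζ‖ ^ 2 < 1 := by
    have := hq.trans h.1
    rw [div_lt_one (by positivity)]
    exact pow_lt_pow_left₀ h.1 hq.le (by norm_num)
  have := h.2
  have : 0 < 1 - P.q₀ ^ 2 / ‖ζ‖ ^ 2 := by linarith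
  positivity

/-- The linear map with a given `2 × 2` matrix. -/
def pairMap (a b c d : ℂ) : ℂ × ℂ →L[ℂ] ℂ × ℂ :=
  (a • ContinuousLinearMap.fst ℂ ℂ ℂ + b • ContinuousLinearMap.snd ℂ ℂ ℂ).prod
    (c • ContinuousLinearMap.fst ℂ ℂ ℂ + d • ContinuousLinearMap.snd ℂ ℂ ℂ)

@[simp] theorem pairMap_apply (a b c d : ℂ) (v : ℂ × ℂ) :
    pairMap a b c d v = (a * v.1 + b * v.2, c * v.1 + d * v.2) := rfl

theorem norm_pairMap_le {a b c d : ℂ} {C : ℝ} (h1 : ‖a‖ + ‖b‖ ≤ C) (h2 : ‖c‖ + ‖d‖ ≤ C)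
    (v : ℂ × ℂ) : ‖pairMap a b c d v‖ ≤ C * ‖v‖ := by
  rw [pairMap_apply, Prod.norm_mk]
  have e1 : ‖v.1‖ ≤ ‖v‖ := norm_fst_le v
  have e2 : ‖v.2‖ ≤ ‖v‖ := norm_snd_le v
  have key : ∀ a b : ℂ, ‖a‖ + ‖b‖ ≤ C → ‖a * v.1 + b * v.2‖ ≤ C * ‖v‖ := by
    intro a b h
    calc ‖a * v.1 + b * v.2‖ ≤ ‖a‖ * ‖v.1‖ + ‖b‖ * ‖v.2‖ := by
          simpa [norm_mul] using norm_add_le (a * v.1) (b * v.2)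
      _ ≤ ‖a‖ * ‖v‖ + ‖b‖ * ‖v‖ := by gcongr
      _ = (‖a‖ + ‖b‖) * ‖v‖ := by ring
      _ ≤ _ := by gcongr
  exact max_le (key _ _ h1) (key _ _ h2)

/-- The constant part of the modified `x`-equation at `+∞`. -/
def stepL (P : Params) (qb ζ : ℂ) : ℂ × ℂ →L[ℂ] ℂ × ℂ :=
  pairMap (-(I * ζ)) qb (-conj qb) (-(I * (P.q₀ : ℂ) ^ 2 / ζ))

/-- The decaying part of the modified `x`-equation at `+∞`. -/
def stepB (P : Params) (u : ℝ → ℂ) (qb : ℂ) (x : ℝ) : ℂ × ℂ →L[ℂ] ℂ × ℂ :=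
  pairMap (I * P.T * ((‖u x‖ ^ 2 - P.q₀ ^ 2 : ℝ) : ℂ)) (u x - qb) (-conj (u x - qb))
    (-(I * P.T * ((‖u x‖ ^ 2 - P.q₀ ^ 2 : ℝ) : ℂ)))

/-- The second column of `E`. -/
def stepE (qb ζ : ℂ) : ℂ × ℂ := (-(I * qb / ζ), 1)

theorem stepL_stepE {P : Params} {qb ζ : ℂ} (hζ : ζ ≠ 0) (hqb : ‖qb‖ = P.q₀) :
    stepL P qb ζ (stepE qb ζ) = 0 := by
  have h : conj qb * qb = (P.q₀ : ℂ) ^ 2 := by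
    rw [Complex.conj_mul', hqb]
  simp only [stepL, stepE, pairMap_apply, Prod.mk_eq_zero]
  constructor
  · field_simp; linear_combination (qb) * I_sq
  · field_simp; linear_combination I * h

/-- Cayley-Hamilton: `stepL` has determinant `0` and trace `-2iλ`. Consequently `e^{sL} = 1 +
expQuot (-2iλ) s • L`, and variation of constants from `+∞` produces the kernel used below. -/
theorem stepL_stepL {P : Params} {qb ζ : ℂ} (hζ : ζ ≠ 0) (hqb : ‖qb‖ = P.q₀) (v : ℂ × ℂ) :
    stepL P qb ζ (stepL P qb ζ v) = (-2 * I * lam P ζ) • stepL P qb ζ v := by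
  have h : conj qb * qb = (P.q₀ : ℂ) ^ 2 := by
    rw [Complex.conj_mul', hqb]
  simp only [stepL, pairMap_apply, Prod.smul_mk, Prod.mk.injEq, smul_eq_mul, lam]
  constructor
  · field_simp
    linear_combination (- v.1 * ζ) * h + (-(P.q₀:ℂ)^2 * v.1 * ζ ) * I_sq
  · field_simp
    linear_combination (- v.2 * ζ^2) * h + (-(P.q₀:ℂ)^2 * v.2 * ζ^2 ) * I_sq

end KE

end

/-! ### Majorants and the Volterra kernel of the modified equation -/

noncomputable section

namespace KE

open scoped BoundedContinuousFunction

theorem integrableOn_Ioi_of_continuous {f : ℝ → ℝ} {b : ℝ} (hc : Continuous f)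
    (hf : IntegrableOn f (Ioi b)) (a : ℝ) : IntegrableOn f (Ioi a) := by
  have h1 : IntegrableOn f (Icc a b) := hc.continuousOn.integrableOn_compact isCompact_Icc
  refine (h1.union hf).mono_set fun x hx => ?_
  rcases le_or_gt x b with h | h
  · exact Or.inl ⟨le_of_lt hx, h⟩
  · exact Or.inr h

/-- Tails of a function with finite first moment are integrable. -/
theorem integrableOn_tail {β : ℝ → ℝ} {a : ℝ} (hc : Continuous β) (h0 : ∀ x, 0 ≤ β x)
    (hi : IntegrableOn β (Ioi a)) (hi' : IntegrableOn (fun x => (x - a) * β x) (Ioi a)) :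
    IntegrableOn (fun x => ∫ y in Ioi x, β y) (Ioi a) := by
  set σ : ℝ → ℝ := fun x => ∫ y in Ioi x, β y
  set τ : ℝ → ℝ := fun x => ∫ y in Ioi x, (y - a) * β y
  have hσ0 : ∀ x, 0 ≤ σ x := fun x => setIntegral_nonneg measurableSet_Ioi fun y _ => h0 y
  have tail : ∀ f : ℝ → ℝ, IntegrableOn f (Ioi a) →
      Tendsto (fun x => ∫ y in Ioi x, f y) atTop (𝓝 0) := by
    intro f hf
    have h3 := intervalIntegral_tendsto_integral_Ioi a hf tendsto_id
    have h4 := (tendsto_const_nhds (x := ∫ y in Ioi a, f y)).sub h3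
    rw [sub_self] at h4
    refine h4.congr' ?_
    filter_upwards [eventually_ge_atTop a] with y hy
    exact (setIntegral_Ioi_sub_of_le hf hy).symm
  -- An explicit primitive of the non-negative function `σ`. It has a limit at infinity because `(x
  -- - a) σ(x) ≤ ∫_x^∞ (y - a) β`.
  have hd : ∀ x ∈ Ioi a, HasDerivAt (fun x => (x - a) * σ x - τ x) (σ x) x := by
    intro x hx
    have h1 : HasDerivAt σ (-β x) x := hasDerivAt_integral_Ioi hc.continuousOn hi hx
    have h2 : HasDerivAt τ (-((x - a) * β x)) x :=
      hasDerivAt_integral_Ioi (by fun_prop) hi' hx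
    have h3 := (((hasDerivAt_id x).sub_const a).mul h1).sub h2
    refine h3.congr_deriv ?_
    simp
  have hle : ∀ x, a ≤ x → (x - a) * σ x ≤ τ x := by
    intro x hx
    rw [← integral_const_mul]
    refine setIntegral_mono_on ((hi.mono_set (Ioi_subset_Ioi hx)).const_mul _)
      (hi'.mono_set (Ioi_subset_Ioi hx)) measurableSet_Ioi fun y hy => ?_
    exact mul_le_mul_of_nonneg_right (by linarith [mem_Ioi.1 hy]) (h0 y)
  have ht : Tendsto (fun x => (x - a) * σ x - τ x) atTop (𝓝 0) := by
    have h1 : Tendsto (fun x => (x - a) * σ x) atTop (𝓝 0) := by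
      refine tendsto_of_tendsto_of_tendsto_of_le_of_le' tendsto_const_nhds (tail _ hi') ?_ ?_
      · filter_upwards [eventually_ge_atTop a] with x hx
        exact mul_nonneg (by linarith) (hσ0 x)
      · filter_upwards [eventually_ge_atTop a] with x hx using hle x hx
    simpa using h1.sub (tail _ hi')
  have hcw : ContinuousWithinAt (fun x => (x - a) * σ x - τ x) (Ici a) a := by
    have hprim : ∀ f : ℝ → ℝ, Continuous f → IntegrableOn f (Ioi a) →
        ContinuousWithinAt (fun x => ∫ y in Ioi x, f y) (Ici a) a := by
      intro f hf hfi
      have h1 : Continuous fun x => (∫ y in Ioi a, f y) - ∫ y in a..x, f y :=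
        continuous_const.sub (intervalIntegral.continuous_primitive
          (fun _ _ => hf.intervalIntegrable _ _) a)
      refine h1.continuousWithinAt.congr (fun x hx => ?_) ?_
      · exact setIntegral_Ioi_sub_of_le hfi hx
      · exact setIntegral_Ioi_sub_of_le hfi le_rfl
    exact ((continuousWithinAt_id.sub continuousWithinAt_const).mul (hprim _ hc hi)).sub
      (hprim _ (by fun_prop) hi')
  exact integrableOn_Ioi_deriv_of_nonneg hcw hd (fun x _ => hσ0 x) ht

namespace IsStep

variable {P : Params} {u : ℝ → ℂ} {qb : ℂ}

theorem continuous (hu : IsStep P u qb) : Continuous u := hu.contDiff.continuous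

/-- On the exterior `|ζ|` is controlled by `2|λ|`, so the growth of `stepL` in `ζ` is absorbed by
the bound for `c * expQuot c s` with `c = -2iλ`. -/
theorem norm_exterior_bounds (hq : 0 < P.q₀) {ζ : ℂ} (hζ : ζ ∈ extUpper P) :
    ‖(P.q₀ : ℂ) ^ 2 / ζ‖ ≤ P.q₀ ∧ ‖ζ‖ ≤ 2 * ‖lam P ζ‖ + P.q₀ := by
  have hpos : 0 < ‖ζ‖ := hq.trans_le hζ.1
  have h1 : ‖(P.q₀ : ℂ) ^ 2 / ζ‖ ≤ P.q₀ := by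
    rw [norm_div, norm_pow, Complex.norm_real, Real.norm_of_nonneg hq.le, div_le_iff₀ hpos, sq]
    exact mul_le_mul_of_nonneg_left hζ.1 hq.le
  refine ⟨h1, ?_⟩
  have h2 : ζ = 2 * lam P ζ - (P.q₀ : ℂ) ^ 2 / ζ := by rw [lam]; ring
  calc ‖ζ‖ = ‖2 * lam P ζ - (P.q₀ : ℂ) ^ 2 / ζ‖ := by rw [← h2]
    _ ≤ ‖2 * lam P ζ‖ + ‖(P.q₀ : ℂ) ^ 2 / ζ‖ := norm_sub_le _ _
    _ ≤ 2 * ‖lam P ζ‖ + P.q₀ := by rw [norm_mul, Complex.norm_ofNat]; linarith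

theorem norm_stepL_le (hq : 0 < P.q₀) (hqb : ‖qb‖ = P.q₀) {ζ : ℂ} (hζ : ζ ∈ extUpper P)
    (v : ℂ × ℂ) : ‖stepL P qb ζ v‖ ≤ (‖ζ‖ + P.q₀) * ‖v‖ := by
  have h1 := (norm_exterior_bounds hq hζ).1
  refine norm_pairMap_le ?_ ?_ v
  · simp [hqb]
  · rw [norm_neg, norm_neg, RCLike.norm_conj, hqb, mul_div_assoc, norm_mul, norm_I, one_mul]
    linarith [hζ.1]

/-- A majorant of the decaying part of the modified `x`-equation. -/
theorem exists_majorant (hq : 0 < P.q₀) (hu : IsStep P u qb) : ∃ β : ℝ → ℝ, Continuous β ∧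
    (∀ x, 0 ≤ β x) ∧ (∀ a, IntegrableOn β (Ioi a)) ∧
    (∀ a, IntegrableOn (fun x => (x - a) * β x) (Ioi a)) ∧
    (∀ x v, ‖stepB P u qb x v‖ ≤ β x * ‖v‖) := by
  obtain ⟨C, hC⟩ := hu.bounded
  have hC0 : 0 ≤ C := (norm_nonneg _).trans (hC 0)
  have hcu := hu.continuous
  -- The summand `|T| (C + q₀)` comes from the diagonal, where `| |u|² - q₀² | ≤ (|u| + q₀) |u -
  -- qb|`, and the summand `1` from the off-diagonal entry.
  set c : ℝ := |P.T| * (C + P.q₀) + 1 with hc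
  have hc0 : 0 ≤ c := by positivity
  have hβc : Continuous fun x => c * ‖u x - qb‖ := by fun_prop
  have hm : ∀ a, IntegrableOn (fun x => (1 + |x|) * (c * ‖u x - qb‖)) (Ioi a) := by
    refine integrableOn_Ioi_of_continuous (b := 0) (by fun_prop) ?_
    refine (hu.integrable.const_mul c).congr (Eventually.of_forall fun x => ?_)
    ring
  refine ⟨fun x => c * ‖u x - qb‖, hβc, fun x => by positivity, fun a => ?_, fun a => ?_, ?_⟩
  · refine (hm a).mono' hβc.aestronglyMeasurable (Eventually.of_forall fun x => ?_)
    rw [Real.norm_of_nonneg (mul_nonneg hc0 (norm_nonneg _))]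
    have h1 : 0 ≤ c * ‖u x - qb‖ := by positivity
    nlinarith [abs_nonneg x, mul_nonneg (abs_nonneg x) h1]
  · refine ((hm a).const_mul (1 + |a|)).mono' (by fun_prop) (Eventually.of_forall fun x => ?_)
    have h0 : 0 ≤ c * ‖u x - qb‖ := by positivity
    have h1 : |x - a| ≤ (1 + |a|) * (1 + |x|) := by
      have := abs_sub x a
      nlinarith [abs_nonneg x, abs_nonneg a, mul_nonneg (abs_nonneg x) (abs_nonneg a)]
    calc ‖(x - a) * (c * ‖u x - qb‖)‖ = |x - a| * (c * ‖u x - qb‖) := by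
          rw [norm_mul, Real.norm_of_nonneg h0, Real.norm_eq_abs]
      _ ≤ (1 + |a|) * (1 + |x|) * (c * ‖u x - qb‖) := mul_le_mul_of_nonneg_right h1 h0
      _ = _ := by ring
  · intro x v
    have h1 : ‖(I * P.T * ((‖u x‖ ^ 2 - P.q₀ ^ 2 : ℝ) : ℂ))‖
        ≤ |P.T| * (C + P.q₀) * ‖u x - qb‖ := by
      rw [norm_mul, norm_mul, norm_I, one_mul, Complex.norm_real, Complex.norm_real,
        Real.norm_eq_abs, Real.norm_eq_abs, mul_assoc]
      refine mul_le_mul_of_nonneg_left ?_ (abs_nonneg _)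
      have e : ‖u x‖ ^ 2 - P.q₀ ^ 2 = (‖u x‖ + P.q₀) * (‖u x‖ - ‖qb‖) := by
        rw [hu.norm_eq]; ring
      rw [e, abs_mul, abs_of_nonneg (by positivity : 0 ≤ ‖u x‖ + P.q₀)]
      exact mul_le_mul (by linarith [hC x]) (abs_norm_sub_norm_le _ _) (abs_nonneg _)
        (by positivity)
    refine norm_pairMap_le ?_ ?_ v
    · linarith [h1]
    · rw [norm_neg, norm_neg, RCLike.norm_conj]
      linarith [h1]

theorem continuous_stepL (hq : 0 < P.q₀) (qb : ℂ) :
    Continuous fun r : extUpper P × (ℂ × ℂ) => stepL P qb r.1 r.2 := by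
  have h0 : Continuous fun r : extUpper P × (ℂ × ℂ) => (r.1 : ℂ) :=
    continuous_subtype_val.comp continuous_fst
  have h1 : Continuous fun r : extUpper P × (ℂ × ℂ) => I * (P.q₀ : ℂ) ^ 2 / (r.1 : ℂ) :=
    continuous_const.div h0 fun r => ne_zero_of_mem_extUpper hq r.1.2
  simp only [stepL, pairMap_apply]
  fun_prop

theorem continuous_lam (hq : 0 < P.q₀) : Continuous fun ζ : extUpper P => lam P ζ := by
  have h0 : Continuous fun ζ : extUpper P => (ζ : ℂ) := continuous_subtype_val
  have h1 : Continuous fun ζ : extUpper P => (P.q₀ : ℂ) ^ 2 / (ζ : ℂ) :=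
    continuous_const.div h0 fun r => ne_zero_of_mem_extUpper hq r.2
  unfold lam
  fun_prop

/-- The kernel of the Volterra equation for the modified Jost solution. -/
def kernel (P : Params) (u : ℝ → ℂ) (qb : ℂ) (x y : ℝ) (ζ : extUpper P) (v : ℂ × ℂ) : ℂ × ℂ :=
  -(stepB P u qb y v + expQuot (-2 * I * lam P ζ) (x - y) • stepL P qb ζ (stepB P u qb y v))

theorem exponent_re_nonpos (hq : 0 < P.q₀) {ζ : ℂ} (hζ : ζ ∈ extUpper P) {s : ℝ} (hs : s ≤ 0) :
    (-2 * I * lam P ζ * s).re ≤ 0 := by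
  have h1 := lam_im_nonneg hq hζ
  have h2 : (-2 * I * lam P ζ * s).re = 2 * (lam P ζ).im * s := by
    simp [Complex.mul_re]
  rw [h2]
  exact mul_nonpos_of_nonneg_of_nonpos (by positivity) hs

theorem continuous_stepB (hu : IsStep P u qb) :
    Continuous fun r : ℝ × (ℂ × ℂ) => stepB P u qb r.1 r.2 := by
  have hcu := hu.continuous
  simp only [stepB, pairMap_apply]
  have hc : Continuous (starRingEnd ℂ) := Complex.continuous_conj
  have h1 : Continuous fun r : ℝ × (ℂ × ℂ) => u r.1 := hcu.comp continuous_fst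
  have h2 : Continuous fun r : ℝ × (ℂ × ℂ) => conj (u r.1 - qb) :=
    hc.comp (h1.sub continuous_const)
  fun_prop

theorem continuous_kernel (hq : 0 < P.q₀) (hu : IsStep P u qb) :
    Continuous fun r : ℝ × ℝ × extUpper P × (ℂ × ℂ) =>
      kernel P u qb r.1 r.2.1 r.2.2.1 r.2.2.2 := by
  have g1 : Continuous fun r : ℝ × ℝ × extUpper P × (ℂ × ℂ) => (r.2.1, r.2.2.2) := by fun_prop
  have g2 : Continuous fun r : ℝ × ℝ × extUpper P × (ℂ × ℂ) => r.2.2.1 := by fun_prop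
  have hB := hu.continuous_stepB.comp g1
  have hL := (continuous_stepL hq qb).comp (g2.prodMk hB)
  have hl := (continuous_lam hq).comp g2
  have g3 : Continuous fun r : ℝ × ℝ × extUpper P × (ℂ × ℂ) => r.1 - r.2.1 := by fun_prop
  have hφ := continuous_expQuot.comp (((continuous_const (y := -2 * I)).mul hl).prodMk g3)
  exact (hB.add (hφ.smul hL)).neg

/-- In the factor `3 + 2q₀|y - x₀|` the identity part of the propagator contributes `1`, and
`|expQuot| (2|λ| + 2q₀)` contributes `2 + 2q₀|y - x₀|`. As `ζ` does not enter, the whole closed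
exterior can serve as parameter space. -/
theorem volterraKernel (hq : 0 < P.q₀) (hu : IsStep P u qb) {β : ℝ → ℝ} (hβc : Continuous β)
    (hβ0 : ∀ x, 0 ≤ β x) (hβi : ∀ a, IntegrableOn β (Ioi a))
    (hβi' : ∀ a, IntegrableOn (fun x => (x - a) * β x) (Ioi a))
    (hβ : ∀ x v, ‖stepB P u qb x v‖ ≤ β x * ‖v‖) (x₀ : ℝ) :
    VolterraKernel x₀ (fun y => (3 + 2 * P.q₀ * |y - x₀|) * β y) (kernel P u qb) where
  cont_bound := by fun_prop
  bound_nonneg y := mul_nonneg (by positivity) (hβ0 y)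
  bound_integrable := by
    refine (((hβi x₀).const_mul 3).add ((hβi' x₀).const_mul (2 * P.q₀))).congr ?_
    refine (ae_restrict_mem measurableSet_Ioi).mono fun y hy => ?_
    simp only [Pi.add_apply]
    rw [abs_of_pos (sub_pos.2 hy)]; ring
  map_zero x y ζ := by simp [kernel]
  lipschitz x y ζ v w hx hy := by
    have h1 : kernel P u qb x y ζ v - kernel P u qb x y ζ w = kernel P u qb x y ζ (v - w) := by
      simp only [kernel, map_sub, smul_sub]; abel
    rw [h1, kernel, norm_neg]
    set b := stepB P u qb y (v - w)
    set φ := expQuot (-2 * I * lam P ζ) (x - y)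
    have hb : ‖b‖ ≤ β y * ‖v - w‖ := hβ y _
    have hre := exponent_re_nonpos hq ζ.2 (s := x - y) (by linarith)
    have h2 : ‖φ‖ ≤ |y - x₀| := by
      refine (norm_expQuot_le hre).trans ?_
      rw [abs_of_nonpos (by linarith), abs_of_nonneg (by linarith)]
      linarith
    have h3 : 2 * ‖lam P ζ‖ * ‖φ‖ ≤ 2 := by
      have := norm_mul_expQuot_le hre
      rwa [norm_mul, show ‖-2 * I * lam P ζ‖ = 2 * ‖lam P ζ‖ by simp] at this
    have h4 : ‖φ • stepL P qb ζ b‖ ≤ (2 + 2 * P.q₀ * |y - x₀|) * ‖b‖ := by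
      rw [norm_smul]
      have h5 := norm_stepL_le hq hu.norm_eq ζ.2 b
      have h6 := (norm_exterior_bounds hq ζ.2).2
      calc ‖φ‖ * ‖stepL P qb ζ b‖ ≤ ‖φ‖ * ((2 * ‖lam P ζ‖ + P.q₀ + P.q₀) * ‖b‖) := by
            refine mul_le_mul_of_nonneg_left (h5.trans ?_) (norm_nonneg _)
            refine mul_le_mul_of_nonneg_right ?_ (norm_nonneg _)
            linarith
        _ = (2 * ‖lam P ζ‖ * ‖φ‖ + 2 * P.q₀ * ‖φ‖) * ‖b‖ := by ring
        _ ≤ _ := by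
            refine mul_le_mul_of_nonneg_right (add_le_add h3 ?_) (norm_nonneg _)
            exact mul_le_mul_of_nonneg_left h2 (by positivity)
    calc ‖b + φ • stepL P qb ζ b‖ ≤ ‖b‖ + (2 + 2 * P.q₀ * |y - x₀|) * ‖b‖ :=
          (norm_add_le _ _).trans (by linarith)
      _ = (3 + 2 * P.q₀ * |y - x₀|) * ‖b‖ := by ring
      _ ≤ (3 + 2 * P.q₀ * |y - x₀|) * (β y * ‖v - w‖) := by gcongr
      _ = _ := by ring
  cont y := by
    have g : Continuous fun r : ℝ × extUpper P × (ℂ × ℂ) => (r.1, y, r.2.1, r.2.2) := by fun_prop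
    have h := (continuous_kernel hq hu).comp g
    exact h
  meas x ζ f hf := by
    have g : Continuous fun y : ℝ => (x, y, ζ, f y) := by fun_prop
    have h := (continuous_kernel hq hu).comp g
    exact h.aestronglyMeasurable

end IsStep

end KE

end

/-! ### The modified Jost solution on a half-line -/

noncomputable section

namespace KE

open scoped BoundedContinuousFunction

namespace IsStep

variable {P : Params} {u : ℝ → ℂ} {qb : ℂ}

theorem norm_stepE_le (hqb : ‖qb‖ = P.q₀) {ζ : ℂ} (hζ : ζ ∈ extUpper P) :
    ‖stepE qb ζ‖ ≤ 1 := by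
  rw [stepE, Prod.norm_mk, norm_one, norm_neg, norm_div, norm_mul, norm_I, one_mul, hqb]
  exact max_le (div_le_one_of_le₀ hζ.1 (norm_nonneg _)) le_rfl

theorem continuous_stepE (hq : 0 < P.q₀) (qb : ℂ) :
    Continuous fun ζ : extUpper P => stepE qb ζ := by
  have h1 : Continuous fun ζ : extUpper P => I * qb / (ζ : ℂ) :=
    continuous_const.div continuous_subtype_val fun ζ => ne_zero_of_mem_extUpper hq ζ.2
  unfold stepE
  fun_prop

/-- `f` solves the modified `x`-equation on `(x₀, ∞)`. -/
def SolvesModified (P : Params) (u : ℝ → ℂ) (qb ζ : ℂ) (x₀ : ℝ) (f : ℝ → ℂ × ℂ) : Prop :=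
  ∀ x, x₀ < x → HasDerivAt f (stepL P qb ζ (f x) + stepB P u qb x (f x)) x

/-- A bounded solution of the Volterra equation solves the modified `x`-equation. -/
theorem solvesModified_of_integral_eq (hq : 0 < P.q₀) (hu : IsStep P u qb) {β : ℝ → ℝ}
    (hβi : ∀ a, IntegrableOn β (Ioi a)) (hβ0 : ∀ x, 0 ≤ β x)
    (hβi' : ∀ a, IntegrableOn (fun x => (x - a) * β x) (Ioi a))
    (hβ : ∀ x v, ‖stepB P u qb x v‖ ≤ β x * ‖v‖) {x₀ : ℝ} (ζ : extUpper P) {f : ℝ → ℂ × ℂ}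
    (hf : Continuous f) {C : ℝ} (hC : ∀ x, ‖f x‖ ≤ C)
    (heq : ∀ x, x₀ ≤ x → f x = stepE qb ζ + ∫ y in Ioi x, kernel P u qb x y ζ (f y)) :
    (∀ x, x₀ < x → stepL P qb ζ (f x) =
      -∫ y in Ioi x, Complex.exp (-2 * I * lam P ζ * ((x - y : ℝ) : ℂ)) •
        stepL P qb ζ (stepB P u qb y (f y))) ∧
    SolvesModified P u qb ζ x₀ f := by
  have hζ0 : (ζ : ℂ) ≠ 0 := ne_zero_of_mem_extUpper hq ζ.2
  set c : ℂ := -2 * I * lam P ζ with hc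
  set L := stepL P qb ζ with hL
  set b : ℝ → ℂ × ℂ := fun y => stepB P u qb y (f y) with hb
  have hbc : Continuous b := by
    have g : Continuous fun y : ℝ => (y, f y) := by fun_prop
    have h := hu.continuous_stepB.comp g
    exact h
  have hb_le : ∀ y, ‖b y‖ ≤ β y * C := fun y =>
    (hβ y _).trans (mul_le_mul_of_nonneg_left (hC y) (hβ0 y))
  have hC0 : 0 ≤ C := (norm_nonneg _).trans (hC 0)
  have hbi : ∀ x, IntegrableOn b (Ioi x) := fun x =>
    ((hβi x).mul_const C).mono' hbc.aestronglyMeasurable (Eventually.of_forall hb_le)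
  have hLb : ∀ x, IntegrableOn (fun y => L (b y)) (Ioi x) := fun x =>
    L.integrable_comp (hbi x)
  have hre : ∀ x y : ℝ, x ≤ y → (c * ((x - y : ℝ) : ℂ)).re ≤ 0 := fun x y h =>
    exponent_re_nonpos hq ζ.2 (by linarith)
  have hcexp : ∀ x, Continuous fun y : ℝ => Complex.exp (c * ((x - y : ℝ) : ℂ)) := fun x => by
    fun_prop
  have hexp_le : ∀ x y : ℝ, x ≤ y → ‖Complex.exp (c * ((x - y : ℝ) : ℂ))‖ ≤ 1 := fun x y h => by
    rw [Complex.norm_exp, Real.exp_le_one_iff]; exact hre x y h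
  have hei : ∀ x, IntegrableOn (fun y => Complex.exp (c * ((x - y : ℝ) : ℂ)) • L (b y)) (Ioi x) := by
    intro x
    refine (hLb x).norm.mono' ?_ ?_
    · exact ((hcexp x).smul (L.continuous.comp hbc)).aestronglyMeasurable
    · refine (ae_restrict_mem measurableSet_Ioi).mono fun y hy => ?_
      rw [norm_smul]
      exact mul_le_of_le_one_left (norm_nonneg _) (hexp_le x y (le_of_lt hy))
  have hφc : ∀ x, Continuous fun y : ℝ => expQuot c (x - y) := fun x => by
    have g : Continuous fun y : ℝ => (c, x - y) := by fun_prop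
    exact continuous_expQuot.comp g
  have hφi : ∀ x, IntegrableOn (fun y => expQuot c (x - y) • L (b y)) (Ioi x) := by
    intro x
    refine (((hβi' x).mul_const C).const_mul ‖L‖).mono' ?_ ?_
    · exact ((hφc x).smul (L.continuous.comp hbc)).aestronglyMeasurable
    · refine (ae_restrict_mem measurableSet_Ioi).mono fun y hy => ?_
      rw [norm_smul]
      have h1 := norm_expQuot_le (hre x y (le_of_lt hy))
      rw [abs_of_nonpos (by linarith [mem_Ioi.1 hy])] at h1
      calc ‖expQuot c (x - y)‖ * ‖L (b y)‖ ≤ (y - x) * (‖L‖ * (β y * C)) := by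
            refine mul_le_mul (by linarith) ((L.le_opNorm _).trans ?_) (norm_nonneg _)
              (by linarith [mem_Ioi.1 hy])
            exact mul_le_mul_of_nonneg_left (hb_le y) (norm_nonneg _)
        _ = _ := by ring
  -- `L` annihilates `stepE` and `L e^{sL} = e^{cs} L`. The factor growing with `y - x` disappears,
  -- which later gives a bound for the derivative that is integrable in `x`.
  have hLf : ∀ x, x₀ ≤ x → L (f x) =
      -∫ y in Ioi x, Complex.exp (c * ((x - y : ℝ) : ℂ)) • L (b y) := by
    intro x hx
    have hk : IntegrableOn (fun y => kernel P u qb x y ζ (f y)) (Ioi x) :=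
      ((hbi x).add (hφi x)).neg
    rw [heq x hx, map_add, stepL_stepE hζ0 hu.norm_eq, zero_add,
      ← ContinuousLinearMap.integral_comp_comm _ hk, ← integral_neg]
    refine integral_congr_ae (Eventually.of_forall fun y => ?_)
    simp only [kernel, map_neg, map_add, map_smul]
    rw [stepL_stepL hζ0 hu.norm_eq, smul_smul, mul_comm, mul_expQuot]
    rw [neg_inj, sub_smul, one_smul]
    simp [hL, hb, hc]
  refine ⟨fun x hx => hLf x hx.le, fun x hx => ?_⟩
  -- factor the kernel
  have hi1 : IntegrableOn (fun y => b y + expQuot c (x₀ - y) • L (b y)) (Ioi x₀) :=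
    (hbi x₀).add (hφi x₀)
  have hdec : ∀ z, x₀ ≤ z → f z = stepE qb ζ - (∫ y in Ioi z, (b y + expQuot c (x₀ - y) • L (b y)))
      - expQuot c (z - x₀) • ∫ y in Ioi z, Complex.exp (c * ((x₀ - y : ℝ) : ℂ)) • L (b y) := by
    intro z hz
    have hsub := Ioi_subset_Ioi hz
    have hi2 : IntegrableOn (fun y => expQuot c (z - x₀) •
        (Complex.exp (c * ((x₀ - y : ℝ) : ℂ)) • L (b y))) (Ioi z) :=
      Integrable.smul (expQuot c (z - x₀)) ((hei x₀).mono_set hsub)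
    rw [heq z hz, ← integral_smul, sub_sub, ← integral_add (hi1.mono_set hsub) hi2,
      sub_eq_add_neg, ← integral_neg]
    congr 1
    refine integral_congr_ae (Eventually.of_forall fun y => ?_)
    have : z - y = (z - x₀) + (x₀ - y) := by ring
    simp only [kernel]
    rw [this, expQuot_add, add_smul, smul_smul, mul_comm (expQuot _ _), add_assoc]
  have hd1 : HasDerivAt (fun z => ∫ y in Ioi z, (b y + expQuot c (x₀ - y) • L (b y)))
      (-(b x + expQuot c (x₀ - x) • L (b x))) x :=
    hasDerivAt_integral_Ioi
      (hbc.add ((hφc x₀).smul (L.continuous.comp hbc))).continuousOn hi1 hx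
  have hd2 : HasDerivAt (fun z => ∫ y in Ioi z, Complex.exp (c * ((x₀ - y : ℝ) : ℂ)) • L (b y))
      (-(Complex.exp (c * ((x₀ - x : ℝ) : ℂ)) • L (b x))) x :=
    hasDerivAt_integral_Ioi ((hcexp x₀).smul (L.continuous.comp hbc)).continuousOn (hei x₀) hx
  have hd3 : HasDerivAt (fun z : ℝ => expQuot c (z - x₀))
      (Complex.exp (c * ((x - x₀ : ℝ) : ℂ))) x := by
    simpa using (hasDerivAt_expQuot c (x - x₀)).comp_sub_const x x₀
  have hd := ((hd1.const_sub (stepE qb ζ)).sub (hd3.smul hd2)).congr_of_eventuallyEq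
    (f₁ := f) (by filter_upwards [Ioi_mem_nhds hx] with z hz using hdec z (le_of_lt hz))
  refine hd.congr_deriv ?_
  have e1 : Complex.exp (c * ((x - x₀ : ℝ) : ℂ)) •
      ∫ y in Ioi x, Complex.exp (c * ((x₀ - y : ℝ) : ℂ)) • L (b y)
      = ∫ y in Ioi x, Complex.exp (c * ((x - y : ℝ) : ℂ)) • L (b y) := by
    rw [← integral_smul]
    refine integral_congr_ae (Eventually.of_forall fun y => ?_)
    simp only [smul_smul, ← Complex.exp_add]
    congr 2
    push_cast; ring
  -- The two local terms containing `L (b x)`, one from each factor of the decomposition, cancel by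
  -- the addition formula.
  have e2 : expQuot c (x₀ - x) + expQuot c (x - x₀) * Complex.exp (c * ((x₀ - x : ℝ) : ℂ)) = 0 := by
    have := expQuot_add c (x - x₀) (x₀ - x)
    rw [show x - x₀ + (x₀ - x) = 0 by ring, expQuot_zero_right] at this
    rw [this]; ring
  rw [e1, hLf x hx.le, smul_neg, smul_smul]
  have e3 : expQuot c (x₀ - x) • L (b x)
      = -((expQuot c (x - x₀) * Complex.exp (c * ((x₀ - x : ℝ) : ℂ))) • L (b x)) := by
    rw [← neg_smul]; congr 1; linear_combination e2
  rw [e3]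
  simp only [hb]
  abel

/-- The modified Jost solution on a half-line. -/
theorem exists_halfLine (hq : 0 < P.q₀) (hu : IsStep P u qb) (x₀ : ℝ) :
    ∃ m : ℝ → ℂ → ℂ × ℂ,
      (∀ ζ ∈ extUpper P, SolvesModified P u qb ζ x₀ fun x => m x ζ) ∧
      (∀ x, ContinuousOn (m x) (extUpper P)) ∧
      (∀ x, DifferentiableOn ℂ (m x) (extUpperOpen P)) ∧
      (∃ C, ∀ x, ∀ ζ ∈ extUpper P, ‖m x ζ‖ ≤ C) ∧
      (∀ ε > 0, ∀ᶠ x in atTop, ∀ ζ ∈ extUpper P, ‖m x ζ - stepE qb ζ‖ ≤ ε) ∧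
      ∃ ρ : ℝ → ℝ, IntegrableOn ρ (Ioi x₀) ∧ ∀ x, x₀ < x → ∀ ζ ∈ extUpper P, ‖ζ‖ ≤ 2 * P.q₀ →
        ‖stepL P qb ζ (m x ζ) + stepB P u qb x (m x ζ)‖ ≤ ρ x := by
  obtain ⟨β, hβc, hβ0, hβi, hβi', hβ⟩ := hu.exists_majorant hq
  have K := volterraKernel hq hu hβc hβ0 hβi hβi' hβ x₀
  let v : extUpper P →ᵇ ℂ × ℂ := BoundedContinuousFunction.ofNormedAddCommGroup
    (fun ζ : extUpper P => stepE qb ζ) (continuous_stepE hq qb) 1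
    fun ζ => norm_stepE_le hu.norm_eq ζ.2
  obtain ⟨m, hmc, ⟨C, hC⟩, heq, hS⟩ := K.exists_solution v
  have hC0 : 0 ≤ C := (norm_nonneg _).trans (hC 0 ⟨(P.q₀ : ℂ), by
    refine ⟨?_, ?_⟩
    · rw [Complex.norm_real, Real.norm_of_nonneg hq.le]
    · simp⟩)
  classical
  let ext : (extUpper P → ℂ × ℂ) → ℂ → ℂ × ℂ := fun h ζ =>
    if hζ : ζ ∈ extUpper P then h ⟨ζ, hζ⟩ else 0
  have hext : ∀ h (ζ : extUpper P), ext h ζ = h ζ := fun h ζ => by simp [ext]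
  have hext' : ∀ h ζ (hζ : ζ ∈ extUpper P), ext h ζ = h ⟨ζ, hζ⟩ := fun h ζ hζ => by
    simp [ext, hζ]
  have hmz : ∀ ζ, Continuous fun x => m x ζ := fun ζ =>
    hmc.comp (by fun_prop : Continuous fun x : ℝ => (x, ζ))
  have hode := fun ζ : extUpper P => solvesModified_of_integral_eq hq hu hβi hβ0 hβi' hβ
    (x₀ := x₀) ζ (hmz ζ) (fun x => hC x ζ) fun x hx => heq x ζ hx
  refine ⟨fun x => ext (m x), ?_, ?_, ?_, ⟨C, ?_⟩, ?_, ?_⟩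
  · intro ζ hζ
    have := (hode ⟨ζ, hζ⟩).2
    simp only [hext' _ ζ hζ]
    exact this
  · intro x
    rw [continuousOn_iff_continuous_domRestrict]
    have : (extUpper P).domRestrict (ext (m x)) = m x := by
      funext ζ; exact hext _ ζ
    change Continuous ((extUpper P).domRestrict (ext (m x)))
    rw [this]
    exact hmc.comp (by fun_prop : Continuous fun ζ : extUpper P => (x, ζ))
  · intro x
    -- The property propagated along the Picard iteration is holomorphy in the open exterior of the
    -- extension by `0` off the closed one; uniform limits preserve it.
    refine hS {h | DifferentiableOn ℂ (ext h) (extUpperOpen P)} ?_ ?_ ?_ x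
    · refine (differentiableOn_const (c := (0 : ℂ × ℂ))).congr fun ζ _ => ?_
      simp [ext]
    · rintro h hhc ⟨C', hC'⟩ hh x hx
      have hdE : DifferentiableOn ℂ (stepE qb) (extUpperOpen P) := by
        intro ζ hζ
        have := ne_zero_of_mem_extUpper hq (extUpperOpen_subset P hζ)
        unfold stepE
        exact (((by fun_prop (disch := assumption) :
          DifferentiableAt ℂ (fun ζ : ℂ => -(I * qb / ζ)) ζ)).prodMk
            (differentiableAt_const _)).differentiableWithinAt
      have hkd : ∀ y, DifferentiableOn ℂ (fun ζ => -(stepB P u qb y (ext (h y) ζ)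
          + expQuot (-2 * I * lam P ζ) (x - y) • stepL P qb ζ (stepB P u qb y (ext (h y) ζ))))
          (extUpperOpen P) := by
        intro y
        have h1 : DifferentiableOn ℂ (fun ζ => stepB P u qb y (ext (h y) ζ)) (extUpperOpen P) :=
          (stepB P u qb y).differentiable.comp_differentiableOn (hh y)
        have h2 : DifferentiableOn ℂ (fun ζ => expQuot (-2 * I * lam P ζ) (x - y))
            (extUpperOpen P) := by
          refine (differentiable_expQuot (x - y)).comp_differentiableOn ?_
          intro ζ hζ
          have := ne_zero_of_mem_extUpper hq (extUpperOpen_subset P hζ)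
          unfold lam
          exact DifferentiableAt.differentiableWithinAt (by fun_prop (disch := assumption))
        have h3 : DifferentiableOn ℂ (fun ζ => stepL P qb ζ (stepB P u qb y (ext (h y) ζ)))
            (extUpperOpen P) := by
          intro ζ hζ
          have hz := ne_zero_of_mem_extUpper hq (extUpperOpen_subset P hζ)
          have h4 := h1 ζ hζ
          have h5 := h4.fst
          have h6 := h4.snd
          simp only [stepL, pairMap_apply]
          have h7 : DifferentiableWithinAt ℂ (fun ζ : ℂ => -(I * (P.q₀ : ℂ) ^ 2 / ζ))
              (extUpperOpen P) ζ :=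
            DifferentiableAt.differentiableWithinAt (by fun_prop (disch := assumption))
          have h8 : DifferentiableWithinAt ℂ (fun ζ : ℂ => -(I * ζ)) (extUpperOpen P) ζ :=
            DifferentiableAt.differentiableWithinAt (by fun_prop)
          exact ((h8.mul h5).add (h6.const_mul qb)).prodMk
            ((h5.const_mul (-conj qb)).add (h7.mul h6))
        exact (h1.add (h2.smul h3)).neg
      have hInt : DifferentiableOn ℂ (fun ζ => ∫ y in Ioi x, -(stepB P u qb y (ext (h y) ζ)
          + expQuot (-2 * I * lam P ζ) (x - y) • stepL P qb ζ (stepB P u qb y (ext (h y) ζ))))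
          (extUpperOpen P) := by
        have hker : ∀ ζ (hζ : ζ ∈ extUpper P) y, -(stepB P u qb y (ext (h y) ζ)
          + expQuot (-2 * I * lam P ζ) (x - y) • stepL P qb ζ (stepB P u qb y (ext (h y) ζ)))
          = kernel P u qb x y ⟨ζ, hζ⟩ (h y ⟨ζ, hζ⟩) := fun ζ hζ y => by
          simp only [hext' _ ζ hζ, kernel]
        refine differentiableOn_integral_of_dominated (isOpen_extUpperOpen P)
          (bound := fun y => (3 + 2 * P.q₀ * |y - x₀|) * β y * C') (fun ζ hζ => ?_)
          (Eventually.of_forall hkd) ?_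
          ((K.bound_integrable.mono_set (Ioi_subset_Ioi hx)).mul_const C')
        · have hζ' := extUpperOpen_subset P hζ
          simp only [hker ζ hζ']
          exact (K.meas x ⟨ζ, hζ'⟩ (fun y => h y ⟨ζ, hζ'⟩)
            (hhc.comp (by fun_prop : Continuous fun y : ℝ => (y, (⟨ζ, hζ'⟩ : extUpper P))))).mono_measure
            (Measure.restrict_mono (Ioi_subset_Ioi hx) le_rfl)
        · refine (ae_restrict_mem measurableSet_Ioi).mono fun y hy ζ hζ => ?_
          rw [hker ζ (extUpperOpen_subset P hζ)]
          exact (K.norm_le _ _ hx (le_of_lt hy)).trans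
            (mul_le_mul_of_nonneg_left (hC' _ _) (K.bound_nonneg y))
      refine (hdE.add hInt).congr fun ζ hζ => ?_
      have hζ' := extUpperOpen_subset P hζ
      simp only [ext, dif_pos hζ', Pi.add_apply]
      rfl
    · intro F f hF hFf
      refine TendstoLocallyUniformlyOn.differentiableOn (φ := atTop) (F := fun n => ext (F n)) ?_
        (Eventually.of_forall hF) (isOpen_extUpperOpen P)
      refine TendstoUniformlyOn.tendstoLocallyUniformlyOn ?_
      rw [Metric.tendstoUniformlyOn_iff]
      rw [Metric.tendstoUniformly_iff] at hFf
      intro ε hε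
      filter_upwards [hFf ε hε] with n hn ζ hζ
      simpa only [hext' _ ζ (extUpperOpen_subset P hζ)] using hn ⟨ζ, _⟩
  · intro x ζ hζ
    simp only [hext' _ ζ hζ]
    exact hC _ _
  · intro ε hε
    have ht : Tendsto (fun x => ∫ y in Ioi x, (3 + 2 * P.q₀ * |y - x₀|) * β y * C) atTop (𝓝 0) := by
      have hf := K.bound_integrable.mul_const C
      have h3 := intervalIntegral_tendsto_integral_Ioi x₀ hf tendsto_id
      have h4 := (tendsto_const_nhds
        (x := ∫ y in Ioi x₀, (3 + 2 * P.q₀ * |y - x₀|) * β y * C)).sub h3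
      rw [sub_self] at h4
      refine h4.congr' ?_
      filter_upwards [eventually_ge_atTop x₀] with y hy
      exact (setIntegral_Ioi_sub_of_le hf hy).symm
    filter_upwards [eventually_ge_atTop x₀, ht.eventually (gt_mem_nhds hε)] with x hx hxε ζ hζ
    rw [hext' _ ζ hζ, heq x ⟨ζ, hζ⟩ hx]
    have : v ⟨ζ, hζ⟩ = stepE qb ζ := rfl
    rw [this, add_sub_cancel_left]
    refine le_trans ?_ hxε.le
    refine norm_integral_le_of_norm_le
      ((K.bound_integrable.mono_set (Ioi_subset_Ioi hx)).mul_const C) ?_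
    refine (ae_restrict_mem measurableSet_Ioi).mono fun y hy => ?_
    exact (K.norm_le _ _ hx (le_of_lt hy)).trans
      (mul_le_mul_of_nonneg_left (hC _ _) (K.bound_nonneg y))
  -- The part `stepL (m x ζ)` is a tail integral with a bounded exponential, and `|ζ| + q₀ ≤ 3q₀`.
  -- Tails of `β` are integrable because `β` has a finite first moment.
  · refine ⟨fun x => 3 * P.q₀ * C * (∫ y in Ioi x, β y) + β x * C,
      ((integrableOn_tail hβc hβ0 (hβi x₀) (hβi' x₀)).const_mul _).add ((hβi x₀).mul_const _), ?_⟩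
    intro x hx ζ hζ hζ2
    simp only [hext' _ ζ hζ]
    refine (norm_add_le _ _).trans (add_le_add ?_ ?_)
    · rw [(hode ⟨ζ, hζ⟩).1 x hx, norm_neg, ← integral_const_mul]
      refine norm_integral_le_of_norm_le ((hβi x).const_mul _) ?_
      refine (ae_restrict_mem measurableSet_Ioi).mono fun y hy => ?_
      have hre := exponent_re_nonpos hq hζ (s := x - y) (by linarith [mem_Ioi.1 hy])
      have h1 : ‖Complex.exp (-2 * I * lam P ζ * ((x - y : ℝ) : ℂ))‖ ≤ 1 := by
        rw [Complex.norm_exp, Real.exp_le_one_iff]; exact hre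
      rw [norm_smul]
      calc _ ≤ 1 * ((‖ζ‖ + P.q₀) * (β y * C)) := by
            refine mul_le_mul h1 ((norm_stepL_le hq hu.norm_eq hζ _).trans ?_) (norm_nonneg _)
              zero_le_one
            exact mul_le_mul_of_nonneg_left ((hβ _ _).trans
              (mul_le_mul_of_nonneg_left (hC _ _) (hβ0 y))) (by positivity)
        _ ≤ 1 * ((2 * P.q₀ + P.q₀) * (β y * C)) := by
            have := mul_nonneg (hβ0 y) hC0
            gcongr
        _ = _ := by ring
    · exact (hβ _ _).trans (mul_le_mul_of_nonneg_left (hC _ _) (hβ0 x))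

end IsStep

end KE

end

noncomputable section

namespace KE

/-! ### Uniqueness and limits of solutions of ordinary differential equations -/

section ODE

variable {E : Type*} [NormedAddCommGroup E] [NormedSpace ℝ E]

theorem eqOn_Ioo_of_ODE {v : ℝ → E → E} {κ : ℝ → ℝ} (hκ : Continuous κ)
    (hv : ∀ x y z, ‖v x y - v x z‖ ≤ κ x * ‖y - z‖) {f g : ℝ → E} {a b x₁ : ℝ}
    (hf : ∀ x ∈ Icc a b, HasDerivAt f (v x (f x)) x)
    (hg : ∀ x ∈ Icc a b, HasDerivAt g (v x (g x)) x)
    (hx₁ : x₁ ∈ Ioo a b) (h : f x₁ = g x₁) : EqOn f g (Ioo a b) := by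
  obtain ⟨K, hK⟩ := (isCompact_Icc (a := a) (b := b)).exists_bound_of_continuousOn hκ.continuousOn
  refine ODE_solution_unique_of_mem_Ioo (v := v) (s := fun _ => univ) (K := K.toNNReal)
    (fun t ht => ?_) hx₁ (fun t ht => ⟨hf t (Ioo_subset_Icc_self ht), trivial⟩)
    (fun t ht => ⟨hg t (Ioo_subset_Icc_self ht), trivial⟩) h
  refine (LipschitzWith.of_dist_le_mul fun y z => ?_).lipschitzOnWith
  rw [dist_eq_norm, dist_eq_norm]
  refine (hv t y z).trans (mul_le_mul_of_nonneg_right ?_ (norm_nonneg _))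
  exact (le_abs_self _).trans ((hK t (Ioo_subset_Icc_self ht)).trans (Real.le_coe_toNNReal K))

theorem eqOn_Ioi_of_ODE {v : ℝ → E → E} {κ : ℝ → ℝ} (hκ : Continuous κ)
    (hv : ∀ x y z, ‖v x y - v x z‖ ≤ κ x * ‖y - z‖) {f g : ℝ → E} {a x₁ : ℝ}
    (hf : ∀ x, a < x → HasDerivAt f (v x (f x)) x) (hg : ∀ x, a < x → HasDerivAt g (v x (g x)) x)
    (hx₁ : a < x₁) (h : f x₁ = g x₁) : EqOn f g (Ioi a) := by
  intro x hx
  have hx : a < x := hx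
  have h1 : a < min x x₁ := lt_min hx hx₁
  have hsub : ∀ y ∈ Icc ((a + min x x₁) / 2) (max x x₁ + 1), a < y := fun y hy => by
    linarith [hy.1]
  refine eqOn_Ioo_of_ODE hκ hv (fun y hy => hf y (hsub y hy)) (fun y hy => hg y (hsub y hy))
    (x₁ := x₁) ⟨?_, ?_⟩ h ⟨?_, ?_⟩
  · linarith [min_le_right x x₁]
  · linarith [le_max_right x x₁]
  · linarith [min_le_left x x₁]
  · linarith [le_max_left x x₁]

theorem eq_of_ODE {v : ℝ → E → E} {κ : ℝ → ℝ} (hκ : Continuous κ)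
    (hv : ∀ x y z, ‖v x y - v x z‖ ≤ κ x * ‖y - z‖) {f g : ℝ → E} {x₁ : ℝ}
    (hf : ∀ x, HasDerivAt f (v x (f x)) x) (hg : ∀ x, HasDerivAt g (v x (g x)) x)
    (h : f x₁ = g x₁) (x : ℝ) : f x = g x :=
  eqOn_Ioi_of_ODE hκ hv (a := min x x₁ - 1) (fun y _ => hf y) (fun y _ => hg y)
    (x₁ := x₁) (by linarith [min_le_right x x₁]) h
    (show min x x₁ - 1 < x by linarith [min_le_left x x₁])

/-- Grönwall's inequality: `z` is an approximate trajectory of the `i`-th equation with error `r`,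
so the distance to the true trajectory is at most the Grönwall bound, which tends to `0` with `r`.
-/
theorem tendsto_of_ODE_right {ι : Type*} {l : Filter ι} {v : ι → ℝ → E → E} {K : ℝ}
    {y : ι → ℝ → E} {z z' : ℝ → E} {a b : ℝ}
    (hv : ∀ᶠ i in l, ∀ s ∈ Icc a b, ∀ p q, ‖v i s p - v i s q‖ ≤ K * ‖p - q‖)
    (hy : ∀ᶠ i in l, ∀ s ∈ Icc a b, HasDerivAt (y i) (v i s (y i s)) s)
    (hz : ∀ s ∈ Icc a b, HasDerivAt z (z' s) s)
    (hε : ∀ ε > 0, ∀ᶠ i in l, ∀ s ∈ Icc a b, ‖z' s - v i s (z s)‖ ≤ ε)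
    (ha : Tendsto (fun i => y i a) l (𝓝 (z a))) {s : ℝ} (hs : s ∈ Icc a b) :
    Tendsto (fun i => y i s) l (𝓝 (z s)) := by
  -- The summand `1` keeps the Grönwall constant away from `0`, where the bound has a different
  -- form.
  set K' : NNReal := K.toNNReal + 1 with hK'
  have hK0 : (K' : ℝ) ≠ 0 := by positivity
  have hb : Tendsto (fun r : ℝ => gronwallBound r K' (0 + r) (s - a)) (𝓝[>] 0) (𝓝 0) := by
    simp only [gronwallBound_of_K_ne_0 hK0]
    have : Continuous fun r : ℝ => r * Real.exp (K' * (s - a)) +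
        (0 + r) / K' * (Real.exp (K' * (s - a)) - 1) := by fun_prop
    have h := this.tendsto 0
    simp only [zero_mul, add_zero, zero_div] at h
    exact h.mono_left nhdsWithin_le_nhds
  rw [Metric.tendsto_nhds]
  intro η hη
  obtain ⟨r, hr, hr0⟩ := ((hb.eventually (gt_mem_nhds hη)).and self_mem_nhdsWithin).exists
  have hr0 : 0 < r := hr0
  filter_upwards [hv, hy, hε r hr0, Metric.tendsto_nhds.1 ha r hr0] with i h1 h2 h3 h4
  refine lt_of_le_of_lt ?_ hr
  refine dist_le_of_approx_trajectories_ODE_of_mem (v := v i) (s := fun _ => univ)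
    (a := a) (b := b) (f' := fun s => v i s (y i s)) (g' := z') (fun t ht => ?_)
    (fun t ht => (h2 t ht).continuousAt.continuousWithinAt)
    (fun t ht => (h2 t (Ico_subset_Icc_self ht)).hasDerivWithinAt) (fun t ht => by simp)
    (fun _ _ => trivial) (fun t ht => (hz t ht).continuousAt.continuousWithinAt)
    (fun t ht => (hz t (Ico_subset_Icc_self ht)).hasDerivWithinAt) (fun t ht => ?_)
    (fun _ _ => trivial) h4.le s hs
  · refine (LipschitzWith.of_dist_le_mul fun p q => ?_).lipschitzOnWith
    rw [dist_eq_norm, dist_eq_norm]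
    refine (h1 t (Ico_subset_Icc_self ht) p q).trans
      (mul_le_mul_of_nonneg_right ?_ (norm_nonneg _))
    rw [hK', NNReal.coe_add, NNReal.coe_one]
    linarith [Real.le_coe_toNNReal K]
  · rw [dist_eq_norm]
    exact h3 t (Ico_subset_Icc_self ht)

/-- If the right-hand sides, evaluated along `z`, converge uniformly to `z'`, and if the solutions
converge to `z` at one point, they converge to `z`. -/
theorem tendsto_of_ODE {ι : Type*} {l : Filter ι} {v : ι → ℝ → E → E} {K : ℝ}
    {y : ι → ℝ → E} {z z' : ℝ → E} {a b : ℝ}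
    (hv : ∀ᶠ i in l, ∀ s ∈ uIcc a b, ∀ p q, ‖v i s p - v i s q‖ ≤ K * ‖p - q‖)
    (hy : ∀ᶠ i in l, ∀ s ∈ uIcc a b, HasDerivAt (y i) (v i s (y i s)) s)
    (hz : ∀ s ∈ uIcc a b, HasDerivAt z (z' s) s)
    (hε : ∀ ε > 0, ∀ᶠ i in l, ∀ s ∈ uIcc a b, ‖z' s - v i s (z s)‖ ≤ ε)
    (ha : Tendsto (fun i => y i a) l (𝓝 (z a))) :
    Tendsto (fun i => y i b) l (𝓝 (z b)) := by
  rcases le_total a b with h | h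
  · rw [uIcc_of_le h] at *
    exact tendsto_of_ODE_right hv hy hz hε ha (right_mem_Icc.2 h)
  · rw [uIcc_of_ge h] at *
    have hm : ∀ s ∈ Icc (-a) (-b), -s ∈ Icc b a := fun s hs =>
      ⟨by linarith [hs.2], by linarith [hs.1]⟩
    have key := tendsto_of_ODE_right (l := l) (a := -a) (b := -b) (K := K)
      (v := fun i s p => -v i (-s) p) (y := fun i s => y i (-s)) (z := fun s => z (-s))
      (z' := fun s => -z' (-s)) ?_ ?_ ?_ ?_ ?_ (s := -b) (right_mem_Icc.2 (by linarith))
    · simpa using key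
    · filter_upwards [hv] with i hi s hs p q
      have := hi (-s) (hm s hs) p q
      rwa [neg_sub_neg, norm_sub_rev]
    · filter_upwards [hy] with i hi s hs
      have := (hi (-s) (hm s hs)).scomp s (hasDerivAt_neg s)
      rw [neg_one_smul] at this
      exact this
    · intro s hs
      have := (hz (-s) (hm s hs)).scomp s (hasDerivAt_neg s)
      rw [neg_one_smul] at this
      exact this
    · intro ε h0
      filter_upwards [hε ε h0] with i hi s hs
      have := hi (-s) (hm s hs)
      rwa [neg_sub_neg, norm_sub_rev]
    · simpa using ha

end ODE

/-! ### Uniqueness at `+∞` and the modified Jost solution on the whole line -/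

namespace IsStep

variable {P : Params} {u : ℝ → ℂ} {qb : ℂ}

theorem _root_.HasDerivAt.pair_fst {f : ℝ → ℂ × ℂ} {f' : ℂ × ℂ} {x : ℝ}
    (h : HasDerivAt f f' x) : HasDerivAt (fun y => (f y).1) f'.1 x :=
  (ContinuousLinearMap.fst ℝ ℂ ℂ).hasFDerivAt.comp_hasDerivAt x h

theorem _root_.HasDerivAt.pair_snd {f : ℝ → ℂ × ℂ} {f' : ℂ × ℂ} {x : ℝ}
    (h : HasDerivAt f f' x) : HasDerivAt (fun y => (f y).2) f'.2 x :=
  (ContinuousLinearMap.snd ℝ ℂ ℂ).hasFDerivAt.comp_hasDerivAt x h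

/-- Liouville's formula: `stepB` is traceless and `stepL` has trace `-2iλ`. -/
theorem hasDerivAt_wronskian_modified {ζ : ℂ} {t : ℝ} {f g : ℝ → ℂ × ℂ} (hζ : ζ ≠ 0)
    (hf : HasDerivAt f (stepL P qb ζ (f t) + stepB P u qb t (f t)) t)
    (hg : HasDerivAt g (stepL P qb ζ (g t) + stepB P u qb t (g t)) t) :
    HasDerivAt (fun y => (f y).1 * (g y).2 - (f y).2 * (g y).1)
      ((-2 * I * lam P ζ) * ((f t).1 * (g t).2 - (f t).2 * (g t).1)) t := by
  have h := (hf.pair_fst.mul hg.pair_snd).sub (hf.pair_snd.mul hg.pair_fst)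
  refine h.congr_deriv ?_
  simp only [stepL, stepB, pairMap_apply, Prod.fst_add, Prod.snd_add, lam]
  field_simp
  ring

theorem norm_exp_exterior_le (hq : 0 < P.q₀) {ζ : ℂ} (hζ : ζ ∈ extUpper P) {x : ℝ} (hx : 0 ≤ x) :
    ‖Complex.exp (2 * I * lam P ζ * x)‖ ≤ 1 := by
  rw [Complex.norm_exp, Real.exp_le_one_iff]
  have := exponent_re_nonpos hq hζ (s := -x) (by linarith)
  have e : 2 * I * lam P ζ * x = -2 * I * lam P ζ * ((-x : ℝ) : ℂ) := by push_cast; ring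
  rwa [e]

/-- Solutions of the modified equation are determined by their limit at `+∞`. -/
theorem solvesModified_unique (hq : 0 < P.q₀) (hu : IsStep P u qb) {ζ : ℂ} (hζ : ζ ∈ extUpper P)
    {f g : ℝ → ℂ × ℂ} {a : ℝ} (hf : SolvesModified P u qb ζ a f)
    (hg : SolvesModified P u qb ζ a g) (hft : Tendsto f atTop (𝓝 (stepE qb ζ)))
    (hgt : Tendsto g atTop (𝓝 (stepE qb ζ))) : EqOn f g (Ioi a) := by
  have hζ0 := ne_zero_of_mem_extUpper hq hζ
  obtain ⟨β, hβc, hβ0, -, -, hβ⟩ := hu.exists_majorant hq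
  -- the Wronskian vanishes
  set W : ℝ → ℂ := fun y => (f y).1 * (g y).2 - (f y).2 * (g y).1 with hW
  have hWt : Tendsto W atTop (𝓝 0) := by
    have h1 := ((hft.fst_nhds).mul hgt.snd_nhds).sub (hft.snd_nhds.mul hgt.fst_nhds)
    have h2 : (stepE qb ζ).1 * (stepE qb ζ).2 - (stepE qb ζ).2 * (stepE qb ζ).1 = 0 := by ring
    rwa [h2] at h1
  -- The product `e^{2iλx} W` is constant. The exponential is bounded for `x ≥ 0` and `W → 0`, so
  -- the constant is `0`; decay of the exponential, which fails on the boundary of the region, is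
  -- not needed.
  have hWc : ∀ x ∈ Ioi a, HasDerivAt (fun y : ℝ => Complex.exp (2 * I * lam P ζ * y) * W y) 0 x := by
    intro x hx
    have h1 : HasDerivAt W ((-2 * I * lam P ζ) * W x) x :=
      hasDerivAt_wronskian_modified hζ0 (hf x hx) (hg x hx)
    have h2 : HasDerivAt (fun y : ℝ => Complex.exp (2 * I * lam P ζ * y))
        (Complex.exp (2 * I * lam P ζ * x) * (2 * I * lam P ζ)) x := by
      have h3 : HasDerivAt (fun y : ℝ => 2 * I * lam P ζ * (y : ℂ)) (2 * I * lam P ζ) x := by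
        simpa using ((hasDerivAt_id x).ofReal_comp).const_mul (2 * I * lam P ζ)
      exact h3.cexp
    refine (h2.mul h1).congr_deriv ?_
    ring
  have hW0 : ∀ x ∈ Ioi a, W x = 0 := by
    intro x hx
    have hconst : ∀ y ∈ Ioi a, Complex.exp (2 * I * lam P ζ * y) * W y
        = Complex.exp (2 * I * lam P ζ * x) * W x := fun y hy =>
      isOpen_Ioi.is_const_of_deriv_eq_zero isPreconnected_Ioi
        (fun z hz => (hWc z hz).differentiableAt.differentiableWithinAt)
        (fun z hz => (hWc z hz).deriv) hy hx
    have ht : Tendsto (fun y : ℝ => Complex.exp (2 * I * lam P ζ * y) * W y) atTop (𝓝 0) := by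
      rw [tendsto_zero_iff_norm_tendsto_zero]
      refine tendsto_of_tendsto_of_tendsto_of_le_of_le' tendsto_const_nhds
        (tendsto_zero_iff_norm_tendsto_zero.1 hWt) (Eventually.of_forall fun _ => norm_nonneg _) ?_
      filter_upwards [eventually_ge_atTop 0] with y hy
      rw [norm_mul]
      exact mul_le_of_le_one_left (norm_nonneg _) (norm_exp_exterior_le hq hζ hy)
    have h4 : Tendsto (fun y : ℝ => Complex.exp (2 * I * lam P ζ * y) * W y) atTop
        (𝓝 (Complex.exp (2 * I * lam P ζ * x) * W x)) := by
      refine tendsto_const_nhds.congr' ?_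
      filter_upwards [eventually_gt_atTop a] with y hy using (hconst y hy).symm
    have h5 := tendsto_nhds_unique h4 ht
    exact (mul_eq_zero.1 h5).resolve_left (Complex.exp_ne_zero _)
  -- so the solutions are proportional
  have hf2 : ∀ᶠ x in atTop, (f x).2 ≠ 0 :=
    hft.snd_nhds.eventually_ne (by simp [stepE])
  obtain ⟨x₁, hx₁, hx₁a⟩ := (hf2.and (eventually_gt_atTop a)).exists
  set c := (g x₁).2 / (f x₁).2 with hc
  have hgf : g x₁ = c • f x₁ := by
    have := hW0 x₁ hx₁a
    simp only [hW] at this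
    refine Prod.ext ?_ ?_
    · simp only [Prod.smul_fst, smul_eq_mul, hc]; field_simp; linear_combination -this
    · simp only [Prod.smul_snd, smul_eq_mul, hc]; field_simp
  have hcf : ∀ x, a < x → HasDerivAt (fun y => c • f y)
      (stepL P qb ζ (c • f x) + stepB P u qb x (c • f x)) x := fun x hx => by
    have h := (hf x hx).const_smul c
    rw [smul_add, ← map_smul, ← map_smul] at h
    exact h
  have heq : EqOn g (fun y => c • f y) (Ioi a) := by
    refine eqOn_Ioi_of_ODE (v := fun x p => stepL P qb ζ p + stepB P u qb x p)
      (κ := fun x => (‖ζ‖ + P.q₀) + β x) (by fun_prop) (fun x y z => ?_) hg hcf hx₁a hgf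
    have e : stepL P qb ζ y + stepB P u qb x y - (stepL P qb ζ z + stepB P u qb x z)
        = stepL P qb ζ (y - z) + stepB P u qb x (y - z) := by simp only [map_sub]; abel
    rw [e, add_mul]
    exact (norm_add_le _ _).trans (add_le_add (norm_stepL_le hq hu.norm_eq hζ _) (hβ _ _))
  have hc1 : c = 1 := by
    have h1 : Tendsto (fun x => c * (f x).2) atTop (𝓝 (c * 1)) := hft.snd_nhds.const_mul c
    have h2 : Tendsto (fun x => c * (f x).2) atTop (𝓝 1) := by
      refine hgt.snd_nhds.congr' ?_
      filter_upwards [eventually_gt_atTop a] with y hy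
      rw [heq hy]; simp
    simpa using tendsto_nhds_unique h1 h2
  intro x hx
  rw [heq hx, hc1]
  exact (one_smul _ _).symm

/-- `m` is the modified Jost solution at `+∞`, for `ζ` in the closed upper exterior. -/
structure IsModifiedJost (P : Params) (u : ℝ → ℂ) (qb : ℂ) (m : ℝ → ℂ → ℂ × ℂ) : Prop where
  ode : ∀ ζ ∈ extUpper P, ∀ x,
    HasDerivAt (fun y => m y ζ) (stepL P qb ζ (m x ζ) + stepB P u qb x (m x ζ)) x
  continuousOn : ∀ x, ContinuousOn (m x) (extUpper P)
  differentiableOn : ∀ x, DifferentiableOn ℂ (m x) (extUpperOpen P)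
  bounded : ∀ x₀, ∃ C, ∀ x, x₀ < x → ∀ ζ ∈ extUpper P, ‖m x ζ‖ ≤ C
  limit : ∀ ε > 0, ∀ᶠ x in atTop, ∀ ζ ∈ extUpper P, ‖m x ζ - stepE qb ζ‖ ≤ ε
  deriv_bound : ∀ x₀, ∃ ρ : ℝ → ℝ, IntegrableOn ρ (Ioi x₀) ∧ ∀ x, x₀ < x →
    ∀ ζ ∈ extUpper P, ‖ζ‖ ≤ 2 * P.q₀ → ‖stepL P qb ζ (m x ζ) + stepB P u qb x (m x ζ)‖ ≤ ρ x

theorem tendsto_of_uniform_limit {m : ℝ → ℂ → ℂ × ℂ} 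
    (h : ∀ ε > 0, ∀ᶠ x in atTop, ∀ ζ ∈ extUpper P, ‖m x ζ - stepE qb ζ‖ ≤ ε) {ζ : ℂ}
    (hζ : ζ ∈ extUpper P) : Tendsto (fun x => m x ζ) atTop (𝓝 (stepE qb ζ)) := by
  rw [Metric.tendsto_nhds]
  intro ε hε
  filter_upwards [h (ε / 2) (by positivity)] with x hx
  rw [dist_eq_norm]
  linarith [hx ζ hζ]

/-- By uniqueness the solutions on different half-lines agree where both are defined; the value at
`x` is taken from the one that starts at `x - 1`. -/
theorem exists_modifiedJost (hq : 0 < P.q₀) (hu : IsStep P u qb) :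
    ∃ m, IsModifiedJost P u qb m := by
  choose M hode hcont hdiff hbdd hlim hder using hu.exists_halfLine hq
  have hagree : ∀ a b x, a < x → b < x → ∀ ζ ∈ extUpper P, M a x ζ = M b x ζ := by
    intro a b x ha hb ζ hζ
    refine solvesModified_unique hq hu hζ (a := max a b) (f := fun x => M a x ζ)
      (g := fun x => M b x ζ) (fun y hy => hode a ζ hζ y ((le_max_left _ _).trans_lt hy))
      (fun y hy => hode b ζ hζ y ((le_max_right _ _).trans_lt hy))
      (tendsto_of_uniform_limit (hlim a) hζ) (tendsto_of_uniform_limit (hlim b) hζ) (max_lt ha hb)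
  have hm : ∀ a x, a < x → ∀ ζ ∈ extUpper P, M (x - 1) x ζ = M a x ζ := fun a x hx ζ hζ =>
    hagree _ _ _ (by linarith) hx ζ hζ
  refine ⟨fun x => M (x - 1) x, ⟨?_, fun x => hcont _ _, fun x => hdiff _ _, ?_, ?_, ?_⟩⟩
  · intro ζ hζ x
    refine (hode (x - 1) ζ hζ x (by linarith)).congr_of_eventuallyEq ?_
    filter_upwards [Ioi_mem_nhds (show x - 1 < x by linarith)] with y hy
    exact hm (x - 1) y hy ζ hζ
  · intro x₀
    obtain ⟨C, hC⟩ := hbdd x₀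
    exact ⟨C, fun x hx ζ hζ => by rw [hm x₀ x hx ζ hζ]; exact hC x ζ hζ⟩
  · intro ε hε
    filter_upwards [hlim 0 ε hε, eventually_gt_atTop 0] with x hx hx0 ζ hζ
    rw [hm 0 x hx0 ζ hζ]
    exact hx ζ hζ
  · intro x₀
    obtain ⟨ρ, hρ, h⟩ := hder x₀
    exact ⟨ρ, hρ, fun x hx ζ hζ hζ2 => by simpa only [hm x₀ x hx ζ hζ] using h x hx ζ hζ hζ2⟩

end IsStep

end KE

end

/-! ### Asymptotics of the modified Jost solution as `ζ → ∞` -/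

noncomputable section

namespace KE

namespace IsStep

variable {P : Params} {u : ℝ → ℂ} {qb : ℂ}

/-- `∫_x^∞ (|u|² - q₀²)`. -/
def excess (P : Params) (u : ℝ → ℂ) (x : ℝ) : ℝ := ∫ y in Ioi x, (‖u y‖ ^ 2 - P.q₀ ^ 2)

theorem excess_integrable (hu : IsStep P u qb) (hq : 0 < P.q₀) (a : ℝ) :
    IntegrableOn (fun y => ‖u y‖ ^ 2 - P.q₀ ^ 2) (Ioi a) := by
  obtain ⟨C, hC⟩ := hu.bounded
  have hC0 : 0 ≤ C := (norm_nonneg _).trans (hC 0)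
  have hcu := hu.continuous
  refine integrableOn_Ioi_of_continuous (b := 0) (by fun_prop) ?_ a
  refine (hu.integrable.const_mul (C + P.q₀)).mono' (by fun_prop) (Eventually.of_forall fun x => ?_)
  have e : ‖u x‖ ^ 2 - P.q₀ ^ 2 = (‖u x‖ + P.q₀) * (‖u x‖ - ‖qb‖) := by rw [hu.norm_eq]; ring
  rw [e, norm_mul, Real.norm_of_nonneg (by positivity : 0 ≤ ‖u x‖ + P.q₀)]
  refine mul_le_mul (by linarith [hC x]) ?_ (norm_nonneg _) (by positivity)
  refine (abs_norm_sub_norm_le _ _).trans ?_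
  nlinarith [abs_nonneg x, norm_nonneg (u x - qb), mul_nonneg (abs_nonneg x) (norm_nonneg (u x - qb))]

theorem hasDerivAt_excess (hu : IsStep P u qb) (hq : 0 < P.q₀) (x : ℝ) :
    HasDerivAt (excess P u) (-(‖u x‖ ^ 2 - P.q₀ ^ 2)) x := by
  have hcu := hu.continuous
  exact hasDerivAt_integral_Ioi (a := x - 1)
    (by fun_prop : Continuous fun y => ‖u y‖ ^ 2 - P.q₀ ^ 2).continuousOn
    (hu.excess_integrable hq _) (by linarith)

theorem tendsto_excess (hu : IsStep P u qb) (hq : 0 < P.q₀) :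
    Tendsto (excess P u) atTop (𝓝 0) := by
  have hf := hu.excess_integrable hq 0
  have h3 := intervalIntegral_tendsto_integral_Ioi 0 hf tendsto_id
  have h4 := (tendsto_const_nhds (x := ∫ y in Ioi 0, (‖u y‖ ^ 2 - P.q₀ ^ 2))).sub h3
  rw [sub_self] at h4
  refine h4.congr' ?_
  filter_upwards [eventually_ge_atTop 0] with y hy
  exact (setIntegral_Ioi_sub_of_le hf hy).symm

/-- The phase `e^{iT ∫_x^∞ (|u|² - q₀²)}`. -/
def phase (P : Params) (u : ℝ → ℂ) (x : ℝ) : ℂ := Complex.exp (I * P.T * excess P u x)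

theorem norm_phase (x : ℝ) : ‖phase P u x‖ = 1 := by
  rw [phase, show I * (P.T : ℂ) * (excess P u x : ℂ) = ((P.T * excess P u x : ℝ) : ℂ) * I by
    push_cast; ring]
  exact Complex.norm_exp_ofReal_mul_I _

theorem phase_ne_zero (x : ℝ) : phase P u x ≠ 0 := Complex.exp_ne_zero _

theorem hasDerivAt_phase (hu : IsStep P u qb) (hq : 0 < P.q₀) (x : ℝ) :
    HasDerivAt (phase P u) (-(I * P.T * ((‖u x‖ ^ 2 - P.q₀ ^ 2 : ℝ) : ℂ)) * phase P u x) x := by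
  have h := (((hu.hasDerivAt_excess hq x).ofReal_comp).const_mul (I * P.T)).cexp
  refine h.congr_deriv ?_
  rw [phase]; push_cast; ring

theorem tendsto_phase (hu : IsStep P u qb) (hq : 0 < P.q₀) :
    Tendsto (phase P u) atTop (𝓝 1) := by
  have h : Continuous fun r : ℝ => Complex.exp (I * P.T * r) := by fun_prop
  have h1 := (h.tendsto 0).comp (hu.tendsto_excess hq)
  rw [show Complex.exp (I * P.T * ((0 : ℝ) : ℂ)) = 1 by simp] at h1
  exact h1

end IsStep

open IsStep

namespace IsStep.IsModifiedJost

variable {P : Params} {u : ℝ → ℂ} {qb : ℂ} {m : ℝ → ℂ → ℂ × ℂ}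

theorem ode_fst (hm : IsModifiedJost P u qb m) {ζ : ℂ} (hζ : ζ ∈ extUpper P) (x : ℝ) :
    HasDerivAt (fun y => (m y ζ).1)
      ((-(I * ζ) + I * P.T * ((‖u x‖ ^ 2 - P.q₀ ^ 2 : ℝ) : ℂ)) * (m x ζ).1
        + u x * (m x ζ).2) x := by
  refine (hm.ode ζ hζ x).pair_fst.congr_deriv ?_
  simp only [stepL, stepB, pairMap_apply, Prod.fst_add]
  ring

theorem ode_snd (hm : IsModifiedJost P u qb m) {ζ : ℂ} (hζ : ζ ∈ extUpper P) (x : ℝ) :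
    HasDerivAt (fun y => (m y ζ).2)
      ((-(I * (P.q₀ : ℂ) ^ 2 / ζ) - I * P.T * ((‖u x‖ ^ 2 - P.q₀ ^ 2 : ℝ) : ℂ)) * (m x ζ).2
        - conj (u x) * (m x ζ).1) x := by
  refine (hm.ode ζ hζ x).pair_snd.congr_deriv ?_
  simp only [stepL, stepB, pairMap_apply, Prod.snd_add, map_sub]
  ring

/-- The function `phase · u · m₂`, whose derivative is bounded uniformly in `ζ` on compact
intervals. -/
theorem exists_source_deriv (hq : 0 < P.q₀) (hu : IsStep P u qb) (hm : IsModifiedJost P u qb m)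
    (x R : ℝ) : ∃ K, 0 ≤ K ∧ ∀ ζ ∈ extUpper P, ∀ y ∈ Icc x R, ∃ d, ‖d‖ ≤ K ∧
      HasDerivAt (fun y => phase P u y * u y * (m y ζ).2) d y := by
  obtain ⟨C, hC⟩ := hm.bounded (x - 1)
  obtain ⟨M, hM⟩ := hu.bounded
  have hM0 : 0 ≤ M := (norm_nonneg _).trans (hM 0)
  have hcd : Continuous (deriv u) := hu.contDiff.continuous_deriv le_rfl
  obtain ⟨D, hD⟩ := (isCompact_Icc (a := x) (b := R)).exists_bound_of_continuousOn
    hcd.continuousOn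
  have hcu := hu.continuous
  obtain ⟨p, hp⟩ := (isCompact_Icc (a := x) (b := R)).exists_bound_of_continuousOn
    (by fun_prop : Continuous fun y => I * P.T * ((‖u y‖ ^ 2 - P.q₀ ^ 2 : ℝ) : ℂ)).continuousOn
  set K := (p * M + D) * C + M * ((P.q₀ + p) * C + M * C) with hK
  refine ⟨|K|, abs_nonneg _, fun ζ hζ y hy => ⟨_, ?_,
    ((hu.hasDerivAt_phase hq y).mul
      ((hu.contDiff.differentiable one_ne_zero y).hasDerivAt)).mul (hm.ode_snd hζ y)⟩⟩
  have hyx : x - 1 < y := by linarith [hy.1]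
  have hCζ := hC y hyx ζ hζ
  have hC0 : 0 ≤ C := (norm_nonneg _).trans hCζ
  have h1 : ‖(m y ζ).1‖ ≤ C := (norm_fst_le _).trans hCζ
  have h2 : ‖(m y ζ).2‖ ≤ C := (norm_snd_le _).trans hCζ
  have hp' := hp y hy
  have hD' := hD y hy
  have hp0 : 0 ≤ p := (norm_nonneg _).trans hp'
  have hD0 : 0 ≤ D := (norm_nonneg _).trans hD'
  have hqz : ‖I * (P.q₀ : ℂ) ^ 2 / ζ‖ ≤ P.q₀ := by
    rw [mul_div_assoc, norm_mul, norm_I, one_mul]; exact (norm_exterior_bounds hq hζ).1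
  set a := I * P.T * ((‖u y‖ ^ 2 - P.q₀ ^ 2 : ℝ) : ℂ)
  refine le_trans ?_ (le_abs_self K)
  refine (norm_add_le _ _).trans (add_le_add ?_ ?_)
  · rw [norm_mul]
    refine mul_le_mul ((norm_add_le _ _).trans (add_le_add ?_ ?_)) h2 (norm_nonneg _)
      (by positivity)
    · rw [norm_mul, norm_mul, norm_phase, mul_one, norm_neg]
      exact mul_le_mul hp' (hM y) (norm_nonneg _) hp0
    · rw [norm_mul, norm_phase, one_mul]; exact hD'
  · rw [Pi.mul_apply, norm_mul, norm_mul, norm_phase, one_mul]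
    refine mul_le_mul (hM y) ((norm_sub_le _ _).trans (add_le_add ?_ ?_)) (norm_nonneg _) hM0
    · rw [norm_mul]
      refine mul_le_mul ((norm_sub_le _ _).trans (add_le_add ?_ hp')) h2 (norm_nonneg _)
        (by positivity)
      rw [norm_neg]; exact hqz
    · rw [norm_mul, RCLike.norm_conj]
      exact mul_le_mul (hM y) h1 (norm_nonneg _) hM0

/-- Integration by parts in the first equation. -/
theorem norm_fst_sub_le (hq : 0 < P.q₀) (hu : IsStep P u qb) (hm : IsModifiedJost P u qb m)
    {x R : ℝ} (hxR : x ≤ R) : ∃ K, 0 ≤ K ∧ ∀ ζ ∈ extUpper P,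
      (‖(m x ζ).1 - u x * (m x ζ).2 / (I * ζ)‖
        ≤ ‖(m R ζ).1 - u R * (m R ζ).2 / (I * ζ)‖ + K / ‖ζ‖) ∧
      (0 < ζ.im → ‖(m x ζ).1 - u x * (m x ζ).2 / (I * ζ)‖
        ≤ Real.exp (-(ζ.im * (R - x))) * ‖(m R ζ).1 - u R * (m R ζ).2 / (I * ζ)‖
          + K / (‖ζ‖ * ζ.im)) := by
  obtain ⟨K, hK0, hK⟩ := hm.exists_source_deriv hq hu x R
  -- The first summand serves the estimate valid up to the real axis, the second the sharper
  -- estimate for `Im ζ > 0`.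
  refine ⟨K * (R - x) + K, by have := sub_nonneg.2 hxR; positivity, fun ζ hζ => ?_⟩
  have hζ0 := ne_zero_of_mem_extUpper hq hζ
  have hζn : 0 < ‖ζ‖ := norm_pos_iff.2 hζ0
  set b : ℝ → ℂ := fun y => phase P u y * u y * (m y ζ).2 with hb
  -- The exponential times the phase is the integrating factor of the first equation. Subtracting `b
  -- / (iζ)` removes the source, so that the derivative of `h` is `-e^{iζ(y-x)} b' / (iζ)`, smaller
  -- by a factor `1/ζ`.
  set h : ℝ → ℂ := fun y => Complex.exp (I * ζ * ((y - x : ℝ) : ℂ)) *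
    (phase P u y * (m y ζ).1 - b y / (I * ζ)) with hh
  have hexp : ∀ y : ℝ, ‖Complex.exp (I * ζ * ((y - x : ℝ) : ℂ))‖
      = Real.exp (-(ζ.im * (y - x))) := fun y => by
    rw [Complex.norm_exp]
    congr 1
    rw [Complex.re_mul_ofReal]
    simp
  have hder : ∀ y ∈ Icc x R, ∃ d, HasDerivAt h d y ∧
      ‖d‖ ≤ Real.exp (-(ζ.im * (y - x))) * (K / ‖ζ‖) := by
    intro y hy
    obtain ⟨d, hd, hbd⟩ := hK ζ hζ y hy
    have h1 : HasDerivAt (fun y : ℝ => Complex.exp (I * ζ * ((y - x : ℝ) : ℂ)))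
        (Complex.exp (I * ζ * ((y - x : ℝ) : ℂ)) * (I * ζ)) y := by
      have h3 : HasDerivAt (fun y : ℝ => I * ζ * ((y - x : ℝ) : ℂ)) (I * ζ) y := by
        simpa using (((hasDerivAt_id y).sub_const x).ofReal_comp).const_mul (I * ζ)
      exact h3.cexp
    have h2 := h1.mul (((hu.hasDerivAt_phase hq y).mul (hm.ode_fst hζ y)).sub
      (hbd.div_const (I * ζ)))
    refine ⟨Complex.exp (I * ζ * ((y - x : ℝ) : ℂ)) * (-(d / (I * ζ))), ?_, ?_⟩
    · refine h2.congr_deriv ?_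
      simp only [Pi.sub_apply, Pi.mul_apply]
      have hI := I_ne_zero
      field_simp
      ring
    · rw [norm_mul, hexp, norm_neg, norm_div, norm_mul, norm_I, one_mul]
      gcongr
  have hhx : ‖h x‖ = ‖(m x ζ).1 - u x * (m x ζ).2 / (I * ζ)‖ := by
    have : h x = phase P u x * ((m x ζ).1 - u x * (m x ζ).2 / (I * ζ)) := by
      simp only [hh, hb]; simp; ring
    rw [this, norm_mul, norm_phase, one_mul]
  have hhR : ‖h R‖ = Real.exp (-(ζ.im * (R - x))) *
      ‖(m R ζ).1 - u R * (m R ζ).2 / (I * ζ)‖ := by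
    have : h R = Complex.exp (I * ζ * ((R - x : ℝ) : ℂ)) *
        (phase P u R * ((m R ζ).1 - u R * (m R ζ).2 / (I * ζ))) := by
      simp only [hh, hb]; ring
    rw [this, norm_mul, norm_mul, norm_phase, one_mul, hexp]
  choose! d hd hdn using hder
  have hcont : ContinuousOn (fun y => h y - h x) (Icc x R) := fun y hy =>
    ((hd y hy).continuousAt.continuousWithinAt).sub continuousWithinAt_const
  have tri : ‖h x‖ ≤ ‖h R‖ + ‖h R - h x‖ := by
    have := norm_sub_le (h R) (h R - h x)
    simpa using this
  rw [← hhx]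
  constructor
  · have key := norm_image_sub_le_of_norm_deriv_le_segment' (f := h) (a := x) (b := R)
      (C := K / ‖ζ‖) (fun y hy => (hd y hy).hasDerivWithinAt) (fun y hy => by
        refine (hdn y (Ico_subset_Icc_self hy)).trans ?_
        refine mul_le_of_le_one_left (by positivity) ?_
        rw [Real.exp_le_one_iff]
        have := mul_nonneg hζ.2 (sub_nonneg.2 hy.1)
        linarith) R (right_mem_Icc.2 hxR)
    have h1 : ‖h R‖ ≤ ‖(m R ζ).1 - u R * (m R ζ).2 / (I * ζ)‖ := by
      rw [hhR]
      refine mul_le_of_le_one_left (norm_nonneg _) ?_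
      rw [Real.exp_le_one_iff]
      have := mul_nonneg hζ.2 (sub_nonneg.2 hxR)
      linarith
    have h2 : K / ‖ζ‖ * (R - x) ≤ (K * (R - x) + K) / ‖ζ‖ := by
      rw [div_mul_eq_mul_div]; gcongr; linarith
    linarith
  · intro hη
    rw [← hhR]
    -- The comparison function is the integral of the decaying bound on `d`, which gains the factor
    -- `1 / Im ζ`.
    have key := image_norm_le_of_norm_deriv_right_le_deriv_boundary' (f := fun y => h y - h x)
      (f' := d) (a := x) (b := R) hcont
      (fun y hy => ((hd y (Ico_subset_Icc_self hy)).sub_const _).hasDerivWithinAt)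
      (B := fun y => K / ‖ζ‖ * ((1 - Real.exp (-(ζ.im * (y - x)))) / ζ.im))
      (B' := fun y => Real.exp (-(ζ.im * (y - x))) * (K / ‖ζ‖)) (by simp)
      (by fun_prop) (fun y _ => by
        have h3 : HasDerivAt (fun y : ℝ => -(ζ.im * (y - x))) (-ζ.im) y := by
          exact ((((hasDerivAt_id y).sub_const x).const_mul ζ.im).neg).congr_deriv (by simp)
        have h4 := (((h3.exp).const_sub 1).div_const ζ.im).const_mul (K / ‖ζ‖)
        refine (h4.congr_deriv ?_).hasDerivWithinAt
        field_simp)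
      (fun y hy => hdn y (Ico_subset_Icc_self hy)) (right_mem_Icc.2 hxR)
    have h2 : K / ‖ζ‖ * ((1 - Real.exp (-(ζ.im * (R - x)))) / ζ.im)
        ≤ (K * (R - x) + K) / (‖ζ‖ * ζ.im) := by
      rw [div_mul_div_comm]
      gcongr
      have h5 := Real.exp_pos (-(ζ.im * (R - x)))
      nlinarith [mul_nonneg hK0 (sub_nonneg.2 hxR), mul_nonneg hK0 h5.le]
    linarith

/-- `ζ → ∞` in the closed upper exterior. -/
def _root_.KE.extInfty (P : Params) : Filter ℂ := comap norm atTop ⊓ 𝓟 (extUpper P)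

instance : (extInfty P).IsCountablyGenerated := by unfold extInfty; infer_instance

theorem tendsto_norm_extInfty : Tendsto (fun ζ : ℂ => ‖ζ‖) (extInfty P) atTop :=
  tendsto_comap.mono_left inf_le_left

theorem eventually_mem_extInfty : ∀ᶠ ζ in extInfty P, ζ ∈ extUpper P :=
  mem_inf_of_right (mem_principal_self _)

/-- At a large `R` the solution is close to `stepE`, uniformly in `ζ`, and the first component of
`stepE` is `O(1/ζ)`. Integration by parts carries this back from `R` to `x` at a cost of `O(1/ζ)`.
-/
theorem tendsto_fst_infty (hq : 0 < P.q₀) (hu : IsStep P u qb) (hm : IsModifiedJost P u qb m)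
    (x : ℝ) : Tendsto (fun ζ => (m x ζ).1) (extInfty P) (𝓝 0) := by
  obtain ⟨C, hC⟩ := hm.bounded (x - 1)
  obtain ⟨M, hM⟩ := hu.bounded
  have hM0 : 0 ≤ M := (norm_nonneg _).trans (hM 0)
  rw [Metric.tendsto_nhds]
  intro ε hε
  obtain ⟨R, hR, hxR⟩ := ((hm.limit (ε / 4) (by positivity)).and (eventually_ge_atTop x)).exists
  obtain ⟨K, hK0, hK⟩ := hm.norm_fst_sub_le hq hu hxR
  have hlarge : ∀ c : ℝ, ∀ᶠ ζ in extInfty P, c / ‖ζ‖ < ε / 4 := fun c =>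
    (tendsto_norm_extInfty.const_div_atTop c).eventually (gt_mem_nhds (by positivity))
  filter_upwards [eventually_mem_extInfty, hlarge (P.q₀ + K + 2 * (M * C)),
    tendsto_norm_extInfty.eventually_gt_atTop 0] with ζ hζ h1 hζn
  rw [dist_zero_right]
  have h2 := (hK ζ hζ).1
  have h3 : ‖(m R ζ).1‖ ≤ ε / 4 + P.q₀ / ‖ζ‖ := by
    have h4 := (norm_fst_le _).trans (hR ζ hζ)
    have h5 : ‖(stepE qb ζ).1‖ = P.q₀ / ‖ζ‖ := by
      rw [stepE, norm_neg, norm_div, norm_mul, norm_I, one_mul, hu.norm_eq]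
    rw [Prod.fst_sub] at h4
    have h6 := norm_add_le ((m R ζ).1 - (stepE qb ζ).1) (stepE qb ζ).1
    rw [sub_add_cancel] at h6
    linarith
  have h4 : ∀ y, x ≤ y → ‖u y * (m y ζ).2 / (I * ζ)‖ ≤ M * C / ‖ζ‖ := fun y hy => by
    rw [norm_div, norm_mul, norm_mul, norm_I, one_mul]
    refine div_le_div_of_nonneg_right ?_ hζn.le
    exact mul_le_mul (hM y) ((norm_snd_le _).trans (hC y (by linarith) ζ hζ)) (norm_nonneg _) hM0
  have h5 := norm_add_le ((m x ζ).1 - u x * (m x ζ).2 / (I * ζ)) (u x * (m x ζ).2 / (I * ζ))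
  rw [sub_add_cancel] at h5
  have h6 := norm_sub_le (m R ζ).1 (u R * (m R ζ).2 / (I * ζ))
  have h7 : (P.q₀ + K + 2 * (M * C)) / ‖ζ‖
      = P.q₀ / ‖ζ‖ + K / ‖ζ‖ + M * C / ‖ζ‖ + M * C / ‖ζ‖ := by ring
  linarith [h4 x le_rfl, h4 R hxR]

/-- The function `phase⁻¹ m₂` has derivative `phase⁻¹ (-(i q₀²/ζ) m₂ - ū m₁)`, which is bounded and
tends to `0` as `ζ → ∞`. Hence its value at `x` has the same limit as at a large `R`, where both
`m₂` and the phase are close to `1`. -/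
theorem tendsto_snd_infty (hq : 0 < P.q₀) (hu : IsStep P u qb) (hm : IsModifiedJost P u qb m)
    (x : ℝ) : Tendsto (fun ζ => (m x ζ).2) (extInfty P) (𝓝 (phase P u x)) := by
  obtain ⟨C, hC⟩ := hm.bounded (x - 1)
  obtain ⟨M, hM⟩ := hu.bounded
  have hM0 : 0 ≤ M := (norm_nonneg _).trans (hM 0)
  have hcu := hu.continuous
  have hcphase : Continuous (phase P u) :=
    continuous_iff_continuousAt.2 fun y => (hu.hasDerivAt_phase hq y).continuousAt
  set n : ℝ → ℂ → ℂ := fun y ζ => (phase P u y)⁻¹ * (m y ζ).2 with hn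
  set n' : ℝ → ℂ → ℂ := fun y ζ => (phase P u y)⁻¹ * (-(I * (P.q₀ : ℂ) ^ 2 / ζ) * (m y ζ).2
    - conj (u y) * (m y ζ).1) with hn'
  have hnd : ∀ ζ ∈ extUpper P, ∀ y, HasDerivAt (fun y => n y ζ) (n' y ζ) y := by
    intro ζ hζ y
    have h0 := phase_ne_zero (P := P) (u := u) y
    refine (((hu.hasDerivAt_phase hq y).inv h0).mul (hm.ode_snd hζ y)).congr_deriv ?_
    simp only [hn', Pi.inv_apply]
    field_simp
    ring
  have hmc : ∀ ζ ∈ extUpper P, Continuous fun y => m y ζ := fun ζ hζ =>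
    continuous_iff_continuousAt.2 fun y => (hm.ode ζ hζ y).continuousAt
  have hn'c : ∀ ζ ∈ extUpper P, Continuous fun y => n' y ζ := fun ζ hζ => by
    have h1 : Continuous fun y => (phase P u y)⁻¹ := hcphase.inv₀ fun y => phase_ne_zero y
    have h2 := hmc ζ hζ
    have h3 : Continuous fun y => conj (u y) := Complex.continuous_conj.comp hcu
    simp only [hn']
    fun_prop
  have hint : ∀ R, x ≤ R → Tendsto (fun ζ => n R ζ - n x ζ) (extInfty P) (𝓝 0) := by
    intro R hR
    have h1 : Tendsto (fun ζ => ∫ y in x..R, n' y ζ) (extInfty P) (𝓝 (∫ y in x..R, (0 : ℂ))) := by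
      refine intervalIntegral.tendsto_integral_filter_of_dominated_convergence
        (fun _ => P.q₀ * C + M * C) ?_ ?_ (by simp) ?_
      · filter_upwards [eventually_mem_extInfty] with ζ hζ
        exact (hn'c ζ hζ).aestronglyMeasurable
      · filter_upwards [eventually_mem_extInfty] with ζ hζ
        refine Eventually.of_forall fun y hy => ?_
        rw [uIoc_of_le hR] at hy
        have hb := hC y (by linarith [hy.1]) ζ hζ
        simp only [hn', norm_mul, norm_inv, norm_phase, inv_one, one_mul]
        refine (norm_sub_le _ _).trans (add_le_add ?_ ?_)
        · rw [norm_mul, norm_neg, mul_div_assoc, norm_mul, norm_I, one_mul]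
          exact mul_le_mul (norm_exterior_bounds hq hζ).1 ((norm_snd_le _).trans hb)
            (norm_nonneg _) hq.le
        · rw [norm_mul, RCLike.norm_conj]
          exact mul_le_mul (hM y) ((norm_fst_le _).trans hb) (norm_nonneg _) hM0
      · refine Eventually.of_forall fun y hy => ?_
        rw [uIoc_of_le hR] at hy
        have h2 : Tendsto (fun ζ : ℂ => I * (P.q₀ : ℂ) ^ 2 / ζ) (extInfty P) (𝓝 0) := by
          rw [tendsto_zero_iff_norm_tendsto_zero]
          simp_rw [norm_div]
          exact tendsto_norm_extInfty.const_div_atTop _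
        have h3 : Tendsto (fun ζ => -(I * (P.q₀ : ℂ) ^ 2 / ζ) * (m y ζ).2) (extInfty P) (𝓝 0) := by
          rw [tendsto_zero_iff_norm_tendsto_zero]
          have h4 := (h2.norm).mul_const C
          rw [norm_zero, zero_mul] at h4
          refine tendsto_of_tendsto_of_tendsto_of_le_of_le' tendsto_const_nhds h4
            (Eventually.of_forall fun _ => norm_nonneg _) ?_
          filter_upwards [eventually_mem_extInfty] with ζ hζ
          rw [norm_mul, norm_neg]
          exact mul_le_mul_of_nonneg_left
            ((norm_snd_le _).trans (hC y (by linarith [hy.1]) ζ hζ)) (norm_nonneg _)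
        have h5 := (h3.sub ((hm.tendsto_fst_infty hq hu y).const_mul (conj (u y)))).const_mul
          (phase P u y)⁻¹
        simp only [mul_zero, sub_zero] at h5
        exact h5
    rw [intervalIntegral.integral_zero] at h1
    refine h1.congr' ?_
    filter_upwards [eventually_mem_extInfty] with ζ hζ
    exact intervalIntegral.integral_eq_sub_of_hasDerivAt (fun y _ => hnd ζ hζ y)
      ((hn'c ζ hζ).intervalIntegrable _ _)
  have hnlim : Tendsto (fun ζ => n x ζ) (extInfty P) (𝓝 1) := by
    rw [Metric.tendsto_nhds]
    intro ε hε
    have hph : Tendsto (fun R => (phase P u R)⁻¹) atTop (𝓝 1) := by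
      simpa using (hu.tendsto_phase hq).inv₀ one_ne_zero
    obtain ⟨R, ⟨hR, hxR⟩, hRp⟩ := (((hm.limit (ε / 4) (by positivity)).and
      (eventually_ge_atTop x)).and
      (Metric.tendsto_nhds.1 hph (ε / 4) (by positivity))).exists
    filter_upwards [eventually_mem_extInfty, Metric.tendsto_nhds.1 (hint R hxR) (ε / 4)
      (by positivity)] with ζ hζ h1
    rw [dist_zero_right] at h1
    rw [dist_eq_norm] at hRp ⊢
    have h2 : ‖n R ζ - (phase P u R)⁻¹‖ ≤ ε / 4 := by
      have h3 := (norm_snd_le _).trans (hR ζ hζ)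
      rw [Prod.snd_sub] at h3
      have : n R ζ - (phase P u R)⁻¹ = (phase P u R)⁻¹ * ((m R ζ).2 - (stepE qb ζ).2) := by
        simp only [hn, stepE]; ring
      rwa [this, norm_mul, norm_inv, norm_phase, inv_one, one_mul]
    have e : n x ζ - 1 = -(n R ζ - n x ζ) + (n R ζ - (phase P u R)⁻¹) + ((phase P u R)⁻¹ - 1) := by
      ring
    rw [e]
    have h4 := norm_add_le (-(n R ζ - n x ζ) + (n R ζ - (phase P u R)⁻¹)) ((phase P u R)⁻¹ - 1)
    have h5 := norm_add_le (-(n R ζ - n x ζ)) (n R ζ - (phase P u R)⁻¹)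
    rw [norm_neg] at h5
    linarith
  have := hnlim.const_mul (phase P u x)
  rw [mul_one] at this
  refine this.congr fun ζ => ?_
  simp only [hn]
  rw [mul_inv_cancel_left₀ (phase_ne_zero x)]

theorem tendsto_imaginary (P : Params) :
    Tendsto (fun s : ℝ => I * (s : ℂ)) atTop (extInfty P) := by
  refine tendsto_inf.2 ⟨tendsto_comap_iff.2 ?_, tendsto_principal.2 ?_⟩
  · refine tendsto_abs_atTop_atTop.congr fun s => ?_
    simp
  · filter_upwards [eventually_ge_atTop P.q₀, eventually_ge_atTop 0] with s hs hs0
    refine ⟨?_, ?_⟩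
    · simpa [abs_of_nonneg hs0] using hs
    · simpa using hs0

/-- The leading term of `m₁` is `u m₂ / (iζ)`, with `m₂` tending to the phase. On the imaginary ray
`Im ζ = |ζ| = s`, so after multiplication by `ζ` the contribution of the endpoint `x + 1` is `O(s
e^{-s})` and the remainder is `O(1/s)`. This is the limit from which the potential is recovered. -/
theorem tendsto_mul_fst_imaginary (hq : 0 < P.q₀) (hu : IsStep P u qb)
    (hm : IsModifiedJost P u qb m) (x : ℝ) :
    Tendsto (fun s : ℝ => I * (s : ℂ) * (m x (I * s)).1) atTop (𝓝 (-(I * u x * phase P u x))) := by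
  obtain ⟨K, hK0, hK⟩ := hm.norm_fst_sub_le hq hu (show x ≤ x + 1 by linarith)
  have hlim := tendsto_imaginary P
  have h1 : Tendsto (fun s : ℝ => ‖(m (x + 1) (I * s)).1
      - u (x + 1) * (m (x + 1) (I * s)).2 / (I * (I * s))‖) atTop (𝓝 0) := by
    have a1 := (hm.tendsto_fst_infty hq hu (x + 1)).comp hlim
    have a2 := ((hm.tendsto_snd_infty hq hu (x + 1)).comp hlim).const_mul (u (x + 1))
    have a3 : Tendsto (fun s : ℝ => (I * (I * (s : ℂ)))⁻¹) atTop (𝓝 0) := by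
      rw [tendsto_zero_iff_norm_tendsto_zero]
      refine (tendsto_inv_atTop_zero.comp tendsto_abs_atTop_atTop).congr fun s => ?_
      simp
    have a4 := (a1.sub (a2.mul a3)).norm
    rw [mul_zero, sub_zero, norm_zero] at a4
    refine a4.congr fun s => ?_
    simp only [Function.comp_apply, div_eq_mul_inv]
  have h2 : Tendsto (fun s : ℝ => s * Real.exp (-s)) atTop (𝓝 0) := by
    simpa using Real.tendsto_pow_mul_exp_neg_atTop_nhds_zero 1
  have h3 : Tendsto (fun s : ℝ => K / s) atTop (𝓝 0) := tendsto_id.const_div_atTop K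
  have h4 : Tendsto (fun s : ℝ => I * (s : ℂ) * (m x (I * s)).1
      - u x * (m x (I * s)).2 / I) atTop (𝓝 0) := by
    rw [tendsto_zero_iff_norm_tendsto_zero]
    have h5 := (h2.mul h1).add h3
    rw [mul_zero, add_zero] at h5
    refine tendsto_of_tendsto_of_tendsto_of_le_of_le' tendsto_const_nhds h5
      (Eventually.of_forall fun _ => norm_nonneg _) ?_
    filter_upwards [hlim.eventually eventually_mem_extInfty, eventually_gt_atTop 0] with s hs hs0
    have him : (I * (s : ℂ)).im = s := by simp
    have hnm : ‖I * (s : ℂ)‖ = s := by simp [abs_of_pos hs0]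
    have h6 := (hK _ hs).2 (by rwa [him])
    rw [him, hnm] at h6
    have h7 : I * (s : ℂ) * (m x (I * s)).1 - u x * (m x (I * s)).2 / I
        = I * s * ((m x (I * s)).1 - u x * (m x (I * s)).2 / (I * (I * s))) := by
      have : (s : ℂ) ≠ 0 := by exact_mod_cast hs0.ne'
      have hI := I_ne_zero
      field_simp
    rw [h7, norm_mul, hnm]
    calc _ ≤ s * (Real.exp (-(s * (x + 1 - x))) * ‖(m (x + 1) (I * s)).1
            - u (x + 1) * (m (x + 1) (I * s)).2 / (I * (I * s))‖ + K / (s * s)) :=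
          mul_le_mul_of_nonneg_left h6 hs0.le
      _ = _ := by
          rw [add_sub_cancel_left, mul_one]
          field_simp
  have h8 := (((hm.tendsto_snd_infty hq hu x).comp hlim).const_mul (u x)).div_const I
  have h9 := h4.add h8
  rw [zero_add] at h9
  have e : u x * phase P u x / I = -(I * u x * phase P u x) := by
    rw [div_I]; ring
  rw [e] at h9
  refine h9.congr fun s => ?_
  simp

end IsStep.IsModifiedJost

end KE

end

/-! ### The branch point `iq₀` -/

noncomputable section

namespace KE

/-- `(ζ - q₀²/ζ)/2`. -/
def kOf (P : Params) (ζ : ℂ) : ℂ := (ζ - (P.q₀ : ℂ) ^ 2 / ζ) / 2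

namespace IsStep.IsModifiedJost

variable {P : Params} {u : ℝ → ℂ} {qb : ℂ} {m : ℝ → ℂ → ℂ × ℂ}

theorem branchPoint_mem (hq : 0 < P.q₀) : I * (P.q₀ : ℂ) ∈ extUpper P := by
  refine ⟨?_, ?_⟩ <;> simp [abs_of_pos hq, hq.le]

theorem lam_branchPoint (hq : 0 < P.q₀) : lam P (I * P.q₀) = 0 := by
  have h : (P.q₀ : ℂ) ≠ 0 := by exact_mod_cast hq.ne'
  have hI := I_ne_zero
  rw [lam]
  field_simp
  rw [I_sq]; ring

theorem norm_exp_lam_le (hq : 0 < P.q₀) {ζ : ℂ} (hζ : ζ ∈ extUpper P) {s : ℝ} (hs : 0 ≤ s) :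
    ‖Complex.exp (I * lam P ζ * s)‖ ≤ 1 := by
  rw [Complex.norm_exp, Real.exp_le_one_iff, Complex.re_mul_ofReal]
  have h1 := lam_im_nonneg hq hζ
  have : (I * lam P ζ).re = -(lam P ζ).im := by simp
  rw [this]
  nlinarith [mul_nonneg h1 hs]

theorem norm_exp_lam_tendsto (hq : 0 < P.q₀) {ζ : ℂ} (hζ : ζ ∈ extUpperOpen P) (x : ℝ) :
    Tendsto (fun y : ℝ => Complex.exp (I * lam P ζ * ((y - x : ℝ) : ℂ))) atTop (𝓝 0) := by
  rw [tendsto_zero_iff_norm_tendsto_zero]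
  have h1 := lam_im_pos hq hζ
  have e : ∀ y : ℝ, ‖Complex.exp (I * lam P ζ * ((y - x : ℝ) : ℂ))‖
      = Real.exp (-((lam P ζ).im * (y - x))) := fun y => by
    rw [Complex.norm_exp, Complex.re_mul_ofReal]
    congr 1; simp
  simp_rw [e]
  refine Real.tendsto_exp_neg_atTop_nhds_zero.comp ?_
  exact (tendsto_atTop_add_const_right _ (-x) tendsto_id).const_mul_atTop h1

/-- The Wronskian of the modified Jost solution with its value at the branch point `i q₀`
vanishes to first order in `λ`. -/
theorem tendsto_wronskian_div_lam (hq : 0 < P.q₀) (hu : IsStep P u qb)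
    (hm : IsModifiedJost P u qb m) (x : ℝ) :
    ∃ L, Tendsto (fun ζ => ((m x ζ).1 * (m x (I * P.q₀)).2 - (m x ζ).2 * (m x (I * P.q₀)).1)
      / lam P ζ) (𝓝[extUpperOpen P] (I * P.q₀)) (𝓝 L) := by
  set ζ₀ : ℂ := I * P.q₀ with hζ₀
  have hmem₀ : ζ₀ ∈ extUpper P := branchPoint_mem hq
  have hζ₀0 : ζ₀ ≠ 0 := ne_zero_of_mem_extUpper hq hmem₀
  have hζ₀sq : ζ₀ ^ 2 = -(P.q₀ : ℂ) ^ 2 := by rw [hζ₀, mul_pow, I_sq]; ring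
  have hl0 : lam P ζ₀ = 0 := lam_branchPoint hq
  set F : ℝ → ℂ → ℂ × ℂ := fun y ζ => stepL P qb ζ (m y ζ) + stepB P u qb y (m y ζ) with hF
  -- The Wronskian `D` satisfies `D' = -iλD - i(k - k₀)h`. With `c = (k - k₀)/λ` the function
  -- `e^{iλ(y-x)} (D + c h)` has derivative `c e^{iλ(y-x)} h'`, so `D = -c (h + ∫ e^{iλ(y-x)} h')`.
  -- The function `h` itself does not decay, but `h'` is integrable uniformly near `iq₀`.
  set h : ℝ → ℂ → ℂ := fun y ζ => (m y ζ).1 * (m y ζ₀).2 + (m y ζ).2 * (m y ζ₀).1 with hh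
  set h' : ℝ → ℂ → ℂ := fun y ζ => ((F y ζ).1 * (m y ζ₀).2 + (m y ζ).1 * (F y ζ₀).2)
    + ((F y ζ).2 * (m y ζ₀).1 + (m y ζ).2 * (F y ζ₀).1) with hh'
  set D : ℝ → ℂ → ℂ := fun y ζ => (m y ζ).1 * (m y ζ₀).2 - (m y ζ).2 * (m y ζ₀).1 with hD
  set c : ℂ → ℂ := fun ζ => (kOf P ζ - kOf P ζ₀) / lam P ζ with hc
  have hder : ∀ ζ ∈ extUpper P, ∀ y, HasDerivAt (fun y => h y ζ) (h' y ζ) y := fun ζ hζ y =>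
    ((hm.ode ζ hζ y).pair_fst.mul (hm.ode _ hmem₀ y).pair_snd).add
      ((hm.ode ζ hζ y).pair_snd.mul (hm.ode _ hmem₀ y).pair_fst)
  have hDder : ∀ ζ ∈ extUpper P, ∀ y, HasDerivAt (fun y => D y ζ)
      (-(I * lam P ζ) * D y ζ - I * (kOf P ζ - kOf P ζ₀) * h y ζ) y := by
    intro ζ hζ y
    have hζ0 := ne_zero_of_mem_extUpper hq hζ
    refine (((hm.ode_fst hζ y).mul (hm.ode_snd hmem₀ y)).sub
      ((hm.ode_snd hζ y).mul (hm.ode_fst hmem₀ y))).congr_deriv ?_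
    simp only [hD, hh]
    have e0 : (P.q₀ : ℂ) ^ 2 / ζ₀ = -ζ₀ := by
      rw [div_eq_iff hζ₀0]; linear_combination hζ₀sq
    simp only [lam, kOf, mul_div_assoc, e0]
    ring
  obtain ⟨C, hC⟩ := hm.bounded (x - 1)
  have hC0 : 0 ≤ C := (norm_nonneg _).trans (hC x (by linarith) _ hmem₀)
  obtain ⟨ρ, hρ, hρb⟩ := hm.deriv_bound (x - 1)
  have hρx : IntegrableOn ρ (Ioi x) := hρ.mono_set (Ioi_subset_Ioi (by linarith))
  have hmc : ∀ ζ ∈ extUpper P, Continuous fun y => m y ζ := fun ζ hζ =>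
    continuous_iff_continuousAt.2 fun y => (hm.ode ζ hζ y).continuousAt
  have hFc : ∀ ζ ∈ extUpper P, Continuous fun y => F y ζ := fun ζ hζ => by
    have h1 := hu.continuous_stepB.comp (continuous_id.prodMk (hmc ζ hζ))
    exact ((stepL P qb ζ).continuous.comp (hmc ζ hζ)).add h1
  have hh'c : ∀ ζ ∈ extUpper P, Continuous fun y => h' y ζ := fun ζ hζ => by
    have a1 := hFc ζ hζ
    have a2 := hFc _ hmem₀
    have a3 := hmc ζ hζ
    have a4 := hmc _ hmem₀
    simp only [hh']
    fun_prop
  have hh'b : ∀ ζ ∈ extUpper P, ‖ζ‖ ≤ 2 * P.q₀ → ∀ y, x - 1 < y → ‖h' y ζ‖ ≤ 4 * C * ρ y := by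
    intro ζ hζ hζn y hy
    have a1 := hρb y hy ζ hζ hζn
    have a2 := hρb y hy _ hmem₀ (by simp [hζ₀, abs_of_pos hq]; linarith)
    have a3 := hC y hy ζ hζ
    have a4 := hC y hy _ hmem₀
    have hρ0 : 0 ≤ ρ y := (norm_nonneg _).trans a1
    have key : ∀ p q r s : ℂ, ‖p‖ ≤ ρ y → ‖q‖ ≤ C → ‖r‖ ≤ C → ‖s‖ ≤ ρ y →
        ‖p * q + r * s‖ ≤ 2 * C * ρ y := fun p q r s hp hq' hr hs => by
      refine (norm_add_le _ _).trans ?_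
      rw [norm_mul, norm_mul]
      nlinarith [mul_le_mul hp hq' (norm_nonneg _) hρ0, mul_le_mul hr hs (norm_nonneg _) hC0]
    refine (norm_add_le _ _).trans ?_
    have b1 := key _ _ _ _ ((norm_fst_le _).trans a1) ((norm_snd_le _).trans a4)
      ((norm_fst_le _).trans a3) ((norm_snd_le _).trans a2)
    have b2 := key _ _ _ _ ((norm_snd_le _).trans a1) ((norm_fst_le _).trans a4)
      ((norm_snd_le _).trans a3) ((norm_fst_le _).trans a2)
    linarith
  set J : ℂ → ℂ := fun ζ => ∫ y in Ioi x, Complex.exp (I * lam P ζ * ((y - x : ℝ) : ℂ)) * h' y ζ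
    with hJ
  -- the integrated identity
  have hid : ∀ ζ ∈ extUpperOpen P, ‖ζ‖ ≤ 2 * P.q₀ → D x ζ + c ζ * h x ζ = -(c ζ * J ζ) := by
    intro ζ hζ hζn
    have hζ' := extUpperOpen_subset P hζ
    have hl : lam P ζ ≠ 0 := fun h0 => by
      have := lam_im_pos hq hζ
      rw [h0] at this; simp at this
    set e : ℝ → ℂ := fun y => Complex.exp (I * lam P ζ * ((y - x : ℝ) : ℂ)) with he
    have hed : ∀ y, HasDerivAt e (e y * (I * lam P ζ)) y := fun y => by
      have h3 : HasDerivAt (fun y : ℝ => I * lam P ζ * ((y - x : ℝ) : ℂ)) (I * lam P ζ) y := by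
        simpa using (((hasDerivAt_id y).sub_const x).ofReal_comp).const_mul (I * lam P ζ)
      exact h3.cexp
    have hec : Continuous e := continuous_iff_continuousAt.2 fun y => (hed y).continuousAt
    have hZ : ∀ y ∈ Ici x, HasDerivAt (fun y => e y * (D y ζ + c ζ * h y ζ))
        (c ζ * (e y * h' y ζ)) y := fun y _ => by
      refine ((hed y).mul ((hDder ζ hζ' y).add ((hder ζ hζ' y).const_mul (c ζ)))).congr_deriv ?_
      simp only [hc, Pi.add_apply]
      field_simp
      ring
    have hint : IntegrableOn (fun y => c ζ * (e y * h' y ζ)) (Ioi x) := by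
      refine Integrable.mono' ((hρx.const_mul (4 * C)).const_mul ‖c ζ‖)
        ((continuous_const.mul (hec.mul (hh'c ζ hζ'))).aestronglyMeasurable) ?_
      refine (ae_restrict_mem measurableSet_Ioi).mono fun y hy => ?_
      have hy : x < y := hy
      rw [norm_mul, norm_mul]
      refine mul_le_mul_of_nonneg_left ?_ (norm_nonneg _)
      exact (mul_le_of_le_one_left (norm_nonneg _)
        (norm_exp_lam_le hq hζ' (by linarith : 0 ≤ y - x))).trans
        (hh'b ζ hζ' hζn y (by linarith))
    have hlim : Tendsto (fun y => e y * (D y ζ + c ζ * h y ζ)) atTop (𝓝 0) := by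
      have h1 := tendsto_of_uniform_limit hm.limit hζ'
      have h2 := tendsto_of_uniform_limit hm.limit hmem₀
      have h3 := (norm_exp_lam_tendsto hq hζ x).mul
        (((h1.fst_nhds.mul h2.snd_nhds).sub (h1.snd_nhds.mul h2.fst_nhds)).add
        (((h1.fst_nhds.mul h2.snd_nhds).add (h1.snd_nhds.mul h2.fst_nhds)).const_mul (c ζ)))
      rw [zero_mul] at h3
      exact h3
    have key := integral_Ioi_of_hasDerivAt_of_tendsto' hZ hint hlim
    rw [integral_const_mul, zero_sub] at key
    have e1 : e x = 1 := by simp [he]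
    rw [e1, one_mul] at key
    rw [hJ]
    simp only
    rw [key, neg_neg]
  -- convergence
  have hnear : ∀ᶠ ζ in 𝓝[extUpperOpen P] ζ₀, ζ ∈ extUpperOpen P ∧ ‖ζ‖ ≤ 2 * P.q₀ := by
    refine (eventually_mem_nhdsWithin).and (eventually_nhdsWithin_of_eventually_nhds ?_)
    have : Tendsto (fun ζ : ℂ => ‖ζ‖) (𝓝 ζ₀) (𝓝 ‖ζ₀‖) := continuous_norm.tendsto _
    refine this.eventually (eventually_le_nhds ?_)
    simp [hζ₀, abs_of_pos hq, hq]
  have hmt : ∀ y, Tendsto (fun ζ => m y ζ) (𝓝[extUpperOpen P] ζ₀) (𝓝 (m y ζ₀)) := fun y =>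
    ((hm.continuousOn y) ζ₀ hmem₀).mono_left (nhdsWithin_mono _ (extUpperOpen_subset P))
  have hidt : Tendsto (fun ζ : ℂ => ζ) (𝓝[extUpperOpen P] ζ₀) (𝓝 ζ₀) :=
    tendsto_id.mono_left nhdsWithin_le_nhds
  have hlt : Tendsto (fun ζ => lam P ζ) (𝓝[extUpperOpen P] ζ₀) (𝓝 (lam P ζ₀)) :=
    ((hidt.add (tendsto_const_nhds.div hidt hζ₀0)).div_const 2)
  have hFt : ∀ y, Tendsto (fun ζ => F y ζ) (𝓝[extUpperOpen P] ζ₀) (𝓝 (F y ζ₀)) := fun y => by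
    have a1 := (hmt y).fst_nhds
    have a2 := (hmt y).snd_nhds
    have a3 : Tendsto (fun ζ : ℂ => I * (P.q₀ : ℂ) ^ 2 / ζ) (𝓝[extUpperOpen P] ζ₀)
        (𝓝 (I * (P.q₀ : ℂ) ^ 2 / ζ₀)) := tendsto_const_nhds.div hidt hζ₀0
    refine Tendsto.add ?_ (((stepB P u qb y).continuous.tendsto _).comp (hmt y))
    simp only [stepL, pairMap_apply]
    exact (((hidt.const_mul I).neg.mul a1).add (a2.const_mul _)).prodMk_nhds
      ((a1.const_mul _).add (a3.neg.mul a2))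
  have hht : Tendsto (fun ζ => h x ζ) (𝓝[extUpperOpen P] ζ₀) (𝓝 (h x ζ₀)) :=
    ((hmt x).fst_nhds.mul_const _).add ((hmt x).snd_nhds.mul_const _)
  have hh't : ∀ y, Tendsto (fun ζ => h' y ζ) (𝓝[extUpperOpen P] ζ₀) (𝓝 (h' y ζ₀)) := fun y =>
    (((hFt y).fst_nhds.mul_const _).add ((hmt y).fst_nhds.mul_const _)).add
      (((hFt y).snd_nhds.mul_const _).add ((hmt y).snd_nhds.mul_const _))
  have hJt : ∃ l, Tendsto J (𝓝[extUpperOpen P] ζ₀) (𝓝 l) := by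
    refine ⟨∫ y in Ioi x, Complex.exp (I * lam P ζ₀ * ((y - x : ℝ) : ℂ)) * h' y ζ₀, ?_⟩
    refine tendsto_integral_filter_of_dominated_convergence (fun y => 4 * C * ρ y) ?_ ?_
      (hρx.const_mul (4 * C)) ?_
    · filter_upwards [hnear] with ζ hζ
      have := hh'c ζ (extUpperOpen_subset P hζ.1)
      exact (by fun_prop : Continuous _).aestronglyMeasurable
    · filter_upwards [hnear] with ζ hζ
      refine (ae_restrict_mem measurableSet_Ioi).mono fun y hy => ?_
      have hy : x < y := hy
      rw [norm_mul]
      exact (mul_le_of_le_one_left (norm_nonneg _)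
        (norm_exp_lam_le hq (extUpperOpen_subset P hζ.1) (by linarith : 0 ≤ y - x))).trans
        (hh'b ζ (extUpperOpen_subset P hζ.1) hζ.2 y (by linarith))
    · refine Eventually.of_forall fun y => ?_
      exact ((Complex.continuous_exp.tendsto _).comp ((hlt.const_mul I).mul_const _)).mul (hh't y)
  obtain ⟨l, hl⟩ := hJt
  -- This quotient is `c / λ`. It is regular at `iq₀` because `k - k₀` has a double zero there and
  -- `λ` a simple one.
  have hct : Tendsto (fun ζ : ℂ => 2 * ζ / (ζ + ζ₀) ^ 2) (𝓝[extUpperOpen P] ζ₀)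
      (𝓝 (2 * ζ₀ / (ζ₀ + ζ₀) ^ 2)) := by
    refine (hidt.const_mul 2).div ((hidt.add_const _).pow 2) ?_
    rw [← two_mul]
    exact pow_ne_zero _ (mul_ne_zero two_ne_zero hζ₀0)
  refine ⟨_, Tendsto.congr' ?_ ((hct.mul (hht.add hl)).neg)⟩
  filter_upwards [hnear] with ζ hζ
  have hζ0 := ne_zero_of_mem_extUpper hq (extUpperOpen_subset P hζ.1)
  have hlne : lam P ζ ≠ 0 := fun h0 => by
    have := lam_im_pos hq hζ.1
    rw [h0] at this; simp at this
  have hfac : lam P ζ = (ζ - ζ₀) * (ζ + ζ₀) / (2 * ζ) := by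
    rw [lam]; field_simp; linear_combination hζ₀sq
  have hk : kOf P ζ - kOf P ζ₀ = (ζ - ζ₀) ^ 2 / (2 * ζ) := by
    have e0 : (P.q₀ : ℂ) ^ 2 / ζ₀ = -ζ₀ := by
      rw [div_eq_iff hζ₀0]; linear_combination hζ₀sq
    rw [kOf, kOf, e0]; field_simp; linear_combination -hζ₀sq
  have hne : ζ - ζ₀ ≠ 0 ∧ ζ + ζ₀ ≠ 0 := by
    constructor <;> intro h0 <;> apply hlne <;> rw [hfac, h0] <;> simp
  have hcl : c ζ / lam P ζ = 2 * ζ / (ζ + ζ₀) ^ 2 := by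
    obtain ⟨n1, n2⟩ := hne
    simp only [hc]
    rw [hk, hfac]
    field_simp
  have h1 := hid ζ hζ.1 hζ.2
  have h2 : D x ζ = -(c ζ * (h x ζ + J ζ)) := by linear_combination h1
  rw [show (m x ζ).1 * (m x ζ₀).2 - (m x ζ).2 * (m x ζ₀).1 = D x ζ from rfl, h2, ← hcl]
  ring

end IsStep.IsModifiedJost

end KE

end

/-! ### The zero curvature representation -/

noncomputable section

namespace KE

/-- `∂_x q`. -/
def derivX (q : ℝ → ℝ → ℂ) (x t : ℝ) : ℂ := deriv (fun y => q y t) x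

/-- `∂_t q`. -/
def derivT (q : ℝ → ℝ → ℂ) (x t : ℝ) : ℂ := deriv (fun s => q x s) t

theorem _root_.HasDerivAt.conj_comp {f : ℝ → ℂ} {f' : ℂ} {x : ℝ} (h : HasDerivAt f f' x) :
    HasDerivAt (fun y => conj (f y)) (conj f') x :=
  (Complex.conjCLE : ℂ →L[ℝ] ℂ).hasFDerivAt.comp_hasDerivAt x h

section Slices

variable {F : ℝ × ℝ → ℂ} {x t : ℝ}

theorem hasDerivAt_slice_fst (h : DifferentiableAt ℝ F (x, t)) :
    HasDerivAt (fun y => F (y, t)) (fderiv ℝ F (x, t) (1, 0)) x := by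
  have h1 : HasDerivAt (fun y : ℝ => (y, t)) ((1 : ℝ), (0 : ℝ)) x :=
    (hasDerivAt_id x).prodMk (hasDerivAt_const x t)
  exact h.hasFDerivAt.comp_hasDerivAt x h1

theorem hasDerivAt_slice_snd (h : DifferentiableAt ℝ F (x, t)) :
    HasDerivAt (fun s => F (x, s)) (fderiv ℝ F (x, t) (0, 1)) t := by
  have h1 : HasDerivAt (fun s : ℝ => (x, s)) ((0 : ℝ), (1 : ℝ)) t :=
    (hasDerivAt_const t x).prodMk (hasDerivAt_id t)
  exact h.hasFDerivAt.comp_hasDerivAt t h1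

end Slices

namespace IsSolution

variable {T : ℝ} {q : ℝ → ℝ → ℂ}

theorem contDiff_derivX (h : IsSolution T q) :
    ContDiff ℝ 1 fun r : ℝ × ℝ => derivX q r.1 r.2 := by
  have hd : Differentiable ℝ fun y : ℝ × ℝ => q y.1 y.2 := h.1.differentiable two_ne_zero
  have h1 : ContDiff ℝ 1 fun r : ℝ × ℝ => fderiv ℝ (fun y : ℝ × ℝ => q y.1 y.2) r (1, 0) :=
    (h.1.fderiv_right (m := 1) (by norm_num)).clm_apply contDiff_const
  have e : (fun r : ℝ × ℝ => derivX q r.1 r.2)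
      = fun r : ℝ × ℝ => fderiv ℝ (fun y : ℝ × ℝ => q y.1 y.2) r (1, 0) :=
    funext fun r => (hasDerivAt_slice_fst (x := r.1) (t := r.2) (hd _)).deriv
  rw [e]
  exact h1

theorem hasDerivAt_fst (h : IsSolution T q) (x t : ℝ) :
    HasDerivAt (fun y => q y t) (derivX q x t) x := by
  have hd : Differentiable ℝ fun y : ℝ × ℝ => q y.1 y.2 := h.1.differentiable two_ne_zero
  exact (hasDerivAt_slice_fst (x := x) (t := t) (hd _)).differentiableAt.hasDerivAt

theorem hasDerivAt_snd (h : IsSolution T q) (x t : ℝ) :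
    HasDerivAt (fun s => q x s) (derivT q x t) t := by
  have hd : Differentiable ℝ fun y : ℝ × ℝ => q y.1 y.2 := h.1.differentiable two_ne_zero
  exact (hasDerivAt_slice_snd (x := x) (t := t) (hd _)).differentiableAt.hasDerivAt

theorem hasDerivAt_derivX (h : IsSolution T q) (x t : ℝ) :
    HasDerivAt (fun y => derivX q y t) (derivX (derivX q) x t) x := by
  have hd := h.contDiff_derivX.differentiable one_ne_zero
  exact (hasDerivAt_slice_fst (x := x) (t := t) (hd _)).differentiableAt.hasDerivAt

theorem continuous (h : IsSolution T q) : Continuous fun r : ℝ × ℝ => q r.1 r.2 := h.1.continuous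

theorem continuous_derivX (h : IsSolution T q) :
    Continuous fun r : ℝ × ℝ => derivX q r.1 r.2 := h.contDiff_derivX.continuous

theorem continuous_derivXX (h : IsSolution T q) :
    Continuous fun r : ℝ × ℝ => derivX (derivX q) r.1 r.2 := by
  have hd := h.contDiff_derivX.differentiable one_ne_zero
  have h1 : Continuous fun r : ℝ × ℝ =>
      fderiv ℝ (fun r : ℝ × ℝ => derivX q r.1 r.2) r (1, 0) :=
    (h.contDiff_derivX.continuous_fderiv one_ne_zero).clm_apply continuous_const
  refine h1.congr fun r => ?_
  exact (hasDerivAt_slice_fst (x := r.1) (t := r.2) (hd _)).deriv.symm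

theorem deriv_norm_sq (h : IsSolution T q) (x t : ℝ) :
    ((deriv (fun y => ‖q y t‖ ^ 2) x : ℝ) : ℂ)
      = conj (derivX q x t) * q x t + conj (q x t) * derivX q x t := by
  have h1 := (h.hasDerivAt_fst x t).conj_comp.mul (h.hasDerivAt_fst x t)
  have h2 : DifferentiableAt ℝ (fun y => ‖q y t‖ ^ 2) x :=
    (h.hasDerivAt_fst x t).differentiableAt.norm_sq ℝ
  have h3 := h2.hasDerivAt.ofReal_comp
  refine h3.unique (h1.congr_of_eventuallyEq (Eventually.of_forall fun y => ?_))
  simp only [Pi.mul_apply, Complex.conj_mul']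
  push_cast
  rfl

/-- The equation with `|q|²` written as `q̄ q`. -/
theorem equation (h : IsSolution T q) (x t : ℝ) :
    I * derivT q x t + derivX (derivX q) x t + 2 * (conj (q x t) * q x t) * q x t
      + 4 * (T : ℂ) ^ 2 * (conj (q x t) * q x t) ^ 2 * q x t
      - 4 * I * T * (conj (derivX q x t) * q x t + conj (q x t) * derivX q x t) * q x t = 0 := by
  rw [← h.2 x t, h.deriv_norm_sq, Complex.conj_mul']
  simp only [derivT]
  rw [show derivX (derivX q) x t = deriv (deriv fun y => q y t) x from rfl]
  ring

end IsSolution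

section Lax

variable (P : Params) (q : ℝ → ℝ → ℂ)

theorem laxX_eq (ζ : ℂ) (x t : ℝ) : laxX P q ζ x t =
    !![I * P.T * (conj (q x t) * q x t) - I * (zOf P ζ + P.α / 2),
        q x t * exp (-(I * Ups P x t));
      -conj (q x t) * exp (I * Ups P x t),
        -(I * P.T * (conj (q x t) * q x t) - I * (zOf P ζ + P.α / 2))] := by
  ext i j
  rw [Complex.conj_mul']
  fin_cases i <;> fin_cases j <;> (simp [laxX, sigma3]; try ring)

/-- The rate `2q₀² + 4T²q₀⁴ - α²`. -/
def rate : ℂ := 2 * (P.q₀ : ℂ) ^ 2 + 4 * (P.T : ℂ) ^ 2 * (P.q₀ : ℂ) ^ 4 - (P.α : ℂ) ^ 2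

/-- The upper left entry of the matrix of the `t`-part. -/
def laxTdiag (ζ : ℂ) (x t : ℝ) : ℂ :=
  I * (conj (q x t) * q x t) + 4 * I * (P.T : ℂ) ^ 2 * (conj (q x t) * q x t) ^ 2
    + P.T * (q x t * conj (derivX q x t) - derivX q x t * conj (q x t))
    - 2 * I * (zOf P ζ ^ 2 + rate P / 4)

theorem laxT_eq (ζ : ℂ) (x t : ℝ) : laxT P q ζ x t =
    !![laxTdiag P q ζ x t,
        (I * derivX q x t + 2 * zOf P ζ * q x t + 2 * P.T * (conj (q x t) * q x t) * q x t)
          * exp (-(I * Ups P x t));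
      (I * conj (derivX q x t) - 2 * zOf P ζ * conj (q x t)
          - 2 * P.T * (conj (q x t) * q x t) * conj (q x t)) * exp (I * Ups P x t),
        -laxTdiag P q ζ x t] := by
  ext i j
  simp only [laxTdiag]
  rw [Complex.conj_mul']
  fin_cases i <;> fin_cases j <;> (simp [laxT, sigma3, derivX, rate]; try ring)

/-- `∂_t` of the matrix of the `x`-part. -/
def laxXdt (x t : ℝ) : Matrix (Fin 2) (Fin 2) ℂ :=
  !![I * P.T * (conj (derivT q x t) * q x t + conj (q x t) * derivT q x t),
      (derivT q x t - I * rate P * q x t) * exp (-(I * Ups P x t));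
    -(conj (derivT q x t) + I * rate P * conj (q x t)) * exp (I * Ups P x t),
      -(I * P.T * (conj (derivT q x t) * q x t + conj (q x t) * derivT q x t))]

/-- `∂_x` of the upper left entry of the matrix of the `t`-part. -/
def laxTdiagDx (x t : ℝ) : ℂ :=
  I * (conj (derivX q x t) * q x t + conj (q x t) * derivX q x t)
    + 8 * I * (P.T : ℂ) ^ 2 * (conj (q x t) * q x t)
      * (conj (derivX q x t) * q x t + conj (q x t) * derivX q x t)
    + P.T * (q x t * conj (derivX (derivX q) x t) - derivX (derivX q) x t * conj (q x t))

/-- `∂_x` of the matrix of the `t`-part. -/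
def laxTdx (ζ : ℂ) (x t : ℝ) : Matrix (Fin 2) (Fin 2) ℂ :=
  !![laxTdiagDx P q x t,
      (I * derivX (derivX q) x t + 2 * zOf P ζ * derivX q x t
        + 2 * P.T * ((conj (derivX q x t) * q x t + conj (q x t) * derivX q x t) * q x t
          + conj (q x t) * q x t * derivX q x t)
        - I * P.α * (I * derivX q x t + 2 * zOf P ζ * q x t
          + 2 * P.T * (conj (q x t) * q x t) * q x t)) * exp (-(I * Ups P x t));
    (I * conj (derivX (derivX q) x t) - 2 * zOf P ζ * conj (derivX q x t)
        - 2 * P.T * ((conj (derivX q x t) * q x t + conj (q x t) * derivX q x t) * conj (q x t)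
          + conj (q x t) * q x t * conj (derivX q x t))
        + I * P.α * (I * conj (derivX q x t) - 2 * zOf P ζ * conj (q x t)
          - 2 * P.T * (conj (q x t) * q x t) * conj (q x t))) * exp (I * Ups P x t),
      -laxTdiagDx P q x t]

theorem hasDerivAt_Ups_fst (x t : ℝ) :
    HasDerivAt (fun y => ((Ups P y t : ℝ) : ℂ)) P.α x := by
  have h : HasDerivAt (fun y => Ups P y t) P.α x := by
    unfold Ups
    exact (((hasDerivAt_id x).const_mul P.α).add_const _).congr_deriv (by simp)
  exact h.ofReal_comp

theorem hasDerivAt_Ups_snd (x t : ℝ) :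
    HasDerivAt (fun s => ((Ups P x s : ℝ) : ℂ)) (rate P) t := by
  have h : HasDerivAt (fun s => Ups P x s)
      (2 * P.q₀ ^ 2 + 4 * P.T ^ 2 * P.q₀ ^ 4 - P.α ^ 2) t := by
    unfold Ups
    exact (((hasDerivAt_id t).const_mul _).const_add _).congr_deriv (by simp)
  refine h.ofReal_comp.congr_deriv ?_
  rw [rate]; push_cast; ring

variable {P q}

theorem hasDerivAt_laxX_snd {T : ℝ} (h : IsSolution T q) (ζ : ℂ) (x t : ℝ) (i j : Fin 2) :
    HasDerivAt (fun s => laxX P q ζ x s i j) (laxXdt P q x t i j) t := by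
  have a := h.hasDerivAt_snd x t
  have b := a.conj_comp
  have c := b.mul a
  have e := hasDerivAt_Ups_snd P x t
  have e1 := (e.const_mul I).cexp
  have e2 := (e.const_mul I).neg.cexp
  simp only [laxX_eq, laxXdt]
  have d := (c.const_mul (I * P.T)).sub_const (I * (zOf P ζ + P.α / 2))
  fin_cases i <;> fin_cases j
  · exact d
  · refine (a.mul e2).congr_deriv ?_
    simp; ring
  · refine (b.neg.mul e1).congr_deriv ?_
    simp; ring
  · exact d.neg

theorem hasDerivAt_laxT_fst {T : ℝ} (h : IsSolution T q) (ζ : ℂ) (x t : ℝ) (i j : Fin 2) :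
    HasDerivAt (fun y => laxT P q ζ y t i j) (laxTdx P q ζ x t i j) x := by
  have a := h.hasDerivAt_fst x t
  have a' := h.hasDerivAt_derivX x t
  have b := a.conj_comp
  have b' := a'.conj_comp
  have c := b.mul a
  have e := hasDerivAt_Ups_fst P x t
  have e1 := (e.const_mul I).cexp
  have e2 := (e.const_mul I).neg.cexp
  simp only [laxT_eq, laxTdx]
  have d : HasDerivAt (fun y => laxTdiag P q ζ y t) (laxTdiagDx P q x t) x := by
    unfold laxTdiag
    refine ((((c.const_mul I).add ((c.pow 2).const_mul (4 * I * (P.T : ℂ) ^ 2))).add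
      (((a.mul b').sub (a'.mul b)).const_mul (P.T : ℂ))).sub_const _).congr_deriv ?_
    simp [laxTdiagDx]; ring
  fin_cases i <;> fin_cases j
  · exact d
  · refine ((((a'.const_mul I).add (a.const_mul (2 * zOf P ζ))).add
      ((c.const_mul (2 * (P.T : ℂ))).mul a)).mul e2).congr_deriv ?_
    simp; ring
  · refine ((((b'.const_mul I).sub (b.const_mul (2 * zOf P ζ))).sub
      ((c.const_mul (2 * (P.T : ℂ))).mul b)).mul e1).congr_deriv ?_
    simp; ring
  · exact d.neg

/-- The zero curvature representation of the Kundu-Eckhaus equation. -/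
theorem zero_curvature (h : IsSolution P.T q) (ζ : ℂ) (x t : ℝ) :
    laxXdt P q x t + laxX P q ζ x t * laxT P q ζ x t
      = laxTdx P q ζ x t + laxT P q ζ x t * laxX P q ζ x t := by
  have h1 := h.equation x t
  have h2 := congrArg conj h1
  simp only [map_add, map_sub, map_mul, map_pow, Complex.conj_conj, conj_I, map_ofNat,
    Complex.conj_ofReal, map_zero] at h2
  have hE : exp (-(I * Ups P x t)) * exp (I * Ups P x t) = 1 := by
    rw [← Complex.exp_add]; simp
  rw [laxX_eq, laxT_eq]
  simp only [laxXdt, laxTdx, laxTdiag, laxTdiagDx]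
  -- The exponentials, `q`, its derivatives and their conjugates become independent symbols. What
  -- remains is a polynomial identity modulo the equation, its conjugate, `E E' = 1` and `I² = -1`.
  generalize exp (-(I * Ups P x t)) = E at *
  generalize exp (I * Ups P x t) = E' at *
  generalize derivX (derivX q) x t = qxx at *
  generalize derivX q x t = qx at *
  generalize derivT q x t = qt at *
  generalize q x t = u at *
  generalize conj qxx = qxx' at *
  generalize conj qx = qx' at *
  generalize conj qt = qt' at *
  generalize conj u = u' at *
  have hI := I_sq
  ext i j
  fin_cases i <;> fin_cases j <;> simp [rate]
  · linear_combination P.T * u' * h1 - P.T * u * h2 + I * (qx' * u + u' * qx) * hE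
  · generalize zOf P ζ = z
    clear h2 hE
    grind
  · generalize zOf P ζ = z
    clear h1 hE
    grind
  · linear_combination -P.T * u' * h1 + P.T * u * h2 - I * (qx' * u + u' * qx) * hE

end Lax

end KE

end

/-! ### Simultaneous solutions of the Lax pair and the reflection exchanging the two ends -/

noncomputable section

namespace KE

theorem hasDerivAt_mulVec_iff {M : Matrix (Fin 2) (Fin 2) ℂ} {f : ℝ → Fin 2 → ℂ} {x : ℝ}
    {v : Fin 2 → ℂ} : HasDerivAt f (M.mulVec v) x ↔
      HasDerivAt (fun y => f y 0) (M 0 0 * v 0 + M 0 1 * v 1) x ∧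
      HasDerivAt (fun y => f y 1) (M 1 0 * v 0 + M 1 1 * v 1) x := by
  rw [hasDerivAt_pi, Fin.forall_fin_two]
  simp [Matrix.mulVec, dotProduct, Fin.sum_univ_two]

theorem norm_mulVec_le (M : Matrix (Fin 2) (Fin 2) ℂ) (v : Fin 2 → ℂ) :
    ‖M.mulVec v‖ ≤ (∑ i, ∑ j, ‖M i j‖) * ‖v‖ := by
  refine (pi_norm_le_iff_of_nonneg (by positivity)).2 fun i => ?_
  calc ‖M.mulVec v i‖ = ‖∑ j, M i j * v j‖ := rfl
    _ ≤ ∑ j, ‖M i j‖ * ‖v j‖ := by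
        refine (norm_sum_le _ _).trans (Finset.sum_le_sum fun j _ => ?_)
        rw [norm_mul]
    _ ≤ ∑ j, ‖M i j‖ * ‖v‖ := by gcongr with j; exact norm_le_pi_norm v j
    _ = (∑ j, ‖M i j‖) * ‖v‖ := by rw [Finset.sum_mul]
    _ ≤ _ := by
        refine mul_le_mul_of_nonneg_right ?_ (norm_nonneg _)
        exact Finset.single_le_sum (f := fun i => ∑ j, ‖M i j‖)
          (fun i _ => by positivity) (Finset.mem_univ i)

/-- Simultaneous solutions of both parts of the Lax pair. -/
structure IsLaxSol (P : Params) (q : ℝ → ℝ → ℂ) (ζ : ℂ) (f : ℝ → ℝ → Fin 2 → ℂ) : Prop where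
  fst : ∀ x t, HasDerivAt (fun y => f y t) ((laxX P q ζ x t).mulVec (f x t)) x
  snd : ∀ x t, HasDerivAt (fun s => f x s) ((laxT P q ζ x t).mulVec (f x t)) t

theorem IsJost.isLaxSol {P : Params} {q : ℝ → ℝ → ℂ} {l : Filter ℝ} {qb : ℂ} {c : Fin 2} {ζ : ℂ}
    {f : ℝ → ℝ → Fin 2 → ℂ} (h : IsJost P q l qb c ζ f) : IsLaxSol P q ζ f := ⟨h.1, h.2.1⟩

section

variable {P : Params} {q : ℝ → ℝ → ℂ} {ζ : ℂ}

theorem laxX_trace (x t : ℝ) : laxX P q ζ x t 1 1 = -laxX P q ζ x t 0 0 := by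
  rw [laxX_eq]; simp

theorem laxT_trace (x t : ℝ) : laxT P q ζ x t 1 1 = -laxT P q ζ x t 0 0 := by
  rw [laxT_eq]; simp

theorem hasDerivAt_wronskian {M : Matrix (Fin 2) (Fin 2) ℂ} (hM : M 1 1 = -M 0 0)
    {f g : ℝ → Fin 2 → ℂ} {x : ℝ} (hf : HasDerivAt f (M.mulVec (f x)) x)
    (hg : HasDerivAt g (M.mulVec (g x)) x) :
    HasDerivAt (fun y => wronskian (f y) (g y)) 0 x := by
  rw [hasDerivAt_mulVec_iff] at hf hg
  refine ((hf.1.mul hg.2).sub (hf.2.mul hg.1)).congr_deriv ?_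
  rw [hM]; ring

theorem wronskian_eq_of_hasDerivAt {M : ℝ → Matrix (Fin 2) (Fin 2) ℂ}
    (hM : ∀ x, M x 1 1 = -M x 0 0) {f g : ℝ → Fin 2 → ℂ}
    (hf : ∀ x, HasDerivAt f ((M x).mulVec (f x)) x)
    (hg : ∀ x, HasDerivAt g ((M x).mulVec (g x)) x) (x y : ℝ) :
    wronskian (f x) (g x) = wronskian (f y) (g y) := by
  have h := fun x => hasDerivAt_wronskian (hM x) (hf x) (hg x)
  exact is_const_of_deriv_eq_zero (fun x => (h x).differentiableAt) (fun x => (h x).deriv) x y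

namespace IsLaxSol

variable {f g : ℝ → ℝ → Fin 2 → ℂ}

/-- Both matrices of the Lax pair are traceless, so the Wronskian depends neither on `x` nor on `t`.
-/
theorem wronskian_eq (hf : IsLaxSol P q ζ f) (hg : IsLaxSol P q ζ g) (x t : ℝ) :
    wronskian (f x t) (g x t) = wronskian (f 0 0) (g 0 0) :=
  (wronskian_eq_of_hasDerivAt (fun x => laxX_trace x t) (fun x => hf.fst x t)
    (fun x => hg.fst x t) x 0).trans
  (wronskian_eq_of_hasDerivAt (fun t => laxT_trace 0 t) (fun t => hf.snd 0 t)
    (fun t => hg.snd 0 t) t 0)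

theorem smul (hf : IsLaxSol P q ζ f) (c : ℂ) : IsLaxSol P q ζ fun x t => c • f x t := by
  constructor
  · intro x t
    rw [Matrix.mulVec_smul]
    exact (hf.fst x t).const_smul c
  · intro x t
    rw [Matrix.mulVec_smul]
    exact (hf.snd x t).const_smul c

theorem sub (hf : IsLaxSol P q ζ f) (hg : IsLaxSol P q ζ g) :
    IsLaxSol P q ζ fun x t => f x t - g x t := by
  constructor
  · intro x t
    rw [Matrix.mulVec_sub]
    exact (hf.fst x t).sub (hg.fst x t)
  · intro x t
    rw [Matrix.mulVec_sub]
    exact (hf.snd x t).sub (hg.snd x t)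

end IsLaxSol

theorem mulVec_lipschitz (M : Matrix (Fin 2) (Fin 2) ℂ) (v w : Fin 2 → ℂ) :
    ‖M.mulVec v - M.mulVec w‖ ≤ (∑ i, ∑ j, ‖M i j‖) * ‖v - w‖ := by
  rw [← Matrix.mulVec_sub]
  exact norm_mulVec_le M _

theorem continuous_Ups : Continuous fun r : ℝ × ℝ => ((Ups P r.1 r.2 : ℝ) : ℂ) := by
  unfold Ups
  fun_prop

theorem continuous_laxX (hq : Continuous fun r : ℝ × ℝ => q r.1 r.2) :
    Continuous fun r : ℝ × ℝ => laxX P q ζ r.1 r.2 := by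
  have h1 : Continuous fun r : ℝ × ℝ => conj (q r.1 r.2) := Complex.continuous_conj.comp hq
  have h2 := continuous_Ups (P := P)
  refine continuous_matrix fun i j => ?_
  simp only [laxX_eq]
  fin_cases i <;> fin_cases j <;> simp <;> fun_prop

theorem continuous_laxT {T : ℝ} (h : IsSolution T q) :
    Continuous fun r : ℝ × ℝ => laxT P q ζ r.1 r.2 := by
  have h0 := h.continuous
  have h0' := h.continuous_derivX
  have h1 : Continuous fun r : ℝ × ℝ => conj (q r.1 r.2) := Complex.continuous_conj.comp h0
  have h1' : Continuous fun r : ℝ × ℝ => conj (derivX q r.1 r.2) :=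
    Complex.continuous_conj.comp h0'
  have h2 := continuous_Ups (P := P)
  refine continuous_matrix fun i j => ?_
  simp only [laxT_eq, laxTdiag]
  fin_cases i <;> fin_cases j <;> simp <;> fun_prop

theorem continuous_laxTdx {T : ℝ} (h : IsSolution T q) :
    Continuous fun r : ℝ × ℝ => laxTdx P q ζ r.1 r.2 := by
  have h0 := h.continuous
  have h0' := h.continuous_derivX
  have h0'' := h.continuous_derivXX
  have h1 : Continuous fun r : ℝ × ℝ => conj (q r.1 r.2) := Complex.continuous_conj.comp h0
  have h1' : Continuous fun r : ℝ × ℝ => conj (derivX q r.1 r.2) :=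
    Complex.continuous_conj.comp h0'
  have h1'' : Continuous fun r : ℝ × ℝ => conj (derivX (derivX q) r.1 r.2) :=
    Complex.continuous_conj.comp h0''
  have h2 := continuous_Ups (P := P)
  refine continuous_matrix fun i j => ?_
  simp only [laxTdx, laxTdiagDx]
  fin_cases i <;> fin_cases j <;> simp <;> fun_prop

theorem _root_.Continuous.sum_norm_entries {X : Type*} [TopologicalSpace X]
    {M : X → Matrix (Fin 2) (Fin 2) ℂ} (hM : Continuous M) :
    Continuous fun x => ∑ i, ∑ j, ‖M x i j‖ :=
  continuous_finsetSum _ fun i _ => continuous_finsetSum _ fun j _ =>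
    (hM.matrix_elem i j).norm

theorem eq_of_matrix_ODE {M : ℝ → Matrix (Fin 2) (Fin 2) ℂ} (hM : Continuous M)
    {f g : ℝ → Fin 2 → ℂ} {x₁ : ℝ} (hf : ∀ x, HasDerivAt f ((M x).mulVec (f x)) x)
    (hg : ∀ x, HasDerivAt g ((M x).mulVec (g x)) x) (h : f x₁ = g x₁) (x : ℝ) : f x = g x :=
  eq_of_ODE (v := fun x y => (M x).mulVec y) hM.sum_norm_entries
    (fun x y z => mulVec_lipschitz (M x) y z) hf hg h x

/-- Solutions of the Lax pair are determined by one value. -/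
theorem IsLaxSol.ext {T : ℝ} (h : IsSolution T q) {f g : ℝ → ℝ → Fin 2 → ℂ}
    (hf : IsLaxSol P q ζ f) (hg : IsLaxSol P q ζ g) {x₀ t₀ : ℝ} (h0 : f x₀ t₀ = g x₀ t₀) :
    f = g := by
  have h1 : ∀ t, f x₀ t = g x₀ t := eq_of_matrix_ODE
    ((continuous_laxT (P := P) (ζ := ζ) h).comp (by fun_prop : Continuous fun t : ℝ => (x₀, t)))
    (fun t => hf.snd x₀ t) (fun t => hg.snd x₀ t) h0
  funext x t
  exact eq_of_matrix_ODE (f := fun x => f x t) (g := fun x => g x t)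
    ((continuous_laxX (P := P) (ζ := ζ) h.continuous).comp
      (by fun_prop : Continuous fun x : ℝ => (x, t)))
    (fun x => hf.fst x t) (fun x => hg.fst x t) (h1 t) x

end

/- Reflection -/

/-- The parameters of the reflected problem. -/
def Params.refl (P : Params) : Params := { P with θp := -P.θm, θm := -P.θp }

/-- The reflected solution `conj q(-x,-t)`. -/
def reflQ (q : ℝ → ℝ → ℂ) (x t : ℝ) : ℂ := conj (q (-x) (-t))

section Reflection

variable {P : Params} {q : ℝ → ℝ → ℂ}

@[simp] theorem refl_T : P.refl.T = P.T := rfl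

@[simp] theorem refl_amplitude : P.refl.q₀ = P.q₀ := rfl

@[simp] theorem refl_α : P.refl.α = P.α := rfl

@[simp] theorem zOf_refl (ζ : ℂ) : zOf P.refl ζ = zOf P ζ := rfl

@[simp] theorem lam_refl (ζ : ℂ) : lam P.refl ζ = lam P ζ := rfl

@[simp] theorem rate_refl : rate P.refl = rate P := rfl

theorem qPlus_refl : qPlus P.refl = conj (qMinus P) := by
  simp [qPlus, qMinus, Params.refl, ← Complex.exp_conj]

theorem qMinus_refl : qMinus P.refl = conj (qPlus P) := by
  simp [qPlus, qMinus, Params.refl, ← Complex.exp_conj]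

theorem norm_qPlus (hq : 0 < P.q₀) : ‖qPlus P‖ = P.q₀ := by
  rw [qPlus, norm_mul, mul_comm I, Complex.norm_exp_ofReal_mul_I, mul_one, Complex.norm_real,
    Real.norm_of_nonneg hq.le]

theorem norm_qMinus (hq : 0 < P.q₀) : ‖qMinus P‖ = P.q₀ := by
  rw [qMinus, norm_mul, mul_comm I, Complex.norm_exp_ofReal_mul_I, mul_one, Complex.norm_real,
    Real.norm_of_nonneg hq.le]

theorem Ups_refl (x t : ℝ) : Ups P.refl x t = -Ups P (-x) (-t) := by
  simp only [Ups, Params.refl]; ring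

theorem envelope_refl (x t : ℝ) :
    envelope P.refl (reflQ q) x t = conj (envelope P q (-x) (-t)) := by
  simp only [envelope, reflQ, Ups_refl, map_mul, ← Complex.exp_conj]
  simp

theorem _root_.HasDerivAt.comp_neg {E : Type*} [NormedAddCommGroup E] [NormedSpace ℝ E]
    {f : ℝ → E} {f' : E} {x : ℝ} (h : HasDerivAt f f' (-x)) :
    HasDerivAt (fun y => f (-y)) (-f') x := by
  have h1 := h.scomp x (hasDerivAt_neg x)
  rw [neg_one_smul] at h1
  exact h1

theorem hasDerivAt_reflQ_fst {T : ℝ} (h : IsSolution T q) (x t : ℝ) :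
    HasDerivAt (fun y => reflQ q y t) (-conj (derivX q (-x) (-t))) x := by
  refine ((h.hasDerivAt_fst (-x) (-t)).comp_neg.conj_comp).congr_deriv ?_
  rw [map_neg]

theorem derivX_reflQ {T : ℝ} (h : IsSolution T q) (x t : ℝ) :
    derivX (reflQ q) x t = -conj (derivX q (-x) (-t)) := (hasDerivAt_reflQ_fst h x t).deriv

/-- Conjugation combined with `(x, t) ↦ (-x, -t)` preserves the equation and interchanges the two
ends. Every statement about `-∞` is thereby reduced to one about `+∞`. -/
theorem isSolution_refl (h : IsSolution P.T q) : IsSolution P.refl.T (reflQ q) := by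
  have h2 : ∀ x t, HasDerivAt (fun s => reflQ q x s) (-conj (derivT q (-x) (-t))) t := fun x t => by
    refine ((h.hasDerivAt_snd (-x) (-t)).comp_neg.conj_comp).congr_deriv ?_
    rw [map_neg]
  have h3 : ∀ x t, HasDerivAt (fun y => derivX (reflQ q) y t)
      (conj (derivX (derivX q) (-x) (-t))) x := fun x t => by
    simp_rw [derivX_reflQ h]
    refine ((h.hasDerivAt_derivX (-x) (-t)).comp_neg.conj_comp.neg).congr_deriv ?_
    rw [map_neg, neg_neg]
  have h4 : ∀ x t, HasDerivAt (fun y => ‖reflQ q y t‖ ^ 2)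
      (-deriv (fun y => ‖q y (-t)‖ ^ 2) (-x)) x := fun x t => by
    have : DifferentiableAt ℝ (fun y => ‖q y (-t)‖ ^ 2) (-x) :=
      (h.hasDerivAt_fst (-x) (-t)).differentiableAt.norm_sq ℝ
    refine this.hasDerivAt.comp_neg.congr_of_eventuallyEq (Eventually.of_forall fun y => ?_)
    simp [reflQ]
  refine ⟨?_, fun x t => ?_⟩
  · have := h.1.comp (contDiff_neg (𝕜 := ℝ) (F := ℝ × ℝ))
    exact (Complex.conjCLE : ℂ →L[ℝ] ℂ).contDiff.comp this
  · have e1 := (h2 x t).deriv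
    have e2 : deriv (deriv fun y => reflQ q y t) x = _ := (h3 x t).deriv
    have e3 := (h4 x t).deriv
    rw [e1, e2, e3]
    have key := congrArg conj (h.equation (-x) (-t))
    have h5 := h.deriv_norm_sq (-x) (-t)
    have h6 : conj (q (-x) (-t)) * q (-x) (-t) = (‖q (-x) (-t)‖ : ℂ) ^ 2 := Complex.conj_mul' _
    rw [← h5, h6] at key
    simp only [map_add, map_sub, map_mul, map_pow, conj_I, map_ofNat, Complex.conj_ofReal,
      map_zero] at key
    simp only [Params.refl, reflQ, RCLike.norm_conj]
    push_cast
    linear_combination key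

theorem contDiff_envelope {T : ℝ} (h : IsSolution T q) (t : ℝ) :
    ContDiff ℝ 1 fun x => envelope P q x t := by
  have h1 : ContDiff ℝ 1 fun x : ℝ => q x t :=
    (h.1.of_le (by norm_num)).comp (contDiff_id.prodMk contDiff_const)
  have h2 : ContDiff ℝ 1 fun x : ℝ => -(I * ((Ups P x t : ℝ) : ℂ)) := by
    unfold Ups
    have : ContDiff ℝ 1 fun x : ℝ => ((P.α * x
      + (2 * P.q₀ ^ 2 + 4 * P.T ^ 2 * P.q₀ ^ 4 - P.α ^ 2) * t : ℝ) : ℂ) :=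
      Complex.ofRealCLM.contDiff.comp ((contDiff_const.mul contDiff_id).add contDiff_const)
    fun_prop
  exact h1.mul h2.cexp

theorem norm_envelope (x t : ℝ) : ‖envelope P q x t‖ = ‖q x t‖ := by
  rw [envelope, norm_mul, show -(I * ((Ups P x t : ℝ) : ℂ)) = ((-Ups P x t : ℝ) : ℂ) * I by
    push_cast; ring, Complex.norm_exp_ofReal_mul_I, mul_one]

theorem hasNZBC_refl (hsol : IsSolution P.T q) (h : HasNZBC P q) :
    HasNZBC P.refl (reflQ q) := by
  have hconj : ∀ z : ℂ, Tendsto conj (𝓝 z) (𝓝 (conj z)) := fun z =>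
    Complex.continuous_conj.tendsto z
  have hder : ∀ x t, deriv (fun y => envelope P.refl (reflQ q) y t) x
      = -conj (deriv (fun y => envelope P q y (-t)) (-x)) := fun x t => by
    simp_rw [envelope_refl]
    have h1 := ((contDiff_envelope (P := P) hsol (-t)).differentiable one_ne_zero
      (-x)).hasDerivAt.comp_neg.conj_comp.deriv
    rw [h1, map_neg]
  refine ⟨fun t => ?_, fun t => ?_, fun t => ?_, fun t => ?_, fun t => ?_, fun t => ?_, fun τ => ?_⟩
  · simp_rw [envelope_refl, qPlus_refl]
    exact (hconj _).comp ((h.tendsto_bot (-t)).comp tendsto_neg_atTop_atBot)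
  · simp_rw [envelope_refl, qMinus_refl]
    exact (hconj _).comp ((h.tendsto_top (-t)).comp tendsto_neg_atBot_atTop)
  · simp_rw [hder]
    have := ((hconj _).comp ((h.deriv_bot (-t)).comp tendsto_neg_atTop_atBot)).neg
    simpa using this
  · simp_rw [hder]
    have := ((hconj _).comp ((h.deriv_top (-t)).comp tendsto_neg_atBot_atTop)).neg
    simpa using this
  · simp_rw [envelope_refl, qPlus_refl]
    have h1 := h.integrable_bot (-t)
    have h2 := ((Measure.measurePreserving_neg (volume : Measure ℝ)).integrableOn_comp_preimage
      (MeasurableEquiv.neg ℝ).measurableEmbedding).2 h1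
    rw [show (Neg.neg ⁻¹' Iio (0 : ℝ)) = Ioi 0 by ext; simp] at h2
    refine ((Complex.conjCLE : ℂ →L[ℝ] ℂ).integrable_comp h2).congr ?_
    refine Eventually.of_forall fun x => ?_
    simp
  · simp_rw [envelope_refl, qMinus_refl]
    have h1 := h.integrable_top (-t)
    have h2 := ((Measure.measurePreserving_neg (volume : Measure ℝ)).integrableOn_comp_preimage
      (MeasurableEquiv.neg ℝ).measurableEmbedding).2 h1
    rw [show (Neg.neg ⁻¹' Ioi (0 : ℝ)) = Iio 0 by ext; simp] at h2
    refine ((Complex.conjCLE : ℂ →L[ℝ] ℂ).integrable_comp h2).congr ?_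
    refine Eventually.of_forall fun x => ?_
    simp
  · obtain ⟨C, hC⟩ := h.bounded τ
    refine ⟨C, fun x t ht => ?_⟩
    have h1 := hC (-x) (-t) (by rwa [abs_neg])
    refine ⟨by simpa [reflQ] using h1.1, ?_⟩
    have h2 := derivX_reflQ hsol x t
    rw [show deriv (fun y => reflQ q y t) x = derivX (reflQ q) x t from rfl, h2, norm_neg,
      RCLike.norm_conj]
    exact h1.2

/-- The map exchanging the two components and reflecting `x` and `t`. -/
def reflF (f : ℝ → ℝ → Fin 2 → ℂ) (x t : ℝ) : Fin 2 → ℂ := ![f (-x) (-t) 1, f (-x) (-t) 0]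

theorem reflF_reflF (f : ℝ → ℝ → Fin 2 → ℂ) : reflF (reflF f) = f := by
  funext x t i
  fin_cases i <;> simp [reflF]

theorem laxX_refl (ζ : ℂ) (x t : ℝ) (i j : Fin 2) :
    laxX P.refl (reflQ q) ζ x t i j = -laxX P q ζ (-x) (-t) (1 - i) (1 - j) := by
  rw [laxX_eq, laxX_eq, Ups_refl]
  fin_cases i <;> fin_cases j <;> (simp [reflQ]; try ring_nf; try simp)

theorem laxT_refl (hsol : IsSolution P.T q) (ζ : ℂ) (x t : ℝ) (i j : Fin 2) :
    laxT P.refl (reflQ q) ζ x t i j = -laxT P q ζ (-x) (-t) (1 - i) (1 - j) := by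
  rw [laxT_eq, laxT_eq]
  simp only [laxTdiag, derivX_reflQ hsol, Ups_refl]
  fin_cases i <;> fin_cases j <;> (simp [reflQ]; try ring)

theorem hasDerivAt_refl {M M' : Matrix (Fin 2) (Fin 2) ℂ}
    (hM : ∀ i j, M' i j = -M (1 - i) (1 - j)) {f : ℝ → Fin 2 → ℂ} {x : ℝ}
    (h : HasDerivAt f (M'.mulVec (f (-x))) (-x)) :
    HasDerivAt (fun y => ![f (-y) 1, f (-y) 0]) (M.mulVec ![f (-x) 1, f (-x) 0]) x := by
  rw [hasDerivAt_mulVec_iff] at h ⊢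
  obtain ⟨h1, h2⟩ := h
  constructor
  · refine (h2.comp_neg).congr_deriv ?_
    rw [hM, hM]; simp
  · refine (h1.comp_neg).congr_deriv ?_
    rw [hM, hM]; simp

theorem isLaxSol_refl (hsol : IsSolution P.T q) {ζ : ℂ} {f : ℝ → ℝ → Fin 2 → ℂ}
    (h : IsLaxSol P.refl (reflQ q) ζ f) : IsLaxSol P q ζ (reflF f) := by
  constructor
  · intro x t
    exact hasDerivAt_refl (f := fun y => f y (-t)) (fun i j => by
      rw [laxX_refl, neg_neg, neg_neg]) (h.fst (-x) (-t))
  · intro x t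
    refine hasDerivAt_refl (f := fun s => f (-x) s) (fun i j => ?_) (h.snd (-x) (-t))
    rw [laxT_refl hsol, neg_neg, neg_neg]

theorem refl_refl : P.refl.refl = P := by simp [Params.refl]

theorem reflQ_reflQ : reflQ (reflQ q) = q := by funext x t; simp [reflQ]

theorem Theta_refl (x t : ℝ) (ζ : ℂ) : Theta P.refl x t ζ = -Theta P (-x) (-t) ζ := by
  simp [Theta]; try ring

/-- At the reflected point both Lax matrices change sign after the two components are swapped, and
`Θ` changes sign as well; the second column at `+∞` therefore turns into the first column at `-∞`,
for the same `ζ`. -/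
theorem isJost_refl (hsol : IsSolution P.T q) {ζ qb : ℂ} {f : ℝ → ℝ → Fin 2 → ℂ}
    (h : IsJost P.refl (reflQ q) atTop (conj qb) 1 ζ f) : IsJost P q atBot qb 0 ζ (reflF f) := by
  have h1 := isLaxSol_refl hsol h.isLaxSol
  refine ⟨h1.fst, h1.snd, fun t => ?_⟩
  have h2 := (h.2.2 (-t)).comp tendsto_neg_atBot_atTop
  rw [tendsto_pi_nhds] at h2 ⊢
  intro i
  have h3 := h2 (1 - i)
  fin_cases i
  · simpa [colExp, Theta_refl, Emat, reflF, Function.comp_def] using h3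
  · simpa [colExp, Theta_refl, Emat, reflF, Function.comp_def] using h3

theorem isJost_refl_symm (hsol : IsSolution P.T q) {ζ qb : ℂ} {f : ℝ → ℝ → Fin 2 → ℂ}
    (h : IsJost P q atBot qb 0 ζ f) :
    IsJost P.refl (reflQ q) atTop (conj qb) 1 ζ (reflF f) := by
  have h1 : IsLaxSol P.refl (reflQ q) ζ (reflF f) := by
    refine isLaxSol_refl (isSolution_refl hsol) ?_
    rw [refl_refl, reflQ_reflQ]
    exact h.isLaxSol
  refine ⟨h1.fst, h1.snd, fun t => ?_⟩
  have h2 := (h.2.2 (-t)).comp tendsto_neg_atTop_atBot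
  rw [tendsto_pi_nhds] at h2 ⊢
  intro i
  have h3 := h2 (1 - i)
  fin_cases i
  · simpa [colExp, Theta_refl, Emat, reflF, Function.comp_def] using h3
  · simpa [colExp, Theta_refl, Emat, reflF, Function.comp_def] using h3

end Reflection

end KE

end

/-! ### Compatibility of the two parts of the Lax pair -/

noncomputable section

namespace KE

/-- The Volterra theorem with a one-point parameter space: reversing time maps `[a, b]` to `[-b,
-a]`, and cutting the kernel off beyond `-a` makes the equation one on a half-line. -/
theorem exists_matrix_ODE {M : ℝ → Matrix (Fin 2) (Fin 2) ℂ} (hM : Continuous M) {a b : ℝ}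
    (c : Fin 2 → ℂ) : ∃ g : ℝ → Fin 2 → ℂ, g a = c ∧
      ∀ t ∈ Icc a b, HasDerivAt g ((M t).mulVec (g t)) t := by
  obtain ⟨C, hC⟩ := (isCompact_Icc (a := a) (b := b)).exists_bound_of_continuousOn
    hM.sum_norm_entries.continuousOn
  have hMv : ∀ f : ℝ → Fin 2 → ℂ, Continuous f → Continuous fun s => (M s).mulVec (f s) :=
    fun f hf => hM.matrix_mulVec hf
  set k : ℝ → ℝ → Unit → (Fin 2 → ℂ) → Fin 2 → ℂ := fun _ y _ v =>
    if y ≤ -a then (M (-y)).mulVec v else 0 with hk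
  -- The exponential factor is at least `1` for `y ≤ -a`, where the kernel lives, and makes `κ`
  -- continuous and integrable at infinity.
  set κ : ℝ → ℝ := fun y => |C| * (Real.exp (-a) * Real.exp (-y)) with hκ
  have hκ0 : ∀ y, 0 ≤ κ y := fun y => by positivity
  have K : VolterraKernel (-b) κ k := by
    refine ⟨by fun_prop, hκ0, ?_, fun _ y _ => ?_, fun x y p v w hx hy => ?_, fun y => ?_,
      fun x p f hf => ?_⟩
    · exact ((integrableOn_exp_neg_Ioi (-b)).const_mul _).const_mul _
    · simp [hk]
    · simp only [hk]
      split_ifs with h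
      · refine (mulVec_lipschitz _ v w).trans (mul_le_mul_of_nonneg_right ?_ (norm_nonneg _))
        have h1 := hC (-y) ⟨by linarith, by linarith⟩
        refine (le_abs_self _).trans (h1.trans ((le_abs_self C).trans ?_))
        refine le_mul_of_one_le_right (abs_nonneg C) ?_
        rw [← Real.exp_add, Real.one_le_exp_iff]
        linarith
      · rw [sub_zero, norm_zero]; exact mul_nonneg (hκ0 y) (norm_nonneg _)
    · simp only [hk]
      split_ifs
      · exact continuous_const.matrix_mulVec (by fun_prop)
      · exact continuous_const
    · simp only [hk]
      have h1 : Continuous fun y => (M (-y)).mulVec (f y) :=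
        (hM.comp continuous_neg).matrix_mulVec hf
      have h2 : (fun y => if y ≤ -a then (M (-y)).mulVec (f y) else 0)
          = (Iic (-a)).indicator fun y => (M (-y)).mulVec (f y) := by
        funext y; simp [indicator]
      rw [h2]
      exact (h1.stronglyMeasurable.indicator measurableSet_Iic).aestronglyMeasurable
  obtain ⟨m, hmc, -, hm, -⟩ := K.exists_solution (BoundedContinuousFunction.const Unit c)
  set w : ℝ → Fin 2 → ℂ := fun s => m (-s) () with hw
  have hwc : Continuous w := hmc.comp (by fun_prop : Continuous fun s : ℝ => (-s, ()))
  -- The function `w` may have a corner at `a`; the primitive `g` agrees with it on `[a, b]` and has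
  -- two-sided derivatives at the endpoints as well.
  set g : ℝ → Fin 2 → ℂ := fun t => c + ∫ s in a..t, (M s).mulVec (w s) with hg
  have hgw : ∀ t ∈ Icc a b, g t = w t := by
    intro t ht
    simp only [hw, hg]
    rw [hm (-t) () (by linarith [ht.2])]
    congr 1
    have h2 : (fun y => k (-t) y () (m y ()))
        = (Iic (-a)).indicator fun y => (M (-y)).mulVec (m y ()) := by
      funext y; simp [indicator, hk]
    rw [h2, setIntegral_indicator measurableSet_Iic, Ioi_inter_Iic,
      ← intervalIntegral.integral_of_le (by linarith [ht.1]), ← intervalIntegral.integral_comp_neg]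
    simp only [neg_neg]
  refine ⟨g, by simp [hg], fun t ht => ?_⟩
  rw [hgw t ht]
  exact (((hMv w hwc).integral_hasStrictDerivAt a t).hasDerivAt).const_add c

section Uniform

variable {F F' : ℝ × ℝ → ℂ} {x a b : ℝ}

theorem eventually_norm_sub_le (hF : Continuous F) {ε : ℝ} (hε : 0 < ε) :
    ∀ᶠ h in 𝓝 (0 : ℝ), ∀ s ∈ Icc a b, ‖F (x + h, s) - F (x, s)‖ ≤ ε := by
  refine isCompact_Icc.eventually_forall_of_forall_eventually fun s _ => ?_
  have h1 : Continuous fun r : ℝ × ℝ => ‖F (x + r.1, r.2) - F (x, r.2)‖ := by fun_prop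
  have h2 := h1.tendsto (0, s)
  simp only [add_zero, sub_self, norm_zero] at h2
  exact h2.eventually (eventually_le_nhds hε)

theorem eventually_norm_slope_sub_le (hF : ∀ y s, HasDerivAt (fun y => F (y, s)) (F' (y, s)) y)
    (hF' : Continuous F') {ε : ℝ} (hε : 0 < ε) :
    ∀ᶠ h : ℝ in 𝓝[≠] 0, ∀ s ∈ Icc a b,
      ‖(h : ℂ)⁻¹ * (F (x + h, s) - F (x, s)) - F' (x, s)‖ ≤ ε := by
  obtain ⟨δ, hδ, hball⟩ := Metric.eventually_nhds_iff_ball.1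
    (eventually_norm_sub_le (x := x) (a := a) (b := b) hF' hε)
  filter_upwards [self_mem_nhdsWithin, nhdsWithin_le_nhds (Metric.ball_mem_nhds (0 : ℝ) hδ)]
    with h hne hh s hs
  have hne : (h : ℝ) ≠ 0 := hne
  have h1 := (convex_ball (0 : ℝ) δ).norm_image_sub_le_of_norm_hasDerivWithin_le
    (f := fun y => F (x + y, s) - (y : ℂ) * F' (x, s))
    (f' := fun y => F' (x + y, s) - F' (x, s)) (C := ε) (x := 0) (y := h)
    (fun y _ => by
      have h2 : HasDerivAt (fun y => F (x + y, s)) (F' (x + y, s)) y :=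
        (hF (x + y) s).comp_const_add x y
      have h3 : HasDerivAt (fun y : ℝ => (y : ℂ) * F' (x, s)) (F' (x, s)) y := by
        simpa using ((hasDerivAt_id y).ofReal_comp).mul_const (F' (x, s))
      exact (h2.sub h3).hasDerivWithinAt)
    (fun y hy => hball y hy s hs) (Metric.mem_ball_self hδ) hh
  have hc : (h : ℂ) ≠ 0 := by exact_mod_cast hne
  have e : (h : ℂ)⁻¹ * (F (x + h, s) - F (x, s)) - F' (x, s)
      = (h : ℂ)⁻¹ * (F (x + h, s) - h * F' (x, s) - (F (x + 0, s) - ((0 : ℝ) : ℂ) * F' (x, s))) := by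
    field_simp; simp; ring
  rw [e, norm_mul, norm_inv, Complex.norm_real]
  rw [sub_zero] at h1
  have hpos : 0 < ‖h‖ := norm_pos_iff.2 hne
  rw [inv_mul_le_iff₀ hpos, mul_comm ‖h‖]
  exact h1

end Uniform

section

variable {P : Params} {q : ℝ → ℝ → ℂ} {ζ : ℂ}

/-- A family of solutions of the `t`-part that solves the `x`-part at one time solves it at all
times. -/
theorem hasDerivAt_fst_of_snd (hsol : IsSolution P.T q) {g : ℝ → ℝ → Fin 2 → ℂ} {a b : ℝ}
    (hgt : ∀ x, ∀ t ∈ Icc a b, HasDerivAt (g x) ((laxT P q ζ x t).mulVec (g x t)) t)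
    (hga : ∀ x, HasDerivAt (fun y => g y a) ((laxX P q ζ x a).mulVec (g x a)) x) (x : ℝ)
    {t : ℝ} (ht : t ∈ Icc a b) :
    HasDerivAt (fun y => g y t) ((laxX P q ζ x t).mulVec (g x t)) x := by
  have hTc := continuous_laxT (P := P) (ζ := ζ) hsol
  have hXc := continuous_laxX (P := P) (ζ := ζ) hsol.continuous
  have hgc : ContinuousOn (g x) (Icc a b) := fun s hs => (hgt x s hs).continuousAt.continuousWithinAt
  -- The expected `x`-derivative of `g`. By zero curvature its derivative `X_t g + X T g` equals
  -- `T_x g + T X g`, which is the `t`-equation differentiated formally in `x`. The difference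
  -- quotients of `g` solve the same equation up to a small error and start from the right value at
  -- time `a`, so they converge to `z`.
  set z : ℝ → Fin 2 → ℂ := fun s => (laxX P q ζ x s).mulVec (g x s) with hz
  have hzd : ∀ s ∈ Icc a b, HasDerivAt z ((laxXdt P q x s).mulVec (g x s)
      + (laxX P q ζ x s).mulVec ((laxT P q ζ x s).mulVec (g x s))) s := by
    intro s hs
    rw [hasDerivAt_pi]
    intro i
    have h1 := fun j => (hasDerivAt_laxX_snd (P := P) hsol ζ x s i j).mul
      ((hasDerivAt_pi.1 (hgt x s hs)) j)
    have h2 := (h1 0).add (h1 1)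
    simp only [hz]
    refine (h2.congr_of_eventuallyEq (Eventually.of_forall fun s => ?_)).congr_deriv ?_
    · simp [Matrix.mulVec, dotProduct, Fin.sum_univ_two]
    · fin_cases i <;> (simp [Matrix.mulVec, dotProduct, Fin.sum_univ_two]; ring)
  have hzc : ContinuousOn z (Icc a b) := fun s hs => (hzd s hs).continuousAt.continuousWithinAt
  obtain ⟨G, hG⟩ := isCompact_Icc.exists_bound_of_continuousOn hgc
  obtain ⟨Z, hZ⟩ := isCompact_Icc.exists_bound_of_continuousOn hzc
  have hG0 : 0 ≤ G := (norm_nonneg _).trans (hG t ht)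
  have hZ0 : 0 ≤ Z := (norm_nonneg _).trans (hZ t ht)
  obtain ⟨K, hK⟩ := ((isCompact_Icc (a := x - 1) (b := x + 1)).prod
    (isCompact_Icc (a := a) (b := b))).exists_bound_of_continuousOn hTc.sum_norm_entries.continuousOn
  have hsmall : ∀ᶠ h in 𝓝[≠] (0 : ℝ), h ∈ Icc (-1 : ℝ) 1 :=
    nhdsWithin_le_nhds (Icc_mem_nhds (by norm_num) (by norm_num))
  set DQ : ℝ → ℝ → Matrix (Fin 2) (Fin 2) ℂ := fun h s =>
    (h : ℂ)⁻¹ • (laxT P q ζ (x + h) s - laxT P q ζ x s) with hDQ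
  rw [hasDerivAt_iff_tendsto_slope_zero]
  refine tendsto_of_ODE_right (a := a) (b := b) (K := K) (z := z)
    (v := fun h s p => (laxT P q ζ (x + h) s).mulVec p + (DQ h s).mulVec (g x s))
    (y := fun h s => h⁻¹ • (g (x + h) s - g x s))
    (z' := fun s => (laxXdt P q x s).mulVec (g x s)
      + (laxX P q ζ x s).mulVec ((laxT P q ζ x s).mulVec (g x s))) ?_ ?_ ?_ ?_ ?_ ht
  · filter_upwards [hsmall] with h hh s hs p r
    rw [add_sub_add_right_eq_sub]
    refine (mulVec_lipschitz _ p r).trans (mul_le_mul_of_nonneg_right ?_ (norm_nonneg _))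
    exact (le_abs_self _).trans (hK (x + h, s)
      ⟨⟨by linarith [hh.1], by linarith [hh.2]⟩, hs⟩)
  · filter_upwards [self_mem_nhdsWithin] with h hne s hs
    have hne : (h : ℂ) ≠ 0 := by exact_mod_cast hne
    refine (((hgt (x + h) s hs).sub (hgt x s hs)).const_smul h⁻¹).congr_deriv ?_
    simp only [hDQ, Matrix.smul_mulVec, Matrix.sub_mulVec]
    have e : ∀ v : Fin 2 → ℂ, (h⁻¹ : ℝ) • v = (h : ℂ)⁻¹ • v := fun v => by
      ext i; simp
    rw [e, e, Matrix.mulVec_smul, Matrix.mulVec_sub, ← smul_add]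
    congr 1
    abel
  · exact hzd
  · intro ε hε
    set ε' := ε / (4 * (G + Z) + 1) with hε'
    have hε'0 : 0 < ε' := by positivity
    have e1 : ∀ᶠ h in 𝓝[≠] (0 : ℝ), ∀ i j, ∀ s ∈ Icc a b,
        ‖laxT P q ζ (x + h) s i j - laxT P q ζ x s i j‖ ≤ ε' := by
      refine nhdsWithin_le_nhds (eventually_all.2 fun i => eventually_all.2 fun j => ?_)
      exact eventually_norm_sub_le (F := fun r => laxT P q ζ r.1 r.2 i j) (hTc.matrix_elem i j) hε'0
    have e2 : ∀ᶠ h : ℝ in 𝓝[≠] 0, ∀ i j, ∀ s ∈ Icc a b,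
        ‖(h : ℂ)⁻¹ * (laxT P q ζ (x + h) s i j - laxT P q ζ x s i j) - laxTdx P q ζ x s i j‖
          ≤ ε' := by
      refine eventually_all.2 fun i => eventually_all.2 fun j => ?_
      exact eventually_norm_slope_sub_le (F := fun r => laxT P q ζ r.1 r.2 i j)
        (F' := fun r => laxTdx P q ζ r.1 r.2 i j)
        (fun y s => hasDerivAt_laxT_fst (P := P) hsol ζ y s i j)
        ((continuous_laxTdx (P := P) (ζ := ζ) hsol).matrix_elem i j) hε'0
    filter_upwards [e1, e2] with h h1 h2 s hs
    have key : (laxXdt P q x s).mulVec (g x s)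
        + (laxX P q ζ x s).mulVec ((laxT P q ζ x s).mulVec (g x s))
        - ((laxT P q ζ (x + h) s).mulVec (z s) + (DQ h s).mulVec (g x s))
        = -((DQ h s - laxTdx P q ζ x s).mulVec (g x s)
          + (laxT P q ζ (x + h) s - laxT P q ζ x s).mulVec (z s)) := by
      have zc := congrArg (fun M => M.mulVec (g x s)) (zero_curvature (P := P) hsol ζ x s)
      simp only [Matrix.add_mulVec, ← Matrix.mulVec_mulVec] at zc
      rw [zc]
      simp only [hz, Matrix.sub_mulVec]
      abel
    rw [key, norm_neg]
    have sum4 : ∀ M : Matrix (Fin 2) (Fin 2) ℂ, (∀ i j, ‖M i j‖ ≤ ε') →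
        ∑ i, ∑ j, ‖M i j‖ ≤ 4 * ε' := fun M hM => by
      simp only [Fin.sum_univ_two]
      linarith [hM 0 0, hM 0 1, hM 1 0, hM 1 1]
    refine (norm_add_le _ _).trans ?_
    have b1 := (norm_mulVec_le (DQ h s - laxTdx P q ζ x s) (g x s)).trans
      (mul_le_mul (sum4 _ fun i j => by simpa [hDQ] using h2 i j s hs) (hG s hs) (norm_nonneg _)
        (by positivity))
    have b2 := (norm_mulVec_le (laxT P q ζ (x + h) s - laxT P q ζ x s) (z s)).trans
      (mul_le_mul (sum4 _ fun i j => by simpa using h1 i j s hs) (hZ s hs) (norm_nonneg _)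
        (by positivity))
    have b3 : ε' * (4 * (G + Z) + 1) = ε := by rw [hε']; field_simp
    nlinarith
  · have := hasDerivAt_iff_tendsto_slope_zero.1 (hga x)
    exact this

/-- Averaging: solutions of linear equations whose coefficients converge boundedly to a matrix
annihilating the initial value keep that value in the limit. -/
theorem tendsto_of_bounded_coefficients {A : ℝ → ℝ → Matrix (Fin 2) (Fin 2) ℂ}
    {A₀ : Matrix (Fin 2) (Fin 2) ℂ} {e : Fin 2 → ℂ} {a b K : ℝ} {w : ℝ → ℝ → Fin 2 → ℂ}
    (hAc : ∀ x, Continuous (A x)) (hAK : ∀ x, ∀ s ∈ Icc a b, ∑ i, ∑ j, ‖A x s i j‖ ≤ K)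
    (hlim : ∀ s, Tendsto (fun x => (A x s).mulVec e) atTop (𝓝 (A₀.mulVec e)))
    (he : A₀.mulVec e = 0)
    (hw : ∀ x, ∀ s ∈ Icc a b, HasDerivAt (w x) ((A x s).mulVec (w x s)) s)
    (ha : Tendsto (fun x => w x a) atTop (𝓝 e)) {t : ℝ} (ht : t ∈ Icc a b) :
    Tendsto (fun x => w x t) atTop (𝓝 e) := by
  have hab : a ≤ b := ht.1.trans ht.2
  have hK0 : 0 ≤ K := le_trans (by positivity) (hAK 0 t ht)
  have hAec : ∀ x, Continuous fun s => (A x s).mulVec e := fun x =>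
    (hAc x).matrix_mulVec continuous_const
  set R : ℝ → ℝ := fun x => ∫ s in a..b, ‖(A x s).mulVec e‖ with hR
  have hRt : Tendsto R atTop (𝓝 0) := by
    have h1 : Tendsto R atTop (𝓝 (∫ s in a..b, (0 : ℝ))) := by
      refine intervalIntegral.tendsto_integral_filter_of_dominated_convergence
        (fun _ => K * ‖e‖) (Eventually.of_forall fun x => (hAec x).norm.aestronglyMeasurable)
        (Eventually.of_forall fun x => Eventually.of_forall fun s hs => ?_) (by simp)
        (Eventually.of_forall fun s _ => ?_)
      · rw [uIoc_of_le hab] at hs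
        rw [norm_norm]
        exact (norm_mulVec_le _ _).trans (mul_le_mul_of_nonneg_right
          (hAK x s (Ioc_subset_Icc_self hs)) (norm_nonneg _))
      · have := (hlim s).norm
        rwa [he, norm_zero] at this
    simpa using h1
  -- The coefficients converge only pointwise in `s`, so dominated convergence makes `A e` small
  -- merely in the mean. Subtracting its primitive `r`, which is uniformly small, leaves an equation
  -- satisfied by the constant `e` up to a uniformly small error.
  set r : ℝ → ℝ → Fin 2 → ℂ := fun x s => ∫ σ in a..s, (A x σ).mulVec e with hr
  have hrd : ∀ x s, HasDerivAt (r x) ((A x s).mulVec e) s := fun x s =>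
    ((hAec x).integral_hasStrictDerivAt a s).hasDerivAt
  have hrR : ∀ x, ∀ s ∈ Icc a b, ‖r x s‖ ≤ R x := fun x s hs => by
    refine (intervalIntegral.norm_integral_le_integral_norm hs.1).trans ?_
    exact intervalIntegral.integral_mono_interval le_rfl hs.1 hs.2
      (Eventually.of_forall fun _ => norm_nonneg _) ((hAec x).norm.intervalIntegrable _ _)
  have key : Tendsto (fun x => w x t - r x t) atTop (𝓝 e) := by
    refine tendsto_of_ODE_right (a := a) (b := b) (K := K) (z := fun _ => e) (z' := fun _ => 0)
      (v := fun x s p => (A x s).mulVec (p + r x s) - (A x s).mulVec e)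
      (y := fun x s => w x s - r x s) ?_ ?_ (fun s _ => hasDerivAt_const s e) ?_ ?_ ht
    · refine Eventually.of_forall fun x s hs p p' => ?_
      rw [sub_sub_sub_cancel_right]
      refine (mulVec_lipschitz _ _ _).trans ?_
      rw [add_sub_add_right_eq_sub]
      exact mul_le_mul_of_nonneg_right (hAK x s hs) (norm_nonneg _)
    · refine Eventually.of_forall fun x s hs => ?_
      refine ((hw x s hs).sub (hrd x s)).congr_deriv ?_
      simp only [sub_add_cancel]
    · intro ε hε
      have h1 := hRt.const_mul K
      rw [mul_zero] at h1
      filter_upwards [h1.eventually (eventually_le_nhds hε)] with x hx s hs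
      rw [← Matrix.mulVec_sub, add_sub_cancel_left, zero_sub, norm_neg]
      refine (norm_mulVec_le _ _).trans (le_trans ?_ hx)
      exact mul_le_mul (hAK x s hs) (hrR x s hs) (norm_nonneg _) hK0
    · refine ha.congr fun x => ?_
      simp [hr]
  have h3 : Tendsto (fun x => r x t) atTop (𝓝 0) := by
    rw [tendsto_zero_iff_norm_tendsto_zero]
    exact squeeze_zero (fun _ => norm_nonneg _) (fun x => hrR x t ht) hRt
  simpa using key.add h3

end

end KE

end

/-! ### Jost solutions of the full Lax pair -/

noncomputable section

namespace KE

open IsStep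

section

variable {P : Params} {q : ℝ → ℝ → ℂ} {ζ : ℂ}

theorem isStep_envelope (hq : 0 < P.q₀) (hsol : IsSolution P.T q) (hbc : HasNZBC P q) (t : ℝ) :
    IsStep P (fun x => envelope P q x t) (qPlus P) := by
  refine ⟨contDiff_envelope hsol t, ?_, norm_qPlus hq, ?_⟩
  · obtain ⟨C, hC⟩ := hbc.bounded |t|
    exact ⟨C, fun x => by rw [norm_envelope]; exact (hC x t le_rfl).1⟩
  · refine (hbc.integrable_top t).norm.congr (Eventually.of_forall fun x => ?_)
    simp only [norm_mul, Complex.norm_real]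
    rw [Real.norm_of_nonneg (by positivity)]

theorem conj_envelope (x t : ℝ) :
    conj (envelope P q x t) = conj (q x t) * exp (I * Ups P x t) := by
  simp [envelope, ← Complex.exp_conj]

theorem hasDerivAt_Theta_fst (x t : ℝ) (ζ : ℂ) :
    HasDerivAt (fun y : ℝ => Theta P y t ζ) (lam P ζ) x := by
  unfold Theta
  exact ((((hasDerivAt_id x).ofReal_comp).add_const _).const_mul (lam P ζ)).congr_deriv (by simp)

/-- The velocity `2(z + T q₀² - α/2)`. -/
def speed (P : Params) (ζ : ℂ) : ℂ := 2 * (zOf P ζ + P.T * (P.q₀ : ℂ) ^ 2 - P.α / 2)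

theorem hasDerivAt_Theta_snd (x t : ℝ) (ζ : ℂ) :
    HasDerivAt (fun s : ℝ => Theta P x s ζ) (lam P ζ * speed P ζ) t := by
  unfold Theta speed
  exact (((((hasDerivAt_id t).ofReal_comp).const_mul _).const_add _).const_mul
    (lam P ζ)).congr_deriv (by simp)

/-- The solution of the modified equation belonging to a solution of the `x`-part. -/
def toModified (P : Params) (ζ : ℂ) (t : ℝ) (f : ℝ → Fin 2 → ℂ) (x : ℝ) : ℂ × ℂ :=
  (exp (-(I * Theta P x t ζ)) * f x 0, exp (-(I * Theta P x t ζ)) * f x 1)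

/-- The solution of the `x`-part belonging to a solution of the modified equation. -/
def ofModified (P : Params) (ζ : ℂ) (t : ℝ) (m : ℝ → ℂ × ℂ) (x : ℝ) : Fin 2 → ℂ :=
  exp (I * Theta P x t ζ) • ![(m x).1, (m x).2]

theorem toModified_ofModified (t : ℝ) (m : ℝ → ℂ × ℂ) :
    toModified P ζ t (ofModified P ζ t m) = m := by
  funext x
  simp [toModified, ofModified, ← mul_assoc, ← Complex.exp_add]

theorem ofModified_toModified (t : ℝ) (f : ℝ → Fin 2 → ℂ) :
    ofModified P ζ t (toModified P ζ t f) = f := by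
  funext x i
  fin_cases i <;> simp [toModified, ofModified, ← mul_assoc, ← Complex.exp_add]

theorem hasDerivAt_toModified {t x : ℝ} {f : ℝ → Fin 2 → ℂ} (qb : ℂ)
    (h : HasDerivAt f ((laxX P q ζ x t).mulVec (f x)) x) :
    HasDerivAt (toModified P ζ t f) (stepL P qb ζ (toModified P ζ t f x)
      + stepB P (fun y => envelope P q y t) qb x (toModified P ζ t f x)) x := by
  have e := ((hasDerivAt_Theta_fst (P := P) x t ζ).const_mul I).neg.cexp
  rw [hasDerivAt_mulVec_iff] at h
  refine ((e.mul h.1).prodMk (e.mul h.2)).congr_deriv ?_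
  simp only [stepL, stepB, pairMap_apply, toModified, laxX_eq, map_sub, conj_envelope,
    norm_envelope, Prod.mk_add_mk]
  push_cast
  rw [← Complex.conj_mul']
  refine Prod.ext ?_ ?_
  · simp [envelope, zOf, lam]; ring
  · simp [zOf, lam]; ring

theorem hasDerivAt_ofModified {t x : ℝ} {m : ℝ → ℂ × ℂ} {qb : ℂ}
    (h : HasDerivAt m (stepL P qb ζ (m x)
      + stepB P (fun y => envelope P q y t) qb x (m x)) x) :
    HasDerivAt (ofModified P ζ t m) ((laxX P q ζ x t).mulVec (ofModified P ζ t m x)) x := by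
  have e := ((hasDerivAt_Theta_fst (P := P) x t ζ).const_mul I).cexp
  rw [hasDerivAt_mulVec_iff]
  have h1 := e.mul h.pair_fst
  have h2 := e.mul h.pair_snd
  constructor
  · refine h1.congr_deriv ?_
    simp only [stepL, stepB, pairMap_apply, ofModified, laxX_eq, map_sub,
      norm_envelope, Prod.mk_add_mk]
    push_cast
    rw [← Complex.conj_mul']
    simp [envelope, zOf, lam]; ring
  · refine h2.congr_deriv ?_
    simp only [stepL, stepB, pairMap_apply, ofModified, laxX_eq, map_sub, conj_envelope,
      norm_envelope, Prod.mk_add_mk]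
    push_cast
    rw [← Complex.conj_mul']
    simp [zOf, lam]; ring

theorem tendsto_toModified_iff {t : ℝ} {f : ℝ → Fin 2 → ℂ} {l : Filter ℝ} {qb : ℂ} :
    Tendsto (toModified P ζ t f) l (𝓝 (stepE qb ζ)) ↔
      Tendsto (fun x => colExp P 1 ζ x t • f x) l (𝓝 (fun i => Emat qb ζ i 1)) := by
  rw [tendsto_pi_nhds, Fin.forall_fin_two, nhds_prod_eq]
  constructor
  · intro h
    exact ⟨by simpa [colExp, Emat, toModified, stepE] using h.fst,
      by simpa [colExp, Emat, toModified, stepE] using h.snd⟩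
  · rintro ⟨h1, h2⟩
    refine Tendsto.prodMk ?_ ?_
    · simpa [colExp, Emat, stepE] using h1
    · simpa [colExp, Emat, stepE] using h2

theorem jost_unique_at (hq : 0 < P.q₀) (hsol : IsSolution P.T q) (hbc : HasNZBC P q)
    (hζ : ζ ∈ extUpper P) {t : ℝ} {f g : ℝ → Fin 2 → ℂ}
    (hf : ∀ x, HasDerivAt f ((laxX P q ζ x t).mulVec (f x)) x)
    (hg : ∀ x, HasDerivAt g ((laxX P q ζ x t).mulVec (g x)) x)
    (hft : Tendsto (fun x => colExp P 1 ζ x t • f x) atTop (𝓝 (fun i => Emat (qPlus P) ζ i 1)))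
    (hgt : Tendsto (fun x => colExp P 1 ζ x t • g x) atTop (𝓝 (fun i => Emat (qPlus P) ζ i 1))) :
    f = g := by
  have h : toModified P ζ t f = toModified P ζ t g := by
    funext x
    exact solvesModified_unique hq (isStep_envelope hq hsol hbc t) hζ (a := x - 1)
      (fun y _ => hasDerivAt_toModified (qPlus P) (hf y))
      (fun y _ => hasDerivAt_toModified (qPlus P) (hg y))
      (tendsto_toModified_iff.2 hft) (tendsto_toModified_iff.2 hgt) (by simp)
  rw [← ofModified_toModified (P := P) (ζ := ζ) t f, h, ofModified_toModified]

theorem IsJost.unique_top (hq : 0 < P.q₀) (hsol : IsSolution P.T q) (hbc : HasNZBC P q)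
    (hζ : ζ ∈ extUpper P) {f g : ℝ → ℝ → Fin 2 → ℂ}
    (hf : IsJost P q atTop (qPlus P) 1 ζ f) (hg : IsJost P q atTop (qPlus P) 1 ζ g) : f = g := by
  funext x t
  exact congrFun (jost_unique_at hq hsol hbc hζ (t := t) (fun x => hf.1 x t) (fun x => hg.1 x t)
    (hf.2.2 t) (hg.2.2 t)) x

/-- The matrix of the `t`-part as a function of `u = q e^{-iΥ}` and `w = q_x e^{-iΥ}`. -/
def laxTpoly (P : Params) (ζ : ℂ) (r : ℂ × ℂ) : Matrix (Fin 2) (Fin 2) ℂ :=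
  let d : ℂ := I * (conj r.1 * r.1) + 4 * I * (P.T : ℂ) ^ 2 * (conj r.1 * r.1) ^ 2
    + P.T * (r.1 * conj r.2 - r.2 * conj r.1) - 2 * I * (zOf P ζ ^ 2 + rate P / 4)
  !![d, I * r.2 + 2 * zOf P ζ * r.1 + 2 * P.T * (conj r.1 * r.1) * r.1;
    I * conj r.2 - 2 * zOf P ζ * conj r.1 - 2 * P.T * (conj r.1 * r.1) * conj r.1, -d]

theorem continuous_laxTpoly : Continuous (laxTpoly P ζ) := by
  have h1 : Continuous fun r : ℂ × ℂ => conj r.1 := Complex.continuous_conj.comp continuous_fst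
  have h2 : Continuous fun r : ℂ × ℂ => conj r.2 := Complex.continuous_conj.comp continuous_snd
  refine continuous_matrix fun i j => ?_
  simp only [laxTpoly]
  fin_cases i <;> fin_cases j <;> simp <;> fun_prop

theorem laxT_eq_poly (x t : ℝ) : laxT P q ζ x t =
    laxTpoly P ζ (envelope P q x t, derivX q x t * exp (-(I * Ups P x t))) := by
  have hE : exp (-(I * Ups P x t)) * exp (I * Ups P x t) = 1 := by
    rw [← Complex.exp_add]; simp
  have e1 : conj (derivX q x t * exp (-(I * Ups P x t)))
      = conj (derivX q x t) * exp (I * Ups P x t) := by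
    simp [← Complex.exp_conj]
  have e2 : envelope P q x t = q x t * exp (-(I * Ups P x t)) := rfl
  simp only [laxTpoly, e1, conj_envelope, laxT_eq, laxTdiag]
  rw [e2]
  generalize exp (-(I * Ups P x t)) = E at *
  generalize exp (I * Ups P x t) = E' at *
  ext i j
  fin_cases i <;> fin_cases j <;> simp <;> grind

theorem tendsto_derivX_mul_exp (hsol : IsSolution P.T q) (hbc : HasNZBC P q) (t : ℝ) :
    Tendsto (fun x => derivX q x t * exp (-(I * Ups P x t))) atTop (𝓝 (I * P.α * qPlus P)) := by
  have h1 : ∀ x, derivX q x t * exp (-(I * Ups P x t))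
      = deriv (fun y => envelope P q y t) x + I * P.α * envelope P q x t := fun x => by
    have := ((hsol.hasDerivAt_fst x t).mul
      ((hasDerivAt_Ups_fst P x t).const_mul I).neg.cexp).deriv
    have e : deriv (fun y => envelope P q y t) x = _ := this
    rw [e]
    simp only [envelope, Pi.neg_apply]; ring
  simp_rw [h1]
  simpa using (hbc.deriv_top t).add ((hbc.tendsto_top t).const_mul (I * P.α))

/-- At the boundary values the column of `Emat` is an eigenvector of the `t`-matrix with eigenvalue
`iλ · speed`, the `t`-derivative of `iΘ`. Passing to the modified solution cancels exactly this
eigenvalue. -/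
theorem laxTpoly_limit (hq : 0 < P.q₀) (hζ : ζ ≠ 0) :
    (laxTpoly P ζ (qPlus P, I * P.α * qPlus P) - (I * (lam P ζ * speed P ζ)) • 1).mulVec
      (fun i => Emat (qPlus P) ζ i 1) = 0 := by
  have h : conj (qPlus P) * qPlus P = (P.q₀ : ℂ) ^ 2 := by
    rw [Complex.conj_mul', norm_qPlus hq]
  have hI := I_sq
  funext i
  simp only [laxTpoly, map_mul, conj_I, Complex.conj_ofReal, lam, speed, rate, zOf]
  generalize qPlus P = u at *
  generalize conj u = u' at *
  fin_cases i
  · simp [Matrix.mulVec, dotProduct, Fin.sum_univ_two, Emat]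
    rw [h]
    field_simp
    grind
  · simp [Matrix.mulVec, dotProduct, Fin.sum_univ_two, Emat]
    rw [h]
    field_simp
    grind

/-- The modified solutions are constructed for each `t` separately. Near `t₀`, let the values at
time `t₀ - 1` evolve by the `t`-part. The result still solves the `x`-part by compatibility and
keeps its normalisation at `+∞` because the `t`-matrix, less the eigenvalue, annihilates the limit
there. Uniqueness identifies it with the given family, which therefore solves the `t`-part. -/
theorem isJost_ofModified (hq : 0 < P.q₀) (hsol : IsSolution P.T q) (hbc : HasNZBC P q)
    (hζ : ζ ∈ extUpper P) {m : ℝ → ℝ → ℂ → ℂ × ℂ}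
    (hm : ∀ t, IsModifiedJost P (fun x => envelope P q x t) (qPlus P) (m t)) :
    IsJost P q atTop (qPlus P) 1 ζ fun x t => ofModified P ζ t (fun y => m t y ζ) x := by
  have hζ0 := ne_zero_of_mem_extUpper hq hζ
  set f : ℝ → ℝ → Fin 2 → ℂ := fun x t => ofModified P ζ t (fun y => m t y ζ) x with hf
  have hfx : ∀ x t, HasDerivAt (fun y => f y t) ((laxX P q ζ x t).mulVec (f x t)) x := fun x t =>
    hasDerivAt_ofModified ((hm t).ode ζ hζ x)
  have hft : ∀ t, Tendsto (fun x => colExp P 1 ζ x t • f x t) atTop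
      (𝓝 (fun i => Emat (qPlus P) ζ i 1)) := fun t => by
    refine (tendsto_toModified_iff (f := fun x => f x t)).1 ?_
    have e : toModified P ζ t (fun x => f x t) = fun y => m t y ζ := toModified_ofModified t _
    rw [e]
    exact tendsto_of_uniform_limit (hm t).limit hζ
  refine ⟨hfx, fun x₀ t₀ => ?_, hft⟩
  set a := t₀ - 1
  set b := t₀ + 1
  have hTc := continuous_laxT (P := P) (ζ := ζ) hsol
  choose g hga hgt using fun x => exists_matrix_ODE (a := a) (b := b)
    (hTc.comp (by fun_prop : Continuous fun s : ℝ => (x, s))) (f x a)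
  have hgx : ∀ x, ∀ t ∈ Icc a b,
      HasDerivAt (fun y => g y t) ((laxX P q ζ x t).mulVec (g x t)) x := fun x t ht =>
    hasDerivAt_fst_of_snd hsol hgt (fun x => by simp_rw [hga]; exact hfx x a) x ht
  have hglim : ∀ t ∈ Icc a b, Tendsto (fun x => colExp P 1 ζ x t • g x t) atTop
      (𝓝 (fun i => Emat (qPlus P) ζ i 1)) := by
    intro t ht
    obtain ⟨C, hC⟩ := hbc.bounded (|t₀| + 1)
    obtain ⟨K, hK⟩ := ((isCompact_closedBall (0 : ℂ) C).prod
      (isCompact_closedBall (0 : ℂ) C)).exists_bound_of_continuousOn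
      ((continuous_laxTpoly (P := P) (ζ := ζ)).sub
        (continuous_const (y := (I * (lam P ζ * speed P ζ)) • (1 : Matrix (Fin 2) (Fin 2) ℂ)))
        ).sum_norm_entries.continuousOn
    refine tendsto_of_bounded_coefficients (a := a) (b := b) (K := K)
      (A := fun x s => laxT P q ζ x s - (I * (lam P ζ * speed P ζ)) • 1)
      (w := fun x s => colExp P 1 ζ x s • g x s) (fun x => ?_) (fun x s hs => ?_) (fun s => ?_)
      (laxTpoly_limit hq hζ0) (fun x s hs => ?_) ?_ ht
    · exact (hTc.comp (by fun_prop : Continuous fun s : ℝ => (x, s))).sub continuous_const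
    · have hs' : |s| ≤ |t₀| + 1 := by
        have h1 := abs_sub_le s t₀ 0
        have h2 : |s - t₀| ≤ 1 := abs_le.2 ⟨by linarith [hs.1], by linarith [hs.2]⟩
        simp only [sub_zero] at h1
        linarith
      have h1 := hC x s hs'
      rw [laxT_eq_poly]
      refine (le_abs_self _).trans (hK _ ⟨?_, ?_⟩)
      · rw [mem_closedBall_zero_iff, norm_envelope]; exact h1.1
      · rw [mem_closedBall_zero_iff]
        have := norm_envelope (P := P) (q := derivX q) x s
        rw [envelope] at this
        rw [this]
        exact h1.2
    · simp_rw [laxT_eq_poly]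
      have h1 := ((continuous_laxTpoly (P := P) (ζ := ζ)).tendsto (qPlus P, I * P.α * qPlus P)).comp
        ((hbc.tendsto_top s).prodMk_nhds (tendsto_derivX_mul_exp hsol hbc s))
      have h2 : Continuous fun M : Matrix (Fin 2) (Fin 2) ℂ =>
          (M - (I * (lam P ζ * speed P ζ)) • 1).mulVec (fun i => Emat (qPlus P) ζ i 1) :=
        (continuous_id.sub continuous_const).matrix_mulVec continuous_const
      exact (h2.tendsto _).comp h1
    · have e := ((hasDerivAt_Theta_snd (P := P) x s ζ).const_mul I).neg.cexp
      have h1 := e.smul (hgt x s hs)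
      simp only [colExp, one_ne_zero, if_false]
      refine h1.congr_deriv ?_
      rw [Matrix.sub_mulVec, Matrix.mulVec_smul, Matrix.smul_mulVec, Matrix.one_mulVec, smul_smul,
        sub_eq_add_neg, ← neg_smul]
      congr 2
      simp only [Pi.neg_apply]
      ring
    · simp_rw [hga]
      exact hft a
  have hgf : ∀ t ∈ Icc a b, ∀ x, g x t = f x t := fun t ht x =>
    congrFun (jost_unique_at hq hsol hbc hζ (t := t) (f := fun x => g x t) (g := fun x => f x t)
      (fun x => hgx x t ht) (fun x => hfx x t) (hglim t ht) (hft t)) x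
  have ht₀ : t₀ ∈ Ioo a b := ⟨by simp [a], by simp [b]⟩
  have h1 := hgt x₀ t₀ (Ioo_subset_Icc_self ht₀)
  rw [hgf t₀ (Ioo_subset_Icc_self ht₀)] at h1
  refine h1.congr_of_eventuallyEq ?_
  filter_upwards [Ioo_mem_nhds ht₀.1 ht₀.2] with s hs
  exact (hgf s (Ioo_subset_Icc_self hs) x₀).symm

end

end KE

end

/-! ### Symmetries in `ζ` and identification of the Jost functions -/

noncomputable section

namespace KE

open IsStep

section Symmetries

variable {P : Params} {q : ℝ → ℝ → ℂ} {ζ qb : ℂ} {l : Filter ℝ} {f : ℝ → ℝ → Fin 2 → ℂ}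

theorem zOf_conj (ζ : ℂ) : zOf P (conj ζ) = conj (zOf P ζ) := by
  simp [zOf, map_ofNat]

theorem lam_conj (ζ : ℂ) : lam P (conj ζ) = conj (lam P ζ) := by
  simp [lam, map_ofNat]

theorem Theta_conj (x t : ℝ) (ζ : ℂ) : Theta P x t (conj ζ) = conj (Theta P x t ζ) := by
  simp [Theta, zOf_conj, lam_conj, map_ofNat]

theorem lam_inv (hq : 0 < P.q₀) (hζ : ζ ≠ 0) : lam P (-(P.q₀ : ℂ) ^ 2 / ζ) = -lam P ζ := by
  have h : (P.q₀ : ℂ) ≠ 0 := by exact_mod_cast hq.ne'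
  rw [lam, lam]; field_simp; ring

theorem zOf_inv (hq : 0 < P.q₀) (hζ : ζ ≠ 0) : zOf P (-(P.q₀ : ℂ) ^ 2 / ζ) = zOf P ζ := by
  have h : (P.q₀ : ℂ) ≠ 0 := by exact_mod_cast hq.ne'
  rw [zOf, zOf]; field_simp; ring

theorem Theta_inv (hq : 0 < P.q₀) (hζ : ζ ≠ 0) (x t : ℝ) :
    Theta P x t (-(P.q₀ : ℂ) ^ 2 / ζ) = -Theta P x t ζ := by
  rw [Theta, Theta, lam_inv hq hζ, zOf_inv hq hζ]; ring

theorem hasDerivAt_conj_mulVec {M M' : Matrix (Fin 2) (Fin 2) ℂ} (h00 : M' 0 0 = conj (M 1 1))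
    (h01 : M' 0 1 = -conj (M 1 0)) (h10 : M' 1 0 = -conj (M 0 1)) (h11 : M' 1 1 = conj (M 0 0))
    {f : ℝ → Fin 2 → ℂ} {x : ℝ} (h : HasDerivAt f (M.mulVec (f x)) x) :
    HasDerivAt (fun y => ![conj (f y 1), -conj (f y 0)])
      (M'.mulVec ![conj (f x 1), -conj (f x 0)]) x := by
  rw [hasDerivAt_mulVec_iff] at h ⊢
  constructor
  · refine h.2.conj_comp.congr_deriv ?_
    simp [h00, h01]; ring
  · refine h.1.conj_comp.neg.congr_deriv ?_
    simp [h10, h11]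

/-- The first symmetry of the Lax pair. -/
def conjF (f : ℝ → ℝ → Fin 2 → ℂ) (x t : ℝ) : Fin 2 → ℂ := ![conj (f x t 1), -conj (f x t 0)]

theorem IsLaxSol.conjF (h : IsLaxSol P q ζ f) : IsLaxSol P q (conj ζ) (conjF f) := by
  have e : ∀ x t, conj (exp (I * Ups P x t)) = exp (-(I * Ups P x t)) := fun x t => by
    simp [← Complex.exp_conj]
  have e' : ∀ x t, conj (exp (-(I * Ups P x t))) = exp (I * Ups P x t) := fun x t => by
    simp [← Complex.exp_conj]
  constructor
  · intro x t
    refine hasDerivAt_conj_mulVec ?_ ?_ ?_ ?_ (h.fst x t) <;>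
      simp only [laxX_eq, zOf_conj] <;> simp [e, e', map_ofNat] <;> ring
  · intro x t
    refine hasDerivAt_conj_mulVec ?_ ?_ ?_ ?_ (h.snd x t) <;>
      simp only [laxT_eq, zOf_conj, laxTdiag, rate] <;> simp [e, e', map_ofNat] <;> ring

theorem IsJost.conjF (h : IsJost P q l qb 1 ζ f) : IsJost P q l qb 0 (conj ζ) (conjF f) := by
  have h1 := h.isLaxSol.conjF
  refine ⟨h1.fst, h1.snd, fun t => ?_⟩
  have h2 := h.2.2 t
  rw [tendsto_pi_nhds, Fin.forall_fin_two] at h2 ⊢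
  have hc : ∀ z : ℂ, Tendsto conj (𝓝 z) (𝓝 (conj z)) := fun z => Complex.continuous_conj.tendsto z
  constructor
  · have h3 := (hc _).comp h2.2
    simpa [colExp, Emat, KE.conjF, Theta_conj, Function.comp_def, ← Complex.exp_conj] using h3
  · have h3 := (hc _).comp h2.1
    simpa [colExp, Emat, KE.conjF, Theta_conj, Function.comp_def, ← Complex.exp_conj, neg_div]
      using h3

theorem IsJost.conjF_symm (h : IsJost P q l qb 0 ζ f) :
    IsJost P q l qb 1 (conj ζ) fun x t => (-1 : ℂ) • KE.conjF f x t := by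
  have h1 := h.isLaxSol.conjF.smul (-1)
  refine ⟨h1.fst, h1.snd, fun t => ?_⟩
  have h2 := h.2.2 t
  rw [tendsto_pi_nhds, Fin.forall_fin_two] at h2 ⊢
  have hc : ∀ z : ℂ, Tendsto conj (𝓝 z) (𝓝 (conj z)) := fun z => Complex.continuous_conj.tendsto z
  constructor
  · have h3 := (hc _).comp h2.2
    simpa [colExp, Emat, KE.conjF, Theta_conj, Function.comp_def, ← Complex.exp_conj, neg_div]
      using h3
  · have h3 := (hc _).comp h2.1
    simpa [colExp, Emat, KE.conjF, Theta_conj, Function.comp_def, ← Complex.exp_conj] using h3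

/-- The parameter `z` is invariant under `ζ ↦ -q₀²/ζ`, so the Lax pair is literally the same. Only
`λ` changes sign, which interchanges the roles of the two columns. -/
theorem IsLaxSol.inv (hq : 0 < P.q₀) (hζ : ζ ≠ 0) (h : IsLaxSol P q ζ f) :
    IsLaxSol P q (-(P.q₀ : ℂ) ^ 2 / ζ) f := by
  have e1 : ∀ x t, laxX P q (-(P.q₀ : ℂ) ^ 2 / ζ) x t = laxX P q ζ x t := fun x t => by
    rw [laxX_eq, laxX_eq, zOf_inv hq hζ]
  have e2 : ∀ x t, laxT P q (-(P.q₀ : ℂ) ^ 2 / ζ) x t = laxT P q ζ x t := fun x t => by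
    rw [laxT_eq, laxT_eq, laxTdiag, laxTdiag, zOf_inv hq hζ]
  constructor
  · intro x t; rw [e1]; exact h.fst x t
  · intro x t; rw [e2]; exact h.snd x t

/-- The second symmetry of the Lax pair. -/
theorem IsJost.inv (hq : 0 < P.q₀) (hqb : ‖qb‖ = P.q₀) (hζ : ζ ≠ 0)
    (h : IsJost P q l qb 1 ζ f) :
    IsJost P q l qb 0 (-(P.q₀ : ℂ) ^ 2 / ζ) fun x t => (I * ζ / qb) • f x t := by
  have h0 : (P.q₀ : ℂ) ≠ 0 := by exact_mod_cast hq.ne'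
  have hqb0 : qb ≠ 0 := by rw [← norm_pos_iff, hqb]; exact hq
  have hc : conj qb * qb = (P.q₀ : ℂ) ^ 2 := by rw [Complex.conj_mul', hqb]
  have h1 := (h.isLaxSol.inv hq hζ).smul (I * ζ / qb)
  refine ⟨h1.fst, h1.snd, fun t => ?_⟩
  have h2 := (h.2.2 t).const_smul (I * ζ / qb)
  have e : (I * ζ / qb) • (fun i => Emat qb ζ i 1)
      = fun i => Emat qb (-(P.q₀ : ℂ) ^ 2 / ζ) i 0 := by
    funext i
    fin_cases i
    · simp [Emat]; field_simp; simp
    · simp [Emat]; rw [← hc]; field_simp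
      have : conj qb ≠ 0 := by simpa using hqb0
      field_simp
  rw [e] at h2
  refine h2.congr fun x => ?_
  simp only [colExp, one_ne_zero, if_false, if_true, Theta_inv hq hζ, mul_neg]
  rw [smul_comm]

theorem IsJost.inv_symm (hq : 0 < P.q₀) (hqb : ‖qb‖ = P.q₀) (hζ : ζ ≠ 0)
    (h : IsJost P q l qb 0 (-(P.q₀ : ℂ) ^ 2 / ζ) f) :
    IsJost P q l qb 1 ζ fun x t => (-(I * qb / ζ)) • f x t := by
  have h0 : (P.q₀ : ℂ) ≠ 0 := by exact_mod_cast hq.ne'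
  have hqb0 : qb ≠ 0 := by rw [← norm_pos_iff, hqb]; exact hq
  have hc : conj qb * qb = (P.q₀ : ℂ) ^ 2 := by rw [Complex.conj_mul', hqb]
  have hinv : -(P.q₀ : ℂ) ^ 2 / (-(P.q₀ : ℂ) ^ 2 / ζ) = ζ := by field_simp
  have h1 := (h.isLaxSol.inv hq (by
    simpa [hζ] using h0 : -(P.q₀ : ℂ) ^ 2 / ζ ≠ 0)).smul (-(I * qb / ζ))
  rw [hinv] at h1
  refine ⟨h1.fst, h1.snd, fun t => ?_⟩
  have h2 := (h.2.2 t).const_smul (-(I * qb / ζ))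
  have e : (-(I * qb / ζ)) • (fun i => Emat qb (-(P.q₀ : ℂ) ^ 2 / ζ) i 0)
      = fun i => Emat qb ζ i 1 := by
    funext i
    fin_cases i
    · simp [Emat]
    · simp [Emat]
      have hI := I_sq
      field_simp
      grind
  rw [e] at h2
  refine h2.congr fun x => ?_
  simp only [colExp, one_ne_zero, if_false, if_true, Theta_inv hq hζ, mul_neg]
  rw [smul_comm]

end Symmetries

section JostFunctions

variable {P : Params} {q : ℝ → ℝ → ℂ} {ζ : ℂ}

theorem IsJost.unique_bot (hq : 0 < P.q₀) (hsol : IsSolution P.T q) (hbc : HasNZBC P q)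
    (hζ : ζ ∈ extUpper P) {f g : ℝ → ℝ → Fin 2 → ℂ}
    (hf : IsJost P q atBot (qMinus P) 0 ζ f) (hg : IsJost P q atBot (qMinus P) 0 ζ g) :
    f = g := by
  have h1 := isJost_refl_symm hsol hf
  have h2 := isJost_refl_symm hsol hg
  rw [← qPlus_refl] at h1 h2
  rw [← reflF_reflF f, IsJost.unique_top (P := P.refl) hq (isSolution_refl hsol)
    (hasNZBC_refl hsol hbc) hζ h1 h2, reflF_reflF]

/-- The modified Jost solutions at both ends. -/
structure JostPair (P : Params) (q : ℝ → ℝ → ℂ) where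
  top : ℝ → ℝ → ℂ → ℂ × ℂ
  bot : ℝ → ℝ → ℂ → ℂ × ℂ
  isModifiedJost_top : ∀ t, IsModifiedJost P (fun x => envelope P q x t) (qPlus P) (top t)
  isModifiedJost_bot : ∀ t, IsModifiedJost P.refl (fun x => envelope P.refl (reflQ q) x t)
    (qPlus P.refl) (bot t)

theorem exists_jostPair (hq : 0 < P.q₀) (hsol : IsSolution P.T q) (hbc : HasNZBC P q) :
    Nonempty (JostPair P q) := by
  choose m hm using fun t => exists_modifiedJost hq (isStep_envelope hq hsol hbc t)
  choose n hn using fun t => exists_modifiedJost (P := P.refl) hq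
    (isStep_envelope (P := P.refl) hq (isSolution_refl hsol) (hasNZBC_refl hsol hbc) t)
  exact ⟨⟨m, n, hm, hn⟩⟩

theorem isJost_psiPlus (hq : 0 < P.q₀) (hsol : IsSolution P.T q) (hbc : HasNZBC P q)
    (hζ : ζ ∈ extUpper P) : IsJost P q atTop (qPlus P) 1 ζ (psiPlus P q 1 ζ) := by
  obtain ⟨J⟩ := exists_jostPair hq hsol hbc
  exact Classical.epsilon_spec ⟨_, isJost_ofModified hq hsol hbc hζ J.isModifiedJost_top⟩

theorem JostPair.isJost_bot (J : JostPair P q) (hq : 0 < P.q₀) (hsol : IsSolution P.T q)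
    (hbc : HasNZBC P q) (hζ : ζ ∈ extUpper P) : IsJost P q atBot (qMinus P) 0 ζ
      (reflF fun x t => ofModified P.refl ζ t (fun y => J.bot t y ζ) x) := by
  have h := isJost_ofModified (P := P.refl) hq (isSolution_refl hsol) (hasNZBC_refl hsol hbc) hζ
    J.isModifiedJost_bot
  rw [qPlus_refl] at h
  exact isJost_refl hsol h

theorem isJost_psiMinus (hq : 0 < P.q₀) (hsol : IsSolution P.T q) (hbc : HasNZBC P q)
    (hζ : ζ ∈ extUpper P) : IsJost P q atBot (qMinus P) 0 ζ (psiMinus P q 0 ζ) := by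
  obtain ⟨J⟩ := exists_jostPair hq hsol hbc
  exact Classical.epsilon_spec ⟨_, J.isJost_bot hq hsol hbc hζ⟩

/-- By uniqueness the chosen Jost function is the constructed one, and so inherits its regularity
and its limits in `ζ`. -/
theorem JostPair.muPlus_eq (J : JostPair P q) (hq : 0 < P.q₀) (hsol : IsSolution P.T q)
    (hbc : HasNZBC P q) (hζ : ζ ∈ extUpper P) (x t : ℝ) :
    muPlus P q 1 x t ζ = ![(J.top t x ζ).1, (J.top t x ζ).2] := by
  have h := (isJost_psiPlus hq hsol hbc hζ).unique_top hq hsol hbc hζ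
    (isJost_ofModified hq hsol hbc hζ J.isModifiedJost_top)
  rw [muPlus, h, colExp, if_neg one_ne_zero]
  simp only [ofModified]
  rw [smul_smul, ← Complex.exp_add]
  simp

theorem JostPair.muMinus_eq (J : JostPair P q) (hq : 0 < P.q₀) (hsol : IsSolution P.T q)
    (hbc : HasNZBC P q) (hζ : ζ ∈ extUpper P) (x t : ℝ) :
    muMinus P q 0 x t ζ = ![(J.bot (-t) (-x) ζ).2, (J.bot (-t) (-x) ζ).1] := by
  have h := (isJost_psiMinus hq hsol hbc hζ).unique_bot hq hsol hbc hζ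
    (J.isJost_bot hq hsol hbc hζ)
  rw [muMinus, h, colExp, if_pos rfl]
  funext i
  fin_cases i <;>
    simp [reflF, ofModified, Theta_refl, ← mul_assoc, ← Complex.exp_add]

end JostFunctions

end KE

end

/-! ### Wronskians, the scattering coefficient `a` and the boundary relations -/

noncomputable section

namespace KE

open IsStep

theorem wronskian_smul_left (c : ℂ) (u v : Fin 2 → ℂ) :
    wronskian (c • u) v = c * wronskian u v := by
  simp [wronskian]; ring

theorem wronskian_smul_right (c : ℂ) (u v : Fin 2 → ℂ) :
    wronskian u (c • v) = c * wronskian u v := by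
  simp [wronskian]; ring

/-- The Plücker relation. -/
theorem wronskian_mul (a b c d : Fin 2 → ℂ) : wronskian a b * wronskian c d
    = wronskian a c * wronskian b d - wronskian a d * wronskian b c := by
  simp only [wronskian]; ring

theorem wronskian_expand (f p r : Fin 2 → ℂ) :
    wronskian p r • f = wronskian f r • p + wronskian p f • r := by
  funext i
  fin_cases i <;> simp [wronskian] <;> ring

theorem exists_wronskian_ne_zero {u : Fin 2 → ℂ} (hu : u ≠ 0) : ∃ e, wronskian u e ≠ 0 := by
  by_contra! h
  apply hu
  funext i
  fin_cases i
  · simpa [wronskian] using h ![0, 1]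
  · simpa [wronskian] using h ![1, 0]

theorem exists_smul_eq_of_wronskian_eq_zero {u v : Fin 2 → ℂ} (hv : v ≠ 0)
    (h : wronskian u v = 0) : ∃ c : ℂ, u = c • v := by
  obtain ⟨e, he⟩ := exists_wronskian_ne_zero hv
  refine ⟨wronskian u e / wronskian v e, ?_⟩
  have h1 := wronskian_expand u v e
  have h2 : wronskian v u = 0 := by
    have : wronskian v u = -wronskian u v := by simp only [wronskian]; ring
    rw [this, h, neg_zero]
  rw [h2, zero_smul, add_zero] at h1
  rw [div_eq_inv_mul, ← smul_smul, ← h1, smul_smul, inv_mul_cancel₀ he, one_smul]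

theorem continuous_wronskian : Continuous fun r : (Fin 2 → ℂ) × (Fin 2 → ℂ) =>
    wronskian r.1 r.2 := by
  unfold wronskian; fun_prop

section

variable {P : Params} {q : ℝ → ℝ → ℂ} {ζ : ℂ}

theorem colExp_mul_colExp (x t : ℝ) : colExp P 0 ζ x t * colExp P 1 ζ x t = 1 := by
  simp [colExp, ← Complex.exp_add]

/-- The Wronskian is constant and the two exponentials cancel in it, so it equals its limit, the
determinant of `Emat`. -/
theorem IsJost.wronskian_eq {l : Filter ℝ} [l.NeBot] {qb : ℂ} (hqb : ‖qb‖ = P.q₀)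
    {f g : ℝ → ℝ → Fin 2 → ℂ} (hf : IsJost P q l qb 0 ζ f) (hg : IsJost P q l qb 1 ζ g) :
    wronskian (f 0 0) (g 0 0) = 1 + (P.q₀ : ℂ) ^ 2 / ζ ^ 2 := by
  have hc : conj qb * qb = (P.q₀ : ℂ) ^ 2 := by rw [Complex.conj_mul', hqb]
  have h1 := (continuous_wronskian.tendsto _).comp ((hf.2.2 0).prodMk_nhds (hg.2.2 0))
  have h2 : (fun r : (Fin 2 → ℂ) × (Fin 2 → ℂ) => wronskian r.1 r.2) ∘
      (fun x => (colExp P 0 ζ x 0 • f x 0, colExp P 1 ζ x 0 • g x 0))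
      = fun _ => wronskian (f 0 0) (g 0 0) := by
    funext x
    simp only [Function.comp_apply]
    rw [wronskian_smul_left, wronskian_smul_right, ← mul_assoc, colExp_mul_colExp, one_mul,
      hf.isLaxSol.wronskian_eq hg.isLaxSol]
  rw [h2] at h1
  refine (tendsto_nhds_unique h1 tendsto_const_nhds).symm.trans ?_
  simp only [wronskian, Emat]
  simp
  rw [← hc]
  linear_combination (-(conj qb * qb / ζ ^ 2)) * I_sq

/-- A solution with a zero vanishes identically, whereas the diagonal component of its modified form
tends to `1`. -/
theorem IsJost.ne_zero (hsol : IsSolution P.T q) {l : Filter ℝ} [l.NeBot] {qb : ℂ} {c : Fin 2}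
    {f : ℝ → ℝ → Fin 2 → ℂ} (hf : IsJost P q l qb c ζ f) (x t : ℝ) : f x t ≠ 0 := by
  intro h
  have h0 : IsLaxSol P q ζ fun _ _ => 0 := by
    have := hf.isLaxSol.smul 0
    simpa using this
  have h1 := hf.isLaxSol.ext hsol h0 h
  have h2 := (tendsto_pi_nhds.1 (hf.2.2 0)) c
  rw [h1] at h2
  have h3 : Emat qb ζ c c = 1 := by fin_cases c <;> simp [Emat]
  rw [h3] at h2
  simp only [smul_zero, Pi.zero_apply] at h2
  exact one_ne_zero (tendsto_nhds_unique h2 tendsto_const_nhds)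

theorem one_add_eq (hζ : ζ ≠ 0) : 1 + (P.q₀ : ℂ) ^ 2 / ζ ^ 2 = 2 * lam P ζ / ζ := by
  rw [lam]; field_simp

theorem one_add_ne_zero (hq : 0 < P.q₀) (hζ : ζ ∈ extUpper P) (hne : ζ ≠ I * P.q₀) :
    1 + (P.q₀ : ℂ) ^ 2 / ζ ^ 2 ≠ 0 := by
  have hζ0 := ne_zero_of_mem_extUpper hq hζ
  intro h
  have h1 : (ζ - I * P.q₀) * (ζ + I * P.q₀) = 0 := by
    field_simp at h
    linear_combination h - (P.q₀ : ℂ) ^ 2 * I_sq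
  rcases mul_eq_zero.1 h1 with h2 | h2
  · exact hne (sub_eq_zero.1 h2)
  · have h3 := hζ.2
    rw [eq_neg_of_add_eq_zero_left h2] at h3
    simp at h3
    linarith

variable (hq : 0 < P.q₀) (hsol : IsSolution P.T q) (hbc : HasNZBC P q)
include hq hsol hbc

theorem aCoef_eq (hζ : ζ ∈ extUpper P) (x t : ℝ) : aCoef P q ζ =
    wronskian (muMinus P q 0 x t ζ) (muPlus P q 1 x t ζ) / (1 + (P.q₀ : ℂ) ^ 2 / ζ ^ 2) := by
  rw [muMinus, muPlus, wronskian_smul_left, wronskian_smul_right, ← mul_assoc, colExp_mul_colExp,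
    one_mul, (isJost_psiMinus hq hsol hbc hζ).isLaxSol.wronskian_eq
      (isJost_psiPlus hq hsol hbc hζ).isLaxSol, aCoef]

theorem continuousOn_muPlus (x t : ℝ) : ContinuousOn (muPlus P q 1 x t) (extUpper P) := by
  obtain ⟨J⟩ := exists_jostPair hq hsol hbc
  refine ContinuousOn.congr ?_ fun ζ hζ => J.muPlus_eq hq hsol hbc hζ x t
  have h := (J.isModifiedJost_top t).continuousOn x
  exact continuousOn_pi.2 (Fin.forall_fin_two.2 ⟨h.fst, h.snd⟩)

theorem continuousOn_muMinus (x t : ℝ) : ContinuousOn (muMinus P q 0 x t) (extUpper P) := by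
  obtain ⟨J⟩ := exists_jostPair hq hsol hbc
  refine ContinuousOn.congr ?_ fun ζ hζ => J.muMinus_eq hq hsol hbc hζ x t
  have h : ContinuousOn _ (extUpper P) := (J.isModifiedJost_bot (-t)).continuousOn (-x)
  exact continuousOn_pi.2 (Fin.forall_fin_two.2 ⟨h.snd, h.fst⟩)

theorem differentiableOn_muPlus (x t : ℝ) :
    DifferentiableOn ℂ (muPlus P q 1 x t) (extUpperOpen P) := by
  obtain ⟨J⟩ := exists_jostPair hq hsol hbc
  refine DifferentiableOn.congr ?_ fun ζ hζ =>
    J.muPlus_eq hq hsol hbc (extUpperOpen_subset P hζ) x t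
  have h := (J.isModifiedJost_top t).differentiableOn x
  exact differentiableOn_pi.2 (Fin.forall_fin_two.2 ⟨h.fst, h.snd⟩)

theorem differentiableOn_muMinus (x t : ℝ) :
    DifferentiableOn ℂ (muMinus P q 0 x t) (extUpperOpen P) := by
  obtain ⟨J⟩ := exists_jostPair hq hsol hbc
  refine DifferentiableOn.congr ?_ fun ζ hζ =>
    J.muMinus_eq hq hsol hbc (extUpperOpen_subset P hζ) x t
  have h : DifferentiableOn ℂ _ (extUpperOpen P) :=
    (J.isModifiedJost_bot (-t)).differentiableOn (-x)
  exact differentiableOn_pi.2 (Fin.forall_fin_two.2 ⟨h.snd, h.fst⟩)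

theorem continuousOn_wronskian_mu (x t : ℝ) : ContinuousOn (fun ζ =>
    wronskian (muMinus P q 0 x t ζ) (muPlus P q 1 x t ζ)) (extUpper P) := by
  have h1 := continuousOn_pi.1 (continuousOn_muMinus hq hsol hbc x t)
  have h2 := continuousOn_pi.1 (continuousOn_muPlus hq hsol hbc x t)
  simp only [wronskian]
  exact ((h1 0).mul (h2 1)).sub ((h1 1).mul (h2 0))

theorem continuousOn_aCoef : ContinuousOn (aCoef P q) (extUpper P \ {I * (P.q₀ : ℂ)}) := by
  refine ContinuousOn.congr ?_ fun ζ hζ => aCoef_eq hq hsol hbc hζ.1 0 0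
  refine ((continuousOn_wronskian_mu hq hsol hbc 0 0).mono sdiff_subset).div ?_
    fun ζ hζ => one_add_ne_zero hq hζ.1 hζ.2
  exact continuousOn_const.add (continuousOn_const.div (continuousOn_id.pow 2) fun ζ hζ =>
    pow_ne_zero _ (ne_zero_of_mem_extUpper hq hζ.1))

omit hsol hbc in
theorem ne_branchPoint_of_mem (hζ : ζ ∈ extUpperOpen P) : ζ ≠ I * P.q₀ := by
  rintro rfl
  have := hζ.1
  simp [abs_of_pos hq] at this

theorem differentiableOn_aCoef : DifferentiableOn ℂ (aCoef P q) (extUpperOpen P) := by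
  refine DifferentiableOn.congr ?_ fun ζ hζ =>
    aCoef_eq hq hsol hbc (extUpperOpen_subset P hζ) 0 0
  have h1 := differentiableOn_pi.1 (differentiableOn_muMinus hq hsol hbc 0 0)
  have h2 := differentiableOn_pi.1 (differentiableOn_muPlus hq hsol hbc 0 0)
  refine DifferentiableOn.div (((h1 0).mul (h2 1)).sub ((h1 1).mul (h2 0))) ?_ fun ζ hζ =>
    one_add_ne_zero hq (extUpperOpen_subset P hζ) (ne_branchPoint_of_mem hq hζ)
  exact (differentiableOn_const _).add ((differentiableOn_const _).div (differentiableOn_id.pow 2)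
    fun ζ hζ => pow_ne_zero _ (ne_zero_of_mem_extUpper hq (extUpperOpen_subset P hζ)))

/- Relations on the continuous spectrum -/

/-- For real `ζ` the conjugation symmetry maps `ζ` to itself. It carries existence and uniqueness
from the second column, for which they are known, over to the first. -/
theorem psiPlus_zero_real (hζ : ζ ∈ extUpper P) (him : ζ.im = 0) :
    IsJost P q atTop (qPlus P) 0 ζ (psiPlus P q 0 ζ) ∧
      psiPlus P q 0 ζ = conjF (psiPlus P q 1 ζ) := by
  have hr : conj ζ = ζ := Complex.conj_eq_iff_im.2 him
  have h1 := (isJost_psiPlus hq hsol hbc hζ).conjF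
  rw [hr] at h1
  have h2 : IsJost P q atTop (qPlus P) 0 ζ (psiPlus P q 0 ζ) := Classical.epsilon_spec ⟨_, h1⟩
  refine ⟨h2, ?_⟩
  have h3 := h2.conjF_symm
  have h4 := h1.conjF_symm
  rw [hr] at h3 h4
  have h5 := h3.unique_top hq hsol hbc hζ h4
  funext x t i
  have h6 := congrFun (congrFun h5 x) t
  have h7 := congrFun h6 0
  have h8 := congrFun h6 1
  have inj : ∀ z w : ℂ, conj z = conj w → z = w := fun z w => (starRingEnd ℂ).injective.eq_iff.1
  simp only [conjF, Pi.smul_apply, Matrix.cons_val_zero, Matrix.cons_val_one, smul_eq_mul] at h7 h8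
  fin_cases i
  · refine inj _ _ ?_
    simpa [conjF] using h8
  · refine inj _ _ (neg_injective ?_)
    simpa [conjF] using h7

omit hsol hbc in
theorem inv_mem_arc (hζ : ‖ζ‖ = P.q₀) (him : 0 ≤ ζ.im) :
    ‖-(P.q₀ : ℂ) ^ 2 / ζ‖ = P.q₀ ∧ 0 ≤ (-(P.q₀ : ℂ) ^ 2 / ζ).im ∧
      -(P.q₀ : ℂ) ^ 2 / (-(P.q₀ : ℂ) ^ 2 / ζ) = ζ ∧
      (ζ ≠ I * P.q₀ → -(P.q₀ : ℂ) ^ 2 / ζ ≠ I * P.q₀) := by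
  have h0 : (P.q₀ : ℂ) ≠ 0 := by exact_mod_cast hq.ne'
  have hζ0 : ζ ≠ 0 := norm_pos_iff.1 (by rw [hζ]; exact hq)
  have e : -(P.q₀ : ℂ) ^ 2 / ζ = -conj ζ := by
    rw [div_eq_iff hζ0, neg_mul, Complex.conj_mul', hζ]
  refine ⟨?_, ?_, ?_, fun hne h => hne ?_⟩
  · rw [e, norm_neg, RCLike.norm_conj, hζ]
  · rw [e]; simpa using him
  · field_simp
  · rw [e] at h
    have := congrArg conj (congrArg Neg.neg h)
    simpa using this

theorem psiPlus_zero_arc (hζ : ‖ζ‖ = P.q₀) (him : 0 ≤ ζ.im) :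
    IsJost P q atTop (qPlus P) 0 ζ (psiPlus P q 0 ζ) ∧
      psiPlus P q 0 ζ = fun x t => (I * (-(P.q₀ : ℂ) ^ 2 / ζ) / qPlus P) •
        psiPlus P q 1 (-(P.q₀ : ℂ) ^ 2 / ζ) x t := by
  obtain ⟨hw1, hw2, hw3, -⟩ := inv_mem_arc hq hζ him
  set w := -(P.q₀ : ℂ) ^ 2 / ζ with hw
  have hwU : w ∈ extUpper P := ⟨hw1.ge, hw2⟩
  have hw0 := ne_zero_of_mem_extUpper hq hwU
  have h1 := (isJost_psiPlus hq hsol hbc hwU).inv hq (norm_qPlus hq) hw0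
  rw [hw3] at h1
  have h2 : IsJost P q atTop (qPlus P) 0 ζ (psiPlus P q 0 ζ) := Classical.epsilon_spec ⟨_, h1⟩
  refine ⟨h2, ?_⟩
  rw [← hw3] at h1 h2
  have h5 := (h2.inv_symm hq (norm_qPlus hq) hw0).unique_top hq hsol hbc hwU
    (h1.inv_symm hq (norm_qPlus hq) hw0)
  have hc : -(I * qPlus P / w) ≠ 0 := by
    have : qPlus P ≠ 0 := by rw [← norm_pos_iff, norm_qPlus hq]; exact hq
    exact neg_ne_zero.2 (div_ne_zero (mul_ne_zero I_ne_zero this) hw0)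
  rw [hw3] at h5
  funext x t
  exact smul_right_injective _ hc (congrFun (congrFun h5 x) t)

theorem psiMinus_eq_smul (hrefl : Reflectionless P q) (hζ : ζ ∈ extUpper P)
    (hS : ζ.im = 0 ∨ ‖ζ‖ = P.q₀) (hne : ζ ≠ I * P.q₀) :
    psiMinus P q 0 ζ = fun x t => aCoef P q ζ • psiPlus P q 0 ζ x t := by
  have hζ0 := ne_zero_of_mem_extUpper hq hζ
  have hmem : ζ ∈ contSpec P := by
    refine ⟨hS, hζ0, hne, fun h => ?_⟩
    have h3 := hζ.2
    rw [h] at h3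
    simp at h3
    linarith
  have h0 : IsJost P q atTop (qPlus P) 0 ζ (psiPlus P q 0 ζ) := by
    rcases hS with h | h
    · exact (psiPlus_zero_real hq hsol hbc hζ h).1
    · exact (psiPlus_zero_arc hq hsol hbc h hζ.2).1
  have h1 := isJost_psiPlus hq hsol hbc hζ
  have hD := h0.wronskian_eq (norm_qPlus hq) h1
  have hD0 := one_add_ne_zero hq hζ hne
  have hb := hrefl ζ hmem
  rw [bCoef, div_eq_zero_iff, or_iff_left hD0] at hb
  refine (isJost_psiMinus hq hsol hbc hζ).isLaxSol.ext hsol (h0.isLaxSol.smul (aCoef P q ζ))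
    (x₀ := 0) (t₀ := 0) ?_
  have h2 := wronskian_expand (psiMinus P q 0 ζ 0 0) (psiPlus P q 0 ζ 0 0) (psiPlus P q 1 ζ 0 0)
  rw [hb, zero_smul, add_zero, hD] at h2
  rw [aCoef, div_eq_inv_mul, ← smul_smul, ← h2, smul_smul, inv_mul_cancel₀ hD0, one_smul]

/-- The jump relation of the reflectionless problem: up to the factor `a`, the boundary value of
`μ₋₁` is the conjugate image of `μ₊₂`. Its counterpart on the arc uses the inversion in place of
conjugation. -/
theorem muMinus_real (hrefl : Reflectionless P q) (hζ : ζ ∈ extUpper P) (him : ζ.im = 0)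
    (x t : ℝ) : muMinus P q 0 x t ζ = aCoef P q ζ •
      ![conj (muPlus P q 1 x t ζ 1), -conj (muPlus P q 1 x t ζ 0)] := by
  have hne : ζ ≠ I * P.q₀ := by
    rintro rfl
    simp [hq.ne'] at him
  have hr : conj ζ = ζ := Complex.conj_eq_iff_im.2 him
  have hT : conj (Theta P x t ζ) = Theta P x t ζ := by rw [← Theta_conj, hr]
  rw [muMinus, psiMinus_eq_smul hq hsol hbc hrefl hζ (Or.inl him) hne,
    (psiPlus_zero_real hq hsol hbc hζ him).2, muPlus, smul_comm]
  congr 1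
  funext i
  fin_cases i <;> simp [conjF, colExp, ← Complex.exp_conj, hT]

theorem muMinus_arc (hrefl : Reflectionless P q) (hζ : ‖ζ‖ = P.q₀) (him : 0 ≤ ζ.im)
    (hne : ζ ≠ I * P.q₀) (x t : ℝ) : muMinus P q 0 x t ζ =
      (aCoef P q ζ * (I * (-(P.q₀ : ℂ) ^ 2 / ζ) / qPlus P)) •
        muPlus P q 1 x t (-(P.q₀ : ℂ) ^ 2 / ζ) := by
  have hζ0 : ζ ≠ 0 := norm_pos_iff.1 (by rw [hζ]; exact hq)
  rw [muMinus, psiMinus_eq_smul hq hsol hbc hrefl ⟨hζ.ge, him⟩ (Or.inr hζ) hne,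
    (psiPlus_zero_arc hq hsol hbc hζ him).2, muPlus]
  simp only [smul_smul, colExp, if_true, one_ne_zero, if_false, Theta_inv hq hζ0]
  congr 1
  simp; ring

theorem aCoef_ne_zero_of_mem_spectrum (hrefl : Reflectionless P q) (hζ : ζ ∈ extUpper P)
    (hS : ζ.im = 0 ∨ ‖ζ‖ = P.q₀) (hne : ζ ≠ I * P.q₀) : aCoef P q ζ ≠ 0 := by
  intro h
  refine (isJost_psiMinus hq hsol hbc hζ).ne_zero hsol 0 0 ?_
  rw [psiMinus_eq_smul hq hsol hbc hrefl hζ hS hne, h]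
  simp

/-- The inversion symmetry expresses `ψ₋₂(ζ)` through `ψ₋₁(-q₀²/ζ)`, which is `a(-q₀²/ζ)` times a
multiple of `ψ₊₂(ζ)`. Inserting this in the Wronskian of the two columns of `ψ₋` leaves the product
of the two values of `a`. The identity controls `a` near the branch point. -/
theorem aCoef_mul_aCoef_inv (hrefl : Reflectionless P q) (hζ : ‖ζ‖ = P.q₀) (him : 0 ≤ ζ.im)
    (hne : ζ ≠ I * P.q₀) :
    aCoef P q ζ * aCoef P q (-(P.q₀ : ℂ) ^ 2 / ζ) = qPlus P / qMinus P := by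
  obtain ⟨hw1, hw2, hw3, hw4⟩ := inv_mem_arc hq hζ him
  have hζU : ζ ∈ extUpper P := ⟨hζ.ge, him⟩
  have hwU : -(P.q₀ : ℂ) ^ 2 / ζ ∈ extUpper P := ⟨hw1.ge, hw2⟩
  have hζ0 := ne_zero_of_mem_extUpper hq hζU
  have hp : qPlus P ≠ 0 := by rw [← norm_pos_iff, norm_qPlus hq]; exact hq
  have hm : qMinus P ≠ 0 := by rw [← norm_pos_iff, norm_qMinus hq]; exact hq
  have h1 := (isJost_psiMinus hq hsol hbc hζU).wronskian_eq (norm_qMinus hq)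
    ((isJost_psiMinus hq hsol hbc hwU).inv_symm hq (norm_qMinus hq) hζ0)
  rw [wronskian_smul_right, psiMinus_eq_smul hq hsol hbc hrefl hwU (Or.inr hw1) (hw4 hne),
    (psiPlus_zero_arc hq hsol hbc hw1 hw2).2, hw3] at h1
  simp only [smul_smul] at h1
  rw [wronskian_smul_right] at h1
  have h2 : wronskian (psiMinus P q 0 ζ 0 0) (psiPlus P q 1 ζ 0 0)
      = aCoef P q ζ * (1 + (P.q₀ : ℂ) ^ 2 / ζ ^ 2) := by
    rw [aCoef, div_mul_cancel₀ _ (one_add_ne_zero hq hζU hne)]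
  rw [h2] at h1
  have h3 := one_add_ne_zero hq hζU hne
  generalize aCoef P q (-(P.q₀ : ℂ) ^ 2 / ζ) = A at *
  have h4 : (aCoef P q ζ * A * (qMinus P / qPlus P)
      - 1) * (1 + (P.q₀ : ℂ) ^ 2 / ζ ^ 2) = 0 := by
    rw [sub_mul, one_mul, sub_eq_zero, ← h1, h1]
    refine Eq.trans ?_ h1
    field_simp
    linear_combination (aCoef P q ζ * A) * (ζ ^ 2 + (P.q₀ : ℂ) ^ 2) * I_sq
  have h5 := (mul_eq_zero.1 h4).resolve_right h3
  field_simp at h5 ⊢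
  linear_combination h5

end

end KE

end

/-! ### Limits of the modified functions at infinity and at the branch point -/

noncomputable section

namespace KE

open IsStep IsStep.IsModifiedJost

section

variable {P : Params} {q : ℝ → ℝ → ℂ} {ζ : ℂ}

theorem phase_envelope (x t : ℝ) :
    phase P (fun x => envelope P q x t) x = exp (I * omegaPlus P q x t) := by
  simp only [phase, excess, norm_envelope, omegaPlus]
  congr 1
  push_cast
  ring

variable (hq : 0 < P.q₀) (hsol : IsSolution P.T q) (hbc : HasNZBC P q)
include hq hsol hbc

theorem tendsto_muPlus_infty (x t : ℝ) :
    Tendsto (fun ζ => muPlus P q 1 x t ζ 0) (extInfty P) (𝓝 0) ∧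
    Tendsto (fun ζ => muPlus P q 1 x t ζ 1) (extInfty P) (𝓝 (exp (I * omegaPlus P q x t))) := by
  obtain ⟨J⟩ := exists_jostPair hq hsol hbc
  have hu := isStep_envelope hq hsol hbc t
  have hm := J.isModifiedJost_top t
  have h1 := hm.tendsto_fst_infty hq hu x
  have h2 := hm.tendsto_snd_infty hq hu x
  rw [phase_envelope] at h2
  refine ⟨h1.congr' ?_, h2.congr' ?_⟩ <;>
  · filter_upwards [eventually_mem_extInfty] with ζ hζ
    rw [J.muPlus_eq hq hsol hbc hζ]; simp

theorem tendsto_mul_muPlus_imaginary (x t : ℝ) :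
    Tendsto (fun s : ℝ => I * (s : ℂ) * muPlus P q 1 x t (I * s) 0) atTop
      (𝓝 (-(I * envelope P q x t * exp (I * omegaPlus P q x t)))) := by
  obtain ⟨J⟩ := exists_jostPair hq hsol hbc
  have hu := isStep_envelope hq hsol hbc t
  have h1 := (J.isModifiedJost_top t).tendsto_mul_fst_imaginary hq hu x
  rw [phase_envelope] at h1
  refine h1.congr' ?_
  filter_upwards [(tendsto_imaginary P).eventually eventually_mem_extInfty] with s hs
  rw [J.muPlus_eq hq hsol hbc hs]; simp

/-- As `ζ → ∞` the function `a` tends to the product of the phases accumulated from the two ends. In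
the quotient the phase from `-∞` cancels, and only `omegaPlus` remains. -/
theorem tendsto_muMinus_div_infty (x t : ℝ) :
    Tendsto (fun ζ => muMinus P q 0 x t ζ 0 / aCoef P q ζ) (extInfty P)
      (𝓝 (exp (-(I * omegaPlus P q x t)))) ∧
    Tendsto (fun ζ => muMinus P q 0 x t ζ 1 / aCoef P q ζ) (extInfty P) (𝓝 0) ∧
    ∀ᶠ ζ in extInfty P, aCoef P q ζ ≠ 0 := by
  obtain ⟨J⟩ := exists_jostPair hq hsol hbc
  have hu := isStep_envelope (P := P.refl) hq (isSolution_refl hsol) (hasNZBC_refl hsol hbc) (-t)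
  have hm := J.isModifiedJost_bot (-t)
  set c := phase P.refl (fun x => envelope P.refl (reflQ q) x (-t)) (-x) with hc
  have hc0 : c ≠ 0 := phase_ne_zero _
  obtain ⟨a1, a2⟩ := tendsto_muPlus_infty hq hsol hbc x t
  set e := exp (I * omegaPlus P q x t) with he
  have b1 : Tendsto (fun ζ => muMinus P q 0 x t ζ 0) (extInfty P) (𝓝 c) := by
    have h0 := IsModifiedJost.tendsto_snd_infty (P := P.refl) hq hu hm (-x)
    have h : Tendsto _ (extInfty P) _ := h0
    refine h.congr' ?_
    filter_upwards [eventually_mem_extInfty] with ζ hζ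
    rw [J.muMinus_eq hq hsol hbc hζ]; simp
  have b2 : Tendsto (fun ζ => muMinus P q 0 x t ζ 1) (extInfty P) (𝓝 0) := by
    have h0 := IsModifiedJost.tendsto_fst_infty (P := P.refl) hq hu hm (-x)
    have h : Tendsto _ (extInfty P) _ := h0
    refine h.congr' ?_
    filter_upwards [eventually_mem_extInfty] with ζ hζ
    rw [J.muMinus_eq hq hsol hbc hζ]; simp
  have d1 : Tendsto (fun ζ : ℂ => 1 + (P.q₀ : ℂ) ^ 2 / ζ ^ 2) (extInfty P) (𝓝 1) := by
    have h1 : Tendsto (fun ζ : ℂ => (P.q₀ : ℂ) ^ 2 / ζ ^ 2) (extInfty P) (𝓝 0) := by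
      rw [tendsto_zero_iff_norm_tendsto_zero]
      simp_rw [norm_div, norm_pow]
      exact ((tendsto_pow_atTop two_ne_zero).comp tendsto_norm_extInfty).const_div_atTop _
    simpa using h1.const_add 1
  have ha : Tendsto (aCoef P q) (extInfty P) (𝓝 (c * e)) := by
    have h1 := ((b1.mul a2).sub (b2.mul a1)).div d1 one_ne_zero
    rw [mul_zero, sub_zero, div_one] at h1
    refine h1.congr' ?_
    filter_upwards [eventually_mem_extInfty] with ζ hζ
    simp only [Pi.div_apply]
    rw [aCoef_eq hq hsol hbc hζ x t, wronskian]
  have hce : c * e ≠ 0 := mul_ne_zero hc0 (exp_ne_zero _)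
  refine ⟨?_, ?_, ha.eventually_ne hce⟩
  · have h1 := b1.div ha hce
    have e1 : c / (c * e) = exp (-(I * omegaPlus P q x t)) := by
      rw [Complex.exp_neg, ← he]
      have := exp_ne_zero (I * omegaPlus P q x t)
      field_simp
    rwa [e1] at h1
  · have h1 := b2.div ha hce
    rwa [zero_div] at h1

/- The branch point -/

omit hq hsol hbc in
theorem extUpper_subset_closure : extUpper P ⊆ closure (extUpperOpen P) := by
  intro ζ hζ
  have h1 : Tendsto (fun ε : ℝ => ζ + I * (ε : ℂ)) (𝓝[>] 0) (𝓝 ζ) := by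
    have : Continuous fun ε : ℝ => ζ + I * (ε : ℂ) := by fun_prop
    simpa using (this.tendsto 0).mono_left nhdsWithin_le_nhds
  refine mem_closure_of_tendsto h1 ?_
  filter_upwards [self_mem_nhdsWithin] with ε hε
  have hε : 0 < ε := hε
  have him : (ζ + I * (ε : ℂ)).im = ζ.im + ε := by simp
  have hre : (ζ + I * (ε : ℂ)).re = ζ.re := by simp
  refine ⟨hζ.1.trans_lt ?_, by rw [him]; linarith [hζ.2]⟩
  refine lt_of_pow_lt_pow_left₀ 2 (norm_nonneg _) ?_
  rw [← Complex.normSq_eq_norm_sq, ← Complex.normSq_eq_norm_sq, Complex.normSq_apply,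
    Complex.normSq_apply, him, hre]
  nlinarith [hζ.2]

omit hsol hbc in
/-- The arc through the branch point. -/
theorem arc_facts (s : ℝ) (hs : 0 < s) (hs' : s < 1) :
    let γ : ℝ → ℂ := fun s => I * P.q₀ * exp (s * I)
    ‖γ s‖ = P.q₀ ∧ 0 ≤ (γ s).im ∧ γ s ≠ I * P.q₀ ∧ -(P.q₀ : ℂ) ^ 2 / γ s = γ (-s) := by
  intro γ
  have hc0 : (P.q₀ : ℂ) ≠ 0 := by exact_mod_cast hq.ne'
  have e : γ s = ((-(P.q₀ * Real.sin s) : ℝ) : ℂ) + ((P.q₀ * Real.cos s : ℝ) : ℂ) * I := by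
    simp only [γ]
    rw [Complex.exp_mul_I, ← Complex.ofReal_cos, ← Complex.ofReal_sin]
    push_cast
    linear_combination (P.q₀ : ℂ) * Complex.sin s * I_sq
  have him : (γ s).im = P.q₀ * Real.cos s := by
    rw [e, Complex.add_im, Complex.ofReal_im, Complex.im_ofReal_mul, I_im, zero_add, mul_one]
  have hre : (γ s).re = -(P.q₀ * Real.sin s) := by
    rw [e, Complex.add_re, Complex.ofReal_re, Complex.re_ofReal_mul, I_re, mul_zero, add_zero]
  refine ⟨?_, ?_, ?_, ?_⟩
  · simp only [γ]
    rw [norm_mul, Complex.norm_exp_ofReal_mul_I, norm_mul, norm_I, Complex.norm_real,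
      Real.norm_of_nonneg hq.le]
    ring
  · rw [him]
    exact mul_nonneg hq.le (Real.cos_nonneg_of_mem_Icc
      ⟨by linarith [Real.pi_gt_three], by linarith [Real.pi_gt_three]⟩)
  · intro h
    have h1 := congrArg Complex.re h
    rw [hre] at h1
    simp at h1
    rcases h1 with h1 | h1
    · exact hq.ne' h1
    · exact (Real.sin_pos_of_pos_of_lt_pi hs (by linarith [Real.pi_gt_three])).ne' h1
  · simp only [γ]
    push_cast
    rw [neg_mul (s : ℂ) I, Complex.exp_neg]
    have hI := I_ne_zero
    have he := exp_ne_zero (s * I)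
    field_simp
    rw [I_sq]

omit hq hsol hbc in
theorem div_mul_div_mul_cancel₀' {a b c d : ℂ} (hc : c ≠ 0) (hd : d ≠ 0) :
    a / c * (b / d) * (c * d) = a * b := by
  field_simp

/-- The points of the arc at angles `s` and `-s` from `iq₀` are exchanged by the inversion. The
product of the Wronskians there is `q₊/q₋` times two factors `1 + q₀²/ζ²` which tend to `0`, so by
continuity the square of the Wronskian at `iq₀` is `0`. -/
theorem wronskian_branchPoint (hrefl : Reflectionless P q) :
    wronskian (muMinus P q 0 0 0 (I * P.q₀)) (muPlus P q 1 0 0 (I * P.q₀)) = 0 := by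
  have hc0 : (P.q₀ : ℂ) ≠ 0 := by exact_mod_cast hq.ne'
  set W : ℂ → ℂ := fun ζ => wronskian (muMinus P q 0 0 0 ζ) (muPlus P q 1 0 0 ζ) with hW
  set γ : ℝ → ℂ := fun s => I * P.q₀ * exp (s * I) with hγ
  have hWc : ContinuousOn W (extUpper P) := continuousOn_wronskian_mu hq hsol hbc 0 0
  have hγc : Continuous γ := by fun_prop
  have hγ0 : γ 0 = I * P.q₀ := by simp [hγ]
  have hev : ∀ᶠ s : ℝ in 𝓝[>] 0, 0 < s ∧ s < 1 := by
    filter_upwards [Ioo_mem_nhdsGT (show (0 : ℝ) < 1 by norm_num)] with s hs using hs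
  have hmem : ∀ᶠ s : ℝ in 𝓝[>] 0, γ s ∈ extUpper P ∧ γ (-s) ∈ extUpper P := by
    filter_upwards [hev] with s hs
    obtain ⟨h1, h2, h3, h4⟩ := arc_facts hq s hs.1 hs.2
    obtain ⟨h5, h6, -, -⟩ := inv_mem_arc hq h1 h2
    rw [h4] at h5 h6
    exact ⟨⟨h1.ge, h2⟩, ⟨h5.ge, h6⟩⟩
  have hlim : ∀ σ : ℝ → ℝ, Continuous σ → σ 0 = 0 → (∀ᶠ s : ℝ in 𝓝[>] 0, γ (σ s) ∈ extUpper P) →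
      Tendsto (fun s => W (γ (σ s))) (𝓝[>] 0) (𝓝 (W (I * P.q₀))) := by
    intro σ hσ hσ0 hm
    refine (hWc _ (branchPoint_mem hq)).tendsto.comp (tendsto_nhdsWithin_iff.2 ⟨?_, hm⟩)
    have := (hγc.comp hσ).tendsto 0
    simp only [Function.comp_apply, hσ0, hγ0] at this
    exact this.mono_left nhdsWithin_le_nhds
  have l1 := hlim id continuous_id rfl (hmem.mono fun _ h => h.1)
  have l2 := hlim (fun s => -s) continuous_neg neg_zero (hmem.mono fun _ h => h.2)
  have l3 : Tendsto (fun s : ℝ => qPlus P / qMinus P * ((1 + (P.q₀ : ℂ) ^ 2 / γ s ^ 2)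
      * (1 + (P.q₀ : ℂ) ^ 2 / γ (-s) ^ 2))) (𝓝[>] 0) (𝓝 0) := by
    have hne : ∀ s, γ s ≠ 0 := fun s => mul_ne_zero (mul_ne_zero I_ne_zero hc0) (exp_ne_zero _)
    have hc : Continuous fun s : ℝ => qPlus P / qMinus P * ((1 + (P.q₀ : ℂ) ^ 2 / γ s ^ 2)
        * (1 + (P.q₀ : ℂ) ^ 2 / γ (-s) ^ 2)) := by
      refine continuous_const.mul ((continuous_const.add (continuous_const.div (hγc.pow 2)
        fun s => pow_ne_zero _ (hne s))).mul (continuous_const.add (continuous_const.div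
        ((hγc.comp continuous_neg).pow 2) fun s => pow_ne_zero _ (hne _))))
    have := (hc.tendsto 0).mono_left (nhdsWithin_le_nhds (s := Ioi 0))
    convert this using 2
    rw [neg_zero, hγ0, mul_pow, I_sq]
    field_simp
    ring
  have l4 : Tendsto (fun s : ℝ => W (γ s) * W (γ (-s))) (𝓝[>] 0) (𝓝 0) := by
    refine l3.congr' ?_
    filter_upwards [hev, hmem] with s hs hm
    obtain ⟨h1, h2, h3, h4⟩ := arc_facts hq s hs.1 hs.2
    have h5 := aCoef_mul_aCoef_inv hq hsol hbc hrefl h1 h2 h3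
    have h6 := (inv_mem_arc hq h1 h2).2.2.2 h3
    rw [h4] at h5 h6
    rw [← h5, aCoef_eq hq hsol hbc hm.1 0 0, aCoef_eq hq hsol hbc hm.2 0 0]
    have n1 := one_add_ne_zero hq hm.1 h3
    have n2 := one_add_ne_zero hq hm.2 h6
    simp only [hW]
    exact div_mul_div_mul_cancel₀' n1 n2
  exact mul_self_eq_zero.1 (tendsto_nhds_unique (l1.mul l2) l4)

/-- At `iq₀` the two modified functions are proportional. A Plücker relation with an auxiliary
vector then expresses their Wronskian at `ζ` through the Wronskians of each function with its own
value at `iq₀`, and both of these are `O(λ)`. Division by `1 + q₀²/ζ² = 2λ/ζ` leaves a finite limit.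
-/
theorem exists_aCoef_limit_open (hrefl : Reflectionless P q) :
    ∃ L, Tendsto (aCoef P q) (𝓝[extUpperOpen P] (I * P.q₀)) (𝓝 L) := by
  obtain ⟨J⟩ := exists_jostPair hq hsol hbc
  have hz := branchPoint_mem (P := P) hq
  set ζ₀ : ℂ := I * P.q₀ with hζ₀
  have hM0 : muPlus P q 1 0 0 ζ₀ ≠ 0 := smul_ne_zero (by simp [colExp])
    ((isJost_psiPlus hq hsol hbc hz).ne_zero hsol 0 0)
  have hN0 : muMinus P q 0 0 0 ζ₀ ≠ 0 := smul_ne_zero (by simp [colExp])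
    ((isJost_psiMinus hq hsol hbc hz).ne_zero hsol 0 0)
  obtain ⟨γ, hγ⟩ := exists_smul_eq_of_wronskian_eq_zero hM0
    (wronskian_branchPoint hq hsol hbc hrefl)
  obtain ⟨e, he⟩ := exists_wronskian_ne_zero hN0
  set M := fun ζ => muPlus P q 1 0 0 ζ
  set N := fun ζ => muMinus P q 0 0 0 ζ
  obtain ⟨L1, hL1⟩ := (J.isModifiedJost_top 0).tendsto_wronskian_div_lam hq
    (isStep_envelope hq hsol hbc 0) 0
  obtain ⟨L2, hL2⟩ := (J.isModifiedJost_bot (-0)).tendsto_wronskian_div_lam (P := P.refl) hq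
    (isStep_envelope (P := P.refl) hq (isSolution_refl hsol) (hasNZBC_refl hsol hbc) (-0)) (-0)
  have k1 : Tendsto (fun ζ => wronskian (M ζ) (M ζ₀) / lam P ζ) (𝓝[extUpperOpen P] ζ₀)
      (𝓝 L1) := by
    refine hL1.congr' ?_
    filter_upwards [self_mem_nhdsWithin] with ζ hζ
    simp only [M]
    rw [J.muPlus_eq hq hsol hbc (extUpperOpen_subset P hζ), J.muPlus_eq hq hsol hbc hz, wronskian]
    simp [hζ₀]
  have k2 : Tendsto (fun ζ => wronskian (N ζ) (N ζ₀) / lam P ζ) (𝓝[extUpperOpen P] ζ₀)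
      (𝓝 (-L2)) := by
    have h : Tendsto _ (𝓝[extUpperOpen P] ζ₀) (𝓝 L2) := hL2
    refine h.neg.congr' ?_
    filter_upwards [self_mem_nhdsWithin] with ζ hζ
    simp only [N]
    rw [J.muMinus_eq hq hsol hbc (extUpperOpen_subset P hζ), J.muMinus_eq hq hsol hbc hz, wronskian,
      ← neg_div]
    simp [hζ₀]
  have hle : 𝓝[extUpperOpen P] ζ₀ ≤ 𝓝[extUpper P] ζ₀ :=
    nhdsWithin_mono _ (extUpperOpen_subset P)
  have m1 : Tendsto M (𝓝[extUpperOpen P] ζ₀) (𝓝 (M ζ₀)) :=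
    (continuousOn_muPlus hq hsol hbc 0 0 ζ₀ hz).tendsto.mono_left hle
  have m2 : Tendsto N (𝓝[extUpperOpen P] ζ₀) (𝓝 (N ζ₀)) :=
    (continuousOn_muMinus hq hsol hbc 0 0 ζ₀ hz).tendsto.mono_left hle
  have we : ∀ {F : ℂ → Fin 2 → ℂ} {v}, Tendsto F (𝓝[extUpperOpen P] ζ₀) (𝓝 v) →
      Tendsto (fun ζ => wronskian (F ζ) e) (𝓝[extUpperOpen P] ζ₀) (𝓝 (wronskian v e)) :=
    fun hF => (continuous_wronskian.tendsto _).comp (hF.prodMk_nhds tendsto_const_nhds)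
  have hid : Tendsto (fun ζ : ℂ => ζ) (𝓝[extUpperOpen P] ζ₀) (𝓝 ζ₀) :=
    tendsto_id.mono_left nhdsWithin_le_nhds
  have key := ((((k2.mul (we m1)).sub ((we m2).mul (k1.const_mul γ))).div_const
    (wronskian (N ζ₀) e)).mul hid).div_const 2
  refine ⟨_, key.congr' ?_⟩
  filter_upwards [self_mem_nhdsWithin] with ζ hζ
  have hζU := extUpperOpen_subset P hζ
  have hζ0 := ne_zero_of_mem_extUpper hq hζU
  have hl : lam P ζ ≠ 0 := fun h0 => by
    have := lam_im_pos hq hζ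
    rw [h0] at this; simp at this
  rw [aCoef_eq hq hsol hbc hζU 0 0, one_add_eq hζ0]
  have pl := wronskian_mul (N ζ) (M ζ) (N ζ₀) e
  have hg : wronskian (M ζ) (N ζ₀) = γ * wronskian (M ζ) (M ζ₀) := by
    rw [← wronskian_smul_right]; congr 1
  rw [hg] at pl
  have : wronskian (N ζ) (M ζ) = (wronskian (N ζ) (N ζ₀) * wronskian (M ζ) e -
      wronskian (N ζ) e * (γ * wronskian (M ζ) (M ζ₀))) / wronskian (N ζ₀) e := by
    rw [eq_div_iff he, pl]
  simp only [M, N] at this ⊢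
  rw [this]
  field_simp

/-- Continuity of `a` away from `iq₀` extends the limit to the closed region. Taken along the arc
from both sides it satisfies `L² = q₊/q₋`, hence `L ≠ 0`. -/
theorem exists_aCoef_limit (hrefl : Reflectionless P q) : ∃ L, L ≠ 0 ∧
    Tendsto (aCoef P q) (𝓝[extUpper P \ {I * (P.q₀ : ℂ)}] (I * P.q₀)) (𝓝 L) := by
  obtain ⟨L, hL⟩ := exists_aCoef_limit_open hq hsol hbc hrefl
  have hac := continuousOn_aCoef hq hsol hbc
  set ζ₀ : ℂ := I * P.q₀ with hζ₀
  have hlim : Tendsto (aCoef P q) (𝓝[extUpper P \ {ζ₀}] ζ₀) (𝓝 L) := by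
    rw [Metric.tendsto_nhdsWithin_nhds] at hL ⊢
    intro ε hε
    obtain ⟨δ, hδ, h⟩ := hL (ε / 2) (by positivity)
    refine ⟨δ, hδ, fun {w} hw hwd => ?_⟩
    have hcl : w ∈ closure (extUpperOpen P ∩ Metric.ball ζ₀ δ) := by
      rw [inter_comm]
      exact Metric.isOpen_ball.inter_closure ⟨hwd, extUpper_subset_closure hw.1⟩
    have hsub : extUpperOpen P ∩ Metric.ball ζ₀ δ ⊆ extUpper P \ {ζ₀} := fun z hz =>
      ⟨extUpperOpen_subset P hz.1, ne_branchPoint_of_mem hq hz.1⟩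
    have h1 : dist (aCoef P q w) L ≤ ε / 2 := by
      have h2 : ContinuousWithinAt (fun z => dist (aCoef P q z) L)
          (extUpperOpen P ∩ Metric.ball ζ₀ δ) w := ((hac w hw).mono hsub).dist
        continuousWithinAt_const
      exact h2.closure_le hcl continuousWithinAt_const fun z hz => (h hz.1 hz.2).le
    linarith
  refine ⟨L, ?_, hlim⟩
  set γ : ℝ → ℂ := fun s => I * P.q₀ * exp (s * I) with hγ
  have hγc : Continuous γ := by fun_prop
  have hγ0 : γ 0 = ζ₀ := by simp [hγ, hζ₀]
  have hev : ∀ᶠ s : ℝ in 𝓝[>] 0, 0 < s ∧ s < 1 := by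
    filter_upwards [Ioo_mem_nhdsGT (show (0 : ℝ) < 1 by norm_num)] with s hs using hs
  have lim : ∀ σ : ℝ → ℝ, Continuous σ → σ 0 = 0 →
      (∀ᶠ s : ℝ in 𝓝[>] 0, γ (σ s) ∈ extUpper P \ {ζ₀}) →
      Tendsto (fun s => aCoef P q (γ (σ s))) (𝓝[>] 0) (𝓝 L) := by
    intro σ hσ hσ0 hm
    refine hlim.comp (tendsto_nhdsWithin_iff.2 ⟨?_, hm⟩)
    have := (hγc.comp hσ).tendsto 0
    simp only [Function.comp_apply, hσ0, hγ0] at this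
    exact this.mono_left nhdsWithin_le_nhds
  have l1 := lim id continuous_id rfl (by
    filter_upwards [hev] with s hs
    obtain ⟨h1, h2, h3, -⟩ := arc_facts hq s hs.1 hs.2
    exact ⟨⟨h1.ge, h2⟩, h3⟩)
  have l2 := lim (fun s => -s) continuous_neg neg_zero (by
    filter_upwards [hev] with s hs
    obtain ⟨h1, h2, h3, h4⟩ := arc_facts hq s hs.1 hs.2
    obtain ⟨h5, h6, -, h8⟩ := inv_mem_arc hq h1 h2
    have h9 := h8 h3
    rw [h4] at h5 h6 h9
    exact ⟨⟨h5.ge, h6⟩, h9⟩)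
  have l3 : Tendsto (fun s : ℝ => aCoef P q (γ s) * aCoef P q (γ (-s))) (𝓝[>] 0)
      (𝓝 (qPlus P / qMinus P)) := by
    refine tendsto_const_nhds.congr' ?_
    filter_upwards [hev] with s hs
    obtain ⟨h1, h2, h3, h4⟩ := arc_facts hq s hs.1 hs.2
    rw [← aCoef_mul_aCoef_inv hq hsol hbc hrefl h1 h2 h3, h4]
  have h := tendsto_nhds_unique (l1.mul l2) l3
  rintro rfl
  have hp : qPlus P ≠ 0 := by rw [← norm_pos_iff, norm_qPlus hq]; exact hq
  have hm : qMinus P ≠ 0 := by rw [← norm_pos_iff, norm_qMinus hq]; exact hq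
  rw [mul_zero] at h
  exact div_ne_zero hp hm h.symm

theorem exists_muMinus_div_limit (hrefl : Reflectionless P q) (x t : ℝ) (i : Fin 2) : ∃ L,
    Tendsto (fun ζ => muMinus P q 0 x t ζ i / aCoef P q ζ)
      (𝓝[extUpper P \ {I * (P.q₀ : ℂ)}] (I * P.q₀)) (𝓝 L) := by
  obtain ⟨L, hL0, hL⟩ := exists_aCoef_limit hq hsol hbc hrefl
  have h1 := (continuousOn_muMinus hq hsol hbc x t _ (branchPoint_mem hq)).tendsto.mono_left
    (nhdsWithin_mono _ (sdiff_subset (t := {I * (P.q₀ : ℂ)})))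
  exact ⟨_, (tendsto_pi_nhds.1 h1 i).div hL hL0⟩

end

end KE

end

/-! ### Continuous dependence on `ζ` and the norming constants -/

noncomputable section

namespace KE

section

variable {P : Params} {q : ℝ → ℝ → ℂ} {ζ₀ : ℂ}

theorem continuousAt_zOf (h : ζ₀ ≠ 0) : ContinuousAt (zOf P) ζ₀ := by
  unfold zOf
  exact (((continuousAt_id.sub (continuousAt_const.div continuousAt_id h)).div_const 2).add
    continuousAt_const).sub continuousAt_const

theorem continuousAt_laxX (hq : Continuous fun r : ℝ × ℝ => q r.1 r.2) (h : ζ₀ ≠ 0) (x t : ℝ) :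
    ContinuousAt (fun r : ℂ × ℝ × ℝ => laxX P q r.1 r.2.1 r.2.2) (ζ₀, x, t) := by
  have h0 : Continuous fun r : ℂ × ℝ × ℝ => q r.2.1 r.2.2 := hq.comp continuous_snd
  have h1 : Continuous fun r : ℂ × ℝ × ℝ => conj (q r.2.1 r.2.2) :=
    Complex.continuous_conj.comp h0
  have h2 : Continuous fun r : ℂ × ℝ × ℝ => ((Ups P r.2.1 r.2.2 : ℝ) : ℂ) :=
    (continuous_Ups (P := P)).comp continuous_snd
  have hz : ContinuousAt (fun r : ℂ × ℝ × ℝ => zOf P r.1) (ζ₀, x, t) :=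
    ContinuousAt.comp (f := fun r : ℂ × ℝ × ℝ => r.1) (continuousAt_zOf h) continuousAt_fst
  refine continuousAt_pi.2 fun i => continuousAt_pi.2 fun j => ?_
  simp only [laxX_eq]
  fin_cases i <;> fin_cases j <;> simp <;> fun_prop

theorem continuousAt_laxT_entries {X : Type*} [TopologicalSpace X] {r₀ : X} {u v z y : X → ℂ}
    (hu : ContinuousAt u r₀) (hv : ContinuousAt v r₀) (hz : ContinuousAt z r₀)
    (hy : ContinuousAt y r₀) (T k : ℂ) :
    ContinuousAt (fun r => I * (conj (u r) * u r) + 4 * I * T ^ 2 * (conj (u r) * u r) ^ 2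
      + T * (u r * conj (v r) - v r * conj (u r)) - 2 * I * (z r ^ 2 + k / 4)) r₀ ∧
    ContinuousAt (fun r => (I * v r + 2 * z r * u r + 2 * T * (conj (u r) * u r) * u r)
      * exp (-(I * y r))) r₀ ∧
    ContinuousAt (fun r => (I * conj (v r) - 2 * z r * conj (u r)
      - 2 * T * (conj (u r) * u r) * conj (u r)) * exp (I * y r)) r₀ := by
  have hu' : ContinuousAt (fun r => conj (u r)) r₀ := Complex.continuous_conj.continuousAt.comp hu
  have hv' : ContinuousAt (fun r => conj (v r)) r₀ := Complex.continuous_conj.continuousAt.comp hv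
  refine ⟨?_, ?_, ?_⟩ <;> fun_prop

theorem continuousAt_laxT {T : ℝ} (hsol : IsSolution T q) (h : ζ₀ ≠ 0) (x t : ℝ) :
    ContinuousAt (fun r : ℂ × ℝ × ℝ => laxT P q r.1 r.2.1 r.2.2) (ζ₀, x, t) := by
  have h0 : Continuous fun r : ℂ × ℝ × ℝ => q r.2.1 r.2.2 := hsol.continuous.comp continuous_snd
  have h1 : Continuous fun r : ℂ × ℝ × ℝ => derivX q r.2.1 r.2.2 :=
    hsol.continuous_derivX.comp continuous_snd
  have h2 : Continuous fun r : ℂ × ℝ × ℝ => ((Ups P r.2.1 r.2.2 : ℝ) : ℂ) :=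
    (continuous_Ups (P := P)).comp continuous_snd
  have hz : ContinuousAt (fun r : ℂ × ℝ × ℝ => zOf P r.1) (ζ₀, x, t) :=
    ContinuousAt.comp (f := fun r : ℂ × ℝ × ℝ => r.1) (continuousAt_zOf h) continuousAt_fst
  obtain ⟨e1, e2, e3⟩ := continuousAt_laxT_entries h0.continuousAt h1.continuousAt hz
    h2.continuousAt P.T (rate P)
  refine continuousAt_pi.2 fun i => continuousAt_pi.2 fun j => ?_
  simp only [laxT_eq, laxTdiag]
  fin_cases i <;> fin_cases j
  · exact e1
  · exact e2
  · exact e3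
  · exact e1.neg

/-- Linear equations depending continuously on a parameter: limits of solutions propagate. -/
theorem tendsto_of_matrix_ODE {M : ℂ → ℝ → Matrix (Fin 2) (Fin 2) ℂ}
    (hM : ∀ s, ContinuousAt (fun r : ℂ × ℝ => M r.1 r.2) (ζ₀, s)) {y : ℂ → ℝ → Fin 2 → ℂ}
    {z : ℝ → Fin 2 → ℂ}
    (hy : ∀ᶠ ζ in 𝓝[≠] ζ₀, ∀ s, HasDerivAt (y ζ) ((M ζ s).mulVec (y ζ s)) s)
    (hz : ∀ s, HasDerivAt z ((M ζ₀ s).mulVec (z s)) s) {a : ℝ}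
    (ha : Tendsto (fun ζ => y ζ a) (𝓝[≠] ζ₀) (𝓝 (z a))) (b : ℝ) :
    Tendsto (fun ζ => y ζ b) (𝓝[≠] ζ₀) (𝓝 (z b)) := by
  have hS : ∀ s, ContinuousAt (fun r : ℂ × ℝ => ∑ i, ∑ j, ‖M r.1 r.2 i j‖) (ζ₀, s) := by
    intro s
    have h := fun i j => (continuousAt_pi.1 (continuousAt_pi.1 (hM s) i) j).norm
    simp only [Fin.sum_univ_two]
    exact ((h 0 0).add (h 0 1)).add ((h 1 0).add (h 1 1))
  have hS0 : Continuous fun s : ℝ => ∑ i, ∑ j, ‖M ζ₀ s i j‖ := continuous_iff_continuousAt.2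
    fun s => ContinuousAt.comp (f := fun s : ℝ => (ζ₀, s)) (hS s) (by fun_prop)
  obtain ⟨K, hK⟩ := (isCompact_uIcc (a := a) (b := b)).exists_bound_of_continuousOn
    hS0.continuousOn
  have hzc : Continuous z := continuous_iff_continuousAt.2 fun s => (hz s).continuousAt
  have e1 : ∀ᶠ ζ in 𝓝 ζ₀, ∀ s ∈ uIcc a b, ∑ i, ∑ j, ‖M ζ s i j‖ < K + 1 :=
    isCompact_uIcc.eventually_forall_of_forall_eventually fun s hs =>
      (hS s).eventually_lt continuousAt_const (lt_of_le_of_lt (le_abs_self _)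
        (lt_of_le_of_lt (hK s hs) (lt_add_one K)))
  refine tendsto_of_ODE (l := 𝓝[≠] ζ₀) (a := a) (b := b) (K := K + 1)
    (v := fun ζ s p => (M ζ s).mulVec p) (z' := fun s => (M ζ₀ s).mulVec (z s)) ?_
    (hy.mono fun ζ h s _ => h s) (fun s _ => hz s) ?_ ha
  · filter_upwards [e1.filter_mono nhdsWithin_le_nhds] with ζ h s hs p r
    exact (mulVec_lipschitz _ _ _).trans (mul_le_mul_of_nonneg_right (h s hs).le (norm_nonneg _))
  · intro ε hε
    refine Filter.Eventually.filter_mono nhdsWithin_le_nhds ?_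
    refine isCompact_uIcc.eventually_forall_of_forall_eventually fun s hs => ?_
    have c1 : ContinuousAt (fun r : ℂ × ℝ => (M r.1 r.2).mulVec (z r.2)) (ζ₀, s) := by
      have h2 : ContinuousAt (fun r : ℂ × ℝ => z r.2) (ζ₀, s) := by fun_prop
      have h := fun i j => (continuousAt_pi.1 (continuousAt_pi.1 (hM s) i) j).mul
        (continuousAt_pi.1 h2 j)
      refine continuousAt_pi.2 fun i => ?_
      have : (fun r : ℂ × ℝ => (M r.1 r.2).mulVec (z r.2) i) =
          fun r => M r.1 r.2 i 0 * z r.2 0 + M r.1 r.2 i 1 * z r.2 1 := by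
        funext r; simp [Matrix.mulVec, dotProduct]
      rw [this]
      exact (h i 0).add (h i 1)
    have c2 : ContinuousAt (fun r : ℂ × ℝ => (M ζ₀ r.2).mulVec (z r.2)) (ζ₀, s) :=
      ContinuousAt.comp (g := fun r : ℂ × ℝ => (M r.1 r.2).mulVec (z r.2))
        (f := fun r : ℂ × ℝ => (ζ₀, r.2)) (x := (ζ₀, s)) c1 (by fun_prop)
    have h := (c2.sub c1).norm.eventually_lt (continuousAt_const (y := ε)) (by simpa using hε)
    exact h.mono fun r hr => hr.le

/-- The derivative in `ζ` of a family of solutions of the Lax pair at one of its zeros. -/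
theorem hasDerivAt_of_isLaxSol (hsol : IsSolution P.T q) (h0 : ζ₀ ≠ 0)
    {H : ℂ → ℝ → ℝ → Fin 2 → ℂ} {K : ℝ → ℝ → Fin 2 → ℂ}
    (hH : ∀ᶠ ζ in 𝓝[≠] ζ₀, IsLaxSol P q ζ (H ζ)) (hH0 : H ζ₀ = 0) (hK : IsLaxSol P q ζ₀ K)
    {x₀ t₀ : ℝ} (h : HasDerivAt (fun ζ => H ζ x₀ t₀) (K x₀ t₀) ζ₀) (x t : ℝ) :
    HasDerivAt (fun ζ => H ζ x t) (K x t) ζ₀ := by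
  have e : ∀ x t, HasDerivAt (fun ζ => H ζ x t) (K x t) ζ₀ ↔
      Tendsto (fun ζ => ((ζ - ζ₀)⁻¹ • H ζ) x t) (𝓝[≠] ζ₀) (𝓝 (K x t)) := by
    intro x t
    rw [hasDerivAt_iff_tendsto_slope]
    refine tendsto_congr fun ζ => ?_
    simp [slope, hH0]
  -- Since `H` vanishes at `ζ₀`, its difference quotient is a scalar multiple of `H ζ` and so solves
  -- the Lax pair at `ζ`. Its limit at one point therefore propagates, first in `x`, then in `t`.
  have hL : ∀ᶠ ζ in 𝓝[≠] ζ₀, IsLaxSol P q ζ ((ζ - ζ₀)⁻¹ • H ζ) :=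
    hH.mono fun ζ h => h.smul _
  rw [e] at h ⊢
  have h1 : Tendsto (fun ζ => ((ζ - ζ₀)⁻¹ • H ζ) x t₀) (𝓝[≠] ζ₀) (𝓝 (K x t₀)) :=
    tendsto_of_matrix_ODE (M := fun ζ x => laxX P q ζ x t₀)
      (y := fun ζ x => ((ζ - ζ₀)⁻¹ • H ζ) x t₀) (z := fun x => K x t₀)
      (fun s => ContinuousAt.comp (g := fun r : ℂ × ℝ × ℝ => laxX P q r.1 r.2.1 r.2.2)
        (f := fun r : ℂ × ℝ => (r.1, r.2, t₀)) (x := (ζ₀, s))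
        (continuousAt_laxX hsol.continuous h0 s t₀) (by fun_prop))
      (hL.mono fun ζ h x => h.fst x t₀) (fun x => hK.fst x t₀) h x
  exact tendsto_of_matrix_ODE (M := fun ζ t => laxT P q ζ x t)
      (y := fun ζ t => ((ζ - ζ₀)⁻¹ • H ζ) x t) (z := fun t => K x t)
      (fun s => ContinuousAt.comp (g := fun r : ℂ × ℝ × ℝ => laxT P q r.1 r.2.1 r.2.2)
        (f := fun r : ℂ × ℝ => (r.1, x, r.2)) (x := (ζ₀, s))
        (continuousAt_laxT hsol h0 x s) (by fun_prop))
      (hL.mono fun ζ h t => h.snd x t) (fun t => hK.snd x t) h1 t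

theorem differentiableAt_Theta (h0 : ζ₀ ≠ 0) (x t : ℝ) :
    DifferentiableAt ℂ (fun ζ => Theta P x t ζ) ζ₀ := by
  unfold Theta lam zOf
  fun_prop (disch := exact h0)

theorem hasDerivAt_Theta (h0 : ζ₀ ≠ 0) (x t : ℝ) :
    HasDerivAt (fun ζ => Theta P x t ζ) (dTheta P x t ζ₀) ζ₀ :=
  (differentiableAt_Theta h0 x t).hasDerivAt

variable (hq : 0 < P.q₀) (hsol : IsSolution P.T q) (hbc : HasNZBC P q)
include hq hsol hbc

/-- Let `F = ψ₋₁` and `G = ψ₊₂`. Their Wronskian is `a (1 + q₀²/ζ²)`, which vanishes at `ζ₀`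
together with its derivative. The first fact gives `F = bG`; the second says that `Ḟ - bĠ` has zero
Wronskian with `G`, so it equals `dG` at the origin, and then everywhere because `F - bG` is a
family of solutions vanishing at `ζ₀`. Differentiating the exponential factors yields the stated
form. -/
theorem exists_norming (hζ : ζ₀ ∈ extUpperOpen P) (ha : aCoef P q ζ₀ = 0)
    (hda : deriv (aCoef P q) ζ₀ = 0) : ∃ b d : ℂ, ∀ x t,
    muMinus P q 0 x t ζ₀ = (exp (2 * I * Theta P x t ζ₀) * b) • muPlus P q 1 x t ζ₀ ∧
    deriv (fun w => muMinus P q 0 x t w) ζ₀ = exp (2 * I * Theta P x t ζ₀) •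
      (d • muPlus P q 1 x t ζ₀ + (2 * I * dTheta P x t ζ₀ * b) • muPlus P q 1 x t ζ₀
        + b • deriv (fun w => muPlus P q 1 x t w) ζ₀) := by
  have hζU := extUpperOpen_subset P hζ
  have hζ0 := ne_zero_of_mem_extUpper hq hζU
  have hnhd := (isOpen_extUpperOpen P).mem_nhds hζ
  set F := psiMinus P q 0 with hF
  set G := psiPlus P q 1 with hG
  have hFL : ∀ ζ ∈ extUpperOpen P, IsLaxSol P q ζ (F ζ) := fun ζ h =>
    (isJost_psiMinus hq hsol hbc (extUpperOpen_subset P h)).isLaxSol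
  have hGL : ∀ ζ ∈ extUpperOpen P, IsLaxSol P q ζ (G ζ) := fun ζ h =>
    (isJost_psiPlus hq hsol hbc (extUpperOpen_subset P h)).isLaxSol
  have hG0 : G ζ₀ 0 0 ≠ 0 := (isJost_psiPlus hq hsol hbc hζU).ne_zero hsol 0 0
  have hmu : ∀ ζ x t, muPlus P q 1 x t ζ = exp (-(I * Theta P x t ζ)) • G ζ x t := fun ζ x t => by
    simp [muPlus, colExp, hG]
  have hmu' : ∀ ζ x t, muMinus P q 0 x t ζ = exp (I * Theta P x t ζ) • F ζ x t := fun ζ x t => by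
    simp [muMinus, colExp, hF]
  have hdM : ∀ x t, DifferentiableAt ℂ (fun ζ => muPlus P q 1 x t ζ) ζ₀ := fun x t =>
    (differentiableOn_muPlus hq hsol hbc x t).differentiableAt hnhd
  have hdN : ∀ x t, DifferentiableAt ℂ (fun ζ => muMinus P q 0 x t ζ) ζ₀ := fun x t =>
    (differentiableOn_muMinus hq hsol hbc x t).differentiableAt hnhd
  have hdG : ∀ x t, DifferentiableAt ℂ (fun ζ => G ζ x t) ζ₀ := fun x t => by
    have : (fun ζ => G ζ x t) = fun ζ => exp (I * Theta P x t ζ) • muPlus P q 1 x t ζ := by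
      funext ζ
      rw [hmu, smul_smul, ← Complex.exp_add, add_neg_cancel, Complex.exp_zero, one_smul]
    rw [this]
    exact ((differentiableAt_Theta hζ0 x t).const_mul I).cexp.smul (hdM x t)
  have hdF : ∀ x t, DifferentiableAt ℂ (fun ζ => F ζ x t) ζ₀ := fun x t => by
    have : (fun ζ => F ζ x t) = fun ζ => exp (-(I * Theta P x t ζ)) • muMinus P q 0 x t ζ := by
      funext ζ
      rw [hmu', smul_smul, ← Complex.exp_add, neg_add_cancel, Complex.exp_zero, one_smul]
    rw [this]
    exact ((differentiableAt_Theta hζ0 x t).const_mul I).neg.cexp.smul (hdN x t)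
  -- the Wronskian vanishes to second order
  have hW : ∀ ζ ∈ extUpperOpen P, wronskian (F ζ 0 0) (G ζ 0 0) =
      aCoef P q ζ * (1 + (P.q₀ : ℂ) ^ 2 / ζ ^ 2) := fun ζ h => by
    rw [aCoef, div_mul_cancel₀ _ (one_add_ne_zero hq (extUpperOpen_subset P h)
      (ne_branchPoint_of_mem hq h))]
  have hW0 : wronskian (F ζ₀ 0 0) (G ζ₀ 0 0) = 0 := by rw [hW _ hζ, ha, zero_mul]
  obtain ⟨b, hb⟩ := exists_smul_eq_of_wronskian_eq_zero hG0 hW0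
  have hbx : F ζ₀ = b • G ζ₀ := (hFL _ hζ).ext hsol ((hGL _ hζ).smul b) hb
  have hF' := (hdF 0 0).hasDerivAt
  have hG' := (hdG 0 0).hasDerivAt
  set F' := deriv (fun ζ => F ζ 0 0) ζ₀
  set G' := deriv (fun ζ => G ζ 0 0) ζ₀
  have hW' : wronskian F' (G ζ₀ 0 0) + wronskian (F ζ₀ 0 0) G' = 0 := by
    have d1 : HasDerivAt (fun ζ => wronskian (F ζ 0 0) (G ζ 0 0))
        (wronskian F' (G ζ₀ 0 0) + wronskian (F ζ₀ 0 0) G') ζ₀ := by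
      have f := hasDerivAt_pi.1 hF'
      have g := hasDerivAt_pi.1 hG'
      refine (((f 0).mul (g 1)).sub ((f 1).mul (g 0))).congr_deriv ?_
      simp only [wronskian]; ring
    have d2 : HasDerivAt (fun ζ => wronskian (F ζ 0 0) (G ζ 0 0)) 0 ζ₀ := by
      have da := ((differentiableOn_aCoef hq hsol hbc).differentiableAt hnhd).hasDerivAt
      have dc : DifferentiableAt ℂ (fun ζ : ℂ => 1 + (P.q₀ : ℂ) ^ 2 / ζ ^ 2) ζ₀ := by
        fun_prop (disch := exact pow_ne_zero 2 hζ0)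
      have := da.mul dc.hasDerivAt
      rw [hda, ha, zero_mul, zero_mul, add_zero] at this
      exact this.congr_of_eventuallyEq (by filter_upwards [hnhd] with ζ h using hW ζ h)
    exact d1.unique d2
  have hd0 : wronskian (F' - b • G') (G ζ₀ 0 0) = 0 := by
    rw [hb] at hW'
    rw [← hW']
    simp [wronskian]; ring
  obtain ⟨d, hd⟩ := exists_smul_eq_of_wronskian_eq_zero hG0 hd0
  have hH : ∀ x t, HasDerivAt (fun ζ => (F ζ - b • G ζ) x t) ((d • G ζ₀) x t) ζ₀ := by
    refine hasDerivAt_of_isLaxSol hsol hζ0 (x₀ := 0) (t₀ := 0) ?_ ?_ ((hGL _ hζ).smul d) ?_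
    · filter_upwards [nhdsWithin_le_nhds hnhd] with ζ h
      exact (hFL _ h).sub ((hGL _ h).smul b)
    · rw [hbx, sub_self]
    · refine (hF'.sub (hG'.const_smul b)).congr_deriv hd
  have hFd : ∀ x t, HasDerivAt (fun ζ => F ζ x t)
      (d • G ζ₀ x t + b • deriv (fun ζ => G ζ x t) ζ₀) ζ₀ := fun x t =>
    ((hH x t).add ((hdG x t).hasDerivAt.const_smul b)).congr_of_eventuallyEq
      (Eventually.of_forall fun ζ => by simp)
  refine ⟨b, d, fun x t => ⟨?_, ?_⟩⟩
  · rw [hmu, hmu', hbx, smul_smul]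
    show _ • b • G ζ₀ x t = _
    rw [smul_smul]
    congr 1
    rw [show I * Theta P x t ζ₀ = 2 * I * Theta P x t ζ₀ + -(I * Theta P x t ζ₀) by ring,
      Complex.exp_add]
    ring_nf
  · have hT := hasDerivAt_Theta (P := P) hζ0 x t
    have n1 : HasDerivAt (fun ζ => muMinus P q 0 x t ζ) _ ζ₀ :=
      ((hT.const_mul I).cexp.smul (hFd x t)).congr_of_eventuallyEq
        (Eventually.of_forall fun ζ => hmu' ζ x t)
    have n2 : HasDerivAt (fun ζ => muPlus P q 1 x t ζ) _ ζ₀ :=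
      ((hT.const_mul I).neg.cexp.smul (hdG x t).hasDerivAt).congr_of_eventuallyEq
        (Eventually.of_forall fun ζ => hmu ζ x t)
    rw [n1.deriv, n2.deriv, hmu, hbx]
    have e1 : exp (2 * I * Theta P x t ζ₀) = exp (I * Theta P x t ζ₀) * exp (I * Theta P x t ζ₀) := by
      rw [← Complex.exp_add]; ring_nf
    have e2 := Complex.exp_neg (I * Theta P x t ζ₀)
    have e3 := exp_ne_zero (I * Theta P x t ζ₀)
    simp only [Pi.neg_apply]
    rw [e1, e2]
    generalize exp (I * Theta P x t ζ₀) = E at e3 ⊢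
    funext i
    simp only [Pi.add_apply, Pi.smul_apply, smul_eq_mul]
    field_simp
    ring

theorem exists_isNorming {N : ℕ} {ζ : Fin N → ℂ} (hζ : HasDoubleZeros P q ζ) :
    ∃ b d : Fin N → ℂ, IsNorming P q ζ b d := by
  have h := fun j => exists_norming hq hsol hbc (ζ₀ := ζ j) ⟨hζ.norm_gt j, hζ.im_pos j⟩
    ((hζ.zero_iff _ (hζ.norm_gt j) (hζ.im_pos j)).2 ⟨j, rfl⟩) (hζ.deriv_eq j)
  choose b d h using h
  exact ⟨b, d, fun j x t => h j x t⟩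

end

end KE

end

/-! ### Removable singularities and relations at double poles -/

noncomputable section

namespace KE

open Asymptotics

/-- Painlevé's theorem for a segment: a continuous function which is holomorphic off the real line
is holomorphic. -/
theorem differentiableAt_of_im_ne_zero {F : ℂ → ℂ} {x₀ : ℂ} (hx : x₀.im = 0)
    (hc : ∀ᶠ ζ in 𝓝 x₀, ContinuousAt F ζ)
    (hd : ∀ᶠ ζ in 𝓝 x₀, ζ.im ≠ 0 → DifferentiableAt ℂ F ζ) : DifferentiableAt ℂ F x₀ := by
  obtain ⟨r, hr, hb⟩ := Metric.eventually_nhds_iff_ball.1 (hc.and hd)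
  have hcont : ContinuousOn F (Metric.ball x₀ r) := fun ζ h => (hb ζ h).1.continuousWithinAt
  have hmono : ∀ p p' : ℂ, p.re = p'.re → |p.im| ≤ |p'.im| → p' ∈ Metric.ball x₀ r →
      p ∈ Metric.ball x₀ r := by
    intro p p' hre him h
    refine Metric.mem_ball.2 (lt_of_le_of_lt ?_ (Metric.mem_ball.1 h))
    rw [Complex.dist_eq_re_im, Complex.dist_eq_re_im, hre, hx, sub_zero, sub_zero]
    exact Real.sqrt_le_sqrt (by have := sq_le_sq.2 him; linarith)
  -- Morera: a rectangle is cut along the real axis, and Cauchy's theorem holds on each piece for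
  -- functions continuous up to the boundary. The disc is centred on the axis, so it contains the
  -- pieces even when the rectangle does not meet the axis.
  have hcons : IsConservativeOn F (Metric.ball x₀ r) := by
    intro z w hzw
    rw [← add_eq_zero_iff_eq_neg, wedgeIntegral_add_wedgeIntegral_eq]
    have hrect : ∀ x ∈ uIcc z.re w.re, ∀ y ∈ uIcc z.im w.im, (⟨x, y⟩ : ℂ) ∈ Metric.ball x₀ r :=
      fun x hx y hy => hzw ⟨hx, hy⟩
    have half : ∀ s : ℝ, s ∈ uIcc z.im w.im → uIcc z.re w.re ×ℂ uIcc s 0 ⊆ Metric.ball x₀ r := by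
      rintro s hs p ⟨hp1, hp2⟩
      refine hmono p ⟨p.re, s⟩ rfl ?_ (hrect _ hp1 s hs)
      have hp2 : p.im ∈ uIcc s 0 := hp2
      have := abs_sub_right_of_mem_uIcc hp2
      simpa using this
    have hz0 := half z.im left_mem_uIcc
    have hw0 := half w.im right_mem_uIcc
    have hne : ∀ s y : ℝ, y ∈ Ioo (min s 0) (max s 0) → y ≠ 0 := by
      rintro s y ⟨h1, h2⟩ rfl
      rcases min_lt_iff.1 h1 with h | h
      · rcases lt_max_iff.1 h2 with h' | h'
        · linarith
        · exact lt_irrefl _ h'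
      · exact lt_irrefl _ h
    have hsub : ∀ s : ℝ, (Ioo (min z.re w.re) (max z.re w.re)) ×ℂ Ioo (min s 0) (max s 0) ⊆
        uIcc z.re w.re ×ℂ uIcc s 0 := fun s p hp =>
      ⟨Ioo_subset_Icc_self hp.1, Ioo_subset_Icc_self hp.2⟩
    have b1 := integral_boundary_rect_eq_zero_of_continuousOn_of_differentiableOn F z ⟨w.re, 0⟩
      (hcont.mono hz0) (fun p hp =>
        ((hb p (hz0 (hsub _ hp))).2 (hne _ _ hp.2)).differentiableWithinAt)
    have b2 := integral_boundary_rect_eq_zero_of_continuousOn_of_differentiableOn F ⟨z.re, 0⟩ w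
      (hcont.mono (by rw [uIcc_comm (0 : ℝ)]; exact hw0)) (fun p hp => by
        have hp' : p ∈ (Ioo (min z.re w.re) (max z.re w.re)) ×ℂ Ioo (min w.im 0) (max w.im 0) := by
          rw [min_comm w.im, max_comm w.im]; exact hp
        exact ((hb p (hw0 (hsub _ hp'))).2 (hne _ _ hp'.2)).differentiableWithinAt)
    simp only at b1 b2
    have hint : ∀ x ∈ uIcc z.re w.re, ∀ s ∈ uIcc z.im w.im,
        IntervalIntegrable (fun y : ℝ => F (x + y * I)) volume s 0 := by
      intro x hx s hs
      refine (hcont.comp (by fun_prop) fun y hy => half s hs ⟨?_, ?_⟩).intervalIntegrable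
      · simpa using hx
      · simpa using hy
    rw [← intervalIntegral.integral_add_adjacent_intervals
        (hint w.re right_mem_uIcc z.im left_mem_uIcc)
        (hint w.re right_mem_uIcc w.im right_mem_uIcc).symm,
      ← intervalIntegral.integral_add_adjacent_intervals
        (hint z.re left_mem_uIcc z.im left_mem_uIcc)
        (hint z.re left_mem_uIcc w.im right_mem_uIcc).symm]
    simp only [smul_eq_mul] at b1 b2 ⊢
    linear_combination b1 + b2
  exact ((isConservativeOn_and_continuousOn_iff_isDifferentiableOn Metric.isOpen_ball).1
    ⟨hcons, hcont⟩).differentiableAt (Metric.ball_mem_nhds _ hr)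

/-- Painlevé's theorem for an arc of a circle. -/
theorem differentiableAt_of_norm_ne {F : ℂ → ℂ} {ζ₀ : ℂ} {c : ℝ} (hc0 : 0 < c) (hζ₀ : ‖ζ₀‖ = c)
    (hc : ∀ᶠ ζ in 𝓝 ζ₀, ContinuousAt F ζ)
    (hd : ∀ᶠ ζ in 𝓝 ζ₀, ‖ζ‖ ≠ c → DifferentiableAt ℂ F ζ) : DifferentiableAt ℂ F ζ₀ := by
  have h0 : ζ₀ ≠ 0 := norm_pos_iff.1 (by rw [hζ₀]; exact hc0)
  -- This parametrisation straightens the circle to the real axis; the branch of the logarithm below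
  -- inverts it near `ζ₀`.
  set φ : ℂ → ℂ := fun w => ζ₀ * exp (I * w) with hφ
  have hφ0 : φ 0 = ζ₀ := by simp [hφ]
  have hφd : Differentiable ℂ φ := by fun_prop
  have hφt : Tendsto φ (𝓝 0) (𝓝 ζ₀) := by
    have := hφd.continuous.tendsto 0
    rwa [hφ0] at this
  have h1 : DifferentiableAt ℂ (F ∘ φ) 0 := by
    refine differentiableAt_of_im_ne_zero rfl ?_ ?_
    · filter_upwards [hφt.eventually hc] with w hw
      exact ContinuousAt.comp hw hφd.continuous.continuousAt
    · filter_upwards [hφt.eventually hd] with w hw him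
      refine DifferentiableAt.comp w (hw ?_) (hφd w)
      intro h
      rw [hφ] at h
      simp only [norm_mul, hζ₀, Complex.norm_exp] at h
      have h2 : Real.exp (I * w).re = 1 := by
        have := mul_left_cancel₀ hc0.ne' (h.trans (mul_one c).symm)
        exact this
      rw [Real.exp_eq_one_iff] at h2
      simp at h2
      exact him h2
  set ψ : ℂ → ℂ := fun ζ => -I * log (ζ / ζ₀) with hψ
  have hψ0 : ψ ζ₀ = 0 := by simp [hψ, div_self h0]
  have hψd : DifferentiableAt ℂ ψ ζ₀ := by
    refine DifferentiableAt.const_mul (DifferentiableAt.clog (by fun_prop) ?_) _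
    rw [div_self h0]
    exact one_mem_slitPlane
  have h2 : DifferentiableAt ℂ ((F ∘ φ) ∘ ψ) ζ₀ :=
    DifferentiableAt.comp ζ₀ (by rwa [hψ0]) hψd
  refine h2.congr_of_eventuallyEq ?_
  filter_upwards [isOpen_ne.mem_nhds h0] with ζ hζ
  simp only [Function.comp_apply, hφ, hψ]
  rw [show I * (-I * log (ζ / ζ₀)) = log (ζ / ζ₀) by linear_combination -log (ζ / ζ₀) * I_sq,
    Complex.exp_log (div_ne_zero hζ h0), mul_div_cancel₀ _ h0]

theorem IsBigO_one.isLittleO_inv {F : ℂ → ℂ} {s : ℂ} (h : F =O[𝓝[≠] s] fun _ => (1 : ℂ)) :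
    F =o[𝓝[≠] s] fun ζ => (ζ - s)⁻¹ :=
  Filter.IsBoundedUnder.isLittleO_sub_self_inv ((isBigO_one_iff ℂ).1 h)

/-- Liouville's theorem for functions with finitely many removable singularities. -/
theorem eq_zero_of_finite_singularities (S : Finset ℂ) : ∀ {F : ℂ → ℂ},
    (∀ ζ ∉ S, DifferentiableAt ℂ F ζ) → (∀ s ∈ S, F =o[𝓝[≠] s] fun ζ => (ζ - s)⁻¹) →
    Tendsto F (cocompact ℂ) (𝓝 0) → ∀ ζ ∉ S, F ζ = 0 := by
  classical
  induction S using Finset.induction_on with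
  | empty =>
    intro F hd _ hinf ζ _
    exact Differentiable.apply_eq_of_tendsto_cocompact (fun ζ => hd ζ (by simp)) ζ hinf
  | insert s S hs ih =>
    intro F hd ho hinf
    set G := Function.update F s (limUnder (𝓝[≠] s) F) with hG
    have hGF : ∀ ζ ≠ s, G ζ = F ζ := fun ζ h => Function.update_of_ne h _ _
    have hopen : IsOpen ((S : Set ℂ)ᶜ) := S.finite_toSet.isClosed.isOpen_compl
    have hdiff : DifferentiableOn ℂ G ((S : Set ℂ)ᶜ) := by
      refine differentiableOn_update_limUnder_of_isLittleO (hopen.mem_nhds (by simpa using hs)) ?_ ?_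
      · intro ζ hζ
        refine (hd ζ ?_).differentiableWithinAt
        have h1 : ζ ∉ S := by simpa using hζ.1
        have h2 : ζ ≠ s := by simpa using hζ.2
        simp [h1, h2]
      · refine (ho s (Finset.mem_insert_self _ _)).sub (IsBigO_one.isLittleO_inv ?_)
        exact isBigO_const_const _ one_ne_zero _
    have key := ih (F := G) (fun ζ hζ => hdiff.differentiableAt (hopen.mem_nhds (by simpa using hζ)))
      (fun s' hs' => by
        have hne : s' ≠ s := fun h => hs (h ▸ hs')
        refine (ho s' (Finset.mem_insert_of_mem hs')).congr' ?_ EventuallyEq.rfl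
        filter_upwards [nhdsWithin_le_nhds (isOpen_ne.mem_nhds hne)] with ζ hζ
        exact (hGF ζ hζ).symm)
      (hinf.congr' (by
        have : ({s} : Set ℂ)ᶜ ∈ cocompact ℂ := isCompact_singleton.compl_mem_cocompact
        filter_upwards [this] with ζ hζ
        exact (hGF ζ hζ).symm))
    intro ζ hζ
    rw [Finset.mem_insert, not_or] at hζ
    rw [← hGF ζ hζ.1]
    exact key ζ hζ.2

theorem exists_eq_add_mul {G : ℂ → ℂ} {p : ℂ} (hG : ∀ᶠ ζ in 𝓝 p, DifferentiableAt ℂ G ζ) :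
    ∃ k : ℂ → ℂ, (∀ᶠ ζ in 𝓝 p, DifferentiableAt ℂ k ζ) ∧ k p = deriv G p ∧
      ∀ ζ, G ζ = G p + (ζ - p) * k ζ := by
  refine ⟨dslope G p, ?_, dslope_same _ _, fun ζ => ?_⟩
  · obtain ⟨U, hU, hUo, hp⟩ := eventually_nhds_iff.1 hG
    have h : DifferentiableOn ℂ (dslope G p) U := (differentiableOn_dslope (hUo.mem_nhds hp)).2
      fun ζ hζ => (hU ζ hζ).differentiableWithinAt
    filter_upwards [hUo.mem_nhds hp] with ζ hζ using h.differentiableAt (hUo.mem_nhds hζ)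
  · have := sub_smul_dslope G p ζ
    rw [smul_eq_mul] at this
    rw [this]; ring

theorem isBigO_one_of_continuousAt {G : ℂ → ℂ} {p : ℂ} (h : ContinuousAt G p) :
    G =O[𝓝[≠] p] fun _ => (1 : ℂ) := h.isBigO_one ℂ |>.mono nhdsWithin_le_nhds

/-- `F` has the same double pole at `p` as `C G (1/(ζ-p)² + D/(ζ-p))`. -/
def PoleRel (F G : ℂ → ℂ) (p C D : ℂ) : Prop :=
  (fun ζ => F ζ - C * G ζ * (1 / (ζ - p) ^ 2 + D / (ζ - p))) =O[𝓝[≠] p] fun _ => (1 : ℂ)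

/-- Second order Taylor expansion: modulo bounded functions only `G p` and `deriv G p` matter. A
pole relation between functions is thus equivalent to an explicit principal part. -/
theorem isBigO_principalPart {G : ℂ → ℂ} {p : ℂ} (hG : ∀ᶠ ζ in 𝓝 p, DifferentiableAt ℂ G ζ)
    (C D : ℂ) : (fun ζ => C * G ζ * (1 / (ζ - p) ^ 2 + D / (ζ - p))
      - C * (G p / (ζ - p) ^ 2 + (deriv G p + D * G p) / (ζ - p))) =O[𝓝[≠] p]
      fun _ => (1 : ℂ) := by
  obtain ⟨k, hk, hkp, hGk⟩ := exists_eq_add_mul hG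
  obtain ⟨l, hl, hlp, hkl⟩ := exists_eq_add_mul hk
  have h1 : ContinuousAt (fun ζ => C * l ζ + C * D * k ζ) p :=
    (hl.self_of_nhds.continuousAt.const_mul C).add (hk.self_of_nhds.continuousAt.const_mul _)
  refine (isBigO_one_of_continuousAt h1).congr' ?_ EventuallyEq.rfl
  filter_upwards [self_mem_nhdsWithin] with ζ hζ
  have hs : ζ - p ≠ 0 := sub_ne_zero.2 hζ
  rw [hGk ζ, hkl ζ, hkp]
  field_simp
  ring

theorem PoleRel.sub_principalPart {F G : ℂ → ℂ} {p C D : ℂ} (h : PoleRel F G p C D)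
    (hG : ∀ᶠ ζ in 𝓝 p, DifferentiableAt ℂ G ζ) :
    (fun ζ => F ζ - C * (G p / (ζ - p) ^ 2 + (deriv G p + D * G p) / (ζ - p))) =O[𝓝[≠] p]
      fun _ => (1 : ℂ) :=
  (h.add (isBigO_principalPart hG C D)).congr_left fun ζ => by ring

theorem PoleRel.of_principalPart {F G : ℂ → ℂ} {p C D : ℂ}
    (hG : ∀ᶠ ζ in 𝓝 p, DifferentiableAt ℂ G ζ)
    (h : (fun ζ => F ζ - C * (G p / (ζ - p) ^ 2 + (deriv G p + D * G p) / (ζ - p))) =O[𝓝[≠] p]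
      fun _ => (1 : ℂ)) : PoleRel F G p C D :=
  (h.sub (isBigO_principalPart hG C D)).congr_left fun ζ => by ring

theorem PoleRel.congr {F F' G G' : ℂ → ℂ} {p C D : ℂ} (h : PoleRel F G p C D)
    (hF : F =ᶠ[𝓝[≠] p] F') (hG : G =ᶠ[𝓝[≠] p] G') : PoleRel F' G' p C D := by
  refine IsBigO.congr' h ?_ EventuallyEq.rfl
  filter_upwards [hF, hG] with ζ h1 h2
  rw [h1, h2]

theorem tendsto_conj_punctured (p : ℂ) : Tendsto (fun ζ => conj ζ) (𝓝[≠] (conj p)) (𝓝[≠] p) := by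
  refine tendsto_nhdsWithin_iff.2 ⟨?_, ?_⟩
  · have := Complex.continuous_conj.tendsto (conj p)
    rw [Complex.conj_conj] at this
    exact this.mono_left nhdsWithin_le_nhds
  · filter_upwards [self_mem_nhdsWithin] with ζ hζ h
    apply hζ
    have h : conj ζ = p := h
    rw [mem_singleton_iff, ← h, Complex.conj_conj]

theorem PoleRel.conj {F G : ℂ → ℂ} {p C D : ℂ} (h : PoleRel F G p C D) :
    PoleRel (fun ζ => conj (F (conj ζ))) (fun ζ => conj (G (conj ζ))) (conj p) (conj C)
      (conj D) := by
  have h1 := (h.comp_tendsto (tendsto_conj_punctured p)).norm_left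
  refine IsBigO.of_norm_left (h1.congr_left fun ζ => ?_)
  rw [Function.comp_apply, ← Complex.norm_conj]
  simp

theorem tendsto_inv_punctured {k p : ℂ} (hk : k ≠ 0) (hp : p ≠ 0) :
    Tendsto (fun ζ => k / ζ) (𝓝[≠] (k / p)) (𝓝[≠] p) := by
  have h0 : k / p ≠ 0 := div_ne_zero hk hp
  refine tendsto_nhdsWithin_iff.2 ⟨?_, ?_⟩
  · have : ContinuousAt (fun ζ : ℂ => k / ζ) (k / p) := continuousAt_const.div continuousAt_id h0
    have := this.tendsto
    rw [div_div_cancel₀ hk] at this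
    exact this.mono_left nhdsWithin_le_nhds
  · filter_upwards [self_mem_nhdsWithin] with ζ hζ h
    apply hζ
    have h : k / ζ = p := h
    rw [mem_singleton_iff, ← h, div_div_cancel₀ hk]

/-- With `p' = -c²/p` one has `-c²/ζ - p = c² (ζ - p') / (ζ p')`. Expanding the powers of `ζ` about
`p'` shifts `D` by `-2/p` and rescales both coefficients, up to a constant multiple of `G`, which is
why `G` has to be bounded. The factors in `AHat` and `BHat` have this origin. -/
theorem PoleRel.inv {F G : ℂ → ℂ} {p C D c κ κ' : ℂ} (h : PoleRel F G p C D)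
    (hG : G =O[𝓝[≠] p] fun _ => (1 : ℂ)) (hc : c ≠ 0) (hp : p ≠ 0) (hκ' : κ' ≠ 0) :
    PoleRel (fun ζ => κ / ζ * F (-c ^ 2 / ζ)) (fun ζ => κ' / ζ * G (-c ^ 2 / ζ)) (-c ^ 2 / p)
      (κ / κ' * C * c ^ 4 / p ^ 4) ((D - 2 / p) * (p ^ 2 / c ^ 2)) := by
  have hk : -c ^ 2 ≠ 0 := neg_ne_zero.2 (pow_ne_zero 2 hc)
  have ht := tendsto_inv_punctured hk hp
  have h1 := h.comp_tendsto ht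
  have h2 := hG.comp_tendsto ht
  set p' := -c ^ 2 / p with hp'
  have h0 : p' ≠ 0 := div_ne_zero hk hp
  have hb : (fun ζ : ℂ => κ / ζ) =O[𝓝[≠] p'] fun _ => (1 : ℂ) :=
    isBigO_one_of_continuousAt (continuousAt_const.div continuousAt_id h0)
  have h3 := hb.mul (h1.add (h2.const_mul_left (C * (p' ^ 2 / c ^ 4 + D * p' / c ^ 2))))
  refine IsBigO.congr' h3 ?_ (Eventually.of_forall fun _ => mul_one _)
  filter_upwards [self_mem_nhdsWithin, nhdsWithin_le_nhds (isOpen_ne.mem_nhds h0)] with ζ hζ hζ0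
  have hs : ζ - p' ≠ 0 := sub_ne_zero.2 hζ
  have hpp : p = -c ^ 2 / p' := by rw [hp', div_div_cancel₀ hk]
  have hw : -c ^ 2 / ζ - p = c ^ 2 * (ζ - p') / (ζ * p') := by
    rw [hpp]; field_simp; ring
  simp only [Function.comp_apply]
  rw [hw]
  generalize F (-c ^ 2 / ζ) = F₀
  generalize G (-c ^ 2 / ζ) = G₀
  clear_value p'
  subst hpp
  have hζ0 : ζ ≠ 0 := hζ0
  generalize hσ : ζ - p' = σ at hs ⊢
  obtain rfl : ζ = p' + σ := by rw [← hσ]; ring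
  field_simp
  ring

/-- Write `a = (ζ - p)² k`, so that `k(p) = a''/2` and `k'(p) = a'''/6`. Then `n / a = (n / k)/(ζ -
p)²`, and the principal part needs only the value and the derivative of `n / k`; the logarithmic
derivative of `k` is `a'''/(3a'')`. -/
theorem PoleRel.of_double_zero {a n M : ℂ → ℂ} {p E b d τ : ℂ}
    (ha : ∀ᶠ ζ in 𝓝 p, DifferentiableAt ℂ a ζ) (hn : ∀ᶠ ζ in 𝓝 p, DifferentiableAt ℂ n ζ)
    (hM : ∀ᶠ ζ in 𝓝 p, DifferentiableAt ℂ M ζ) (ha0 : a p = 0) (ha1 : deriv a p = 0)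
    (ha2 : iteratedDeriv 2 a p ≠ 0) (hb : b ≠ 0) (hn0 : n p = E * b * M p)
    (hn1 : deriv n p = E * (d * M p + 2 * I * τ * b * M p + b * deriv M p)) :
    PoleRel (fun ζ => n ζ / a ζ) M p (2 * b / iteratedDeriv 2 a p * E)
      (d / b - iteratedDeriv 3 a p / (3 * iteratedDeriv 2 a p) + 2 * I * τ) := by
  obtain ⟨k₁, hk₁, hk₁p, hak₁⟩ := exists_eq_add_mul ha
  obtain ⟨k, hk, hkp, hk₁k⟩ := exists_eq_add_mul hk₁
  have hak : ∀ ζ, a ζ = (ζ - p) ^ 2 * k ζ := fun ζ => by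
    rw [hak₁, hk₁k, ha0, hk₁p, ha1]; ring
  have hkA : ∀ᶠ ζ in 𝓝 p, AnalyticAt ℂ k ζ := by
    filter_upwards [hk.eventually_nhds] with ζ h using analyticAt_iff_eventually_differentiableAt.2 h
  have d1 : deriv a =ᶠ[𝓝 p] fun ζ => 2 * (ζ - p) * k ζ + (ζ - p) ^ 2 * deriv k ζ := by
    filter_upwards [hkA] with ζ h
    have : HasDerivAt a _ ζ := ((((hasDerivAt_id ζ).sub_const p).pow 2).mul
      h.differentiableAt.hasDerivAt).congr_of_eventuallyEq (Eventually.of_forall hak)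
    rw [this.deriv]
    simp
  have d2 : iteratedDeriv 2 a =ᶠ[𝓝 p] fun ζ =>
      2 * k ζ + 4 * (ζ - p) * deriv k ζ + (ζ - p) ^ 2 * deriv (deriv k) ζ := by
    filter_upwards [hkA, d1.eventually_nhds] with ζ h h1
    rw [iteratedDeriv_succ, iteratedDeriv_one, EventuallyEq.deriv_eq h1]
    have e := (hasDerivAt_id ζ).sub_const p
    have : HasDerivAt (fun ζ => 2 * (ζ - p) * k ζ + (ζ - p) ^ 2 * deriv k ζ) _ ζ :=
      ((e.const_mul 2).mul h.differentiableAt.hasDerivAt).add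
        ((e.pow 2).mul h.deriv.differentiableAt.hasDerivAt)
    rw [this.deriv]
    simp
    ring
  have d3 : iteratedDeriv 3 a p = 6 * deriv k p := by
    have h := hkA.self_of_nhds
    rw [iteratedDeriv_succ, EventuallyEq.deriv_eq d2]
    have e := (hasDerivAt_id p).sub_const p
    have : HasDerivAt (fun ζ => 2 * k ζ + 4 * (ζ - p) * deriv k ζ
        + (ζ - p) ^ 2 * deriv (deriv k) ζ) _ p :=
      ((h.differentiableAt.hasDerivAt.const_mul 2).add
        ((e.const_mul 4).mul h.deriv.differentiableAt.hasDerivAt)).add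
        ((e.pow 2).mul h.deriv.deriv.differentiableAt.hasDerivAt)
    rw [this.deriv]
    simp
    ring
  have d2' : iteratedDeriv 2 a p = 2 * k p := by
    rw [d2.self_of_nhds]; simp
  rw [d2'] at ha2
  have hk0 : k p ≠ 0 := fun h => ha2 (by rw [h, mul_zero])
  have hkn : ∀ᶠ ζ in 𝓝 p, k ζ ≠ 0 := hk.self_of_nhds.continuousAt.eventually_ne hk0
  have hnk : ∀ᶠ ζ in 𝓝 p, DifferentiableAt ℂ (fun ζ => n ζ / k ζ) ζ := by
    filter_upwards [hn, hk, hkn] with ζ h1 h2 h3 using h1.div h2 h3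
  have hnk' : deriv (fun ζ => n ζ / k ζ) p = (deriv n p * k p - n p * deriv k p) / k p ^ 2 :=
    (hn.self_of_nhds.hasDerivAt.div hk.self_of_nhds.hasDerivAt hk0).deriv
  refine PoleRel.of_principalPart hM ?_
  have h := isBigO_principalPart hnk 1 0
  refine h.congr' ?_ EventuallyEq.rfl
  filter_upwards [self_mem_nhdsWithin, nhdsWithin_le_nhds hkn] with ζ hζ hk1
  have hs : ζ - p ≠ 0 := sub_ne_zero.2 hζ
  rw [hnk', hak, d2', d3, hn0, hn1]
  field_simp
  ring

end KE

end

/-! ### The bordered determinant and the linear system for the values at the poles -/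

noncomputable section

namespace KE

open Asymptotics

/-- Expansion of a bordered determinant with a vanishing corner. -/
theorem det_bordered {n : ℕ} (hn : Even n) (M : Matrix (Fin n) (Fin n) ℂ) (χ ρ v : Fin n → ℂ)
    (h : M.mulVec v = ρ) :
    (Matrix.of (Fin.cons (Fin.snoc (α := fun _ => ℂ) χ 0)
      (fun k => Fin.snoc (α := fun _ => ℂ) (fun j => M k j) (ρ k))) :
        Matrix (Fin (n + 1)) (Fin (n + 1)) ℂ).det = -(∑ j, χ j * v j) * M.det := by
  set A : Matrix (Fin (n + 1)) (Fin (n + 1)) ℂ := Matrix.of (Fin.cons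
    (Fin.snoc (α := fun _ => ℂ) χ 0) (fun k => Fin.snoc (α := fun _ => ℂ) (fun j => M k j) (ρ k)))
    with hA
  -- The last column is replaced by the combination of the others with coefficients `v` minus
  -- itself. This multiplies the determinant by `-1` and leaves only the corner entry, whose
  -- cofactor sign is `+` because `n` is even.
  have h1 := Matrix.det_updateCol_sum A (Fin.last n) (Fin.snoc (α := fun _ => ℂ) v (-1))
  have h2 : (fun k => ∑ i, (Fin.snoc (α := fun _ => ℂ) v (-1) : Fin (n + 1) → ℂ) i • A k i) =
      Fin.cons (∑ j, χ j * v j) 0 := by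
    funext k
    refine Fin.cases ?_ (fun k => ?_) k
    · rw [Fin.sum_univ_castSucc]
      simp [hA, mul_comm]
    · rw [Fin.sum_univ_castSucc]
      simp only [hA, Matrix.of_apply, Fin.cons_succ, Fin.snoc_castSucc, Fin.snoc_last, smul_eq_mul,
        Pi.zero_apply]
      rw [← h, Matrix.mulVec, dotProduct, neg_one_mul, add_neg_eq_zero]
      exact Finset.sum_congr rfl fun i _ => mul_comm _ _
  rw [h2, Fin.snoc_last, Matrix.det_succ_column _ (Fin.last n), Fin.sum_univ_succ] at h1
  simp only [Matrix.updateCol_self, Fin.cons_zero, Fin.cons_succ, Pi.zero_apply, mul_zero,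
    zero_mul, Finset.sum_const_zero, add_zero, Fin.val_zero, zero_add, Fin.val_last,
    hn.neg_one_pow, one_mul] at h1
  have h3 : (A.updateCol (Fin.last n) (Fin.cons (∑ j, χ j * v j) 0)).submatrix
      (Fin.succAbove 0) (Fin.succAbove (Fin.last n)) = M := by
    ext i j
    simp [hA, Matrix.updateCol_ne, (Fin.castSucc_lt_last j).ne]
  rw [h3, smul_eq_mul] at h1
  rw [neg_mul, h1]; ring

section

variable {P : Params} {N : ℕ} {ζ : Fin N → ℂ}

theorem matN_mulVec_append (A B : Fin N → ℂ) (x t : ℝ) (Y X : Fin (N + N) → ℂ) :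
    (matN P ζ A B x t).mulVec (Fin.append Y X) =
      Fin.append ((n11 P ζ A x t).mulVec Y + (n12 P ζ A B x t).mulVec X)
        ((n21 P ζ A x t).mulVec Y + (n22 P ζ A B x t).mulVec X) := by
  funext k
  refine Fin.addCases (fun k => ?_) (fun k => ?_) k <;>
  · rw [Matrix.mulVec, dotProduct, Fin.sum_univ_add]
    simp [-Fin.natAdd_eq_addNat, matN, Matrix.mulVec, dotProduct]

/-- A rational function with double poles at the points `η j`. -/
def polarPart {m : ℕ} (η C D X Y : Fin m → ℂ) (w : ℂ) : ℂ :=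
  ∑ j, C j * (X j / (w - η j) ^ 2 + (Y j + D j * X j) / (w - η j))

section polarPart

variable {m : ℕ} (η C D X Y : Fin m → ℂ)

theorem hasDerivAt_polarPart_term {p w : ℂ} (h : w ≠ p) (C X Z : ℂ) :
    HasDerivAt (fun w => C * (X / (w - p) ^ 2 + Z / (w - p)))
      (-(C * (2 * X / (w - p) ^ 3 + Z / (w - p) ^ 2))) w := by
  have hs : w - p ≠ 0 := sub_ne_zero.2 h
  have e := (hasDerivAt_id w).sub_const p
  have h1 := (((hasDerivAt_const w X).div (e.pow 2) (pow_ne_zero 2 hs)).add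
    ((hasDerivAt_const w Z).div e hs)).const_mul C
  refine HasDerivAt.congr_deriv h1 ?_
  simp only [id, Pi.pow_apply]
  field_simp
  push_cast
  ring

theorem hasDerivAt_polarPart {w : ℂ} (h : ∀ j, w ≠ η j) : HasDerivAt (polarPart η C D X Y)
    (-∑ j, C j * (2 * X j / (w - η j) ^ 3 + (Y j + D j * X j) / (w - η j) ^ 2)) w := by
  rw [← Finset.sum_neg_distrib]
  exact HasDerivAt.fun_sum fun j _ => hasDerivAt_polarPart_term (h j) _ _ _

theorem polarPart_sub_isBigO (hη : Function.Injective η) (k : Fin m) :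
    (fun w => polarPart η C D X Y w
      - C k * (X k / (w - η k) ^ 2 + (Y k + D k * X k) / (w - η k))) =O[𝓝[≠] (η k)]
      fun _ => (1 : ℂ) := by
  have : ContinuousAt (fun w => ∑ j ∈ Finset.univ.erase k,
      C j * (X j / (w - η j) ^ 2 + (Y j + D j * X j) / (w - η j))) (η k) := by
    refine tendsto_finsetSum _ fun j hj => ?_
    exact (hasDerivAt_polarPart_term (fun h => (Finset.ne_of_mem_erase hj) (hη h.symm))
      _ _ _).continuousAt
  refine (isBigO_one_of_continuousAt this).congr_left fun w => ?_
  rw [polarPart, ← Finset.add_sum_erase _ _ (Finset.mem_univ k)]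
  ring

theorem tendsto_div_sub_cocompact (X p : ℂ) :
    Tendsto (fun w => X / (w - p)) (cocompact ℂ) (𝓝 0) := by
  have h1 : Tendsto (fun w : ℂ => w - p) (cocompact ℂ) (cocompact ℂ) := by
    simpa [sub_eq_add_neg] using (Homeomorph.addRight (-p)).isClosedEmbedding.tendsto_cocompact
  have h2 := (tendsto_inv₀_cobounded (α := ℂ)).comp
    (by rwa [← Metric.cobounded_eq_cocompact] at h1)
  rw [← Metric.cobounded_eq_cocompact]
  simpa [div_eq_mul_inv] using h2.const_mul X

theorem tendsto_polarPart : Tendsto (polarPart η C D X Y) (cocompact ℂ) (𝓝 0) := by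
  have h : ∀ j, Tendsto (fun w => C j * (X j / (w - η j) ^ 2 + (Y j + D j * X j) / (w - η j)))
      (cocompact ℂ) (𝓝 0) := fun j => by
    have h1 := (((tendsto_div_sub_cocompact (X j) (η j)).mul (tendsto_div_sub_cocompact 1 (η j))).add
      (tendsto_div_sub_cocompact (Y j + D j * X j) (η j))).const_mul (C j)
    simp only [mul_zero, add_zero] at h1
    refine h1.congr fun w => ?_
    rw [div_mul_div_comm, mul_one, sq]
  have h2 := tendsto_finsetSum Finset.univ fun j _ => h j
  rw [Finset.sum_const_zero] at h2
  exact h2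

theorem tendsto_mul_polarPart : Tendsto (fun w => w * polarPart η C D X Y w) (cocompact ℂ)
    (𝓝 (∑ j, C j * (Y j + D j * X j))) := by
  have hr : ∀ p : ℂ, Tendsto (fun w => w / (w - p)) (cocompact ℂ) (𝓝 1) := fun p => by
    have h1 := (tendsto_div_sub_cocompact p p).const_add 1
    rw [add_zero] at h1
    refine h1.congr' ?_
    have : ({p} : Set ℂ)ᶜ ∈ cocompact ℂ := isCompact_singleton.compl_mem_cocompact
    filter_upwards [this] with w hw
    have : w - p ≠ 0 := sub_ne_zero.2 hw
    field_simp
    ring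
  have h : ∀ j, Tendsto
      (fun w => w * (C j * (X j / (w - η j) ^ 2 + (Y j + D j * X j) / (w - η j))))
      (cocompact ℂ) (𝓝 (C j * (Y j + D j * X j))) := fun j => by
    have h1 := (((hr (η j)).mul (tendsto_div_sub_cocompact (X j) (η j))).add
      ((hr (η j)).mul_const (Y j + D j * X j))).const_mul (C j)
    simp only [mul_zero, zero_add, one_mul] at h1
    refine h1.congr fun w => ?_
    rw [div_mul_div_comm, ← sq]
    ring
  simp only [polarPart, Finset.mul_sum]
  exact tendsto_finsetSum Finset.univ fun j _ => h j

end polarPart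

/- The points -/

variable (hq : 0 < P.q₀) (hζ : ∀ j, ζ j ∈ extUpperOpen P)
include hq hζ

/-- All `η` lie where `Im λ > 0` and all `η̂` where `Im λ < 0`, so no denominator of the matrix
vanishes and none of these points is real, zero or a branch point. -/
theorem lam_eta_im (k : Fin (N + N)) : 0 < (lam P (eta P ζ k)).im := by
  have h0 : ∀ j, ζ j ≠ 0 := fun j => ne_zero_of_mem_extUpper hq (extUpperOpen_subset P (hζ j))
  refine Fin.addCases (fun j => ?_) (fun j => ?_) k
  · simpa [eta] using lam_im_pos hq (hζ j)
  · simp only [eta, Fin.append_right]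
    rw [lam_inv hq ((map_ne_zero _).2 (h0 j)), lam_conj]
    simpa using lam_im_pos hq (hζ j)

theorem lam_etaHat_im (k : Fin (N + N)) : (lam P (etaHat P ζ k)).im < 0 := by
  have h0 : ∀ j, ζ j ≠ 0 := fun j => ne_zero_of_mem_extUpper hq (extUpperOpen_subset P (hζ j))
  refine Fin.addCases (fun j => ?_) (fun j => ?_) k
  · simp only [etaHat, Fin.append_left]
    rw [lam_inv hq (h0 j)]
    simpa using lam_im_pos hq (hζ j)
  · simp only [etaHat, Fin.append_right]
    rw [lam_conj]
    simpa using lam_im_pos hq (hζ j)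

theorem eta_ne_etaHat (k j : Fin (N + N)) : eta P ζ k ≠ etaHat P ζ j := fun h => by
  have h1 := lam_eta_im hq hζ k
  rw [h] at h1
  exact lt_asymm h1 (lam_etaHat_im hq hζ j)

theorem eta_ne_zero (k : Fin (N + N)) : eta P ζ k ≠ 0 := fun h => by
  have h1 := lam_eta_im hq hζ k
  rw [h] at h1
  simp [lam] at h1

theorem etaHat_ne_zero (k : Fin (N + N)) : etaHat P ζ k ≠ 0 := fun h => by
  have h1 := lam_etaHat_im hq hζ k
  rw [h] at h1
  simp [lam] at h1

omit hζ in
theorem lam_neg_branchPoint : lam P (-(I * P.q₀)) = 0 := by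
  have hc0 : (P.q₀ : ℂ) ≠ 0 := by exact_mod_cast hq.ne'
  have := I_ne_zero
  rw [lam]
  field_simp
  rw [I_sq]
  ring

omit hζ in
theorem inv_etaHat (k : Fin (N + N)) : -(P.q₀ : ℂ) ^ 2 / etaHat P ζ k = eta P ζ k := by
  have hc0 : -(P.q₀ : ℂ) ^ 2 ≠ 0 := neg_ne_zero.2 (pow_ne_zero 2 (by exact_mod_cast hq.ne'))
  refine Fin.addCases (fun j => ?_) (fun j => ?_) k
  · simp only [etaHat, eta, Fin.append_left]
    rw [div_div_cancel₀ hc0]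
  · simp only [etaHat, eta, Fin.append_right]

omit hζ in
theorem inv_eta (k : Fin (N + N)) : -(P.q₀ : ℂ) ^ 2 / eta P ζ k = etaHat P ζ k := by
  have hc0 : -(P.q₀ : ℂ) ^ 2 ≠ 0 := neg_ne_zero.2 (pow_ne_zero 2 (by exact_mod_cast hq.ne'))
  rw [← inv_etaHat hq k, div_div_cancel₀ hc0]

omit hq hζ in
/-- The involution exchanging `j` and `N + j`. -/
def flip (k : Fin (N + N)) : Fin (N + N) := Fin.append (Fin.natAdd N) (Fin.castAdd N) k

omit hq hζ in
theorem conj_eta (k : Fin (N + N)) : conj (eta P ζ k) = etaHat P ζ (flip k) := by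
  refine Fin.addCases (fun j => ?_) (fun j => ?_) k <;>
  simp [-Fin.natAdd_eq_addNat, eta, etaHat, flip]

omit hq hζ in
theorem flip_flip (k : Fin (N + N)) : flip (flip k) = k := by
  refine Fin.addCases (fun j => ?_) (fun j => ?_) k <;>
  simp [-Fin.natAdd_eq_addNat, flip]

theorem etaHat_injective (hinj : Function.Injective ζ) : Function.Injective (etaHat P ζ) := by
  have h0 : ∀ j, ζ j ≠ 0 := fun j => ne_zero_of_mem_extUpper hq (extUpperOpen_subset P (hζ j))
  have hc0 : -(P.q₀ : ℂ) ^ 2 ≠ 0 := neg_ne_zero.2 (pow_ne_zero 2 (by exact_mod_cast hq.ne'))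
  have hne : ∀ j k, -(P.q₀ : ℂ) ^ 2 / ζ j ≠ conj (ζ k) := fun j k h => by
    have h1 : ‖-(P.q₀ : ℂ) ^ 2 / ζ j‖ = ‖ζ k‖ := by rw [h, Complex.norm_conj]
    rw [norm_div, norm_neg, norm_pow, Complex.norm_real, Real.norm_of_nonneg hq.le,
      div_eq_iff (norm_ne_zero_iff.2 (h0 j))] at h1
    have a1 : P.q₀ < ‖ζ j‖ := (hζ j).1
    have a2 : P.q₀ < ‖ζ k‖ := (hζ k).1
    nlinarith
  intro k k'
  refine Fin.addCases (fun j => ?_) (fun j => ?_) k <;>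
  refine Fin.addCases (fun j' => ?_) (fun j' => ?_) k' <;>
  simp only [etaHat, Fin.append_left, Fin.append_right]
  · intro h
    have : ζ j = ζ j' := by
      rw [← div_div_cancel₀ hc0 (b := ζ j), h, div_div_cancel₀ hc0]
    rw [hinj this]
  · intro h; exact (hne _ _ h).elim
  · intro h; exact (hne _ _ h.symm).elim
  · intro h
    rw [hinj (star_injective h)]

omit hq hζ in
theorem hasDerivAt_inversion {f g : ℂ → ℂ} {p k g' w₀ : ℂ} (h0 : w₀ ≠ 0)
    (hf : ∀ w, f w = -(p / w) * g (k / w)) (hg : HasDerivAt g g' (k / w₀)) :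
    HasDerivAt f (p / w₀ ^ 2 * g (k / w₀) + p * k / w₀ ^ 3 * g') w₀ := by
  have h1 : ∀ a : ℂ, HasDerivAt (fun w => a / w) (-a / w₀ ^ 2) w₀ := fun a =>
    ((hasDerivAt_const w₀ a).div (hasDerivAt_id w₀) h0).congr_deriv (by simp)
  have h2 : HasDerivAt (fun w => g (k / w)) (g' * (-k / w₀ ^ 2)) w₀ := hg.comp w₀ (h1 k)
  refine (((h1 p).neg.mul h2).congr_of_eventuallyEq (Eventually.of_forall hf)).congr_deriv ?_
  simp only [Pi.neg_apply]
  field_simp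

/-- The linear system satisfied by the values at the poles. -/
theorem matN_mulVec_eq_iff (A B : Fin N → ℂ) (x t : ℝ) (Y X : Fin (N + N) → ℂ) (κ : ℂ)
    {g f : ℂ → ℂ}
    (hg : ∀ k, g =ᶠ[𝓝 (eta P ζ k)] fun w => κ / w +
      polarPart (etaHat P ζ) (CHat P ζ A x t) (DHat P ζ B x t) X Y w)
    (hf : ∀ w, f w = -(I * conj (qPlus P) / w) * g (-(P.q₀ : ℂ) ^ 2 / w)) :
    (matN P ζ A B x t).mulVec (Fin.append Y X) = (fun i => -κ * rho P ζ i) ↔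
      ∀ k, f (etaHat P ζ k) = X k ∧ deriv f (etaHat P ζ k) = Y k := by
  have hc0 : (P.q₀ : ℂ) ≠ 0 := by exact_mod_cast hq.ne'
  have hqq : conj (qPlus P) * qPlus P = (P.q₀ : ℂ) ^ 2 := by
    rw [Complex.conj_mul', norm_qPlus hq]
  have hq0 : qPlus P ≠ 0 := by rw [← norm_pos_iff, norm_qPlus hq]; exact hq
  have hq1 : conj (qPlus P) ≠ 0 := (map_ne_zero _).2 hq0
  set η := eta P ζ with hη
  set η' := etaHat P ζ with hη'
  set C := CHat P ζ A x t with hC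
  set D := DHat P ζ B x t with hD
  set G := polarPart η' C D X Y with hG
  set G' : ℂ → ℂ := fun w =>
    -∑ j, C j * (2 * X j / (w - η' j) ^ 3 + (Y j + D j * X j) / (w - η' j) ^ 2) with hG'
  have e0 : ∀ k, η k ≠ 0 := eta_ne_zero hq hζ
  have e0' : ∀ k, η' k ≠ 0 := etaHat_ne_zero hq hζ
  have ee : ∀ k j, η k ≠ η' j := eta_ne_etaHat hq hζ
  have hs : ∀ k j, η k - η' j ≠ 0 := fun k j => sub_ne_zero.2 (ee k j)
  -- A row of the upper blocks is the polar part at `η_k` plus a multiple of `X_k`, a row of the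
  -- lower blocks minus its derivative plus multiples of `X_k` and `Y_k`. As the inversion relates
  -- `f` at `η̂_k` to `g` at `η_k`, the upper row states `f(η̂_k) = X_k`, and given this the lower
  -- row states `f'(η̂_k) = Y_k`.
  have r1 : ∀ k, ((n11 P ζ A x t).mulVec Y + (n12 P ζ A B x t).mulVec X) k =
      G (η k) + I * qPlus P * X k / η k := fun k => by
    simp only [Pi.add_apply, Matrix.mulVec, dotProduct, n11, n12, Matrix.of_apply, ← hη, ← hη',
      ← hC, ← hD, add_mul, Finset.sum_add_distrib, ite_mul, zero_mul, Finset.sum_ite_eq',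
      Finset.mem_univ, if_true, hG, polarPart]
    rw [← add_assoc, ← Finset.sum_add_distrib]
    congr 1
    · refine Finset.sum_congr rfl fun j _ => ?_
      have := hs k j
      field_simp
      ring
    · ring
  have r2 : ∀ k, ((n21 P ζ A x t).mulVec Y + (n22 P ζ A B x t).mulVec X) k =
      -G' (η k) + I * qPlus P * X k / η k ^ 2
        - I * (P.q₀ : ℂ) ^ 2 * qPlus P * Y k / η k ^ 3 := fun k => by
    simp only [Pi.add_apply, Matrix.mulVec, dotProduct, n21, n22, Matrix.of_apply, ← hη, ← hη',
      ← hC, ← hD, add_mul, sub_mul, Finset.sum_add_distrib, Finset.sum_sub_distrib, ite_mul,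
      zero_mul, Finset.sum_ite_eq', Finset.mem_univ, if_true, hG', neg_neg]
    have : ∀ j, C j * (2 * X j / (η k - η' j) ^ 3 + (Y j + D j * X j) / (η k - η' j) ^ 2) =
        C j / (η k - η' j) ^ 2 * Y j
          + C j / (η k - η' j) ^ 2 * (2 / (η k - η' j) + D j) * X j := fun j => by
      have := hs k j
      field_simp
      ring
    simp only [this, Finset.sum_add_distrib]
    ring
  have f1 : ∀ k, f (η' k) = X k ↔ G (η k) + I * qPlus P * X k / η k = -κ * (1 / η k) := fun k => by
    rw [hf, inv_etaHat hq, ← hη, (hg k).self_of_nhds, hη', ← inv_eta hq, ← hη]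
    have := e0 k
    have hI := I_ne_zero
    rw [← hqq]
    field_simp
    constructor <;> intro h <;> grind [I_sq]
  have f2 : ∀ k, f (η' k) = X k → (deriv f (η' k) = Y k ↔
      -G' (η k) + I * qPlus P * X k / η k ^ 2
        - I * (P.q₀ : ℂ) ^ 2 * qPlus P * Y k / η k ^ 3 = -κ * (1 / η k ^ 2)) := fun k hk => by
    have d1 : HasDerivAt g (-κ / η k ^ 2 + G' (η k)) (η k) := by
      have h1 := ((hasDerivAt_const (η k) κ).div (hasDerivAt_id (η k)) (e0 k)).add
        (hasDerivAt_polarPart η' C D X Y (ee k))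
      refine (h1.congr_of_eventuallyEq (hg k)).congr_deriv ?_
      simp [hG']
    have d2 := hasDerivAt_inversion (e0' k) hf (by rw [hη', inv_etaHat hq]; exact d1)
    rw [d2.deriv]
    rw [f1] at hk
    have hgk : g (η k) = κ / η k + G (η k) := (hg k).self_of_nhds
    rw [hη', inv_etaHat hq, ← hη, ← inv_eta hq, ← hη, hgk]
    generalize G (η k) = G₀ at hk ⊢
    generalize G' (η k) = G₁
    have h0 := e0 k
    generalize η k = e at h0 hk ⊢
    rw [← hqq]
    have hI := I_ne_zero
    generalize conj (qPlus P) = p at hq1 ⊢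
    generalize qPlus P = s at hq0 hk ⊢
    generalize X k = X₀ at hk ⊢
    generalize Y k = Y₀
    have hG₀ : G₀ = -κ * (1 / e) - I * s * X₀ / e := by rw [← hk]; ring
    rw [hG₀]
    field_simp
    constructor <;> intro h
    · linear_combination I * h - e * (-κ - I * s * X₀ + e ^ 2 * G₁) * I_sq
    · linear_combination (-I) * h - p * s ^ 2 * Y₀ * I_sq
  rw [matN_mulVec_append]
  constructor
  · intro h k
    have h1 := congrFun h (Fin.castAdd _ k)
    have h2 := congrFun h (Fin.natAdd _ k)
    rw [Fin.append_left, r1] at h1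
    rw [Fin.append_right, r2] at h2
    simp only [rho, Fin.append_left] at h1
    simp only [rho, Fin.append_right] at h2
    have h3 := (f1 k).2 h1
    exact ⟨h3, (f2 k h3).2 h2⟩
  · intro h
    funext i
    refine Fin.addCases (fun k => ?_) (fun k => ?_) i
    · rw [Fin.append_left, r1]
      simp only [rho, Fin.append_left]
      exact (f1 k).1 (h k).1
    · rw [Fin.append_right, r2]
      simp only [rho, Fin.append_right]
      exact (f2 k (h k).1).1 (h k).2

end

end KE

end

/-! ### Symmetry of the pole data and non-vanishing of the determinant -/

noncomputable section

namespace KE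

open Asymptotics

section

variable {P : Params} {N : ℕ} {ζ : Fin N → ℂ}

theorem dTheta_conj {w : ℂ} (hw : w ≠ 0) (x t : ℝ) :
    dTheta P x t (conj w) = conj (dTheta P x t w) := by
  have h1 := (hasDerivAt_Theta (P := P) hw x t).conj_conj
  have h2 := hasDerivAt_Theta (P := P) (ζ₀ := conj w) ((map_ne_zero _).2 hw) x t
  refine h2.unique (h1.congr_of_eventuallyEq (Eventually.of_forall fun u => ?_))
  simp only [Function.comp_apply]
  rw [Theta_conj, Complex.conj_conj]

theorem dTheta_inv (hq : 0 < P.q₀) {w : ℂ} (hw : w ≠ 0) (x t : ℝ) :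
    dTheta P x t (-(P.q₀ : ℂ) ^ 2 / w) = -dTheta P x t w * (w ^ 2 / (P.q₀ : ℂ) ^ 2) := by
  have hc0 : (P.q₀ : ℂ) ≠ 0 := by exact_mod_cast hq.ne'
  have hk : -(P.q₀ : ℂ) ^ 2 / w ≠ 0 := div_ne_zero (neg_ne_zero.2 (pow_ne_zero 2 hc0)) hw
  have h1 : HasDerivAt (fun u : ℂ => -(P.q₀ : ℂ) ^ 2 / u) ((P.q₀ : ℂ) ^ 2 / w ^ 2) w :=
    ((hasDerivAt_const w _).div (hasDerivAt_id w) hw).congr_deriv (by simp)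
  have h2 := HasDerivAt.comp w (hasDerivAt_Theta (P := P) hk x t) h1
  have h3 := (hasDerivAt_Theta (P := P) hw x t).neg
  have h4 := h2.unique (h3.congr_of_eventuallyEq (by
    filter_upwards [isOpen_ne.mem_nhds hw] with u hu
    exact Theta_inv hq hu x t))
  rw [← h4]
  field_simp

/-- The leading coefficient of the double pole at `ζ j`. -/
def poleC (P : Params) (ζ A : Fin N → ℂ) (x t : ℝ) (j : Fin N) : ℂ :=
  A j * exp (2 * I * Theta P x t (ζ j))

/-- The ratio of the coefficients of the double pole at `ζ j`. -/
def poleD (P : Params) (ζ B : Fin N → ℂ) (x t : ℝ) (j : Fin N) : ℂ :=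
  B j + 2 * I * dTheta P x t (ζ j)

variable (hq : 0 < P.q₀)
include hq

theorem CHat_castAdd {j : Fin N} (h0 : ζ j ≠ 0) (A : Fin N → ℂ) (x t : ℝ) :
    CHat P ζ A x t (Fin.castAdd N j) =
      qPlus P / conj (qPlus P) * poleC P ζ A x t j * (P.q₀ : ℂ) ^ 4 / ζ j ^ 4 := by
  simp only [CHat, AHat, etaHat, Fin.append_left, poleC]
  rw [Theta_inv hq h0, mul_neg, neg_neg]
  ring

omit hq in
theorem CHat_natAdd (j : Fin N) (A : Fin N → ℂ) (x t : ℝ) :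
    CHat P ζ A x t (Fin.natAdd N j) = -conj (poleC P ζ A x t j) := by
  simp only [CHat, AHat, etaHat, Fin.append_right, poleC]
  rw [Theta_conj, map_mul, ← Complex.exp_conj]
  simp [map_ofNat]

theorem DHat_castAdd {j : Fin N} (h0 : ζ j ≠ 0) (B : Fin N → ℂ) (x t : ℝ) :
    DHat P ζ B x t (Fin.castAdd N j) =
      (poleD P ζ B x t j - 2 / ζ j) * (ζ j ^ 2 / (P.q₀ : ℂ) ^ 2) := by
  simp only [DHat, BHat, etaHat, Fin.append_left, poleD]
  rw [dTheta_inv hq h0]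
  ring

omit hq in
theorem DHat_natAdd {j : Fin N} (h0 : ζ j ≠ 0) (B : Fin N → ℂ) (x t : ℝ) :
    DHat P ζ B x t (Fin.natAdd N j) = conj (poleD P ζ B x t j) := by
  simp only [DHat, BHat, etaHat, Fin.append_right, poleD]
  rw [dTheta_conj h0]
  simp [map_ofNat]
  ring

theorem qPlus_ne_zero : qPlus P ≠ 0 := by rw [← norm_pos_iff, norm_qPlus hq]; exact hq

/-- Inversion followed by conjugation permutes the points `η̂` by `flip`, and the coefficients
follow up to a sign. This sign makes the poles cancel in the argument for the non-vanishing of the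
determinant. -/
theorem CHat_flip (hζ : ∀ j, ζ j ∈ extUpperOpen P) (A : Fin N → ℂ) (x t : ℝ)
    (k : Fin (N + N)) :
    CHat P ζ A x t (flip k) = -conj (conj (qPlus P) / qPlus P * CHat P ζ A x t k
      * (P.q₀ : ℂ) ^ 4 / etaHat P ζ k ^ 4) := by
  have h0 : ∀ j, ζ j ≠ 0 := fun j => ne_zero_of_mem_extUpper hq (extUpperOpen_subset P (hζ j))
  have hc0 : (P.q₀ : ℂ) ≠ 0 := by exact_mod_cast hq.ne'
  have hq0 := qPlus_ne_zero hq
  have hq1 : conj (qPlus P) ≠ 0 := (map_ne_zero _).2 hq0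
  refine Fin.addCases (fun j => ?_) (fun j => ?_) k
  · have h := h0 j
    simp only [flip, etaHat, Fin.append_left]
    rw [CHat_natAdd, CHat_castAdd hq h]
    congr 2
    field_simp
  · have h := h0 j
    simp only [flip, etaHat, Fin.append_right]
    rw [CHat_natAdd, CHat_castAdd hq h]
    simp only [map_div₀, map_mul, map_neg, map_pow, Complex.conj_conj, Complex.conj_ofReal]
    ring

theorem DHat_flip (hζ : ∀ j, ζ j ∈ extUpperOpen P) (B : Fin N → ℂ) (x t : ℝ)
    (k : Fin (N + N)) :
    DHat P ζ B x t (flip k) = conj ((DHat P ζ B x t k - 2 / etaHat P ζ k)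
      * (etaHat P ζ k ^ 2 / (P.q₀ : ℂ) ^ 2)) := by
  have h0 : ∀ j, ζ j ≠ 0 := fun j => ne_zero_of_mem_extUpper hq (extUpperOpen_subset P (hζ j))
  have hc0 : (P.q₀ : ℂ) ≠ 0 := by exact_mod_cast hq.ne'
  refine Fin.addCases (fun j => ?_) (fun j => ?_) k
  · have h := h0 j
    simp only [flip, etaHat, Fin.append_left]
    rw [DHat_natAdd h, DHat_castAdd hq h]
    congr 1
    field_simp
    ring
  · have h := h0 j
    simp only [flip, etaHat, Fin.append_right]
    rw [DHat_natAdd h, DHat_castAdd hq h]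
    simp only [map_div₀, map_mul, map_sub, map_pow, Complex.conj_conj, Complex.conj_ofReal,
      map_ofNat]

omit hq in
theorem tendsto_inv_cocompact {k : ℂ} (hk : k ≠ 0) :
    Tendsto (fun w => k / w) (𝓝[≠] 0) (cocompact ℂ) := by
  rw [← Metric.cobounded_eq_cocompact]
  have h1 : Tendsto (fun w : ℂ => k⁻¹ * w) (𝓝[≠] 0) (𝓝[≠] 0) := by
    refine tendsto_nhdsWithin_iff.2 ⟨?_, ?_⟩
    · have : Continuous fun w : ℂ => k⁻¹ * w := by fun_prop
      simpa using (this.tendsto 0).mono_left nhdsWithin_le_nhds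
    · filter_upwards [self_mem_nhdsWithin] with w hw
      exact mul_ne_zero (inv_ne_zero hk) hw
  refine ((tendsto_inv₀_nhdsNE_zero (α := ℂ)).comp h1).congr fun w => ?_
  simp [div_eq_mul_inv, mul_comm]

omit hq in
theorem tendsto_conj_cocompact : Tendsto (fun w : ℂ => conj w) (cocompact ℂ) (cocompact ℂ) :=
  Complex.conjCLE.toHomeomorph.isClosedEmbedding.tendsto_cocompact

/-- The determinant of the linear system does not vanish. -/
theorem det_matN_ne_zero (hζ : ∀ j, ζ j ∈ extUpperOpen P) (hinj : Function.Injective ζ)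
    (A B : Fin N → ℂ) (x t : ℝ) : (matN P ζ A B x t).det ≠ 0 := by
  intro hdet
  obtain ⟨v, hv0, hv⟩ := Matrix.exists_mulVec_eq_zero_iff.2 hdet
  set Y : Fin (N + N) → ℂ := fun k => v (Fin.castAdd _ k) with hY
  set X : Fin (N + N) → ℂ := fun k => v (Fin.natAdd _ k) with hX
  have hvYX : Fin.append Y X = v := Fin.append_castAdd_natAdd
  have hc0 : (P.q₀ : ℂ) ≠ 0 := by exact_mod_cast hq.ne'
  have hk0 : -(P.q₀ : ℂ) ^ 2 ≠ 0 := neg_ne_zero.2 (pow_ne_zero 2 hc0)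
  have hq0 := qPlus_ne_zero hq
  have hq1 : conj (qPlus P) ≠ 0 := (map_ne_zero _).2 hq0
  have hqq : conj (qPlus P) * qPlus P = (P.q₀ : ℂ) ^ 2 := by
    rw [Complex.conj_mul', norm_qPlus hq]
  set η := eta P ζ with hη
  set η' := etaHat P ζ with hη'
  set C := CHat P ζ A x t with hC
  set D := DHat P ζ B x t with hD
  set g : ℂ → ℂ := polarPart η' C D X Y with hg
  set f : ℂ → ℂ := fun w => -(I * conj (qPlus P) / w) * g (-(P.q₀ : ℂ) ^ 2 / w) with hf
  have e0 : ∀ k, η k ≠ 0 := eta_ne_zero hq hζ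
  have e0' : ∀ k, η' k ≠ 0 := etaHat_ne_zero hq hζ
  have ee : ∀ k j, η k ≠ η' j := eta_ne_etaHat hq hζ
  -- A kernel vector consists of the values and derivatives at the `η̂_k` of the function `f`
  -- attached to its own polar part: a solution of the homogeneous Riemann-Hilbert problem.
  have hval := (matN_mulVec_eq_iff hq hζ A B x t Y X 0 (g := g) (f := f)
    (fun k => Eventually.of_forall fun w => by simp only [zero_div, zero_add]; rfl) (fun w => rfl)).1
    (by rw [hvYX, hv]; funext i; simp)
  have gd : ∀ w, (∀ j, w ≠ η' j) → DifferentiableAt ℂ g w := fun w h =>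
    (hasDerivAt_polarPart η' C D X Y h).differentiableAt
  have fd : ∀ w, w ≠ 0 → (∀ j, w ≠ η j) → DifferentiableAt ℂ f w := fun w h0 h => by
    have h1 := (gd (-(P.q₀ : ℂ) ^ 2 / w) fun j hj => h j (by
      rw [hη, ← inv_etaHat hq, ← hη', ← hj, div_div_cancel₀ hk0])).hasDerivAt
    exact (hasDerivAt_inversion h0 (f := f) (fun w => rfl) h1).differentiableAt
  have hgf : ∀ w, w ≠ 0 → g w = -(I * qPlus P / w) * f (-(P.q₀ : ℂ) ^ 2 / w) := fun w h => by
    simp only [hf]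
    rw [div_div_cancel₀ hk0, ← hqq]
    field_simp
    rw [I_sq]; ring
  have hev : ∀ k, ∀ᶠ w in 𝓝 (η' k), w ≠ 0 ∧ ∀ j, w ≠ η j := fun k =>
    (isOpen_ne.eventually_mem (e0' k)).and
      (eventually_all.2 fun j => isOpen_ne.eventually_mem (ee j k).symm)
  have fd' : ∀ k, ∀ᶠ w in 𝓝 (η' k), DifferentiableAt ℂ f w := fun k =>
    (hev k).mono fun w hw => fd w hw.1 hw.2
  have hG : ∀ k, PoleRel g f (η' k) (C k) (D k) := fun k => by
    refine PoleRel.of_principalPart (fd' k) ?_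
    rw [(hval k).1, (hval k).2]
    exact polarPart_sub_isBigO η' C D X Y (etaHat_injective hq hζ hinj) k
  have hF : ∀ k, PoleRel (fun w => conj (f (conj w))) (fun w => conj (g (conj w))) (η' k)
      (-C k) (D k) := fun k => by
    have h1 := ((hG (flip k)).inv (κ := -(I * conj (qPlus P))) (κ' := -(I * qPlus P))
      (isBigO_one_of_continuousAt (fd' _).self_of_nhds.continuousAt) hc0 (e0' _)
      (neg_ne_zero.2 (mul_ne_zero I_ne_zero hq0))).conj
    have e1 : -(I * conj (qPlus P)) / -(I * qPlus P) = conj (qPlus P) / qPlus P := by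
      have := I_ne_zero
      field_simp
    rw [e1, hη', inv_etaHat hq, conj_eta, flip_flip, hC, hD, ← neg_neg (conj (_ * _ / _)),
      ← CHat_flip hq hζ, ← DHat_flip hq hζ, flip_flip] at h1
    refine h1.congr (Eventually.of_forall fun w => ?_) ?_
    · simp only [hf]
      rw [neg_div]
    · filter_upwards [nhdsWithin_le_nhds (isOpen_ne.mem_nhds (e0' k))] with w hw
      rw [hgf (conj w) ((map_ne_zero _).2 hw), neg_div]
  -- At `η̂_k` the function `g` has the pole of `C f (1/s² + D/s)`, and `conj f(w̄)` that of `-C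
  -- conj g(w̄) (1/s² + D/s)`, where `s = w - η̂_k`. The two products in `R` have opposite singular
  -- parts; at `η_k` the conjugation symmetry of `R` applies.
  set R : ℂ → ℂ := fun w => f w * conj (f (conj w)) + g w * conj (g (conj w)) with hR
  have hRconj : ∀ w, conj (R (conj w)) = R w := fun w => by
    simp only [hR, map_add, map_mul, Complex.conj_conj]
    ring
  have conjd : ∀ {F : ℂ → ℂ} {w : ℂ}, DifferentiableAt ℂ F (conj w) →
      DifferentiableAt ℂ (fun w => conj (F (conj w))) w := fun {F w} h => by
    have := h.hasDerivAt.conj_conj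
    rw [Complex.conj_conj] at this
    exact this.differentiableAt
  have hconjη : ∀ w, (∀ j, w ≠ η' j) → ∀ j, conj w ≠ η j := fun w h j hj => h (flip j) (by
    rw [hη', ← conj_eta, ← hη, ← hj, Complex.conj_conj])
  have hconjη' : ∀ w, (∀ j, w ≠ η j) → ∀ j, conj w ≠ η' j := fun w h j hj => h (flip j) (by
    rw [← Complex.conj_conj (η (flip j)), hη, conj_eta, flip_flip, ← hη', ← hj,
      Complex.conj_conj])
  have hRη' : ∀ k, R =O[𝓝[≠] (η' k)] fun _ => (1 : ℂ) := fun k => by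
    have b1 : f =O[𝓝[≠] (η' k)] fun _ => (1 : ℂ) :=
      isBigO_one_of_continuousAt (fd' k).self_of_nhds.continuousAt
    have b2 : (fun w => conj (g (conj w))) =O[𝓝[≠] (η' k)] fun _ => (1 : ℂ) :=
      isBigO_one_of_continuousAt (conjd (gd _ (hconjη' _ fun j => (ee j k).symm))).continuousAt
    refine ((b1.mul (hF k)).add (b2.mul (hG k))).congr (fun w => ?_) (fun w => mul_one _)
    simp only [hR]
    ring
  have hRη : ∀ k, R =O[𝓝[≠] (η k)] fun _ => (1 : ℂ) := fun k => by
    have h1 := (hRη' (flip k)).comp_tendsto (tendsto_conj_punctured _)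
    rw [hη', ← conj_eta, Complex.conj_conj, ← hη] at h1
    refine IsBigO.of_norm_left (h1.norm_left.congr_left fun w => ?_)
    rw [Function.comp_apply, ← Complex.norm_conj, hRconj]
  have hf0 : Tendsto f (𝓝[≠] 0) (𝓝 (I * conj (qPlus P) / (P.q₀ : ℂ) ^ 2
      * ∑ j, C j * (Y j + D j * X j))) := by
    refine (((tendsto_mul_polarPart η' C D X Y).comp (tendsto_inv_cocompact hk0)).const_mul
      (I * conj (qPlus P) / (P.q₀ : ℂ) ^ 2)).congr' ?_
    filter_upwards [self_mem_nhdsWithin] with w hw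
    simp only [hf, Function.comp_apply]
    field_simp
    rfl
  have hR0 : R =O[𝓝[≠] 0] fun _ => (1 : ℂ) := by
    have b1 : f =O[𝓝[≠] 0] fun _ => (1 : ℂ) := hf0.isBigO_one ℂ
    have b2 : (fun w => conj (f (conj w))) =O[𝓝[≠] 0] fun _ => (1 : ℂ) := by
      have := tendsto_conj_punctured 0
      rw [map_zero] at this
      exact ((Complex.continuous_conj.tendsto _).comp (hf0.comp this)).isBigO_one ℂ
    have hne : ∀ j, (0 : ℂ) ≠ η' j := fun j => (e0' j).symm
    have b3 := isBigO_one_of_continuousAt (gd 0 hne).continuousAt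
    have b4 : (fun w => conj (g (conj w))) =O[𝓝[≠] 0] fun _ => (1 : ℂ) :=
      isBigO_one_of_continuousAt (conjd (by rw [map_zero]; exact gd 0 hne)).continuousAt
    exact ((b1.mul b2).add (b3.mul b4)).congr_right fun _ => mul_one _
  have hinfF : Tendsto f (cocompact ℂ) (𝓝 0) := by
    have h1 := tendsto_div_sub_cocompact (-(I * conj (qPlus P))) 0
    have h2 := tendsto_div_sub_cocompact (-(P.q₀ : ℂ) ^ 2) 0
    have h3 := ((gd 0 fun j => (e0' j).symm).continuousAt.tendsto).comp h2
    have h4 : Tendsto (fun w => -(I * conj (qPlus P)) / w * g (-(P.q₀ : ℂ) ^ 2 / w))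
        (cocompact ℂ) (𝓝 0) := by simpa using h1.mul h3
    refine h4.congr fun w => ?_
    simp only [hf, neg_div]
  have hinf : Tendsto R (cocompact ℂ) (𝓝 0) := by
    have hg0 : Tendsto g (cocompact ℂ) (𝓝 0) := tendsto_polarPart η' C D X Y
    have hc : ∀ {F : ℂ → ℂ}, Tendsto F (cocompact ℂ) (𝓝 0) →
        Tendsto (fun w => conj (F (conj w))) (cocompact ℂ) (𝓝 0) := fun {F} h => by
      have h1 := (Complex.continuous_conj.tendsto _).comp (h.comp tendsto_conj_cocompact)
      rw [map_zero] at h1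
      exact h1
    simpa using (hinfF.mul (hc hinfF)).add (hg0.mul (hc hg0))
  classical
  set S : Finset ℂ := insert 0 (Finset.univ.image η ∪ Finset.univ.image η') with hS
  have hmem : ∀ w ∉ S, w ≠ 0 ∧ (∀ j, w ≠ η j) ∧ ∀ j, w ≠ η' j := fun w hw => by
    simp only [hS, Finset.mem_insert, Finset.mem_union, Finset.mem_image, Finset.mem_univ,
      true_and, not_or, not_exists] at hw
    exact ⟨hw.1, fun j h => hw.2.1 j h.symm, fun j h => hw.2.2 j h.symm⟩
  have hzero := eq_zero_of_finite_singularities S (F := R)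
    (fun w hw => by
      obtain ⟨h0, h1, h2⟩ := hmem w hw
      exact ((fd w h0 h1).mul (conjd (fd _ ((map_ne_zero _).2 h0) (hconjη w h2)))).add
        ((gd w h2).mul (conjd (gd _ (hconjη' w h1)))))
    (fun s hs => by
      apply IsBigO_one.isLittleO_inv
      simp only [hS, Finset.mem_insert, Finset.mem_union, Finset.mem_image, Finset.mem_univ,
        true_and] at hs
      rcases hs with rfl | ⟨k, rfl⟩ | ⟨k, rfl⟩
      · exact hR0
      · exact hRη k
      · exact hRη' k) hinf
  have hreal : ∀ s : ℝ, s ≠ 0 → (∀ j, (s : ℂ) ≠ η j) ∧ ∀ j, (s : ℂ) ≠ η' j := fun s hs => by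
    have : (lam P (s : ℂ)).im = 0 := by
      rw [← Complex.conj_eq_iff_im, ← lam_conj, Complex.conj_ofReal]
    refine ⟨fun j h => ?_, fun j h => ?_⟩
    · rw [h] at this
      exact (lam_eta_im hq hζ j).ne' this
    · rw [h] at this
      exact (lam_etaHat_im hq hζ j).ne this
  -- On the real axis `R = |f|² + |g|²`, so both functions vanish there.
  have hg0 : ∀ s : ℝ, s ≠ 0 → g s = 0 := fun s hs => by
    have h1 := hzero s (by
      obtain ⟨h1, h2⟩ := hreal s hs
      simp only [hS, Finset.mem_insert, Finset.mem_union, Finset.mem_image, Finset.mem_univ,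
        true_and, not_or, not_exists]
      exact ⟨by exact_mod_cast hs, fun j h => h1 j h.symm, fun j h => h2 j h.symm⟩)
    simp only [hR, Complex.conj_ofReal, Complex.mul_conj] at h1
    have h2 : normSq (f s) + normSq (g s) = 0 := by exact_mod_cast h1
    exact normSq_eq_zero.1 (le_antisymm (by nlinarith [normSq_nonneg (f s)]) (normSq_nonneg _))
  have hgz : ∀ w, (∀ j, w ≠ η' j) → g w = 0 := by
    set T : Set ℂ := Set.range η' with hT
    have hTf : T.Finite := Set.finite_range _
    have hopen : IsOpen Tᶜ := hTf.isClosed.isOpen_compl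
    have han : AnalyticOnNhd ℂ g Tᶜ := DifferentiableOn.analyticOnNhd (fun w hw =>
      (gd w fun j h => hw ⟨j, h.symm⟩).differentiableWithinAt) hopen
    have hconn : IsPreconnected Tᶜ := (hTf.countable.isConnected_compl_of_one_lt_rank
      (by rw [Complex.rank_real_complex]; norm_num)).isPreconnected
    have h1T : (1 : ℂ) ∈ Tᶜ := by
      rintro ⟨j, hj⟩
      exact (hreal 1 one_ne_zero).2 j (by rw [hj, Complex.ofReal_one])
    have hfreq : ∃ᶠ w in 𝓝[≠] (1 : ℂ), g w = 0 := by
      have ht : Tendsto (fun s : ℝ => (s : ℂ)) (𝓝[>] 1) (𝓝[≠] 1) := by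
        refine tendsto_nhdsWithin_iff.2 ⟨?_, ?_⟩
        · exact (Complex.continuous_ofReal.tendsto 1).mono_left nhdsWithin_le_nhds
        · filter_upwards [self_mem_nhdsWithin] with s hs
          have hs : (1 : ℝ) < s := hs
          have : s ≠ 1 := hs.ne'
          simpa using this
      refine ht.frequently (Eventually.frequently ?_)
      filter_upwards [self_mem_nhdsWithin] with s hs
      have hs : (1 : ℝ) < s := hs
      exact hg0 s (by linarith)
    intro w hw
    exact han.eqOn_zero_of_preconnected_of_frequently_eq_zero hconn h1T hfreq
      (fun ⟨j, hj⟩ => hw j hj.symm)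
  have hfz : ∀ w, (∀ j, w ≠ η j) → f w = 0 := fun w h => by
    simp only [hf]
    rw [hgz _ fun j hj => h j (by rw [hη, ← inv_etaHat hq, ← hη', ← hj, div_div_cancel₀ hk0]),
      mul_zero]
  apply hv0
  rw [← hvYX]
  funext i
  refine Fin.addCases (fun k => ?_) (fun k => ?_) i
  · rw [Fin.append_left, Pi.zero_apply, ← (hval k).2]
    have : f =ᶠ[𝓝 (η' k)] fun _ => 0 := (hev k).mono fun w hw => hfz w hw.2
    rw [this.deriv_eq, deriv_const]
  · rw [Fin.append_right, Pi.zero_apply, ← (hval k).1]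
    exact hfz _ fun j => (ee j k).symm

end

end KE

end

/-! ### Pasting across the real axis and the Riemann-Hilbert data -/

noncomputable section

namespace KE

open Asymptotics

/-- The function equal to `u` on the upper half plane and to the conjugate of `l` at the conjugate
point on the lower half plane. -/
def paste (u l : ℂ → ℂ) (w : ℂ) : ℂ := if 0 ≤ w.im then u w else conj (l (conj w))

/-- The closed exterior of the circle `|ζ| = q₀`. -/
def ext (P : Params) : Set ℂ := {w | P.q₀ ≤ ‖w‖}

section paste

variable {P : Params} {u l : ℂ → ℂ}

theorem paste_of_nonneg {w : ℂ} (h : 0 ≤ w.im) : paste u l w = u w := if_pos h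

theorem paste_of_nonpos (hr : ∀ w ∈ extUpper P, w.im = 0 → u w = conj (l w)) {w : ℂ}
    (hw : P.q₀ ≤ ‖w‖) (h : w.im ≤ 0) : paste u l w = conj (l (conj w)) := by
  rcases h.lt_or_eq with h | h
  · exact if_neg (not_le.2 h)
  · rw [paste_of_nonneg h.ge, hr w ⟨hw, h.ge⟩ h, Complex.conj_eq_iff_im.2 h]

theorem continuousWithinAt_paste {Eu El : Set ℂ}
    (hu : ∀ w ∈ extUpper P, w ∉ Eu → ContinuousWithinAt u (extUpper P) w)
    (hl : ∀ w ∈ extUpper P, w ∉ El → ContinuousWithinAt l (extUpper P) w)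
    (hr : ∀ w ∈ extUpper P, w.im = 0 → u w = conj (l w))
    {w : ℂ} (hwu : w ∉ Eu) (hwl : conj w ∉ El) :
    ContinuousWithinAt (paste u l) (ext P) w := by
  set Ω' : Set ℂ := {z | conj z ∈ extUpper P} with hΩ'
  have hΩ'c : IsClosed Ω' := (isClosed_extUpper P).preimage Complex.continuous_conj
  have hK : ext P ⊆ extUpper P ∪ Ω' := fun z hz => by
    rcases le_total 0 z.im with h | h
    · exact Or.inl ⟨hz, h⟩
    · refine Or.inr ⟨by rw [Complex.norm_conj]; exact hz, by simpa using h⟩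
  refine ContinuousWithinAt.mono (ContinuousWithinAt.union ?_ ?_) hK
  · by_cases hw : w ∈ extUpper P
    · exact (hu w hw hwu).congr (fun z hz => paste_of_nonneg hz.2) (paste_of_nonneg hw.2)
    · exact continuousWithinAt_of_notMem_closure (by rwa [(isClosed_extUpper P).closure_eq])
  · by_cases hw : w ∈ Ω'
    · have e : ∀ z ∈ Ω', paste u l z = conj (l (conj z)) := fun z hz =>
        paste_of_nonpos hr (by simpa using hz.1) (by simpa using hz.2)
      refine ContinuousWithinAt.congr ?_ e (e w hw)
      exact Complex.continuous_conj.continuousAt.comp_continuousWithinAt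
        ((hl _ hw hwl).comp Complex.continuous_conj.continuousWithinAt fun z hz => hz)
    · exact continuousWithinAt_of_notMem_closure (by rwa [hΩ'c.closure_eq])

theorem differentiableAt_conj_conj {F : ℂ → ℂ} {w : ℂ} (h : DifferentiableAt ℂ F (conj w)) :
    DifferentiableAt ℂ (fun w => conj (F (conj w))) w := by
  have := h.hasDerivAt.conj_conj
  rw [Complex.conj_conj] at this
  exact this.differentiableAt

/-- The boundary relation makes the pasted function continuous across the real axis, and Painlevé's
theorem removes the seam. -/
theorem differentiableAt_paste {Eu El : Set ℂ} (hEu : IsClosed Eu) (hEl : IsClosed El)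
    (hu : ∀ w ∈ extUpper P, w ∉ Eu → ContinuousWithinAt u (extUpper P) w)
    (hl : ∀ w ∈ extUpper P, w ∉ El → ContinuousWithinAt l (extUpper P) w)
    (hr : ∀ w ∈ extUpper P, w.im = 0 → u w = conj (l w))
    (hdu : ∀ w ∈ extUpperOpen P, w ∉ Eu → DifferentiableAt ℂ u w)
    (hdl : ∀ w ∈ extUpperOpen P, w ∉ El → DifferentiableAt ℂ l w)
    {w : ℂ} (hw : P.q₀ < ‖w‖) (hwu : w ∉ Eu) (hwl : conj w ∉ El) :
    DifferentiableAt ℂ (paste u l) w := by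
  have hE : ∀ᶠ z in 𝓝 w, P.q₀ < ‖z‖ ∧ z ∉ Eu ∧ conj z ∉ El := by
    refine ((isOpen_lt continuous_const continuous_norm).eventually_mem hw).and
      ((hEu.isOpen_compl.eventually_mem hwu).and ?_)
    exact (hEl.preimage Complex.continuous_conj).isOpen_compl.eventually_mem hwl
  have off : ∀ z, P.q₀ < ‖z‖ ∧ z ∉ Eu ∧ conj z ∉ El → z.im ≠ 0 →
      DifferentiableAt ℂ (paste u l) z := by
    rintro z ⟨h1, h2, h3⟩ him
    rcases him.lt_or_gt with h | h
    · have hd : DifferentiableAt ℂ (fun z => conj (l (conj z))) z :=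
        differentiableAt_conj_conj (hdl _ ⟨by rwa [Complex.norm_conj], by simpa using h⟩ h3)
      refine hd.congr_of_eventuallyEq ?_
      filter_upwards [(isOpen_lt Complex.continuous_im continuous_const).eventually_mem h] with y hy
      exact if_neg (not_le.2 hy)
    · refine (hdu z ⟨h1, h⟩ h2).congr_of_eventuallyEq ?_
      filter_upwards [(isOpen_lt continuous_const Complex.continuous_im).eventually_mem h] with y hy
      exact paste_of_nonneg (le_of_lt hy)
  by_cases him : w.im = 0
  · refine differentiableAt_of_im_ne_zero him ?_ (hE.mono off)
    filter_upwards [hE] with z hz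
    refine (continuousWithinAt_paste hu hl hr hz.2.1 hz.2.2).continuousAt ?_
    exact mem_of_superset ((isOpen_lt continuous_const continuous_norm).mem_nhds hz.1)
      fun y (hy : P.q₀ < ‖y‖) => hy.le
  · exact off w ⟨hw, hwu, hwl⟩ him

theorem isBigO_paste (hq : 0 < P.q₀)
    (hu : u =O[𝓝[extUpper P \ {I * (P.q₀ : ℂ)}] (I * P.q₀)] fun _ => (1 : ℂ))
    (hl : l =O[𝓝[extUpper P \ {I * (P.q₀ : ℂ)}] (I * P.q₀)] fun _ => (1 : ℂ)) {p : ℂ}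
    (hp : p = I * P.q₀ ∨ p = -(I * P.q₀)) :
    paste u l =O[𝓝[ext P \ {p}] p] fun _ => (1 : ℂ) := by
  rcases hp with rfl | rfl
  · have him : ∀ᶠ w in 𝓝 (I * (P.q₀ : ℂ)), 0 < w.im :=
      (isOpen_lt continuous_const Complex.continuous_im).eventually_mem (by simpa using hq)
    have hle : 𝓝[ext P \ {I * (P.q₀ : ℂ)}] (I * (P.q₀ : ℂ)) ≤
        𝓝[extUpper P \ {I * (P.q₀ : ℂ)}] (I * P.q₀) := by
      refine le_inf nhdsWithin_le_nhds ?_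
      rw [le_principal_iff]
      filter_upwards [self_mem_nhdsWithin, nhdsWithin_le_nhds him] with w hw h
      exact ⟨⟨hw.1, le_of_lt h⟩, hw.2⟩
    refine (hu.mono hle).congr' ?_ EventuallyEq.rfl
    filter_upwards [nhdsWithin_le_nhds him] with w h
    exact (paste_of_nonneg h.le).symm
  · have him : ∀ᶠ w in 𝓝 (-(I * (P.q₀ : ℂ))), w.im < 0 :=
      (isOpen_lt Complex.continuous_im continuous_const).eventually_mem (by simpa using hq)
    have ht : Tendsto (fun w => conj w) (𝓝[ext P \ {-(I * (P.q₀ : ℂ))}] (-(I * (P.q₀ : ℂ))))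
        (𝓝[extUpper P \ {I * (P.q₀ : ℂ)}] (I * P.q₀)) := by
      have e : conj (-(I * (P.q₀ : ℂ))) = I * P.q₀ := by simp
      refine tendsto_nhdsWithin_iff.2 ⟨?_, ?_⟩
      · have := Complex.continuous_conj.tendsto (-(I * (P.q₀ : ℂ)))
        rw [e] at this
        exact this.mono_left nhdsWithin_le_nhds
      · filter_upwards [self_mem_nhdsWithin, nhdsWithin_le_nhds him] with w hw h
        refine ⟨⟨by rw [Complex.norm_conj]; exact hw.1, by simpa using h.le⟩, fun h' => hw.2 ?_⟩
        rw [mem_singleton_iff] at h' ⊢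
        rw [← Complex.conj_conj w, h']
        simp
    refine IsBigO.of_norm_left ((hl.comp_tendsto ht).norm_left.congr' ?_ EventuallyEq.rfl)
    filter_upwards [nhdsWithin_le_nhds him] with w h
    rw [paste, if_neg (not_le.2 h), Complex.norm_conj]
    rfl

theorem tendsto_paste {L : ℂ} (hu : Tendsto u (extInfty P) (𝓝 L))
    (hl : Tendsto l (extInfty P) (𝓝 (conj L))) : Tendsto (paste u l) (cocompact ℂ) (𝓝 L) := by
  rw [← Metric.cobounded_eq_cocompact, ← comap_norm_atTop]
  rw [extInfty] at hu hl
  have hl' : Tendsto (fun w => conj (l w)) (comap norm atTop ⊓ 𝓟 (extUpper P)) (𝓝 L) := by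
    have := (Complex.continuous_conj.tendsto _).comp hl
    rwa [Complex.conj_conj] at this
  have hc : Tendsto (fun w : ℂ => conj w) (comap norm atTop) (comap norm atTop) := by
    rw [tendsto_comap_iff]
    refine tendsto_comap.congr fun w => ?_
    rw [Function.comp_apply, Complex.norm_conj]
  refine tendsto_def.2 fun U hU => ?_
  have h1 := eventually_inf_principal.1 (hu.eventually hU)
  have h2 := hc.eventually (eventually_inf_principal.1 (hl'.eventually hU))
  have h3 : ∀ᶠ w : ℂ in comap norm atTop, P.q₀ ≤ ‖w‖ := tendsto_comap.eventually_ge_atTop _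
  filter_upwards [h1, h2, h3] with w a1 a2 a3
  rw [mem_preimage]
  rcases le_or_gt 0 w.im with h | h
  · rw [paste_of_nonneg h]; exact a1 ⟨a3, h⟩
  · rw [paste, if_neg (not_le.2 h)]
    exact a2 ⟨by rwa [Complex.norm_conj], by simpa using h.le⟩

end paste

/-- The data of the Riemann-Hilbert problem on the closed exterior of the circle `|ζ| = q₀` in the
upper half plane. -/
structure RHData (P : Params) {N : ℕ} (ζ C D : Fin N → ℂ) (n : ℂ) (M₁ M₂ h₁ h₂ : ℂ → ℂ) :
    Prop where
  contM₁ : ContinuousOn M₁ (extUpper P)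
  contM₂ : ContinuousOn M₂ (extUpper P)
  diffM₁ : DifferentiableOn ℂ M₁ (extUpperOpen P)
  diffM₂ : DifferentiableOn ℂ M₂ (extUpperOpen P)
  cont₁ : ∀ w ∈ extUpper P, w ∉ insert (I * (P.q₀ : ℂ)) (range ζ) →
    ContinuousWithinAt h₁ (extUpper P) w
  cont₂ : ∀ w ∈ extUpper P, w ∉ insert (I * (P.q₀ : ℂ)) (range ζ) →
    ContinuousWithinAt h₂ (extUpper P) w
  diff₁ : ∀ w ∈ extUpperOpen P, w ∉ range ζ → DifferentiableAt ℂ h₁ w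
  diff₂ : ∀ w ∈ extUpperOpen P, w ∉ range ζ → DifferentiableAt ℂ h₂ w
  bdd₁ : h₁ =O[𝓝[extUpper P \ {I * (P.q₀ : ℂ)}] (I * P.q₀)] fun _ => (1 : ℂ)
  bdd₂ : h₂ =O[𝓝[extUpper P \ {I * (P.q₀ : ℂ)}] (I * P.q₀)] fun _ => (1 : ℂ)
  infM₁ : Tendsto M₁ (extInfty P) (𝓝 0)
  infM₂ : Tendsto M₂ (extInfty P) (𝓝 (conj n))
  inf₁ : Tendsto h₁ (extInfty P) (𝓝 n)
  inf₂ : Tendsto h₂ (extInfty P) (𝓝 0)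
  real₁ : ∀ w ∈ extUpper P, w.im = 0 → h₁ w = conj (M₂ w)
  real₂ : ∀ w ∈ extUpper P, w.im = 0 → h₂ w = -conj (M₁ w)
  arc₁ : ∀ w, ‖w‖ = P.q₀ → 0 ≤ w.im → w ≠ I * P.q₀ →
    h₁ w = I * (-(P.q₀ : ℂ) ^ 2 / w) / qPlus P * M₁ (-(P.q₀ : ℂ) ^ 2 / w)
  arc₂ : ∀ w, ‖w‖ = P.q₀ → 0 ≤ w.im → w ≠ I * P.q₀ →
    h₂ w = I * (-(P.q₀ : ℂ) ^ 2 / w) / qPlus P * M₂ (-(P.q₀ : ℂ) ^ 2 / w)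
  pole₁ : ∀ j, PoleRel h₁ M₁ (ζ j) (C j) (D j)
  pole₂ : ∀ j, PoleRel h₂ M₂ (ζ j) (C j) (D j)

namespace RHData

variable {P : Params} {N : ℕ} {ζ C D : Fin N → ℂ} {n : ℂ} {M₁ M₂ h₁ h₂ : ℂ → ℂ}

/-- The first function on the exterior of the circle. -/
def fExt (M₂ h₁ : ℂ → ℂ) : ℂ → ℂ := paste h₁ M₂

/-- The second function on the exterior of the circle. -/
def gExt (M₁ h₂ : ℂ → ℂ) : ℂ → ℂ := paste M₁ (fun w => -h₂ w)

/-- The second function. -/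
def gFun (P : Params) (M₁ M₂ h₁ h₂ : ℂ → ℂ) (w : ℂ) : ℂ :=
  open Classical in
  if w ∈ ext P then gExt M₁ h₂ w else -(I * qPlus P / w) * fExt M₂ h₁ (-(P.q₀ : ℂ) ^ 2 / w)

/-- The first function, which is determined by the second one. -/
def fFun (P : Params) (M₁ M₂ h₁ h₂ : ℂ → ℂ) (w : ℂ) : ℂ :=
  -(I * conj (qPlus P) / w) * gFun P M₁ M₂ h₁ h₂ (-(P.q₀ : ℂ) ^ 2 / w)

variable (hq : 0 < P.q₀)
include hq

theorem _root_.KE.norm_inv_lt {w : ℂ} (hw : w ≠ 0) :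
    P.q₀ < ‖-(P.q₀ : ℂ) ^ 2 / w‖ ↔ ‖w‖ < P.q₀ := by
  have h := norm_pos_iff.2 hw
  rw [norm_div, norm_neg, norm_pow, Complex.norm_real, Real.norm_of_nonneg hq.le, lt_div_iff₀ h]
  constructor <;> intro h' <;> nlinarith

theorem _root_.KE.norm_inv_le {w : ℂ} (hw : w ≠ 0) :
    P.q₀ ≤ ‖-(P.q₀ : ℂ) ^ 2 / w‖ ↔ ‖w‖ ≤ P.q₀ := by
  have h := norm_pos_iff.2 hw
  rw [norm_div, norm_neg, norm_pow, Complex.norm_real, Real.norm_of_nonneg hq.le, le_div_iff₀ h]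
  constructor <;> intro h' <;> nlinarith

omit hq in
theorem _root_.KE.im_inv (w : ℂ) : (-(P.q₀ : ℂ) ^ 2 / w).im = P.q₀ ^ 2 / normSq w * w.im := by
  have : -(P.q₀ : ℂ) ^ 2 = ((-P.q₀ ^ 2 : ℝ) : ℂ) := by push_cast; ring
  rw [this, div_eq_mul_inv, Complex.im_ofReal_mul, Complex.inv_im]
  ring

/-- The points where `gFun` may fail to be holomorphic. -/
def bad (P : Params) (ζ : Fin N → ℂ) : Set ℂ := {0, I * P.q₀, -(I * P.q₀)} ∪ range (etaHat P ζ)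

omit hq in
theorem isClosed_bad : IsClosed (bad P ζ) :=
  ((finite_singleton _ |>.insert _ |>.insert _).union (finite_range _)).isClosed

omit hq in
theorem isClosed_exceptional : IsClosed (insert (I * (P.q₀ : ℂ)) (range ζ)) :=
  ((finite_range ζ).insert _).isClosed

theorem _root_.KE.inv_branchPoint : -(P.q₀ : ℂ) ^ 2 / (I * P.q₀) = I * P.q₀ := by
  have hc0 : (P.q₀ : ℂ) ≠ 0 := by exact_mod_cast hq.ne'
  have := I_ne_zero
  field_simp
  rw [I_sq]

theorem inv_notMem {w : ℂ} (hw : w ∉ bad P ζ) :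
    -(P.q₀ : ℂ) ^ 2 / w ∉ insert (I * (P.q₀ : ℂ)) (range ζ) := by
  have hc0 : (P.q₀ : ℂ) ≠ 0 := by exact_mod_cast hq.ne'
  have hk0 : -(P.q₀ : ℂ) ^ 2 ≠ 0 := neg_ne_zero.2 (pow_ne_zero 2 hc0)
  rintro (h | ⟨j, h⟩)
  · refine hw (Or.inl (Or.inr (Or.inl ?_)))
    rw [← div_div_cancel₀ hk0 (b := w), h, inv_branchPoint hq]
  · refine hw (Or.inr ⟨Fin.castAdd N j, ?_⟩)
    simp only [etaHat, Fin.append_left]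
    rw [h, div_div_cancel₀ hk0]

omit hq in
theorem conj_notMem {w : ℂ} (hw : w ∉ bad P ζ) :
    conj w ∉ insert (I * (P.q₀ : ℂ)) (range ζ) := by
  rintro (h | ⟨j, h⟩)
  · refine hw (Or.inl (Or.inr (Or.inr ?_)))
    rw [mem_singleton_iff, ← Complex.conj_conj w, h]
    simp
  · refine hw (Or.inr ⟨Fin.natAdd N j, ?_⟩)
    simp only [etaHat, Fin.append_right]
    rw [h, Complex.conj_conj]

end RHData

end KE

end

/-! ### The glued function on the whole plane -/

noncomputable section

namespace KE

open Asymptotics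

namespace RHData

variable {P : Params} {N : ℕ} {ζ C D : Fin N → ℂ} {n : ℂ} {M₁ M₂ h₁ h₂ : ℂ → ℂ}

theorem real₁' (h : RHData P ζ C D n M₁ M₂ h₁ h₂) :
    ∀ w ∈ extUpper P, w.im = 0 → M₁ w = conj (-h₂ w) := fun w hw him => by
  rw [h.real₂ w hw him]; simp

theorem continuousWithinAt_gExt (h : RHData P ζ C D n M₁ M₂ h₁ h₂) {w : ℂ}
    (hw : conj w ∉ insert (I * (P.q₀ : ℂ)) (range ζ)) :
    ContinuousWithinAt (gExt M₁ h₂) (ext P) w :=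
  continuousWithinAt_paste (Eu := ∅) (fun w hw _ => h.contM₁ w hw)
    (fun w hw hE => (h.cont₂ w hw hE).neg) h.real₁' (notMem_empty w) hw

theorem continuousWithinAt_fExt (h : RHData P ζ C D n M₁ M₂ h₁ h₂) {w : ℂ}
    (hw : w ∉ insert (I * (P.q₀ : ℂ)) (range ζ)) :
    ContinuousWithinAt (fExt M₂ h₁) (ext P) w :=
  continuousWithinAt_paste (El := ∅) (fun w hw hE => h.cont₁ w hw hE)
    (fun w hw _ => h.contM₂ w hw) h.real₁ hw (notMem_empty _)

theorem differentiableAt_gExt (h : RHData P ζ C D n M₁ M₂ h₁ h₂) {w : ℂ} (hP : P.q₀ < ‖w‖)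
    (hw : conj w ∉ insert (I * (P.q₀ : ℂ)) (range ζ)) : DifferentiableAt ℂ (gExt M₁ h₂) w :=
  differentiableAt_paste (Eu := ∅) isClosed_empty isClosed_exceptional
    (fun w hw _ => h.contM₁ w hw) (fun w hw hE => (h.cont₂ w hw hE).neg) h.real₁'
    (fun _ hw _ => h.diffM₁.differentiableAt ((isOpen_extUpperOpen P).mem_nhds hw))
    (fun w hw hE => (h.diff₂ w hw fun h' => hE (Or.inr h')).neg) hP (notMem_empty w) hw

theorem differentiableAt_fExt (h : RHData P ζ C D n M₁ M₂ h₁ h₂) {w : ℂ} (hP : P.q₀ < ‖w‖)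
    (hw : w ∉ insert (I * (P.q₀ : ℂ)) (range ζ)) : DifferentiableAt ℂ (fExt M₂ h₁) w :=
  differentiableAt_paste (El := ∅) isClosed_exceptional isClosed_empty
    (fun w hw hE => h.cont₁ w hw hE) (fun w hw _ => h.contM₂ w hw) h.real₁
    (fun w hw hE => h.diff₁ w hw fun h' => hE (Or.inr h'))
    (fun _ hw _ => h.diffM₂.differentiableAt ((isOpen_extUpperOpen P).mem_nhds hw))
    hP hw (notMem_empty _)

variable (hq : 0 < P.q₀)
include hq

/-- On the upper half of the circle this is `arc₁`, on the lower half the conjugate of `arc₂`. The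
exterior and interior definitions of `gFun` therefore agree on the circle away from `±iq₀`. -/
theorem gExt_circle (h : RHData P ζ C D n M₁ M₂ h₁ h₂) {w : ℂ} (hw : ‖w‖ = P.q₀)
    (h1 : w ≠ I * P.q₀) (h2 : w ≠ -(I * P.q₀)) :
    gExt M₁ h₂ w = -(I * qPlus P / w) * fExt M₂ h₁ (-(P.q₀ : ℂ) ^ 2 / w) := by
  have hw0 : w ≠ 0 := norm_pos_iff.1 (by rw [hw]; exact hq)
  have hc0 : (P.q₀ : ℂ) ≠ 0 := by exact_mod_cast hq.ne'
  have hk0 : -(P.q₀ : ℂ) ^ 2 ≠ 0 := neg_ne_zero.2 (pow_ne_zero 2 hc0)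
  have hq0 := qPlus_ne_zero hq
  have hq1 : conj (qPlus P) ≠ 0 := (map_ne_zero _).2 hq0
  have hqq : conj (qPlus P) * qPlus P = (P.q₀ : ℂ) ^ 2 := by
    rw [Complex.conj_mul', norm_qPlus hq]
  have hn : 0 < P.q₀ ^ 2 / normSq w := div_pos (by positivity) (normSq_pos.2 hw0)
  have him := im_inv (P := P) w
  rcases le_or_gt 0 w.im with h0 | h0
  · obtain ⟨a1, a2, a3, a4⟩ := inv_mem_arc hq hw h0
    rw [gExt, fExt, paste_of_nonneg h0, paste_of_nonneg a2, h.arc₁ _ a1 a2 (a4 h1), a3]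
    field_simp
    rw [I_sq]; ring
  · have hneg : (-(P.q₀ : ℂ) ^ 2 / w).im < 0 := by rw [him]; exact mul_neg_of_pos_of_neg hn h0
    rw [gExt, fExt, paste, paste, if_neg (not_le.2 h0), if_neg (not_le.2 hneg)]
    have hc : conj w ≠ I * P.q₀ := fun h' => h2 (by rw [← Complex.conj_conj w, h']; simp)
    rw [h.arc₂ (conj w) (by rwa [Complex.norm_conj]) (by simpa using h0.le) hc]
    simp only [map_neg, map_mul, map_div₀, map_pow, Complex.conj_conj, Complex.conj_ofReal,
      Complex.conj_I]
    rw [← hqq]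
    field_simp

omit hq in
theorem gFun_of_mem {w : ℂ} (hw : P.q₀ ≤ ‖w‖) : gFun P M₁ M₂ h₁ h₂ w = gExt M₁ h₂ w := if_pos hw

theorem gFun_of_norm_le (h : RHData P ζ C D n M₁ M₂ h₁ h₂) {w : ℂ} (hw : ‖w‖ ≤ P.q₀)
    (h1 : w ≠ I * P.q₀) (h2 : w ≠ -(I * P.q₀)) : gFun P M₁ M₂ h₁ h₂ w =
      -(I * qPlus P / w) * fExt M₂ h₁ (-(P.q₀ : ℂ) ^ 2 / w) := by
  rcases hw.lt_or_eq with hw | hw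
  · exact if_neg (not_le.2 hw)
  · rw [gFun_of_mem hw.ge, gExt_circle hq h hw h1 h2]

omit hq in
theorem gFun_of_lt {w : ℂ} (hw : ‖w‖ < P.q₀) : gFun P M₁ M₂ h₁ h₂ w =
    -(I * qPlus P / w) * fExt M₂ h₁ (-(P.q₀ : ℂ) ^ 2 / w) := if_neg (not_le.2 hw)

omit hq in
theorem ne_of_notMem_bad {w : ℂ} (hw : w ∉ bad P ζ) :
    w ≠ 0 ∧ w ≠ I * P.q₀ ∧ w ≠ -(I * P.q₀) ∧ ∀ j, w ≠ etaHat P ζ j :=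
  ⟨fun h => hw (Or.inl (Or.inl h)), fun h => hw (Or.inl (Or.inr (Or.inl h))),
    fun h => hw (Or.inl (Or.inr (Or.inr h))), fun j h => hw (Or.inr ⟨j, h.symm⟩)⟩

omit hq in
theorem continuousAt_div {k w : ℂ} (hw : w ≠ 0) : ContinuousAt (fun w : ℂ => k / w) w :=
  continuousAt_const.div continuousAt_id hw

/-- Off the circle `gFun` is built from holomorphic pieces. At the circle the agreement of the two
definitions gives continuity from both sides, and Painlevé's theorem for an arc concludes. -/
theorem differentiableAt_gFun (h : RHData P ζ C D n M₁ M₂ h₁ h₂) {w : ℂ} (hw : w ∉ bad P ζ) :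
    DifferentiableAt ℂ (gFun P M₁ M₂ h₁ h₂) w := by
  have off : ∀ w, w ∉ bad P ζ → ‖w‖ ≠ P.q₀ → DifferentiableAt ℂ (gFun P M₁ M₂ h₁ h₂) w := by
    intro w hw hne
    obtain ⟨hw0, -, -, -⟩ := ne_of_notMem_bad hw
    rcases hne.lt_or_gt with hlt | hgt
    · have h1 : DifferentiableAt ℂ (fun w : ℂ => -(P.q₀ : ℂ) ^ 2 / w) w := by
        fun_prop (disch := exact hw0)
      have h2 := (differentiableAt_fExt h ((norm_inv_lt hq hw0).2 hlt) (inv_notMem hq hw)).comp w h1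
      have h3 : DifferentiableAt ℂ (fun w : ℂ => -(I * qPlus P / w)) w := by
        fun_prop (disch := exact hw0)
      refine (h3.mul h2).congr_of_eventuallyEq ?_
      filter_upwards [(isOpen_lt continuous_norm continuous_const).eventually_mem hlt] with z hz
      exact gFun_of_lt hz
    · refine (differentiableAt_gExt h hgt (conj_notMem hw)).congr_of_eventuallyEq ?_
      filter_upwards [(isOpen_lt continuous_const continuous_norm).eventually_mem hgt] with z hz
      exact gFun_of_mem (le_of_lt hz)
  by_cases hn : ‖w‖ = P.q₀
  · have hE : ∀ᶠ z in 𝓝 w, z ∉ bad P ζ := isClosed_bad.isOpen_compl.eventually_mem hw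
    refine differentiableAt_of_norm_ne hq hn ?_ (hE.mono off)
    filter_upwards [hE] with z hz
    by_cases hzn : ‖z‖ = P.q₀
    · obtain ⟨hz0, hz1, hz2, -⟩ := ne_of_notMem_bad hz
      have hU : (univ : Set ℂ) ⊆ ext P ∪ {y | ‖y‖ ≤ P.q₀ ∧ y ∉ bad P ζ} ∪
          {y | ‖y‖ ≤ P.q₀ ∧ y ∈ bad P ζ} := fun y _ => by
        rcases le_total P.q₀ ‖y‖ with h' | h'
        · exact Or.inl (Or.inl h')
        · by_cases hy : y ∈ bad P ζ
          · exact Or.inr ⟨h', hy⟩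
          · exact Or.inl (Or.inr ⟨h', hy⟩)
      rw [← continuousWithinAt_univ]
      refine ContinuousWithinAt.mono (((?_ : ContinuousWithinAt _ (ext P) z).union ?_).union ?_) hU
      · exact (continuousWithinAt_gExt h (conj_notMem hz)).congr (fun y hy => gFun_of_mem hy)
          (gFun_of_mem hzn.ge)
      · have h1 : ContinuousWithinAt (fun y : ℂ => fExt M₂ h₁ (-(P.q₀ : ℂ) ^ 2 / y))
            {y | ‖y‖ ≤ P.q₀ ∧ y ∉ bad P ζ} z :=
          (continuousWithinAt_fExt h (inv_notMem hq hz)).comp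
            (continuousAt_div hz0).continuousWithinAt fun y hy =>
            (norm_inv_le hq (ne_of_notMem_bad hy.2).1).2 hy.1
        refine ((continuousAt_div (k := I * qPlus P) hz0).neg.continuousWithinAt.mul h1).congr (fun y hy => ?_) ?_
        · obtain ⟨-, b1, b2, -⟩ := ne_of_notMem_bad hy.2
          exact gFun_of_norm_le hq h hy.1 b1 b2
        · exact gFun_of_norm_le hq h hzn.le hz1 hz2
      · refine continuousWithinAt_of_notMem_closure fun hcl => hz ?_
        have := closure_mono (fun y (hy : ‖y‖ ≤ P.q₀ ∧ y ∈ bad P ζ) => hy.2) hcl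
        rwa [isClosed_bad.closure_eq] at this
    · exact (off z hz hzn).continuousAt
  · exact off w hw hn

omit hq in
theorem isBigO_gExt (hq : 0 < P.q₀) (h : RHData P ζ C D n M₁ M₂ h₁ h₂) {p : ℂ}
    (hp : p = I * P.q₀ ∨ p = -(I * P.q₀)) :
    gExt M₁ h₂ =O[𝓝[ext P \ {p}] p] fun _ => (1 : ℂ) :=
  isBigO_paste hq (((h.contM₁ _ (IsStep.IsModifiedJost.branchPoint_mem hq)).tendsto.isBigO_one
    ℂ).mono (nhdsWithin_mono _ sdiff_subset)) h.bdd₂.neg_left hp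

omit hq in
theorem isBigO_fExt (hq : 0 < P.q₀) (h : RHData P ζ C D n M₁ M₂ h₁ h₂) {p : ℂ}
    (hp : p = I * P.q₀ ∨ p = -(I * P.q₀)) :
    fExt M₂ h₁ =O[𝓝[ext P \ {p}] p] fun _ => (1 : ℂ) :=
  isBigO_paste hq h.bdd₁ (((h.contM₂ _ (IsStep.IsModifiedJost.branchPoint_mem hq)).tendsto.isBigO_one
    ℂ).mono (nhdsWithin_mono _ sdiff_subset)) hp

/-- From outside, boundedness at `±iq₀` is part of the data; from inside it follows because the
inversion fixes these two points. -/
theorem isBigO_gFun (h : RHData P ζ C D n M₁ M₂ h₁ h₂) {p : ℂ}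
    (hp : p = I * P.q₀ ∨ p = -(I * P.q₀)) :
    gFun P M₁ M₂ h₁ h₂ =O[𝓝[≠] p] fun _ => (1 : ℂ) := by
  have hc0 : (P.q₀ : ℂ) ≠ 0 := by exact_mod_cast hq.ne'
  have hk0 : -(P.q₀ : ℂ) ^ 2 ≠ 0 := neg_ne_zero.2 (pow_ne_zero 2 hc0)
  have hp0 : p ≠ 0 := by
    rcases hp with rfl | rfl
    · exact mul_ne_zero I_ne_zero hc0
    · exact neg_ne_zero.2 (mul_ne_zero I_ne_zero hc0)
  have hpp : -(P.q₀ : ℂ) ^ 2 / p = p := by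
    rcases hp with rfl | rfl
    · exact inv_branchPoint hq
    · rw [div_neg, inv_branchPoint hq]
  have hle : 𝓝[≠] p ≤ 𝓝[ext P \ {p}] p ⊔ 𝓝[(ext P)ᶜ] p := by
    rw [← nhdsWithin_union]
    refine nhdsWithin_mono _ fun z hz => ?_
    by_cases h' : z ∈ ext P
    · exact Or.inl ⟨h', hz⟩
    · exact Or.inr h'
  refine IsBigO.mono (IsBigO.sup ?_ ?_) hle
  · refine (isBigO_gExt hq h hp).congr' ?_ EventuallyEq.rfl
    filter_upwards [self_mem_nhdsWithin] with z hz
    exact (gFun_of_mem hz.1).symm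
  · have ht : Tendsto (fun z => -(P.q₀ : ℂ) ^ 2 / z) (𝓝[(ext P)ᶜ] p) (𝓝[ext P \ {p}] p) := by
      refine tendsto_nhdsWithin_iff.2 ⟨?_, ?_⟩
      · have := (continuousAt_div (k := -(P.q₀ : ℂ) ^ 2) hp0).tendsto
        rw [hpp] at this
        exact this.mono_left nhdsWithin_le_nhds
      · filter_upwards [self_mem_nhdsWithin, nhdsWithin_le_nhds (isOpen_ne.mem_nhds hp0)]
          with z hz hz0
        have hz' : ‖z‖ < P.q₀ := not_le.1 hz
        refine ⟨((norm_inv_lt hq hz0).2 hz').le, fun he => hz ?_⟩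
        have he : -(P.q₀ : ℂ) ^ 2 / z = p := he
        have : z = p := by rw [← div_div_cancel₀ hk0 (b := z), he, hpp]
        rw [this]
        rcases hp with rfl | rfl <;> simp [ext, abs_of_pos hq]
    have h1 := (isBigO_fExt hq h hp).comp_tendsto ht
    have h2 : (fun z : ℂ => -(I * qPlus P / z)) =O[𝓝[(ext P)ᶜ] p] fun _ => (1 : ℂ) :=
      ((continuousAt_div hp0).neg.isBigO_one ℂ).mono nhdsWithin_le_nhds
    refine (h2.mul h1).congr' ?_ (Eventually.of_forall fun _ => mul_one _)
    filter_upwards [self_mem_nhdsWithin] with z hz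
    exact (gFun_of_lt (not_le.1 hz)).symm

omit hq in
theorem tendsto_gFun (h : RHData P ζ C D n M₁ M₂ h₁ h₂) :
    Tendsto (gFun P M₁ M₂ h₁ h₂) (cocompact ℂ) (𝓝 0) := by
  have h1 : Tendsto (gExt M₁ h₂) (cocompact ℂ) (𝓝 0) :=
    tendsto_paste h.infM₁ (by simpa using h.inf₂.neg)
  refine h1.congr' ?_
  have h3 : ∀ᶠ w : ℂ in cocompact ℂ, P.q₀ ≤ ‖w‖ :=
    (tendsto_norm_cocompact_atTop (E := ℂ)).eventually_ge_atTop _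
  filter_upwards [h3] with w hw
  exact (gFun_of_mem hw).symm

/-- The simple pole at `0` is the image under inversion of the limit `n` of `fExt` at infinity. -/
theorem tendsto_mul_gFun (h : RHData P ζ C D n M₁ M₂ h₁ h₂) :
    Tendsto (fun w => w * gFun P M₁ M₂ h₁ h₂ w) (𝓝[≠] 0) (𝓝 (-(I * qPlus P * n))) := by
  have hc0 : (P.q₀ : ℂ) ≠ 0 := by exact_mod_cast hq.ne'
  have hk0 : -(P.q₀ : ℂ) ^ 2 ≠ 0 := neg_ne_zero.2 (pow_ne_zero 2 hc0)
  have h1 : Tendsto (fExt M₂ h₁) (cocompact ℂ) (𝓝 n) := tendsto_paste h.inf₁ h.infM₂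
  have h2 := (h1.comp (tendsto_inv_cocompact hk0)).const_mul (-(I * qPlus P))
  rw [neg_mul] at h2
  refine h2.congr' ?_
  have h3 : ∀ᶠ w : ℂ in 𝓝[≠] 0, ‖w‖ < P.q₀ := nhdsWithin_le_nhds
    ((isOpen_lt continuous_norm continuous_const).mem_nhds (by simpa using hq))
  filter_upwards [h3, self_mem_nhdsWithin] with w hw hw0
  have hw0 : w ≠ 0 := hw0
  rw [gFun_of_lt hw, Function.comp_apply]
  field_simp

end RHData

end KE

end

/-! ### Rationality of the glued function and the reconstruction formula -/

noncomputable section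

namespace KE

open Asymptotics

namespace RHData

variable {P : Params} {N : ℕ} {ζ : Fin N → ℂ} {A B : Fin N → ℂ} {x t : ℝ} {n : ℂ}
  {M₁ M₂ h₁ h₂ : ℂ → ℂ}

variable (hq : 0 < P.q₀)
include hq

theorem fFun_eq_fExt {w : ℂ} (hw : P.q₀ < ‖w‖) :
    fFun P M₁ M₂ h₁ h₂ w = fExt M₂ h₁ w := by
  have hc0 : (P.q₀ : ℂ) ≠ 0 := by exact_mod_cast hq.ne'
  have hk0 : -(P.q₀ : ℂ) ^ 2 ≠ 0 := neg_ne_zero.2 (pow_ne_zero 2 hc0)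
  have hw0 : w ≠ 0 := norm_pos_iff.1 (hq.trans hw)
  have hv0 : -(P.q₀ : ℂ) ^ 2 / w ≠ 0 := div_ne_zero hk0 hw0
  have hqq : conj (qPlus P) * qPlus P = (P.q₀ : ℂ) ^ 2 := by
    rw [Complex.conj_mul', norm_qPlus hq]
  have hlt : ‖-(P.q₀ : ℂ) ^ 2 / w‖ < P.q₀ := by
    rw [← norm_inv_lt hq hv0, div_div_cancel₀ hk0]; exact hw
  rw [fFun, gFun_of_lt hlt, div_div_cancel₀ hk0, ← hqq]
  have := qPlus_ne_zero hq
  have h2 : conj (qPlus P) ≠ 0 := (map_ne_zero _).2 this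
  field_simp
  rw [I_sq]; ring

theorem eta_notMem_bad (hζ : ∀ j, ζ j ∈ extUpperOpen P) (k : Fin (N + N)) :
    eta P ζ k ∉ bad P ζ := by
  have h := lam_eta_im hq hζ k
  rintro ((h0 | h0 | h0) | ⟨j, hj⟩)
  · exact eta_ne_zero hq hζ k h0
  · rw [h0, IsStep.IsModifiedJost.lam_branchPoint hq] at h
    simp at h
  · have h0 : eta P ζ k = -(I * P.q₀) := h0
    rw [h0, lam_neg_branchPoint hq] at h
    simp at h
  · exact eta_ne_etaHat hq hζ k j hj.symm

theorem differentiableAt_fFun (h : RHData P ζ (poleC P ζ A x t) (poleD P ζ B x t) n M₁ M₂ h₁ h₂)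
    (hζ : ∀ j, ζ j ∈ extUpperOpen P) (k : Fin (N + N)) :
    ∀ᶠ w in 𝓝 (etaHat P ζ k), DifferentiableAt ℂ (fFun P M₁ M₂ h₁ h₂) w := by
  have h0 := etaHat_ne_zero hq hζ k
  have ht := (continuousAt_div (k := -(P.q₀ : ℂ) ^ 2) h0).tendsto
  have hE : ∀ᶠ z in 𝓝 (-(P.q₀ : ℂ) ^ 2 / etaHat P ζ k), z ∉ bad P ζ := by
    rw [inv_etaHat hq]
    exact isClosed_bad.isOpen_compl.eventually_mem (eta_notMem_bad hq hζ k)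
  filter_upwards [ht.eventually hE, isOpen_ne.eventually_mem h0] with w hw hw0
  exact (hasDerivAt_inversion hw0 (f := fFun P M₁ M₂ h₁ h₂) (fun _ => rfl)
    (differentiableAt_gFun hq h hw).hasDerivAt).differentiableAt

/-- The points `-q₀²/ζ_j` lie inside the circle and receive the poles of `h₁` by inversion; the
points `conj ζ_j` lie in the lower exterior and receive the poles of `h₂` by conjugation. In both
cases the regular partner becomes `fFun`. -/
theorem poleRel_gFun (h : RHData P ζ (poleC P ζ A x t) (poleD P ζ B x t) n M₁ M₂ h₁ h₂)
    (hζ : ∀ j, ζ j ∈ extUpperOpen P) (k : Fin (N + N)) :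
    PoleRel (gFun P M₁ M₂ h₁ h₂) (fFun P M₁ M₂ h₁ h₂) (etaHat P ζ k) (CHat P ζ A x t k)
      (DHat P ζ B x t k) := by
  have h0 : ∀ j, ζ j ≠ 0 := fun j => ne_zero_of_mem_extUpper hq (extUpperOpen_subset P (hζ j))
  have hc0 : (P.q₀ : ℂ) ≠ 0 := by exact_mod_cast hq.ne'
  have hk0 : -(P.q₀ : ℂ) ^ 2 ≠ 0 := neg_ne_zero.2 (pow_ne_zero 2 hc0)
  have hq0 := qPlus_ne_zero hq
  have hq1 : conj (qPlus P) ≠ 0 := (map_ne_zero _).2 hq0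
  refine Fin.addCases (fun j => ?_) (fun j => ?_) k
  · rw [CHat_castAdd hq (h0 j), DHat_castAdd hq (h0 j)]
    simp only [etaHat, Fin.append_left]
    have hM : M₁ =O[𝓝[≠] (ζ j)] fun _ => (1 : ℂ) := isBigO_one_of_continuousAt
      (h.diffM₁.differentiableAt ((isOpen_extUpperOpen P).mem_nhds (hζ j))).continuousAt
    have h1 := (h.pole₁ j).inv (κ := -(I * qPlus P)) (κ' := -(I * conj (qPlus P))) hM hc0 (h0 j)
      (neg_ne_zero.2 (mul_ne_zero I_ne_zero hq1))
    have e1 : -(I * qPlus P) / -(I * conj (qPlus P)) = qPlus P / conj (qPlus P) := by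
      have := I_ne_zero
      field_simp
    rw [e1] at h1
    have hp0 : -(P.q₀ : ℂ) ^ 2 / ζ j ≠ 0 := div_ne_zero hk0 (h0 j)
    have hev : ∀ᶠ w in 𝓝 (-(P.q₀ : ℂ) ^ 2 / ζ j), w ≠ 0 ∧ -(P.q₀ : ℂ) ^ 2 / w ∈ extUpperOpen P := by
      refine (isOpen_ne.eventually_mem hp0).and
        ((continuousAt_div (k := -(P.q₀ : ℂ) ^ 2) hp0).tendsto.eventually ?_)
      rw [div_div_cancel₀ hk0]
      exact (isOpen_extUpperOpen P).eventually_mem (hζ j)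
    refine h1.congr ?_ ?_
    · filter_upwards [nhdsWithin_le_nhds hev] with w hw
      rw [gFun_of_lt ((norm_inv_lt hq hw.1).1 hw.2.1), fExt, paste_of_nonneg (le_of_lt hw.2.2),
        neg_div]
    · filter_upwards [nhdsWithin_le_nhds hev] with w hw
      rw [fFun, gFun_of_mem (le_of_lt hw.2.1), gExt, paste_of_nonneg (le_of_lt hw.2.2), neg_div]
  · rw [CHat_natAdd, DHat_natAdd (h0 j)]
    simp only [etaHat, Fin.append_right]
    have h1 := (h.pole₂ j).conj
    have hev : ∀ᶠ w in 𝓝 (conj (ζ j)), P.q₀ < ‖w‖ ∧ w.im < 0 := by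
      refine ((isOpen_lt continuous_const continuous_norm).eventually_mem ?_).and
        ((isOpen_lt Complex.continuous_im continuous_const).eventually_mem ?_)
      · rw [mem_ofPred_eq, Complex.norm_conj]; exact (hζ j).1
      · simpa using (hζ j).2
    have h2 : PoleRel (fun w => -conj (h₂ (conj w))) (fun w => conj (M₂ (conj w))) (conj (ζ j))
        (-conj (poleC P ζ A x t j)) (conj (poleD P ζ B x t j)) :=
      (IsBigO.neg_left h1).congr_left fun w => by ring
    refine h2.congr ?_ ?_
    · filter_upwards [nhdsWithin_le_nhds hev] with w hw
      rw [gFun_of_mem hw.1.le, gExt, paste, if_neg (not_le.2 hw.2), map_neg]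
    · filter_upwards [nhdsWithin_le_nhds hev] with w hw
      rw [fFun_eq_fExt hq hw.1, fExt, paste, if_neg (not_le.2 hw.2)]

/-- The solution of the Riemann-Hilbert problem is a rational function. -/
theorem gFun_eq (h : RHData P ζ (poleC P ζ A x t) (poleD P ζ B x t) n M₁ M₂ h₁ h₂)
    (hζ : ∀ j, ζ j ∈ extUpperOpen P) (hinj : Function.Injective ζ) {w : ℂ} (hw : w ∉ bad P ζ) :
    gFun P M₁ M₂ h₁ h₂ w = -(I * qPlus P * n) / w + polarPart (etaHat P ζ) (CHat P ζ A x t)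
      (DHat P ζ B x t) (fun k => fFun P M₁ M₂ h₁ h₂ (etaHat P ζ k))
      (fun k => deriv (fFun P M₁ M₂ h₁ h₂) (etaHat P ζ k)) w := by
  classical
  set g := gFun P M₁ M₂ h₁ h₂ with hg
  set X : Fin (N + N) → ℂ := fun k => fFun P M₁ M₂ h₁ h₂ (etaHat P ζ k) with hX
  set Y : Fin (N + N) → ℂ := fun k => deriv (fFun P M₁ M₂ h₁ h₂) (etaHat P ζ k) with hY
  set p := polarPart (etaHat P ζ) (CHat P ζ A x t) (DHat P ζ B x t) X Y with hp
  have hc0 : (P.q₀ : ℂ) ≠ 0 := by exact_mod_cast hq.ne'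
  have hbr : I * (P.q₀ : ℂ) ≠ 0 := mul_ne_zero I_ne_zero hc0
  have pd : ∀ w, (∀ j, w ≠ etaHat P ζ j) → DifferentiableAt ℂ p w := fun w hw =>
    (hasDerivAt_polarPart _ _ _ _ _ hw).differentiableAt
  have hlam : ∀ w, lam P w = 0 → ∀ j, w ≠ etaHat P ζ j := fun w hw j hj => by
    have := lam_etaHat_im hq hζ j
    rw [← hj, hw] at this
    simp at this
  have kd : ∀ w : ℂ, w ≠ 0 → DifferentiableAt ℂ (fun w => I * qPlus P * n / w) w := fun w hw => by
    fun_prop (disch := exact hw)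
  -- The difference of the two sides. Every singularity is removable: it is bounded at `±iq₀` and at
  -- the `η̂_k`, and `o(1/w)` at `0`. As it tends to `0` at infinity, Liouville's theorem applies.
  set F : ℂ → ℂ := fun w => g w + I * qPlus P * n / w - p w with hF
  set S : Finset ℂ := {0, I * (P.q₀ : ℂ), -(I * (P.q₀ : ℂ))} ∪ Finset.univ.image (etaHat P ζ)
    with hS
  have hSb : ∀ w, w ∈ S ↔ w ∈ bad P ζ := fun w => by
    simp [hS, bad, or_assoc]
  have hbranch : ∀ s, (s = I * P.q₀ ∨ s = -(I * P.q₀)) → F =o[𝓝[≠] s] fun w => (w - s)⁻¹ := by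
    intro s hs
    have hs0 : s ≠ 0 := by
      rcases hs with rfl | rfl
      · exact hbr
      · exact neg_ne_zero.2 hbr
    have hl : lam P s = 0 := by
      rcases hs with rfl | rfl
      · exact IsStep.IsModifiedJost.lam_branchPoint hq
      · exact lam_neg_branchPoint hq
    exact IsBigO_one.isLittleO_inv (((isBigO_gFun hq h hs).add
      (isBigO_one_of_continuousAt (kd s hs0).continuousAt)).sub
      (isBigO_one_of_continuousAt (pd s (hlam s hl)).continuousAt))
  have key := eq_zero_of_finite_singularities S (F := F) (fun w hw => ?_) (fun s hs => ?_) ?_ w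
    (by rwa [hSb])
  · simp only [hF] at key
    rw [neg_div]
    linear_combination key
  · rw [hSb] at hw
    obtain ⟨w0, -, -, w3⟩ := ne_of_notMem_bad hw
    exact ((differentiableAt_gFun hq h hw).add (kd w w0)).sub (pd w w3)
  · rw [hSb] at hs
    rcases hs with (rfl | hs | hs) | ⟨k, rfl⟩
    · have t1 := tendsto_mul_gFun hq h
      have t2 : Tendsto (fun w => w * p w) (𝓝[≠] 0) (𝓝 0) := by
        have := (continuousAt_id.mul (pd 0 fun j => (etaHat_ne_zero hq hζ j).symm).continuousAt)
        have h' := this.tendsto.mono_left (nhdsWithin_le_nhds (s := {(0 : ℂ)}ᶜ))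
        have e : ((id : ℂ → ℂ) * p) 0 = 0 := by simp
        rw [e] at h'
        exact h'
      have t3 := (t1.add_const (I * qPlus P * n)).sub t2
      rw [neg_add_cancel, sub_zero] at t3
      rw [isLittleO_iff_tendsto' (by
        filter_upwards [self_mem_nhdsWithin] with w hw h'
        have hw : w ≠ 0 := hw
        exact (inv_ne_zero (by rwa [sub_zero]) h').elim)]
      refine t3.congr' ?_
      filter_upwards [self_mem_nhdsWithin] with w hw
      have hw : w ≠ 0 := hw
      simp only [hF, hg]
      rw [sub_zero]
      field_simp
    · exact hbranch s (Or.inl hs)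
    · exact hbranch s (Or.inr hs)
    · refine IsBigO_one.isLittleO_inv ?_
      have b1 := (poleRel_gFun hq h hζ k).sub_principalPart (differentiableAt_fFun hq h hζ k)
      have b2 := polarPart_sub_isBigO (etaHat P ζ) (CHat P ζ A x t) (DHat P ζ B x t) X Y
        (etaHat_injective hq hζ hinj) k
      have b3 := isBigO_one_of_continuousAt (kd _ (etaHat_ne_zero hq hζ k)).continuousAt
      refine ((b1.sub b2).add b3).congr_left fun w => ?_
      simp only [hF, hp, hX, hY]
      ring
  · have t1 := tendsto_gFun h
    have t2 := tendsto_div_sub_cocompact (I * qPlus P * n) 0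
    simp only [sub_zero] at t2
    simpa using (t1.add t2).sub (tendsto_polarPart (etaHat P ζ) (CHat P ζ A x t)
      (DHat P ζ B x t) X Y)

/-- The reconstruction formula. -/
theorem tendsto_imaginary_eq
    (h : RHData P ζ (poleC P ζ A x t) (poleD P ζ B x t) n M₁ M₂ h₁ h₂)
    (hζ : ∀ j, ζ j ∈ extUpperOpen P) (hinj : Function.Injective ζ) {E : ℂ}
    (hE : Tendsto (fun s : ℝ => I * (s : ℂ) * M₁ (I * s)) atTop (𝓝 E)) :
    E = -(I * qPlus P * n) *
      (1 + (matNDelta P ζ A B x t).det / (matN P ζ A B x t).det) := by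
  set X : Fin (N + N) → ℂ := fun k => fFun P M₁ M₂ h₁ h₂ (etaHat P ζ k) with hX
  set Y : Fin (N + N) → ℂ := fun k => deriv (fFun P M₁ M₂ h₁ h₂) (etaHat P ζ k) with hY
  have hdet := det_matN_ne_zero hq hζ hinj A B x t
  have hq0 := qPlus_ne_zero hq
  -- On the imaginary ray `M₁` coincides with `gFun`, so `E` is the coefficient of `1/w` at infinity
  -- in the rational expression.
  have hEv : E = -(I * qPlus P * n) +
      ∑ j, CHat P ζ A x t j * (Y j + DHat P ζ B x t j * X j) := by
    have ht : Tendsto (fun s : ℝ => I * (s : ℂ)) atTop (cocompact ℂ) := by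
      rw [← Metric.cobounded_eq_cocompact, ← comap_norm_atTop, tendsto_comap_iff]
      refine tendsto_abs_atTop_atTop.congr fun s => ?_
      simp
    have t1 := ((tendsto_mul_polarPart (etaHat P ζ) (CHat P ζ A x t) (DHat P ζ B x t) X Y).comp
      ht).const_add (-(I * qPlus P * n))
    refine tendsto_nhds_unique hE (t1.congr' ?_)
    have hcl : ∀ᶠ w : ℂ in cocompact ℂ, w ∉ bad P ζ := by
      have : IsCompact (bad P ζ) :=
        ((finite_singleton _ |>.insert _ |>.insert _).union (finite_range _)).isCompact
      exact this.compl_mem_cocompact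
    filter_upwards [ht.eventually hcl, eventually_ge_atTop P.q₀] with s hs hs'
    have hs0 : 0 < s := hq.trans_le hs'
    have hn : ‖I * (s : ℂ)‖ = s := by simp [abs_of_pos hs0]
    have h1 := gFun_eq hq h hζ hinj hs
    rw [gFun_of_mem (by rwa [hn]), gExt, paste_of_nonneg (by simpa using hs0.le)] at h1
    rw [h1, Function.comp_apply]
    have : I * (s : ℂ) ≠ 0 := norm_pos_iff.1 (by rwa [hn])
    generalize I * (s : ℂ) = w at this ⊢
    field_simp
    rfl
  have hlin : (matN P ζ A B x t).mulVec (Fin.append Y X) =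
      fun i => I * qPlus P * n * rho P ζ i := by
    have := (matN_mulVec_eq_iff hq hζ A B x t Y X (-(I * qPlus P * n))
      (g := gFun P M₁ M₂ h₁ h₂) (f := fFun P M₁ M₂ h₁ h₂) (fun k => ?_) (fun w => rfl)).2
      fun k => ⟨rfl, rfl⟩
    · rw [this, neg_neg]
    · filter_upwards [isClosed_bad.isOpen_compl.eventually_mem (eta_notMem_bad hq hζ k)] with w hw
      exact gFun_eq hq h hζ hinj hw
  have hchi : ∑ i, chi P ζ A B x t i * Fin.append Y X i =
      ∑ j, CHat P ζ A x t j * (Y j + DHat P ζ B x t j * X j) := by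
    rw [Fin.sum_univ_add]
    simp only [chi, Fin.append_left, Fin.append_right]
    rw [← Finset.sum_add_distrib]
    exact Finset.sum_congr rfl fun j _ => by ring
  -- The solution for the right-hand side `ρ`. The vector of values and derivatives of `fFun` is `i
  -- q₊ n v`, and the expansion of the bordered determinant gives `χ · v = -|N^Δ| / |N|`.
  set v := (matN P ζ A B x t)⁻¹.mulVec (rho P ζ) with hv
  have hunit : IsUnit (matN P ζ A B x t).det := isUnit_iff_ne_zero.2 hdet
  have hNv : (matN P ζ A B x t).mulVec v = rho P ζ := by
    rw [hv, Matrix.mulVec_mulVec, Matrix.mul_nonsing_inv _ hunit, Matrix.one_mulVec]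
  have hYXv : Fin.append Y X = (I * qPlus P * n) • v := by
    have h1 : (matN P ζ A B x t).mulVec (Fin.append Y X) =
        (matN P ζ A B x t).mulVec ((I * qPlus P * n) • v) := by
      rw [Matrix.mulVec_smul, hNv, hlin]; rfl
    have h2 := congrArg ((matN P ζ A B x t)⁻¹.mulVec) h1
    simpa [Matrix.mulVec_mulVec, Matrix.nonsing_inv_mul _ hunit] using h2
  have hb := det_bordered (n := (N + N) + (N + N)) ⟨N + N, rfl⟩ (matN P ζ A B x t)
    (chi P ζ A B x t) (rho P ζ) v hNv
  have hb' : (matNDelta P ζ A B x t).det = -(∑ j, chi P ζ A B x t j * v j) *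
      (matN P ζ A B x t).det := hb
  rw [hEv, ← hchi, hb', hYXv, mul_div_cancel_right₀ _ hdet]
  simp only [Pi.smul_apply, smul_eq_mul, mul_left_comm _ (I * qPlus P * n), ← Finset.mul_sum]
  ring

end RHData

end KE

end

/-! ### The Jost functions solve the Riemann-Hilbert problem -/

noncomputable section

namespace KE

open Asymptotics

section Reconstruction

variable {P : Params} {q : ℝ → ℝ → ℂ} {N : ℕ} {ζ b d : Fin N → ℂ} (hq : 0 < P.q₀)
  (hsol : IsSolution P.T q) (hbc : HasNZBC P q)

theorem HasDoubleZeros.mem_extUpperOpen (hζ : HasDoubleZeros P q ζ) (j : Fin N) :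
    ζ j ∈ extUpperOpen P :=
  ⟨hζ.norm_gt j, hζ.im_pos j⟩

theorem HasDoubleZeros.aCoef_eq_zero (hζ : HasDoubleZeros P q ζ) (j : Fin N) :
    aCoef P q (ζ j) = 0 :=
  (hζ.zero_iff _ (hζ.norm_gt j) (hζ.im_pos j)).2 ⟨j, rfl⟩

include hq hsol hbc

/-- On the continuous spectrum a zero of `a` would make `ψ₋₁ = a ψ₊₁` vanish; inside, the only zeros
are the `ζ_j` by hypothesis. -/
theorem aCoef_ne_zero (hrefl : Reflectionless P q) (hζ : HasDoubleZeros P q ζ) {w : ℂ}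
    (hw : w ∈ extUpper P) (hw' : w ∉ insert (I * (P.q₀ : ℂ)) (range ζ)) : aCoef P q w ≠ 0 := by
  rw [mem_insert_iff, not_or] at hw'
  by_cases hS : w.im = 0 ∨ ‖w‖ = P.q₀
  · exact aCoef_ne_zero_of_mem_spectrum hq hsol hbc hrefl hw hS hw'.1
  · rw [not_or] at hS
    rw [Ne, hζ.zero_iff w (lt_of_le_of_ne hw.1 (Ne.symm hS.2)) (lt_of_le_of_ne hw.2 (Ne.symm hS.1))]
    rintro ⟨j, rfl⟩
    exact hw'.2 ⟨j, rfl⟩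

theorem IsNorming.ne_zero (hζ : HasDoubleZeros P q ζ) (h : IsNorming P q ζ b d) (j : Fin N) :
    b j ≠ 0 := by
  intro hb
  have h0 := (h j 0 0).1
  rw [hb, mul_zero, zero_smul, muMinus, smul_eq_zero] at h0
  refine h0.elim (by simp [colExp]) ?_
  exact (isJost_psiMinus hq hsol hbc (extUpperOpen_subset P (hζ.mem_extUpperOpen j))).ne_zero
    hsol 0 0

theorem poleRel_muMinus_div (hζ : HasDoubleZeros P q ζ) (h : IsNorming P q ζ b d) (x t : ℝ)
    (i : Fin 2) (j : Fin N) :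
    PoleRel (fun w => muMinus P q 0 x t w i / aCoef P q w) (fun w => muPlus P q 1 x t w i) (ζ j)
      (poleC P ζ (Acoef P q ζ b) x t j) (poleD P ζ (Bcoef P q ζ b d) x t j) := by
  have hj := hζ.mem_extUpperOpen j
  have hev : ∀ᶠ w in 𝓝 (ζ j), extUpperOpen P ∈ 𝓝 w :=
    ((isOpen_extUpperOpen P).eventually_mem hj).mono fun w hw => (isOpen_extUpperOpen P).mem_nhds hw
  have dn := differentiableOn_muMinus hq hsol hbc x t
  have dM := differentiableOn_muPlus hq hsol hbc x t
  have hdn := (dn.differentiableAt ((isOpen_extUpperOpen P).mem_nhds hj)).hasDerivAt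
  have hdM := (dM.differentiableAt ((isOpen_extUpperOpen P).mem_nhds hj)).hasDerivAt
  refine PoleRel.of_double_zero (hev.mono fun w hw =>
    (differentiableOn_aCoef hq hsol hbc).differentiableAt hw)
    (hev.mono fun w hw => differentiableAt_pi.1 (dn.differentiableAt hw) i)
    (hev.mono fun w hw => differentiableAt_pi.1 (dM.differentiableAt hw) i)
    (hζ.aCoef_eq_zero j) (hζ.deriv_eq j) (hζ.deriv2_ne j) (h.ne_zero hq hsol hbc hζ j) ?_ ?_
  · exact congrFun (h j x t).1 i
  · rw [(hasDerivAt_pi.1 hdn i).deriv, (hasDerivAt_pi.1 hdM i).deriv]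
    exact congrFun (h j x t).2 i

theorem rhData (hrefl : Reflectionless P q) (hζ : HasDoubleZeros P q ζ)
    (h : IsNorming P q ζ b d) (x t : ℝ) :
    RHData P ζ (poleC P ζ (Acoef P q ζ b) x t) (poleD P ζ (Bcoef P q ζ b d) x t)
      (exp (-(I * omegaPlus P q x t)))
      (fun w => muPlus P q 1 x t w 0) (fun w => muPlus P q 1 x t w 1)
      (fun w => muMinus P q 0 x t w 0 / aCoef P q w)
      (fun w => muMinus P q 0 x t w 1 / aCoef P q w) := by
  have cM := fun i => continuousOn_pi.1 (continuousOn_muPlus hq hsol hbc x t) i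
  have dM := fun i => differentiableOn_pi.1 (differentiableOn_muPlus hq hsol hbc x t) i
  have c : ∀ i, ∀ w ∈ extUpper P, w ∉ insert (I * (P.q₀ : ℂ)) (range ζ) →
      ContinuousWithinAt (fun w => muMinus P q 0 x t w i / aCoef P q w) (extUpper P) w := by
    intro i w hw hw'
    have hne : w ∈ ({I * (P.q₀ : ℂ)} : Set ℂ)ᶜ := fun h' => hw' (Or.inl h')
    refine (continuousOn_pi.1 (continuousOn_muMinus hq hsol hbc x t) i w hw).div ?_
      (aCoef_ne_zero hq hsol hbc hrefl hζ hw hw')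
    exact (continuousOn_aCoef hq hsol hbc w ⟨hw, hne⟩).mono_of_mem_nhdsWithin
      (inter_mem_nhdsWithin _ (isOpen_compl_singleton.mem_nhds hne))
  have df : ∀ i, ∀ w ∈ extUpperOpen P, w ∉ range ζ →
      DifferentiableAt ℂ (fun w => muMinus P q 0 x t w i / aCoef P q w) w := by
    intro i w hw hw'
    have hn := (isOpen_extUpperOpen P).mem_nhds hw
    refine (differentiableAt_pi.1 ((differentiableOn_muMinus hq hsol hbc x t).differentiableAt hn)
      i).div ((differentiableOn_aCoef hq hsol hbc).differentiableAt hn) ?_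
    refine aCoef_ne_zero hq hsol hbc hrefl hζ (extUpperOpen_subset P hw) ?_
    rw [mem_insert_iff, not_or]
    exact ⟨ne_branchPoint_of_mem hq hw, hw'⟩
  have bd : ∀ i, (fun w => muMinus P q 0 x t w i / aCoef P q w)
      =O[𝓝[extUpper P \ {I * (P.q₀ : ℂ)}] (I * P.q₀)] fun _ => (1 : ℂ) := fun i => by
    obtain ⟨L, hL⟩ := exists_muMinus_div_limit hq hsol hbc hrefl x t i
    exact hL.isBigO_one ℂ
  have rl : ∀ w ∈ extUpper P, w.im = 0 → ∀ i, muMinus P q 0 x t w i / aCoef P q w =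
      (![conj (muPlus P q 1 x t w 1), -conj (muPlus P q 1 x t w 0)] : Fin 2 → ℂ) i := by
    intro w hw him i
    have hne : w ≠ I * P.q₀ := by
      rintro rfl
      simp [hq.ne'] at him
    rw [muMinus_real hq hsol hbc hrefl hw him, Pi.smul_apply, smul_eq_mul, mul_div_cancel_left₀]
    exact aCoef_ne_zero_of_mem_spectrum hq hsol hbc hrefl hw (Or.inl him) hne
  have ar : ∀ i w, ‖w‖ = P.q₀ → 0 ≤ w.im → w ≠ I * P.q₀ →
      muMinus P q 0 x t w i / aCoef P q w =
        I * (-(P.q₀ : ℂ) ^ 2 / w) / qPlus P * muPlus P q 1 x t (-(P.q₀ : ℂ) ^ 2 / w) i := by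
    intro i w hn him hne
    rw [muMinus_arc hq hsol hbc hrefl hn him hne, Pi.smul_apply, smul_eq_mul, mul_assoc,
      mul_div_cancel_left₀]
    exact aCoef_ne_zero_of_mem_spectrum hq hsol hbc hrefl ⟨hn.ge, him⟩ (Or.inr hn) hne
  obtain ⟨i1, i2⟩ := tendsto_muPlus_infty hq hsol hbc x t
  obtain ⟨i3, i4, -⟩ := tendsto_muMinus_div_infty hq hsol hbc x t
  have hconj : conj (exp (-(I * omegaPlus P q x t))) = exp (I * omegaPlus P q x t) := by
    rw [← exp_conj]
    simp
  exact
    { contM₁ := cM 0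
      contM₂ := cM 1
      diffM₁ := dM 0
      diffM₂ := dM 1
      cont₁ := c 0
      cont₂ := c 1
      diff₁ := df 0
      diff₂ := df 1
      bdd₁ := bd 0
      bdd₂ := bd 1
      infM₁ := i1
      infM₂ := by rwa [hconj]
      inf₁ := i3
      inf₂ := i4
      real₁ := fun w hw him => rl w hw him 0
      real₂ := fun w hw him => rl w hw him 1
      arc₁ := ar 0
      arc₂ := ar 1
      pole₁ := poleRel_muMinus_div hq hsol hbc hζ h x t 0
      pole₂ := poleRel_muMinus_div hq hsol hbc hζ h x t 1 }

/-- Here `E = -i q e^{-iΥ} e^{iω₊}` and `n = e^{-iω₊}`. The two exponentials combine to the factor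
`e^{-2iω₊}` of the formula. -/
theorem eq_det_div_det (hrefl : Reflectionless P q) (hζ : HasDoubleZeros P q ζ)
    (h : IsNorming P q ζ b d) (x t : ℝ) :
    q x t = exp (I * ((Ups P x t - 2 * omegaPlus P q x t : ℝ) : ℂ)) * qPlus P *
      (1 + (matNDelta P ζ (Acoef P q ζ b) (Bcoef P q ζ b d) x t).det /
        (matN P ζ (Acoef P q ζ b) (Bcoef P q ζ b d) x t).det) := by
  have key := (rhData hq hsol hbc hrefl hζ h x t).tendsto_imaginary_eq hq hζ.mem_extUpperOpen
    hζ.injective (tendsto_mul_muPlus_imaginary hq hsol hbc x t)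
  generalize (matNDelta P ζ (Acoef P q ζ b) (Bcoef P q ζ b d) x t).det /
    (matN P ζ (Acoef P q ζ b) (Bcoef P q ζ b d) x t).det = r at key ⊢
  set W : ℂ := I * omegaPlus P q x t with hW
  set V : ℂ := I * Ups P x t with hV
  have e : exp (I * ((Ups P x t - 2 * omegaPlus P q x t : ℝ) : ℂ)) =
      exp V * exp (-W) * exp (-W) := by
    rw [← exp_add, ← exp_add, hV, hW]
    congr 1
    push_cast
    ring
  have hVV : exp V * exp (-V) = 1 := by rw [← exp_add, add_neg_cancel, exp_zero]
  have hWW : exp W * exp (-W) = 1 := by rw [← exp_add, add_neg_cancel, exp_zero]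
  rw [envelope, ← hV] at key
  have k2 : q x t * exp (-V) * exp W = qPlus P * exp (-W) * (1 + r) := by
    refine mul_left_cancel₀ I_ne_zero ?_
    linear_combination -key
  rw [e]
  linear_combination exp V * exp (-W) * k2 - q x t * (exp W * exp (-W)) * hVV - q x t * hWW

end Reconstruction

end KE

end

theorem mainTheorem8 (P : KE.Params) (hq₀ : 0 < P.q₀) (q : ℝ → ℝ → ℂ)
    (hsol : KE.IsSolution P.T q) (hbc : KE.HasNZBC P q) (hrefl : KE.Reflectionless P q)
    (N : ℕ) (ζ : Fin N → ℂ) (hζ : KE.HasDoubleZeros P q ζ) :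
    (∃ b d : Fin N → ℂ, KE.IsNorming P q ζ b d) ∧
    ∀ b d : Fin N → ℂ, KE.IsNorming P q ζ b d → ∀ x t : ℝ,
      (KE.matN P ζ (KE.Acoef P q ζ b) (KE.Bcoef P q ζ b d) x t).det ≠ 0 ∧
      q x t = Complex.exp (Complex.I * ((KE.Ups P x t - 2 * KE.omegaPlus P q x t : ℝ) : ℂ))
        * KE.qPlus P
        * (1 + (KE.matNDelta P ζ (KE.Acoef P q ζ b) (KE.Bcoef P q ζ b d) x t).det
            / (KE.matN P ζ (KE.Acoef P q ζ b) (KE.Bcoef P q ζ b d) x t).det) :=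
  ⟨KE.exists_isNorming hq₀ hsol hbc hζ, fun b d h x t =>
    ⟨KE.det_matN_ne_zero hq₀ hζ.mem_extUpperOpen hζ.injective
      (KE.Acoef P q ζ b) (KE.Bcoef P q ζ b d) x t,
     KE.eq_det_div_det hq₀ hsol hbc hrefl hζ h x t⟩⟩
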